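/- Let $\Bbbk$ be a field of characteristic $0$ and $I=\{1,\dots,n\}$. All modules over $\Bbbk[[\hbar]]$ carry the $\hbar$-adic topology, and $\widehat\otimes$ is the completed tensor product over $\Bbbk[[\hbar]]$. **Data.** Let $A=(a_{ij})_{i,j\in I}$ be a generalized Cartan matrix, let $d_i$ ($i\in I$) be positive integers with $d_ia_{ij}=d_ja_{ji}$, and let $P=(p_{ij})\in M_n(\Bbbk[[\hbar]])$ satisfy $p_{ij}+p_{ji}=2d_ia_{ij}$. Let $\mathcal R=(\mathfrak h,\{\alpha_i\},\{T_i^\pm\})$ be a realization of $P$: $\mathfrak h$ is a free $\Bbbk[[\hbar]]$-module of finite rank, $T_i^\pm\in\mathfrak h$, $\alpha_i\in\mathfrak h^*$, $\alpha_j(T_i^+)=p_{ij}$, $\alpha_j(T_i^-)=p_{ji}$, and the elements $S_i:=\frac12(T_i^++T_i^-)$ are linearly independent over $\Bbbk$ modulo $\hbar\mathfrak h$. **The algebra.** Put $q_i=e^{\hbar d_i}$, $q_{ij}^{c}=e^{\hbar c\,p_{ij}}$. $U=U^{\mathcal R}_{P,\hbar}(\mathfrak g)$ is the unital $\hbar$-adically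 complete $\Bbbk[[\hbar]]$-algebra topologically generated by the module $\mathfrak h$ and elements $E_i,F_i$ with relations (for $T,T'\in\mathfrak h$) $$TT'=T'T,\quad TE_j-E_jT=\alpha_j(T)E_j,\quad TF_j-F_jT=-\alpha_j(T)F_j,\quad E_iF_j-F_jE_i=\delta_{ij}\frac{e^{\hbar T_i^+}-e^{-\hbar T_i^-}}{q_i-q_i^{-1}},$$ $$\sum_{r=0}^{1-a_{ij}}(-1)^r\binom{1-a_{ij}}{r}_{q_i}q_{ij}^{r/2}q_{ji}^{-r/2}E_i^{1-a_{ij}-r}E_jE_i^r=0,\qquad \sum_{r=0}^{1-a_{ij}}(-1)^r\binom{1-a_{ij}}{r}_{q_i}q_{ij}^{-r/2}q_{ji}^{r/2}F_i^{1-a_{ij}-r}F_jF_i^r=0\quad(i\ne j).$$ Its topological Hopf structure is determined by $\Delta(E_i)=E_i\otimes1+e^{\hbar T_i^+}\otimes E_i$, $\Delta(T)=T\otimes1+1\otimes T$, $\Delta(F_i)=F_i\otimes e^{-\hbar T_i^-}+1\otimes F_i$; $\epsilon=0$ on all $E_i,T,F_i$; $\mathcal S(E_i)=-e^{-\hbar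 T_i^+}E_i$, $\mathcal S(T)=-T$, $\mathcal S(F_i)=-F_ie^{\hbar T_i^-}$. **The toral cocycle.** Let $\chi:\mathfrak h\times\mathfrak h\to\Bbbk[[\hbar]]$ be bilinear and antisymmetric with $\chi(S_i,-)=0$ for all $i$. Let $\mathfrak s=\mathrm{Span}\{S_i\}$, $\overline{\mathfrak h}=\mathfrak h/\mathfrak s$, and let $\widehat S(\overline{\mathfrak h})$ be the $\hbar$-adically completed symmetric algebra with its usual Hopf structure. Let $\tilde\chi$ be the bilinear form on $\widehat S(\overline{\mathfrak h})$ that is induced by $\chi$ in bidegree $(1,1)$ and is $0$ in all other bidegrees, and let $\tilde\chi^{*m}$ be its convolution powers. Let $\pi:U\to\widehat S(\overline{\mathfrak h})$ be the Hopf epimorphism with $\pi(E_i)=\pi(F_i)=0$ and $\pi(T)=T+\mathfrak s$. Let $U^\circ\subseteq U$ be the subalgebra generated over $\Bbbk[[\hbar]]$ by all $E_i$, $F_i$, $T$ and $e^{\hbar T}$ ($T\in\mathfrak h$). Put $$\sigma_\chi^{\pm1}(x,y)=\sum_{m\ge0}\frac{(\pm1)^m\hbar^{-m}}{2^m\,m!}\,\tilde\chi^{*m}\big(\pi(x),\pi(y)\big)\in\Bbbk((\hbar))\qquad(x,y\in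 U^\circ).$$ **Deformed data.** $P_{(\chi)}=\big(p_{ij}+\chi(T_i^+,T_j^+)\big)_{i,j}$ and $\mathcal R_{(\chi)}=(\mathfrak h,\{\alpha_i+\chi(-,T_i^+)\},\{T_i^\pm\})$; this is again a realization of a matrix with $P_{(\chi)}+P_{(\chi)}^T=2DA$, where $D=\mathrm{diag}(d_1,\dots,d_n)$. **Theorem.** The Hopf structures above exist on $U$ and on $U'=U^{\mathcal R_{(\chi)}}_{P_{(\chi)},\hbar}(\mathfrak g)$, and so does $\pi$. Moreover: 1. $U^\circ$ is dense in $U$ and is a Hopf subalgebra in the ordinary (algebraic) sense; the series $\sigma_\chi^{\pm1}$ converge on $U^\circ$ in $\Bbbk((\hbar))$, and $\sigma_\chi$ is a normalized Hopf 2-cocycle on $U^\circ$, $$\sigma_\chi(y_{(1)},z_{(1)})\,\sigma_\chi(x,y_{(2)}z_{(2)})=\sigma_\chi(x_{(1)},y_{(1)})\,\sigma_\chi(x_{(2)}y_{(2)},z),$$ with convolution inverse $\sigma_\chi^{-1}$. 2. Although $\sigma_\chi$ is $\Bbbk((\hbar))$-valued, $U$ carries a $\Bbbk[[\hbar]]$-bilinear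 product $\cdot_\sigma$ with $$x\cdot_\sigma y=\sigma_\chi(x_{(1)},y_{(1)})\,x_{(2)}y_{(2)}\,\sigma_\chi^{-1}(x_{(3)},y_{(3)})\qquad(x,y\in U^\circ),$$ and with it and the original unit, coproduct and counit $U$ is a topological Hopf algebra, denoted $U_{\sigma_\chi}$. 3. There is an isomorphism of topological Hopf algebras $U_{\sigma_\chi}\cong U'$ with $E_i\mapsto E_i$, $F_i\mapsto F_i$, $T\mapsto T$ ($i\in I$, $T\in\mathfrak h$). 4. The same holds for the Borel algebras. Let $\mathfrak t\subseteq\mathfrak h$ be any submodule that contains all $T_i^+$ (resp. all $T_i^-$); for $\mathfrak t=\mathfrak h$ one gets the Borel subalgebras $U^{\mathcal R}_{P,\hbar}(\mathfrak b_\pm)$. The closed subalgebra of $U$ generated by $\mathfrak t$ and all $E_i$ (resp. all $F_i$) is a closed topological Hopf subalgebra both of $U$ and of $U_{\sigma_\chi}$, the corresponding closed subalgebra of $U'$ is a closed topological Hopf subalgebra of $U'$, and the isomorphism in 3 maps the first onto the second. -/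

import Mathlib

open scoped PowerSeries TensorProduct
open PowerSeries (X C)

noncomputable section

namespace FoMpQUEA

/-! ### `ħ`-adic completions over `k⟦ħ⟧` (the variable `ħ` is `PowerSeries.X`) -/

/-- The ideal `(ħ)` of `k⟦ħ⟧`. -/
abbrev hIdeal (k : Type*) [Field k] : Ideal k⟦X⟧ := Ideal.span {PowerSeries.X}

section Completion

variable {k : Type*} [Field k]
variable {M N M' N' B D : Type*}
variable [AddCommGroup M] [Module k⟦X⟧ M] [AddCommGroup N] [Module k⟦X⟧ N]
variable [AddCommGroup M'] [Module k⟦X⟧ M'] [AddCommGroup N'] [Module k⟦X⟧ N']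
variable [AddCommGroup B] [Module k⟦X⟧ B] [AddCommGroup D] [Module k⟦X⟧ D]

/-- The `ħ`-adic completion of a `k⟦ħ⟧`-module. -/
abbrev Hat (k : Type*) [Field k] (M : Type*) [AddCommGroup M] [Module k⟦X⟧ M] : Type _ :=
  AdicCompletion (hIdeal k) M

/-- The completed tensor product `M ⊗̂ N`. -/
abbrev HatTensor (k : Type*) [Field k] (M N : Type*) [AddCommGroup M] [Module k⟦X⟧ M]
    [AddCommGroup N] [Module k⟦X⟧ N] : Type _ :=
  Hat k (M ⊗[k⟦X⟧] N)

instance isAdicComplete_hat : IsAdicComplete (hIdeal k) (Hat k M) :=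
  AdicCompletion.isAdicComplete ⟨{PowerSeries.X}, by simp⟩

/-- The canonical map of a module to its completion. -/
def toHat : M →ₗ[k⟦X⟧] Hat k M := AdicCompletion.of (hIdeal k) M

/-- Functoriality of the completion. -/
def hatMap (f : M →ₗ[k⟦X⟧] N) : Hat k M →ₗ[k⟦X⟧] Hat k N :=
  (AdicCompletion.map (hIdeal k) f).restrictScalars k⟦X⟧

/-- The limit in a complete module of a point of its completion. -/
def hatLim [IsAdicComplete (hIdeal k) N] : Hat k N →ₗ[k⟦X⟧] N :=
  (AdicCompletion.ofLinearEquiv (hIdeal k) N).symm.toLinearMap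

/-- Extension of a `k⟦ħ⟧`-linear map with complete target to the completion of its source. -/
def hatExtend [IsAdicComplete (hIdeal k) N] :
    (M →ₗ[k⟦X⟧] N) →ₗ[k⟦X⟧] (Hat k M →ₗ[k⟦X⟧] N) where
  toFun f := hatLim ∘ₗ hatMap f
  map_add' f g := by
    rw [← LinearMap.comp_add]
    congr 1
    ext a n
    simp [hatMap]
  map_smul' r f := by
    rw [RingHom.id_apply, ← LinearMap.comp_smul]
    congr 1
    ext a n
    simp [hatMap]
    rfl

theorem hatMap_toHat (f : M →ₗ[k⟦X⟧] N) (x : M) : hatMap f (toHat x) = toHat (f x) := rfl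

theorem hatLim_toHat [IsAdicComplete (hIdeal k) N] (x : N) : hatLim (k := k) (toHat x) = x :=
  AdicCompletion.ofLinearEquiv_symm_of (hIdeal k) x

theorem hatExtend_toHat [IsAdicComplete (hIdeal k) N] (f : M →ₗ[k⟦X⟧] N) (x : M) :
    hatExtend f (toHat x) = f x := by
  change hatLim (hatMap f (toHat x)) = f x
  rw [hatMap_toHat, hatLim_toHat]

/-- Linear maps to a Hausdorff module that agree on a module agree on its completion. -/
theorem hat_ext [IsHausdorff (hIdeal k) N] {f g : Hat k M →ₗ[k⟦X⟧] N}
    (h : ∀ x, f (toHat x) = g (toHat x)) : f = g := by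
  refine LinearMap.ext fun x => ?_
  rw [← sub_eq_zero, ← LinearMap.sub_apply]
  refine IsHausdorff.haus ‹IsHausdorff (hIdeal k) N› _ fun n => ?_
  rw [SModEq.zero]
  obtain ⟨y, hy⟩ := Submodule.mkQ_surjective _ (AdicCompletion.eval (hIdeal k) M n x)
  have hx : x - toHat y ∈ (hIdeal k ^ n • ⊤ : Submodule k⟦X⟧ (Hat k M)) := by
    rw [AdicCompletion.pow_smul_top_eq_ker_eval ⟨{PowerSeries.X}, by simp⟩, LinearMap.mem_ker,
      map_sub, ← hy]
    simp [toHat]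
  have h2 : (f - g) x = (f - g) (x - toHat y) := by
    rw [map_sub]; simp [h]
  rw [h2]
  have h3 := Submodule.mem_map_of_mem (f := f - g) hx
  rw [Submodule.map_smul''] at h3
  exact Submodule.smul_mono le_rfl le_top h3

/-- The external product `Hat M × Hat N → M ⊗̂ N`. -/
def boxTensor : Hat k M →ₗ[k⟦X⟧] Hat k N →ₗ[k⟦X⟧] HatTensor k M N :=
  hatExtend ∘ₗ (hatExtend ∘ₗ
    ((TensorProduct.mk k⟦X⟧ M N).flip.compr₂ toHat)).flip

theorem boxTensor_toHat (x : M) (y : N) :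
    boxTensor (toHat x) (toHat y) = (toHat (x ⊗ₜ[k⟦X⟧] y) : HatTensor k M N) := by
  simp [boxTensor, hatExtend_toHat]

/-- `f ⊗̂ g : M ⊗̂ N → M' ⊗̂ N'` for linear maps `f`, `g` with values in completions. -/
def hatTensorMap (f : M →ₗ[k⟦X⟧] Hat k M') (g : N →ₗ[k⟦X⟧] Hat k N') :
    HatTensor k M N →ₗ[k⟦X⟧] HatTensor k M' N' :=
  hatExtend (TensorProduct.lift boxTensor ∘ₗ TensorProduct.map f g)

/-- The sum `∑ ħ ^ j u j` in a complete module. -/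
def hSeries [IsAdicComplete (hIdeal k) M] (u : ℕ → M) : M :=
  hatLim (k := k) (AdicCompletion.mk (hIdeal k) M (AdicCompletion.AdicCauchySequence.mk (hIdeal k) M
    (fun n => ∑ j ∈ Finset.range n, (PowerSeries.X ^ j : k⟦X⟧) • u j) (by
      intro n
      rw [Finset.sum_range_succ, SModEq.sub_mem, sub_add_cancel_left, neg_mem_iff]
      exact Submodule.smul_mem_smul
        (Ideal.pow_mem_pow (Ideal.mem_span_singleton_self _) n) trivial)))

theorem hSeries_sub_mem [IsAdicComplete (hIdeal k) M] (u : ℕ → M) (n : ℕ) :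
    hSeries (k := k) u - ∑ j ∈ Finset.range n, (PowerSeries.X ^ j : k⟦X⟧) • u j ∈
      (hIdeal k ^ n • ⊤ : Submodule k⟦X⟧ M) := by
  have h : toHat (k := k) (hSeries (k := k) u) = AdicCompletion.mk (hIdeal k) M _ :=
    (AdicCompletion.ofLinearEquiv (hIdeal k) M).apply_symm_apply _
  have h2 := congrArg (AdicCompletion.eval (hIdeal k) M n) h
  rw [← Submodule.Quotient.mk_eq_zero, Submodule.Quotient.mk_sub, sub_eq_zero]
  exact h2

/-- The closure of a submodule in the `ħ`-adic topology. -/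
def hClosure (S : Submodule k⟦X⟧ M) : Submodule k⟦X⟧ M :=
  ⨅ n : ℕ, S ⊔ (hIdeal k ^ n • ⊤ : Submodule k⟦X⟧ M)

end Completion

/-! ### Completions of algebras -/

section CompletedAlgebra

variable {k : Type*} [Field k] {A : Type*} [Ring A] [Algebra k⟦X⟧ A]

instance hatMul : Mul (Hat k A) where
  mul x y := hatMap (LinearMap.mul' k⟦X⟧ A) (boxTensor x y)

instance hatOne : One (Hat k A) where
  one := toHat (k := k) (1 : A)

theorem hat_mul_def (x y : Hat k A) :
    x * y = hatMap (LinearMap.mul' k⟦X⟧ A) (boxTensor x y) := rfl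

theorem hat_one_def : (1 : Hat k A) = toHat (k := k) (1 : A) := rfl

theorem toHat_mul (a b : A) :
    (toHat (k := k) a : Hat k A) * (toHat (k := k) b : Hat k A) = toHat (k := k) (a * b) := by
  rw [hat_mul_def, boxTensor_toHat, hatMap_toHat, LinearMap.mul'_apply]

/-- The product of the completed algebra as a bilinear map. -/
def hatMulₗ : Hat k A →ₗ[k⟦X⟧] Hat k A →ₗ[k⟦X⟧] Hat k A :=
  boxTensor.compr₂ (hatMap (LinearMap.mul' k⟦X⟧ A))

theorem hatMulₗ_apply (x y : Hat k A) : hatMulₗ x y = x * y := rfl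

theorem hat_one_mul (x : Hat k A) : 1 * x = x := by
  have : hatMulₗ (1 : Hat k A) = (LinearMap.id : Hat k A →ₗ[k⟦X⟧] Hat k A) :=
    hat_ext fun a => by rw [hatMulₗ_apply, hat_one_def, toHat_mul, one_mul]; rfl
  exact LinearMap.congr_fun this x

theorem hat_mul_one (x : Hat k A) : x * 1 = x := by
  have : hatMulₗ.flip (1 : Hat k A) = (LinearMap.id : Hat k A →ₗ[k⟦X⟧] Hat k A) :=
    hat_ext fun a => by
      rw [LinearMap.flip_apply, hatMulₗ_apply, hat_one_def, toHat_mul, mul_one]; rfl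
  exact LinearMap.congr_fun this x

theorem hat_mul_assoc (x y z : Hat k A) : x * y * z = x * (y * z) := by
  have h1 (a b : A) : hatMulₗ (toHat (k := k) a * toHat (k := k) b) =
      hatMulₗ (toHat (k := k) a) ∘ₗ (hatMulₗ (toHat (k := k) b) : Hat k A →ₗ[k⟦X⟧] Hat k A) :=
    hat_ext fun c => by
      simp only [LinearMap.comp_apply, hatMulₗ_apply, toHat_mul, mul_assoc]
  have h2 (a : A) (z : Hat k A) : hatMulₗ.flip z ∘ₗ hatMulₗ (toHat (k := k) a) =
      hatMulₗ (toHat (k := k) a) ∘ₗ (hatMulₗ.flip z : Hat k A →ₗ[k⟦X⟧] Hat k A) :=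
    hat_ext fun b => LinearMap.congr_fun (h1 a b) z
  have h3 (y z : Hat k A) : hatMulₗ.flip z ∘ₗ hatMulₗ.flip y =
      (hatMulₗ.flip (y * z) : Hat k A →ₗ[k⟦X⟧] Hat k A) :=
    hat_ext fun a => LinearMap.congr_fun (h2 a z) y
  exact LinearMap.congr_fun (h3 y z) x

instance hatRing : Ring (Hat k A) where
  __ := (inferInstance : AddCommGroup (Hat k A))
  mul := (· * ·)
  one := 1
  left_distrib x y z := by
    change x * (y + z) = x * y + x * z
    simp only [← hatMulₗ_apply, map_add]
  right_distrib x y z := by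
    change (x + y) * z = x * z + y * z
    simp only [← hatMulₗ_apply, map_add, LinearMap.add_apply]
  zero_mul x := by
    change 0 * x = 0
    simp only [← hatMulₗ_apply, map_zero, LinearMap.zero_apply]
  mul_zero x := by
    change x * 0 = 0
    simp only [← hatMulₗ_apply, map_zero]
  one_mul := hat_one_mul
  mul_one := hat_mul_one
  mul_assoc := hat_mul_assoc

instance hatAlgebra : Algebra k⟦X⟧ (Hat k A) :=
  Algebra.ofModule
    (fun r x y => by
      change hatMulₗ (r • x) y = r • hatMulₗ x y
      rw [map_smul, LinearMap.smul_apply])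
    (fun r x y => by
      change hatMulₗ x (r • y) = r • hatMulₗ x y
      rw [map_smul])

end CompletedAlgebra

section Exponential

variable {k : Type*} [Field k] {B : Type*} [Ring B] [Algebra k⟦X⟧ B]
  [IsAdicComplete (hIdeal k) B]

/-- `e ^ {ħ x} = ∑ ħ ^ j x ^ j / j!` in an `ħ`-adically complete algebra. -/
def hexp (x : B) : B :=
  hSeries (k := k) fun j => (C ((j.factorial : k)⁻¹) : k⟦X⟧) • x ^ j

/-- `(e ^ {ħ x} - 1) / ħ = ∑ ħ ^ j x ^ (j+1) / (j+1)!` in an `ħ`-adically complete algebra. -/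
def hexpDiv (x : B) : B :=
  hSeries (k := k) fun j => (C (((j + 1).factorial : k)⁻¹) : k⟦X⟧) • x ^ (j + 1)

theorem smul_hexpDiv (x : B) : (PowerSeries.X : k⟦X⟧) • hexpDiv (k := k) x = hexp (k := k) x - 1 := by
  rw [← sub_eq_zero]
  refine IsHausdorff.haus (IsAdicComplete.toIsHausdorff (I := hIdeal k) (M := B)) _ fun n => ?_
  rw [SModEq.zero]
  have h1 := hSeries_sub_mem (k := k)
    (fun j => (C (((j + 1).factorial : k)⁻¹) : k⟦X⟧) • x ^ (j + 1)) n
  have h2 := hSeries_sub_mem (k := k)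
    (fun j => (C ((j.factorial : k)⁻¹) : k⟦X⟧) • x ^ j) (n + 1)
  have h3 := Submodule.sub_mem _ (Submodule.smul_mem _ (PowerSeries.X : k⟦X⟧) h1)
    (Submodule.pow_smul_top_le (hIdeal k) B (Nat.le_succ n) h2)
  rw [Finset.sum_range_succ', smul_sub, Finset.smul_sum] at h3
  convert h3 using 1
  rw [hexpDiv, hexp]
  simp only [smul_smul, pow_succ', pow_zero, Nat.factorial_zero, Nat.cast_one, inv_one, map_one,
    one_smul, mul_assoc]
  abel

end Exponential

/-! ### Topological Hopf algebras -/

section TopHopf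

variable {k : Type*} [Field k]

/-- The structure maps of a topological Hopf algebra on a `k⟦ħ⟧`-module `U`; the axioms are in
`IsTopHopf`. Linear maps are automatically continuous in the `ħ`-adic topology. -/
structure HopfData (k : Type*) [Field k] (U : Type*) [AddCommGroup U] [Module k⟦X⟧ U] where
  mul : U ⊗[k⟦X⟧] U →ₗ[k⟦X⟧] U
  one : U
  comul : U →ₗ[k⟦X⟧] HatTensor k U U
  counit : U →ₗ[k⟦X⟧] k⟦X⟧
  antipode : U →ₗ[k⟦X⟧] U

/-- The coproduct of the tensor product of two (topological) coalgebras. -/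
def tensorComul {M N : Type*} [AddCommGroup M] [Module k⟦X⟧ M] [AddCommGroup N] [Module k⟦X⟧ N]
    (Δ₁ : M →ₗ[k⟦X⟧] HatTensor k M M) (Δ₂ : N →ₗ[k⟦X⟧] HatTensor k N N) :
    M ⊗[k⟦X⟧] N →ₗ[k⟦X⟧] HatTensor k (M ⊗[k⟦X⟧] N) (M ⊗[k⟦X⟧] N) :=
  hatMap (TensorProduct.tensorTensorTensorComm k⟦X⟧ M M N N).toLinearMap ∘ₗ
    TensorProduct.lift boxTensor ∘ₗ TensorProduct.map Δ₁ Δ₂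

/-- The convolution product `x ↦ f (x₍₁₎) g (x₍₂₎)`, for the coproduct `Δ` of the source and the
product `m` of the target. -/
def conv {M B : Type*} [AddCommGroup M] [Module k⟦X⟧ M] [AddCommGroup B] [Module k⟦X⟧ B]
    [IsAdicComplete (hIdeal k) B] (Δ : M →ₗ[k⟦X⟧] HatTensor k M M) (m : B ⊗[k⟦X⟧] B →ₗ[k⟦X⟧] B)
    (f g : M →ₗ[k⟦X⟧] B) : M →ₗ[k⟦X⟧] B :=
  hatExtend (m ∘ₗ TensorProduct.map f g) ∘ₗ Δ

variable {U : Type*} [AddCommGroup U] [Module k⟦X⟧ U] [IsAdicComplete (hIdeal k) U]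

/-- The axioms of a topological Hopf algebra over `k⟦ħ⟧`, with `ħ`-adically complete underlying
module and coproduct valued in the completed tensor square. -/
structure IsTopHopf (H : HopfData k U) : Prop where
  mul_assoc : ∀ x y z, H.mul (H.mul (x ⊗ₜ y) ⊗ₜ z) = H.mul (x ⊗ₜ H.mul (y ⊗ₜ z))
  one_mul : ∀ x, H.mul (H.one ⊗ₜ x) = x
  mul_one : ∀ x, H.mul (x ⊗ₜ H.one) = x
  coassoc : ∀ x, hatMap (TensorProduct.assoc k⟦X⟧ U U U).toLinearMap
      (hatTensorMap H.comul toHat (H.comul x)) = hatTensorMap toHat H.comul (H.comul x)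
  counit_comul : ∀ x, hatExtend ((TensorProduct.lid k⟦X⟧ U).toLinearMap ∘ₗ
      TensorProduct.map H.counit LinearMap.id) (H.comul x) = x
  comul_counit : ∀ x, hatExtend ((TensorProduct.rid k⟦X⟧ U).toLinearMap ∘ₗ
      TensorProduct.map LinearMap.id H.counit) (H.comul x) = x
  comul_mul : ∀ x y, H.comul (H.mul (x ⊗ₜ y)) =
      hatMap (TensorProduct.map H.mul H.mul ∘ₗ
        (TensorProduct.tensorTensorTensorComm k⟦X⟧ U U U U).toLinearMap)
        (boxTensor (H.comul x) (H.comul y))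
  comul_one : H.comul H.one = toHat (H.one ⊗ₜ H.one)
  counit_mul : ∀ x y, H.counit (H.mul (x ⊗ₜ y)) = H.counit x * H.counit y
  counit_one : H.counit H.one = 1
  antipode_left : ∀ x, conv H.comul H.mul H.antipode LinearMap.id x = H.counit x • H.one
  antipode_right : ∀ x, conv H.comul H.mul LinearMap.id H.antipode x = H.counit x • H.one

/-- `B` is a closed topological Hopf subalgebra of `(U, H)`: the coproduct of `B` lies in the
closure of the image of `B ⊗ B`. -/
structure IsHopfSub (H : HopfData k U) (B : Submodule k⟦X⟧ U) : Prop where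
  closed : hClosure B = B
  one_mem : H.one ∈ B
  mul_mem : ∀ x ∈ B, ∀ y ∈ B, H.mul (x ⊗ₜ y) ∈ B
  antipode_mem : ∀ x ∈ B, H.antipode x ∈ B
  comul_mem : ∀ x ∈ B, H.comul x ∈
    hClosure ((LinearMap.range (TensorProduct.map B.subtype B.subtype)).map
      (toHat : U ⊗[k⟦X⟧] U →ₗ[k⟦X⟧] HatTensor k U U))

/-- An isomorphism of topological Hopf algebras. -/
structure IsHopfIso {U' : Type*} [AddCommGroup U'] [Module k⟦X⟧ U']
    [IsAdicComplete (hIdeal k) U'] (H : HopfData k U) (H' : HopfData k U')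
    (φ : U ≃ₗ[k⟦X⟧] U') : Prop where
  map_mul : ∀ x y, φ (H.mul (x ⊗ₜ y)) = H'.mul (φ x ⊗ₜ φ y)
  map_one : φ H.one = H'.one
  map_comul : ∀ x, hatMap (TensorProduct.map φ.toLinearMap φ.toLinearMap) (H.comul x) =
    H'.comul (φ x)
  map_counit : ∀ x, H'.counit (φ x) = H.counit x
  map_antipode : ∀ x, φ (H.antipode x) = H'.antipode (φ x)

end TopHopf

/-! ### Multiparameters, realizations and their deformations -/

/-- `A` is a generalized Cartan matrix, symmetrized by the positive integers `d i`. -/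
structure IsSymmetrizableGCM {n : ℕ} (A : Matrix (Fin n) (Fin n) ℤ) (d : Fin n → ℕ) : Prop where
  diag : ∀ i, A i i = 2
  nonpos : ∀ i j, i ≠ j → A i j ≤ 0
  zero_symm : ∀ i j, A i j = 0 → A j i = 0
  d_pos : ∀ i, 0 < d i
  symm : ∀ i j, (d i : ℤ) * A i j = d j * A j i

/-- `P` is of Cartan type: `P + Pᵀ = 2 D A`. -/
def IsCartanType {k : Type*} [Field k] {n : ℕ} (A : Matrix (Fin n) (Fin n) ℤ) (d : Fin n → ℕ)
    (P : Matrix (Fin n) (Fin n) k⟦X⟧) : Prop :=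
  ∀ i j, P i j + P j i = 2 * ((d i : k⟦X⟧) * (A i j : k⟦X⟧))

section Realizations

variable {k : Type*} [Field k] {n : ℕ}
variable {h : Type*} [AddCommGroup h] [Module k⟦X⟧ h]

/-- A realization of the multiparameter `P` on the `k⟦ħ⟧`-module `h`. -/
structure Realization (P : Matrix (Fin n) (Fin n) k⟦X⟧) (h : Type*) [AddCommGroup h]
    [Module k⟦X⟧ h] where
  Tpos : Fin n → h
  Tneg : Fin n → h
  α : Fin n → (h →ₗ[k⟦X⟧] k⟦X⟧)
  α_Tpos : ∀ i j, α j (Tpos i) = P i j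
  α_Tneg : ∀ i j, α j (Tneg i) = P j i
  /-- the `S i = (Tpos i + Tneg i) / 2` are linearly independent over `k` modulo `ħ` -/
  indep : ∀ c : Fin n → k,
    ∑ i, (C (c i) : k⟦X⟧) • (C (2⁻¹ : k) : k⟦X⟧) • (Tpos i + Tneg i) ∈
      (hIdeal k • ⊤ : Submodule k⟦X⟧ h) → c = 0

variable {P : Matrix (Fin n) (Fin n) k⟦X⟧}

/-- `S i = (T⁺ i + T⁻ i) / 2`. -/
def Realization.S (R : Realization P h) (i : Fin n) : h :=
  (C (2⁻¹ : k) : k⟦X⟧) • (R.Tpos i + R.Tneg i)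

/-- Antisymmetric bilinear forms on `h` that vanish on all `S i`. -/
structure AltS (R : Realization P h) where
  form : h →ₗ[k⟦X⟧] h →ₗ[k⟦X⟧] k⟦X⟧
  antisymm : ∀ x y, form x y = - form y x
  vanish : ∀ i x, form (R.S i) x = 0

theorem AltS.vanish_right {R : Realization P h} (χ : AltS R) (i : Fin n) (x : h) :
    χ.form x (R.S i) = 0 := by
  rw [χ.antisymm, χ.vanish, neg_zero]

theorem AltS.form_Tneg [CharZero k] {R : Realization P h} (χ : AltS R) (i : Fin n) (x : h) :
    χ.form (R.Tneg i) x = - χ.form (R.Tpos i) x := by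
  have h1 := χ.vanish i x
  rw [Realization.S, map_smul, map_add, LinearMap.smul_apply, LinearMap.add_apply] at h1
  have h2 : (C (2 : k) : k⟦X⟧) • (C (2⁻¹ : k) : k⟦X⟧) •
      (χ.form (R.Tpos i) x + χ.form (R.Tneg i) x) = 0 := by rw [h1, smul_zero]
  rw [smul_smul, ← map_mul, mul_inv_cancel₀ two_ne_zero, map_one, one_smul] at h2
  exact eq_neg_of_add_eq_zero_right h2

/-- The deformed multiparameter `P₍χ₎`, with entries `P i j + χ (T⁺ i, T⁺ j)`. -/
def deformP (R : Realization P h) (χ : AltS R) : Matrix (Fin n) (Fin n) k⟦X⟧ :=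
  fun i j => P i j + χ.form (R.Tpos i) (R.Tpos j)

theorem isCartanType_deformP {A : Matrix (Fin n) (Fin n) ℤ} {d : Fin n → ℕ}
    (hP : IsCartanType A d P) (R : Realization P h) (χ : AltS R) :
    IsCartanType A d (deformP R χ) := by
  intro i j
  rw [← hP i j, deformP, deformP, χ.antisymm (R.Tpos j)]
  ring

/-- The deformed realization `R₍χ₎`: same coroots, roots `α i + χ (-, T⁺ i)`. -/
def Realization.deform [CharZero k] (R : Realization P h) (χ : AltS R) : Realization (deformP R χ) h where
  Tpos := R.Tpos
  Tneg := R.Tneg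
  α i := R.α i + χ.form.flip (R.Tpos i)
  α_Tpos i j := by
    rw [LinearMap.add_apply, LinearMap.flip_apply, R.α_Tpos, deformP]
  α_Tneg i j := by
    rw [LinearMap.add_apply, LinearMap.flip_apply, R.α_Tneg, deformP, χ.form_Tneg,
      ← χ.antisymm]
  indep := R.indep

end Realizations

/-! ### The algebras `U_{P,ħ}^R(g)` -/

section QNumbers

variable {k : Type*} [Field k]

/-- The `q`-integer `[m]_q` for `q = e ^ {ħ d}`. -/
def qInt (k : Type*) [Field k] (d m : ℕ) : k⟦X⟧ :=
  ∑ s ∈ Finset.range m, hexp (k := k) (B := k⟦X⟧) ((d : k⟦X⟧) * (2 * (s : k⟦X⟧) - (m : k⟦X⟧) + 1))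

/-- The `q`-factorial `[m]_q!` for `q = e ^ {ħ d}`. -/
def qFact (k : Type*) [Field k] (d m : ℕ) : k⟦X⟧ := ∏ s ∈ Finset.range m, qInt k d (s + 1)

/-- The `q`-binomial coefficient for `q = e ^ {ħ d}` (only used for `r ≤ m`). -/
def qBinom (k : Type*) [Field k] (d m r : ℕ) : k⟦X⟧ :=
  qFact k d m * (qFact k d r * qFact k d (m - r))⁻¹

/-- The coefficient `(-1) ^ r * [m choose r]_{q_i} * q_{ij} ^ {r/2} * q_{ji} ^ {-r/2}`, where
`q_i = e ^ {ħ d}`, `q_{ij} = e ^ {ħ p}` and `q_{ji} = e ^ {ħ p'}`. -/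
def serreCoeff (d m r : ℕ) (p p' : k⟦X⟧) : k⟦X⟧ :=
  (-1) ^ r * qBinom k d m r *
    (hexp (k := k) (B := k⟦X⟧) (C ((r : k) / 2) * p) *
      hexp (k := k) (B := k⟦X⟧) (-(C ((r : k) / 2) * p')))

end QNumbers

/-- The generators of `U_{P,ħ}^R(g)`. -/
inductive Gen (n : ℕ) (h : Type*)
  | tor (T : h) : Gen n h
  | E (i : Fin n) : Gen n h
  | F (i : Fin n) : Gen n h

section Algebra

variable {k : Type*} [Field k] {n : ℕ}
variable {h : Type*} [AddCommGroup h] [Module k⟦X⟧ h]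

/-- The free `ħ`-adically complete algebra on the generators. -/
abbrev FreeTop (k : Type*) [Field k] (n : ℕ) (h : Type*) : Type _ :=
  Hat k (FreeAlgebra k⟦X⟧ (Gen n h))

/-- A generator, as an element of the free complete algebra. -/
def gen (k : Type*) [Field k] {n : ℕ} {h : Type*} (g : Gen n h) : FreeTop k n h :=
  toHat (k := k) (FreeAlgebra.ι k⟦X⟧ g)

open Gen in
/-- The defining relations of `U_{P,ħ}^R(g)`. -/
inductive Rel (A : Matrix (Fin n) (Fin n) ℤ) (d : Fin n → ℕ) {P : Matrix (Fin n) (Fin n) k⟦X⟧}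
    (R : Realization P h) : FreeTop k n h → FreeTop k n h → Prop
  | tor_add (T T' : h) : Rel A d R (gen k (tor (T + T'))) (gen k (tor T) + gen k (tor T'))
  | tor_smul (c : k⟦X⟧) (T : h) : Rel A d R (gen k (tor (c • T))) (c • gen k (tor T))
  | tor_comm (T T' : h) :
      Rel A d R (gen k (tor T) * gen k (tor T')) (gen k (tor T') * gen k (tor T))
  | tor_E (T : h) (j : Fin n) :
      Rel A d R (gen k (tor T) * gen k (E j) - gen k (E j) * gen k (tor T))
        (R.α j T • gen k (E j))
  | tor_F (T : h) (j : Fin n) :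
      Rel A d R (gen k (tor T) * gen k (F j) - gen k (F j) * gen k (tor T))
        (-(R.α j T • gen k (F j)))
  | E_F_ne (i j : Fin n) (hij : i ≠ j) :
      Rel A d R (gen k (E i) * gen k (F j) - gen k (F j) * gen k (E i)) 0
  /-- the right-hand side is `(e ^ {ħ T⁺} - e ^ {-ħ T⁻}) / (e ^ {ħ d} - e ^ {-ħ d})`, with
  numerator and denominator divided by `ħ` -/
  | E_F (i : Fin n) :
      Rel A d R (gen k (E i) * gen k (F i) - gen k (F i) * gen k (E i))
        ((hexpDiv (k := k) (B := k⟦X⟧) (d i : k⟦X⟧) -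
            hexpDiv (k := k) (B := k⟦X⟧) (-(d i : k⟦X⟧)))⁻¹ •
          (hexpDiv (k := k) (gen k (tor (R.Tpos i)) : FreeTop k n h) -
            hexpDiv (k := k) (-gen k (tor (R.Tneg i)) : FreeTop k n h)))
  | serre_E (i j : Fin n) (hij : i ≠ j) :
      Rel A d R (∑ r ∈ Finset.range ((1 - A i j).toNat + 1),
        serreCoeff (d i) (1 - A i j).toNat r (P i j) (P j i) •
          (gen k (E i) ^ ((1 - A i j).toNat - r) * gen k (E j) * gen k (E i) ^ r)) 0
  | serre_F (i j : Fin n) (hij : i ≠ j) :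
      Rel A d R (∑ r ∈ Finset.range ((1 - A i j).toNat + 1),
        serreCoeff (d i) (1 - A i j).toNat r (P j i) (P i j) •
          (gen k (F i) ^ ((1 - A i j).toNat - r) * gen k (F j) * gen k (F i) ^ r)) 0

variable (A : Matrix (Fin n) (Fin n) ℤ) (d : Fin n → ℕ) {P : Matrix (Fin n) (Fin n) k⟦X⟧}
  (R : Realization P h)

/-- The `ħ`-adically complete algebra `U_{P,ħ}^R(g)`: the completion of the quotient of the free
complete algebra by its defining relations, that is, its quotient by the closed two-sided ideal
generated by them. -/
def UAlg : Type _ := Hat k (RingQuot (Rel A d R))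

instance instRingUAlg : Ring (UAlg A d R) := inferInstanceAs (Ring (Hat k (RingQuot (Rel A d R))))

instance instAlgebraUAlg : Algebra k⟦X⟧ (UAlg A d R) :=
  inferInstanceAs (Algebra k⟦X⟧ (Hat k (RingQuot (Rel A d R))))

instance instCompleteUAlg : IsAdicComplete (hIdeal k) (UAlg A d R) :=
  inferInstanceAs (IsAdicComplete (hIdeal k) (Hat k (RingQuot (Rel A d R))))

/-- The image of a generator in `U_{P,ħ}^R(g)`. -/
def UAlg.gen (g : Gen n h) : UAlg A d R :=
  (toHat (k := k) (RingQuot.mkAlgHom k⟦X⟧ (Rel A d R) (FoMpQUEA.gen k g)) :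
    Hat k (RingQuot (Rel A d R)))

/-- The toral element `T ∈ h` of `U_{P,ħ}^R(g)`. -/
abbrev UAlg.tor (T : h) : UAlg A d R := UAlg.gen A d R (Gen.tor T)

/-- The generator `E i`. -/
abbrev UAlg.E (i : Fin n) : UAlg A d R := UAlg.gen A d R (Gen.E i)

/-- The generator `F i`. -/
abbrev UAlg.F (i : Fin n) : UAlg A d R := UAlg.gen A d R (Gen.F i)

/-- `H` is the standard topological Hopf algebra structure of `U_{P,ħ}^R(g)`. -/
structure IsFoMpHopf (H : HopfData k (UAlg A d R)) : Prop where
  isTopHopf : IsTopHopf H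
  mul_eq : ∀ x y, H.mul (x ⊗ₜ y) = x * y
  one_eq : H.one = 1
  comul_E : ∀ i, H.comul (UAlg.E A d R i) = toHat (UAlg.E A d R i ⊗ₜ[k⟦X⟧] (1 : UAlg A d R) +
    hexp (k := k) (UAlg.tor A d R (R.Tpos i)) ⊗ₜ[k⟦X⟧] UAlg.E A d R i)
  comul_tor : ∀ T, H.comul (UAlg.tor A d R T) = toHat (UAlg.tor A d R T ⊗ₜ[k⟦X⟧]
    (1 : UAlg A d R) + (1 : UAlg A d R) ⊗ₜ[k⟦X⟧] UAlg.tor A d R T)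
  comul_F : ∀ i, H.comul (UAlg.F A d R i) = toHat (UAlg.F A d R i ⊗ₜ[k⟦X⟧]
    hexp (k := k) (-UAlg.tor A d R (R.Tneg i)) + (1 : UAlg A d R) ⊗ₜ[k⟦X⟧] UAlg.F A d R i)
  counit_E : ∀ i, H.counit (UAlg.E A d R i) = 0
  counit_tor : ∀ T, H.counit (UAlg.tor A d R T) = 0
  counit_F : ∀ i, H.counit (UAlg.F A d R i) = 0
  antipode_E : ∀ i, H.antipode (UAlg.E A d R i) =
    -(hexp (k := k) (-UAlg.tor A d R (R.Tpos i)) * UAlg.E A d R i)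
  antipode_tor : ∀ T, H.antipode (UAlg.tor A d R T) = -UAlg.tor A d R T
  antipode_F : ∀ i, H.antipode (UAlg.F A d R i) =
    -(UAlg.F A d R i * hexp (k := k) (UAlg.tor A d R (R.Tneg i)))

/-- The closed subalgebra of `U_{P,ħ}^R(g)` generated by `t ⊆ h` and all `E i`; for `t = h` it is
the positive Borel subalgebra. -/
def borelPos (t : Submodule k⟦X⟧ h) : Submodule k⟦X⟧ (UAlg A d R) :=
  hClosure (Subalgebra.toSubmodule (Algebra.adjoin k⟦X⟧
    (UAlg.tor A d R '' (t : Set h) ∪ Set.range (UAlg.E A d R))))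

/-- The closed subalgebra of `U_{P,ħ}^R(g)` generated by `t ⊆ h` and all `F i`; for `t = h` it is
the negative Borel subalgebra. -/
def borelNeg (t : Submodule k⟦X⟧ h) : Submodule k⟦X⟧ (UAlg A d R) :=
  hClosure (Subalgebra.toSubmodule (Algebra.adjoin k⟦X⟧
    (UAlg.tor A d R '' (t : Set h) ∪ Set.range (UAlg.F A d R))))

/-- The dense subalgebra generated by the `E i`, the `F i`, the toral elements `T` and their
exponentials `e ^ {ħ T}`. -/
def polySub : Subalgebra k⟦X⟧ (UAlg A d R) :=
  Algebra.adjoin k⟦X⟧ (Set.range (UAlg.tor A d R) ∪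
    Set.range (fun T => hexp (k := k) (UAlg.tor A d R T)) ∪
    Set.range (UAlg.E A d R) ∪ Set.range (UAlg.F A d R))

end Algebra

/-! ### Toral 2-cocycles -/

section Toral

/-- The projection of the symmetric algebra onto its component of degree one. -/
def symDegOne (K M : Type*) [CommRing K] [AddCommGroup M] [Module K M] :
    SymmetricAlgebra K M →ₗ[K] M :=
  letI : Module Kᵐᵒᵖ M := Module.compHom M ((RingHom.id K).fromOpposite mul_comm)
  haveI : IsCentralScalar K M := ⟨fun _ _ => rfl⟩
  TrivSqZeroExt.sndHom K M ∘ₗ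
    (SymmetricAlgebra.lift (A := TrivSqZeroExt K M) (TrivSqZeroExt.inrHom K M)).toLinearMap

theorem symDegOne_one (K M : Type*) [CommRing K] [AddCommGroup M] [Module K M] :
    symDegOne K M 1 = 0 := by
  let _ : Module Kᵐᵒᵖ M := Module.compHom M ((RingHom.id K).fromOpposite mul_comm)
  have _ : IsCentralScalar K M := ⟨fun _ _ => rfl⟩
  exact congrArg TrivSqZeroExt.snd
    (map_one (SymmetricAlgebra.lift (A := TrivSqZeroExt K M) (TrivSqZeroExt.inrHom K M)))

theorem symDegOne_ι (K M : Type*) [CommRing K] [AddCommGroup M] [Module K M] (x : M) :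
    symDegOne K M (SymmetricAlgebra.ι K M x) = x := by
  simp [symDegOne]

theorem symDegOne_ι_mul_ι_mul (K M : Type*) [CommRing K] [AddCommGroup M] [Module K M] (x y : M)
    (z : SymmetricAlgebra K M) :
    symDegOne K M (SymmetricAlgebra.ι K M x * SymmetricAlgebra.ι K M y * z) = 0 := by
  simp [symDegOne]

variable {k : Type*} [Field k] {n : ℕ}
variable {h : Type*} [AddCommGroup h] [Module k⟦X⟧ h]
variable {P : Matrix (Fin n) (Fin n) k⟦X⟧}

/-- The span `s` of the `S i`. -/
def Realization.sSpan (R : Realization P h) : Submodule k⟦X⟧ h :=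
  Submodule.span k⟦X⟧ (Set.range R.S)

/-- The quotient `h / s`. -/
abbrev Realization.hBar (R : Realization P h) : Type _ := h ⧸ R.sSpan

/-- The symmetric algebra of `h / s`. -/
abbrev Realization.symBar (R : Realization P h) : Type _ := SymmetricAlgebra k⟦X⟧ R.hBar

/-- The form on `h / s` induced by `χ`. -/
def AltS.bar {R : Realization P h} (χ : AltS R) : R.hBar →ₗ[k⟦X⟧] R.hBar →ₗ[k⟦X⟧] k⟦X⟧ :=
  R.sSpan.liftQ
    (LinearMap.flip (R.sSpan.liftQ χ.form.flip (by
      refine Submodule.span_le.mpr ?_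
      rintro _ ⟨i, rfl⟩
      exact LinearMap.ext fun x => χ.vanish_right i x)))
    (by
      refine Submodule.span_le.mpr ?_
      rintro _ ⟨i, rfl⟩
      refine LinearMap.ext fun x => ?_
      obtain ⟨y, rfl⟩ := Submodule.Quotient.mk_surjective _ x
      exact χ.vanish i y)

theorem AltS.bar_mk {R : Realization P h} (χ : AltS R) (x y : h) :
    χ.bar (Submodule.Quotient.mk x) (Submodule.Quotient.mk y) = χ.form x y := rfl

/-- The bilinear form `χ̃` on the symmetric algebra of `h / s`: it is `χ` in bidegree `(1, 1)` and
`0` in all other bidegrees. -/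
def AltS.tilde {R : Realization P h} (χ : AltS R) :
    R.symBar ⊗[k⟦X⟧] R.symBar →ₗ[k⟦X⟧] k⟦X⟧ :=
  TensorProduct.lift χ.bar ∘ₗ TensorProduct.map (symDegOne k⟦X⟧ R.hBar) (symDegOne k⟦X⟧ R.hBar)

/-- The convolution power `χ̃ ^ {* m}`, for the standard coalgebra structure of `S ⊗ S`. -/
def AltS.tildePow {R : Realization P h} (χ : AltS R) (m : ℕ) :
    R.symBar ⊗[k⟦X⟧] R.symBar →ₗ[k⟦X⟧] k⟦X⟧ :=
  (WithConv.toConv χ.tilde ^ m).ofConv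

variable {A : Matrix (Fin n) (Fin n) ℤ} {d : Fin n → ℕ} {R : Realization P h}

/-- `π` is the Hopf algebra epimorphism from `U_{P,ħ}^R(g)` onto the completed symmetric algebra
of `h / s` that kills all `E i` and `F i` and is the projection on `h`. -/
structure IsToralProj (H : HopfData k (UAlg A d R)) (π : UAlg A d R →ₐ[k⟦X⟧] Hat k R.symBar) :
    Prop where
  map_E : ∀ i, π (UAlg.E A d R i) = 0
  map_F : ∀ i, π (UAlg.F A d R i) = 0
  map_tor : ∀ T, π (UAlg.tor A d R T) =
    toHat (k := k) (SymmetricAlgebra.ι k⟦X⟧ R.hBar (Submodule.Quotient.mk T))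
  surjective : Function.Surjective π
  map_comul : ∀ x, hatMap (Coalgebra.comul (R := k⟦X⟧) (A := R.symBar)) (π x) =
    hatTensorMap π.toLinearMap π.toLinearMap (H.comul x)
  map_counit : ∀ x, hatExtend (Coalgebra.counit (R := k⟦X⟧) (A := R.symBar)) (π x) = H.counit x

/-- The map `χ̃ ^ {* m} ∘ (π ⊗ π)` on `U ⊗ U`. -/
def toralTerm (χ : AltS R) (π : UAlg A d R →ₐ[k⟦X⟧] Hat k R.symBar) (m : ℕ) :
    UAlg A d R ⊗[k⟦X⟧] UAlg A d R →ₗ[k⟦X⟧] k⟦X⟧ :=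
  hatExtend (χ.tildePow m) ∘ₗ TensorProduct.lift boxTensor ∘ₗ
    TensorProduct.map π.toLinearMap π.toLinearMap

/-- The coefficient `s ^ m / (ħ ^ m 2 ^ m m!)` of the exponential series of `± χ̃ / (2 ħ)`, where
`s = ± 1`. -/
def expCoeff (k : Type*) [Field k] (s : k) (m : ℕ) : LaurentSeries k :=
  HahnSeries.single (-(m : ℤ)) (s ^ m / (2 ^ m * (m.factorial : k)))

/-- `σ` is the toral 2-cocycle `σ_χ` (for `s = 1`), or its convolution inverse (for `s = -1`): on
`polySub`, `σ (x, y) = ∑ s ^ m ħ ^ {-m} χ̃ ^ {* m} (π x, π y) / (2 ^ m m!)`, a convergent series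
in `k((ħ))`. -/
def IsToralCocycle (χ : AltS R) (π : UAlg A d R →ₐ[k⟦X⟧] Hat k R.symBar) (s : k)
    (σ : polySub A d R →ₗ[k⟦X⟧] polySub A d R →ₗ[k⟦X⟧] LaurentSeries k) : Prop :=
  ∀ x y : polySub A d R, ∀ r : ℕ, ∃ M₀ : ℕ, ∀ M ≥ M₀, ∃ v : k⟦X⟧,
    σ x y - ∑ m ∈ Finset.range M, expCoeff k s m *
      algebraMap k⟦X⟧ (LaurentSeries k) (toralTerm χ π m ((x : UAlg A d R) ⊗ₜ (y : UAlg A d R))) =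
    algebraMap k⟦X⟧ (LaurentSeries k) (PowerSeries.X ^ r * v)

/-- `x₍₁₎ ⊗ x₍₂₎ = ∑ a i ⊗ b i`, a finite sum of elements of `polySub`. -/
def IsSweedlerTwo (H : HopfData k (UAlg A d R)) (x : polySub A d R) {N : ℕ}
    (a b : Fin N → polySub A d R) : Prop :=
  H.comul x = toHat (∑ i, (a i : UAlg A d R) ⊗ₜ[k⟦X⟧] (b i : UAlg A d R))

/-- `x₍₁₎ ⊗ x₍₂₎ ⊗ x₍₃₎ = ∑ a i ⊗ b i ⊗ c i`, a finite sum of elements of `polySub`. -/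
def IsSweedlerThree (H : HopfData k (UAlg A d R)) (x : polySub A d R) {N : ℕ}
    (a b c : Fin N → polySub A d R) : Prop :=
  hatTensorMap toHat H.comul (H.comul x) =
    toHat (∑ i, (a i : UAlg A d R) ⊗ₜ[k⟦X⟧] ((b i : UAlg A d R) ⊗ₜ[k⟦X⟧] (c i : UAlg A d R)))

/-- `polySub` is dense and is a Hopf subalgebra in the ordinary sense: its coproducts are finite
sums of tensors. -/
structure IsDenseHopf (H : HopfData k (UAlg A d R)) : Prop where
  dense : hClosure (Subalgebra.toSubmodule (polySub A d R)) = ⊤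
  sweedler_two : ∀ x : polySub A d R, ∃ (N : ℕ) (a b : Fin N → polySub A d R),
    IsSweedlerTwo H x a b
  sweedler_three : ∀ x : polySub A d R, ∃ (N : ℕ) (a b c : Fin N → polySub A d R),
    IsSweedlerThree H x a b c
  antipode_mem : ∀ x ∈ polySub A d R, H.antipode x ∈ polySub A d R

/-- `σ` is a normalized Hopf 2-cocycle on `polySub` with convolution inverse `σ'`. -/
structure IsHopfTwoCocycle (H : HopfData k (UAlg A d R))
    (σ σ' : polySub A d R →ₗ[k⟦X⟧] polySub A d R →ₗ[k⟦X⟧] LaurentSeries k) : Prop where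
  norm_right : ∀ x, σ x 1 = algebraMap k⟦X⟧ (LaurentSeries k) (H.counit x)
  norm_left : ∀ x, σ 1 x = algebraMap k⟦X⟧ (LaurentSeries k) (H.counit x)
  mul_inv : ∀ (x y : polySub A d R) {N N' : ℕ} (x₁ x₂ : Fin N → polySub A d R)
    (y₁ y₂ : Fin N' → polySub A d R), IsSweedlerTwo H x x₁ x₂ → IsSweedlerTwo H y y₁ y₂ →
    ∑ i, ∑ j, σ (x₁ i) (y₁ j) * σ' (x₂ i) (y₂ j) =
      algebraMap k⟦X⟧ (LaurentSeries k) (H.counit x * H.counit y)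
  inv_mul : ∀ (x y : polySub A d R) {N N' : ℕ} (x₁ x₂ : Fin N → polySub A d R)
    (y₁ y₂ : Fin N' → polySub A d R), IsSweedlerTwo H x x₁ x₂ → IsSweedlerTwo H y y₁ y₂ →
    ∑ i, ∑ j, σ' (x₁ i) (y₁ j) * σ (x₂ i) (y₂ j) =
      algebraMap k⟦X⟧ (LaurentSeries k) (H.counit x * H.counit y)
  cocycle : ∀ (x y z : polySub A d R) {N N' N'' : ℕ} (x₁ x₂ : Fin N → polySub A d R)
    (y₁ y₂ : Fin N' → polySub A d R) (z₁ z₂ : Fin N'' → polySub A d R),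
    IsSweedlerTwo H x x₁ x₂ → IsSweedlerTwo H y y₁ y₂ → IsSweedlerTwo H z z₁ z₂ →
    ∑ i, ∑ j, σ (y₁ i) (z₁ j) * σ x (y₂ i * z₂ j) =
      ∑ i, ∑ j, σ (x₁ i) (y₁ j) * σ (x₂ i * y₂ j) z

/-- `mulσ` is the deformed product
`x ·_σ y = σ (x₍₁₎, y₍₁₎) x₍₂₎ y₍₂₎ σ⁻¹ (x₍₃₎, y₍₃₎)` on the dense subalgebra `polySub`. The
formula is read in `k((ħ)) ⊗ U` with its `ħ`-adic topology, in which the submodules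
`ħ ^ m • (1 ⊗ U)` are the neighbourhoods of `0`. -/
def IsDeformedMul (H : HopfData k (UAlg A d R))
    (σ σ' : polySub A d R →ₗ[k⟦X⟧] polySub A d R →ₗ[k⟦X⟧] LaurentSeries k)
    (mulσ : UAlg A d R ⊗[k⟦X⟧] UAlg A d R →ₗ[k⟦X⟧] UAlg A d R) : Prop :=
  ∀ (x y : polySub A d R) {N N' : ℕ} (x₁ x₂ x₃ : Fin N → polySub A d R)
    (y₁ y₂ y₃ : Fin N' → polySub A d R),
    IsSweedlerThree H x x₁ x₂ x₃ → IsSweedlerThree H y y₁ y₂ y₃ →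
    ∀ m : ℕ, ∃ v : UAlg A d R,
      ∑ i, ∑ j, (σ (x₁ i) (y₁ j) * σ' (x₃ i) (y₃ j)) ⊗ₜ[k⟦X⟧]
        H.mul ((x₂ i : UAlg A d R) ⊗ₜ[k⟦X⟧] (y₂ j : UAlg A d R)) =
      (1 : LaurentSeries k) ⊗ₜ[k⟦X⟧]
        (mulσ ((x : UAlg A d R) ⊗ₜ[k⟦X⟧] (y : UAlg A d R)) + (PowerSeries.X ^ m : k⟦X⟧) • v)

end Toral

end FoMpQUEA

end

open FoMpQUEA

noncomputable section

namespace FoMpQUEA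

set_option linter.unusedSectionVars false
set_option linter.unusedVariables false

/-! ### The `ħ`-adic topology -/

section Adic

variable {k : Type*} [Field k]
variable {M N : Type*} [AddCommGroup M] [Module k⟦X⟧ M] [AddCommGroup N] [Module k⟦X⟧ N]

theorem mem_hIdeal_pow_smul_top {n : ℕ} {x : M} :
    x ∈ (hIdeal k ^ n • ⊤ : Submodule k⟦X⟧ M) ↔ ∃ y, x = (PowerSeries.X ^ n : k⟦X⟧) • y := by
  rw [hIdeal, Ideal.span_singleton_pow, Submodule.ideal_span_singleton_smul,
    Submodule.mem_smul_pointwise_iff_exists]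
  simp [eq_comm]

theorem eq_zero_of_forall_pow_smul [IsHausdorff (hIdeal k) M] {x : M}
    (hx : ∀ n : ℕ, ∃ y, x = (PowerSeries.X ^ n : k⟦X⟧) • y) : x = 0 :=
  IsHausdorff.haus ‹_› x fun n => by
    rw [SModEq.zero, mem_hIdeal_pow_smul_top]; exact hx n

theorem isAdicComplete_of_series
    (h1 : ∀ x : M, (∀ n : ℕ, ∃ y, x = (PowerSeries.X ^ n : k⟦X⟧) • y) → x = 0)
    (h2 : ∀ u : ℕ → M, ∃ s, ∀ n : ℕ, ∃ y,
      s - ∑ j ∈ Finset.range n, (PowerSeries.X ^ j : k⟦X⟧) • u j = (PowerSeries.X ^ n : k⟦X⟧) • y) :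
    IsAdicComplete (hIdeal k) M where
  haus' x hx := h1 x fun n => by
    have := hx n
    rwa [SModEq.zero, mem_hIdeal_pow_smul_top] at this
  prec' f hf := by
    have h3 : ∀ n, ∃ y, f (n + 1) - f n = (PowerSeries.X ^ n : k⟦X⟧) • y := fun n => by
      have := (hf (Nat.le_succ n)).symm
      rwa [SModEq.sub_mem, mem_hIdeal_pow_smul_top] at this
    choose u hu using h3
    have h4 : ∀ n, f n = f 0 + ∑ j ∈ Finset.range n, (PowerSeries.X ^ j : k⟦X⟧) • u j := by
      intro n
      induction n with
      | zero => simp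
      | succ n ih => rw [Finset.sum_range_succ, ← add_assoc, ← ih, ← hu]; abel
    obtain ⟨s, hs⟩ := h2 u
    refine ⟨f 0 + s, fun n => ?_⟩
    obtain ⟨y, hy⟩ := hs n
    rw [SModEq.sub_mem, mem_hIdeal_pow_smul_top]
    refine ⟨-y, ?_⟩
    rw [smul_neg, ← hy, h4 n]
    abel

theorem hSeries_sub [IsAdicComplete (hIdeal k) M] (u : ℕ → M) (n : ℕ) :
    ∃ y, hSeries (k := k) u - ∑ j ∈ Finset.range n, (PowerSeries.X ^ j : k⟦X⟧) • u j =
      (PowerSeries.X ^ n : k⟦X⟧) • y :=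
  mem_hIdeal_pow_smul_top.1 (hSeries_sub_mem u n)

theorem eq_of_forall_pow_smul [IsHausdorff (hIdeal k) M] {x x' : M}
    (hx : ∀ n : ℕ, ∃ y, x - x' = (PowerSeries.X ^ n : k⟦X⟧) • y) : x = x' :=
  sub_eq_zero.1 (eq_zero_of_forall_pow_smul (k := k) hx)

theorem hSeries_unique [IsAdicComplete (hIdeal k) M] {u : ℕ → M} {s : M}
    (hs : ∀ n : ℕ, ∃ y, s - ∑ j ∈ Finset.range n, (PowerSeries.X ^ j : k⟦X⟧) • u j =
      (PowerSeries.X ^ n : k⟦X⟧) • y) : s = hSeries (k := k) u := by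
  refine eq_of_forall_pow_smul (k := k) fun n => ?_
  obtain ⟨y, hy⟩ := hs n
  obtain ⟨y', hy'⟩ := hSeries_sub (k := k) u n
  exact ⟨y - y', by rw [smul_sub, ← hy, ← hy']; abel⟩

theorem map_hSeries [IsAdicComplete (hIdeal k) M] [IsAdicComplete (hIdeal k) N]
    (f : M →ₗ[k⟦X⟧] N) (u : ℕ → M) :
    f (hSeries (k := k) u) = hSeries (k := k) fun j => f (u j) := by
  refine hSeries_unique fun n => ?_
  obtain ⟨y, hy⟩ := hSeries_sub (k := k) u n
  refine ⟨f y, ?_⟩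
  rw [← map_smul, ← hy, map_sub, map_sum]
  simp only [map_smul]

/-- A submodule that contains all limits of its elements. -/
def HClosed (S : Submodule k⟦X⟧ M) : Prop :=
  ∀ x, (∀ n : ℕ, ∃ y ∈ S, ∃ v, x = y + (PowerSeries.X ^ n : k⟦X⟧) • v) → x ∈ S

theorem mem_hClosure {S : Submodule k⟦X⟧ M} {x : M} :
    x ∈ hClosure S ↔ ∀ n : ℕ, ∃ y ∈ S, ∃ v, x = y + (PowerSeries.X ^ n : k⟦X⟧) • v := by
  rw [hClosure, Submodule.mem_iInf]
  refine forall_congr' fun n => ?_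
  rw [Submodule.mem_sup]
  constructor
  · rintro ⟨y, hy, z, hz, rfl⟩
    obtain ⟨v, rfl⟩ := mem_hIdeal_pow_smul_top.1 hz
    exact ⟨y, hy, v, rfl⟩
  · rintro ⟨y, hy, v, rfl⟩
    exact ⟨y, hy, _, mem_hIdeal_pow_smul_top.2 ⟨v, rfl⟩, rfl⟩

theorem le_hClosure (S : Submodule k⟦X⟧ M) : S ≤ hClosure S := fun x hx =>
  mem_hClosure.2 fun n => ⟨x, hx, 0, by simp⟩

theorem HClosed.hClosure_eq {S : Submodule k⟦X⟧ M} (hS : HClosed S) : hClosure S = S :=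
  le_antisymm (fun x hx => hS x (mem_hClosure.1 hx)) (le_hClosure S)

theorem hClosed_of_hClosure_eq {S : Submodule k⟦X⟧ M} (hS : hClosure S = S) : HClosed S :=
  fun x hx => by rw [← hS, mem_hClosure]; exact hx

theorem hClosed_hClosure (S : Submodule k⟦X⟧ M) : HClosed (hClosure S) := fun x hx => by
  refine mem_hClosure.2 fun n => ?_
  obtain ⟨y, hy, v, rfl⟩ := hx n
  obtain ⟨z, hz, w, rfl⟩ := mem_hClosure.1 hy n
  exact ⟨z, hz, w + v, by rw [smul_add, add_assoc]⟩

theorem hClosure_le {S S' : Submodule k⟦X⟧ M} (h : S ≤ S') (hS' : HClosed S') : hClosure S ≤ S' :=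
  fun x hx => hS' x fun n => by
    obtain ⟨y, hy, v, e⟩ := mem_hClosure.1 hx n
    exact ⟨y, h hy, v, e⟩

theorem HClosed.comap {S : Submodule k⟦X⟧ N} (hS : HClosed S) (f : M →ₗ[k⟦X⟧] N) :
    HClosed (S.comap f) := fun x hx => hS _ fun n => by
  obtain ⟨y, hy, v, rfl⟩ := hx n
  exact ⟨f y, hy, f v, by rw [map_add, map_smul]⟩

theorem hClosed_bot [IsHausdorff (hIdeal k) M] : HClosed (⊥ : Submodule k⟦X⟧ M) := fun x hx => by
  refine (Submodule.mem_bot _).2 (eq_zero_of_forall_pow_smul (k := k) fun n => ?_)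
  obtain ⟨y, hy, v, rfl⟩ := hx n
  exact ⟨v, by rw [(Submodule.mem_bot _).1 hy, zero_add]⟩

theorem hClosed_eqLocus [IsHausdorff (hIdeal k) N] (f g : M →ₗ[k⟦X⟧] N) :
    HClosed (LinearMap.eqLocus f g) := by
  rw [LinearMap.eqLocus_eq_ker_sub]
  exact hClosed_bot.comap _

theorem HClosed.hSeries_mem [IsAdicComplete (hIdeal k) M] {S : Submodule k⟦X⟧ M} (hS : HClosed S)
    {u : ℕ → M} (hu : ∀ j, u j ∈ S) : hSeries (k := k) u ∈ S := hS _ fun n => by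
  obtain ⟨y, hy⟩ := hSeries_sub (k := k) u n
  exact ⟨_, S.sum_mem fun j _ => S.smul_mem _ (hu j), y, by rw [← hy]; abel⟩

theorem exists_toHat_add (x : Hat k M) (n : ℕ) :
    ∃ y v, x = toHat (k := k) y + (PowerSeries.X ^ n : k⟦X⟧) • v := by
  obtain ⟨y, hy⟩ := Submodule.mkQ_surjective _ (AdicCompletion.eval (hIdeal k) M n x)
  have hx : x - toHat y ∈ (hIdeal k ^ n • ⊤ : Submodule k⟦X⟧ (Hat k M)) := by
    rw [AdicCompletion.pow_smul_top_eq_ker_eval ⟨{PowerSeries.X}, by simp⟩, LinearMap.mem_ker,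
      map_sub, ← hy]
    simp [toHat]
  obtain ⟨v, hv⟩ := mem_hIdeal_pow_smul_top.1 hx
  exact ⟨y, v, by rw [← hv]; abel⟩

end Adic

/-! ### Complete modules of endomorphisms, opposites and series -/

section Complete

variable {k : Type*} [Field k]
variable {M N : Type*} [AddCommGroup M] [Module k⟦X⟧ M] [AddCommGroup N] [Module k⟦X⟧ N]

instance isAdicComplete_linearMap [IsAdicComplete (hIdeal k) N] :
    IsAdicComplete (hIdeal k) (M →ₗ[k⟦X⟧] N) := by
  refine isAdicComplete_of_series (fun f hf => ?_) fun u => ?_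
  · ext x
    refine eq_zero_of_forall_pow_smul (k := k) fun n => ?_
    obtain ⟨g, hg⟩ := hf n
    exact ⟨g x, by rw [hg]; rfl⟩
  · have key : ∀ v : ℕ → (M →ₗ[k⟦X⟧] N), ∃ s : M →ₗ[k⟦X⟧] N,
        ∀ x, s x = hSeries (k := k) fun j => v j x := fun v =>
      ⟨{ toFun := fun x => hSeries (k := k) fun j => v j x
         map_add' := fun x y => Eq.symm <| hSeries_unique fun n => by
           obtain ⟨a, ha⟩ := hSeries_sub (k := k) (fun j => v j x) n
           obtain ⟨b, hb⟩ := hSeries_sub (k := k) (fun j => v j y) n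
           refine ⟨a + b, ?_⟩
           rw [smul_add, ← ha, ← hb]
           simp only [map_add, smul_add, Finset.sum_add_distrib]
           abel
         map_smul' := fun c x => Eq.symm <| hSeries_unique fun n => by
           obtain ⟨a, ha⟩ := hSeries_sub (k := k) (fun j => v j x) n
           refine ⟨c • a, ?_⟩
           rw [smul_comm, ← ha, smul_sub, Finset.smul_sum]
           simp only [map_smul, RingHom.id_apply]
           congr 1
           exact Finset.sum_congr rfl fun j _ => smul_comm _ _ _ }, fun _ => rfl⟩
    obtain ⟨s, hs⟩ := key u
    refine ⟨s, fun n => ?_⟩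
    obtain ⟨t, ht⟩ := key fun j => u (n + j)
    refine ⟨t, ?_⟩
    ext x
    rw [LinearMap.smul_apply, ht, LinearMap.sub_apply, hs, sub_eq_iff_eq_add]
    refine Eq.symm <| hSeries_unique fun m => ?_
    obtain ⟨a, ha⟩ := hSeries_sub (k := k) (fun j => u (n + j) x) m
    obtain ⟨b, hb⟩ : ∃ b, ∑ j ∈ Finset.range (n + m), (PowerSeries.X ^ j : k⟦X⟧) • u j x -
        ∑ j ∈ Finset.range m, (PowerSeries.X ^ j : k⟦X⟧) • u j x =
        (PowerSeries.X ^ m : k⟦X⟧) • b := by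
      refine ⟨∑ j ∈ Finset.range n, (PowerSeries.X ^ j : k⟦X⟧) • u (m + j) x, ?_⟩
      rw [add_comm, Finset.sum_range_add, add_sub_cancel_left, Finset.smul_sum]
      simp only [pow_add, smul_smul]
    refine ⟨(PowerSeries.X ^ n : k⟦X⟧) • a + b, ?_⟩
    rw [smul_add, smul_comm, ← ha, ← hb, Finset.sum_range_add, smul_sub, Finset.smul_sum]
    simp only [LinearMap.coe_sum, Finset.sum_apply, LinearMap.smul_apply, pow_add, smul_smul]
    abel

instance isAdicComplete_end [IsAdicComplete (hIdeal k) M] :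
    IsAdicComplete (hIdeal k) (Module.End k⟦X⟧ M) := isAdicComplete_linearMap

instance isAdicComplete_op [IsAdicComplete (hIdeal k) M] : IsAdicComplete (hIdeal k) Mᵐᵒᵖ := by
  refine isAdicComplete_of_series (fun f hf => ?_) fun u => ?_
  · apply MulOpposite.unop_injective
    refine eq_zero_of_forall_pow_smul (k := k) fun n => ?_
    obtain ⟨g, hg⟩ := hf n
    exact ⟨g.unop, by rw [hg]; rfl⟩
  · refine ⟨MulOpposite.op (hSeries (k := k) fun j => (u j).unop), fun n => ?_⟩
    obtain ⟨y, hy⟩ := hSeries_sub (k := k) (fun j => (u j).unop) n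
    refine ⟨MulOpposite.op y, ?_⟩
    rw [← MulOpposite.op_smul, ← hy]
    simp

end Complete

/-- Formal power series `∑ a m z ^ m` in a central variable `z`. -/
def Ser (A : Type*) : Type _ := PowerSeries A

namespace Ser

variable {k : Type*} [Field k] {A : Type*} [Ring A]

instance : Ring (Ser A) := inferInstanceAs (Ring (PowerSeries A))

instance [Algebra k⟦X⟧ A] : Algebra k⟦X⟧ (Ser A) := inferInstanceAs (Algebra k⟦X⟧ (PowerSeries A))

instance {A : Type*} [CommRing A] : CommRing (Ser A) := inferInstanceAs (CommRing (PowerSeries A))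

/-- The coefficients of a series. -/
def coeff (m : ℕ) : Ser A →+ A := (PowerSeries.coeff (R := A) m).toAddMonoidHom

/-- The series with given coefficients. -/
def mk (a : ℕ → A) : Ser A := PowerSeries.mk a

@[simp] theorem coeff_mk (a : ℕ → A) (m : ℕ) : coeff m (mk a) = a m := PowerSeries.coeff_mk m a

theorem ext {f g : Ser A} (h : ∀ m, coeff m f = coeff m g) : f = g := PowerSeries.ext h

theorem coeff_mul (m : ℕ) (f g : Ser A) :
    coeff m (f * g) = ∑ p ∈ Finset.HasAntidiagonal.antidiagonal m, coeff p.1 f * coeff p.2 g :=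
  PowerSeries.coeff_mul m f g

theorem coeff_one (m : ℕ) : coeff m (1 : Ser A) = if m = 0 then 1 else 0 :=
  PowerSeries.coeff_one m

@[simp] theorem coeff_smul [Algebra k⟦X⟧ A] (m : ℕ) (c : k⟦X⟧) (f : Ser A) : coeff m (c • f) = c • coeff m f := rfl

variable [Algebra k⟦X⟧ A]

/-- The coefficients of a series, as linear maps. -/
def coeffₗ (m : ℕ) : Ser A →ₗ[k⟦X⟧] A where
  __ := coeff m
  map_smul' _ _ := rfl

@[simp] theorem coeffₗ_apply (m : ℕ) (f : Ser A) : coeffₗ (k := k) m f = coeff m f := rfl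

instance isAdicComplete [IsAdicComplete (hIdeal k) A] : IsAdicComplete (hIdeal k) (Ser A) := by
  refine isAdicComplete_of_series (fun f hf => ?_) fun u => ?_
  · refine ext fun m => ?_
    rw [map_zero]
    refine eq_zero_of_forall_pow_smul (k := k) fun n => ?_
    obtain ⟨g, hg⟩ := hf n
    exact ⟨coeff m g, by rw [hg]; rfl⟩
  · refine ⟨mk fun m => hSeries (k := k) fun j => coeff m (u j), fun n => ?_⟩
    choose y hy using fun m => hSeries_sub (k := k) (fun j => coeff m (u j)) n
    refine ⟨mk y, ext fun m => ?_⟩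
    simp only [map_sub, map_sum, coeff_mk, coeff_smul, ← hy]

/-- Constant series. -/
def const : A →ₐ[k⟦X⟧] Ser A where
  toRingHom := (PowerSeries.C : A →+* PowerSeries A)
  commutes' _ := (MvPowerSeries.algebraMap_apply (σ := Unit) (R := k⟦X⟧) (A := A)).symm

theorem coeff_const (m : ℕ) (a : A) : coeff m (const (k := k) a) = if m = 0 then a else 0 :=
  (PowerSeries.coeff_C m a :)

theorem coeff_const_mul (m : ℕ) (a : A) (f : Ser A) :
    coeff m (const (k := k) a * f) = a * coeff m f := (PowerSeries.coeff_C_mul m f a :)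

theorem coeff_mul_const (m : ℕ) (a : A) (f : Ser A) :
    coeff m (f * const (k := k) a) = coeff m f * a := (PowerSeries.coeff_mul_C m f a :)

/-- The substitution `z ↦ c z`. -/
def rescale (c : k⟦X⟧) : Ser A →ₐ[k⟦X⟧] Ser A :=
  AlgHom.ofLinearMap
    { toFun := fun a => mk fun m => c ^ m • coeff m a
      map_add' := fun a b => ext fun m => by simp
      map_smul' := fun r a => ext fun m => by
        simp only [coeff_mk, coeff_smul, RingHom.id_apply]; exact smul_comm _ _ _ }
    (ext fun m => by
      simp only [LinearMap.coe_mk, AddHom.coe_mk, coeff_mk, coeff_one]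
      split_ifs with h <;> simp [h])
    fun a b => ext fun m => by
      simp only [LinearMap.coe_mk, AddHom.coe_mk, coeff_mk, coeff_mul, Finset.smul_sum]
      refine Finset.sum_congr rfl fun p hp => ?_
      rw [← Finset.HasAntidiagonal.mem_antidiagonal.1 hp, pow_add, smul_mul_smul_comm]

@[simp] theorem coeff_rescale (c : k⟦X⟧) (m : ℕ) (a : Ser A) :
    coeff m (rescale c a) = c ^ m • coeff m a :=
  (coeff_mk (fun m => c ^ m • coeff m a) m :)

/-- The series `a z`. -/
def single (a : A) : Ser A := mk fun m => if m = 1 then a else 0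

theorem coeff_single (m : ℕ) (a : A) : coeff m (single a) = if m = 1 then a else 0 := coeff_mk _ _

theorem single_eq (a : A) : single a = const (k := k) a * single 1 := ext fun m => by
  rw [coeff_const_mul, coeff_single, coeff_single]; split_ifs <;> simp

theorem commute_of_forall {f g : Ser A} (h : ∀ m m', Commute (coeff m f) (coeff m' g)) :
    Commute f g := ext fun m => by
  rw [coeff_mul, coeff_mul, ← Finset.Nat.sum_antidiagonal_swap]
  exact Finset.sum_congr rfl fun p _ => h p.2 p.1

end Ser

/-! ### Homomorphisms of completed algebras -/

section HatAlgebra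

variable {k : Type*} [Field k]
variable {A B D : Type*} [Ring A] [Algebra k⟦X⟧ A] [Ring B] [Algebra k⟦X⟧ B] [Ring D] [Algebra k⟦X⟧ D]

variable (k A) in
/-- The canonical homomorphism of an algebra to its completion. -/
def toHatAlg : A →ₐ[k⟦X⟧] Hat k A :=
  AlgHom.ofLinearMap (toHat (k := k)) rfl fun a b => (toHat_mul a b).symm

@[simp] theorem toHatAlg_apply (a : A) : toHatAlg k A a = toHat (k := k) a := rfl

/-- Extension of an algebra homomorphism to the completion. -/
def hatLift [IsAdicComplete (hIdeal k) B] (f : A →ₐ[k⟦X⟧] B) : Hat k A →ₐ[k⟦X⟧] B :=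
  AlgHom.ofLinearMap (hatExtend f.toLinearMap)
    (by rw [hat_one_def, hatExtend_toHat]; simp)
    (by
      have h1 (a : A) : hatExtend f.toLinearMap ∘ₗ hatMulₗ (toHat (k := k) a) =
          LinearMap.mulLeft k⟦X⟧ (f a) ∘ₗ hatExtend f.toLinearMap := hat_ext fun b => by
        simp [hatMulₗ_apply, toHat_mul, hatExtend_toHat]
      have h2 (y : Hat k A) : hatExtend f.toLinearMap ∘ₗ hatMulₗ.flip y =
          LinearMap.mulRight k⟦X⟧ (hatExtend f.toLinearMap y) ∘ₗ hatExtend f.toLinearMap :=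
        hat_ext fun a => by
          have := LinearMap.congr_fun (h1 a) y
          simpa [hatExtend_toHat] using this
      exact fun x y => LinearMap.congr_fun (h2 y) x)

theorem hatLift_eq [IsAdicComplete (hIdeal k) B] (f : A →ₐ[k⟦X⟧] B) (x : Hat k A) :
    hatLift f x = hatExtend f.toLinearMap x := rfl

@[simp] theorem hatLift_toHat [IsAdicComplete (hIdeal k) B] (f : A →ₐ[k⟦X⟧] B) (a : A) :
    hatLift f (toHat (k := k) a) = f a := hatExtend_toHat _ _

theorem hatMap_eq_hatExtend {M N : Type*} [AddCommGroup M] [Module k⟦X⟧ M] [AddCommGroup N]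
    [Module k⟦X⟧ N] (f : M →ₗ[k⟦X⟧] N) : hatMap f = hatExtend (toHat (k := k) ∘ₗ f) :=
  hat_ext fun x => by rw [hatMap_toHat, hatExtend_toHat]; rfl

/-- Functoriality of the completion for algebra homomorphisms. -/
def hatMapAlg (f : A →ₐ[k⟦X⟧] B) : Hat k A →ₐ[k⟦X⟧] Hat k B := hatLift ((toHatAlg k B).comp f)

theorem hatMapAlg_eq (f : A →ₐ[k⟦X⟧] B) (x : Hat k A) : hatMapAlg f x = hatMap f.toLinearMap x := by
  rw [hatMap_eq_hatExtend]; rfl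

@[simp] theorem hatMapAlg_toHat (f : A →ₐ[k⟦X⟧] B) (a : A) :
    hatMapAlg f (toHat (k := k) a) = toHat (k := k) (f a) := hatLift_toHat _ _

instance smulCommClass_hatTensor : SMulCommClass k⟦X⟧ (HatTensor k A B) (HatTensor k A B) := by
  have := Algebra.to_smulCommClass (R := k⟦X⟧) (A := HatTensor k A B)
  exact this

instance isScalarTower_hatTensor : IsScalarTower k⟦X⟧ (HatTensor k A B) (HatTensor k A B) := by
  have := IsScalarTower.right (R := k⟦X⟧) (A := HatTensor k A B)
  exact this

variable (k A B) in
/-- The inclusion of the first factor in the completed tensor product. -/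
def boxL : Hat k A →ₐ[k⟦X⟧] HatTensor k A B := hatMapAlg Algebra.TensorProduct.includeLeft

variable (k A B) in
/-- The inclusion of the second factor in the completed tensor product. -/
def boxR : Hat k B →ₐ[k⟦X⟧] HatTensor k A B := hatMapAlg Algebra.TensorProduct.includeRight

@[simp] theorem boxL_toHat (a : A) : boxL k A B (toHat (k := k) a) = toHat (k := k) (a ⊗ₜ 1) :=
  hatMapAlg_toHat _ _

@[simp] theorem boxR_toHat (b : B) : boxR k A B (toHat (k := k) b) = toHat (k := k) (1 ⊗ₜ b) :=
  hatMapAlg_toHat _ _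

/-- Bilinear maps to a Hausdorff module that agree on modules agree on their completions. -/
theorem hat_ext₂ {M N Q : Type*} [AddCommGroup M] [Module k⟦X⟧ M] [AddCommGroup N] [Module k⟦X⟧ N]
    [AddCommGroup Q] [Module k⟦X⟧ Q] [IsHausdorff (hIdeal k) Q]
    {f g : Hat k M →ₗ[k⟦X⟧] Hat k N →ₗ[k⟦X⟧] Q}
    (h : ∀ x y, f (toHat x) (toHat y) = g (toHat x) (toHat y)) (x : Hat k M) (y : Hat k N) :
    f x y = g x y := by
  have h1 (a : M) : f (toHat a) = g (toHat a) := hat_ext fun b => h a b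
  have h2 : f.flip y = g.flip y := hat_ext fun a => LinearMap.congr_fun (h1 a) y
  exact LinearMap.congr_fun h2 x

theorem boxTensor_eq (x : Hat k A) (y : Hat k B) :
    boxTensor x y = boxL k A B x * boxR k A B y := by
  refine hat_ext₂ (f := boxTensor) (g := (LinearMap.mul k⟦X⟧ (HatTensor k A B)).compl₁₂
    (boxL k A B).toLinearMap (boxR k A B).toLinearMap) (fun a b => ?_) x y
  simp [boxTensor_toHat, toHat_mul]

theorem commute_boxL_boxR (x : Hat k A) (y : Hat k B) :
    Commute (boxL k A B x) (boxR k A B y) := by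
  refine hat_ext₂ (f := (LinearMap.mul k⟦X⟧ (HatTensor k A B)).compl₁₂
    (boxL k A B).toLinearMap (boxR k A B).toLinearMap)
    (g := (LinearMap.mul k⟦X⟧ (HatTensor k A B)).flip.compl₁₂
    (boxL k A B).toLinearMap (boxR k A B).toLinearMap) (fun a b => ?_) x y
  simp [toHat_mul]

theorem commute_boxL_comp_boxR_comp {A' B' : Type*} [Ring A'] [Algebra k⟦X⟧ A'] [Ring B']
    [Algebra k⟦X⟧ B'] (f : A →ₐ[k⟦X⟧] Hat k A') (g : B →ₐ[k⟦X⟧] Hat k B') (a : A) (b : B) :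
    Commute (((boxL k A' B').comp f) a) (((boxR k A' B').comp g) b) :=
  commute_boxL_boxR _ _

/-- The homomorphism `f ⊗̂ g` of completed tensor products. -/
def hatTensorAlg {A' B' : Type*} [Ring A'] [Algebra k⟦X⟧ A'] [Ring B'] [Algebra k⟦X⟧ B']
    (f : A →ₐ[k⟦X⟧] Hat k A') (g : B →ₐ[k⟦X⟧] Hat k B') :
    HatTensor k A B →ₐ[k⟦X⟧] HatTensor k A' B' :=
  hatLift (Algebra.TensorProduct.lift ((boxL k A' B').comp f) ((boxR k A' B').comp g)
    (commute_boxL_comp_boxR_comp f g))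

theorem hatTensorAlg_eq {A' B' : Type*} [Ring A'] [Algebra k⟦X⟧ A'] [Ring B'] [Algebra k⟦X⟧ B']
    (f : A →ₐ[k⟦X⟧] Hat k A') (g : B →ₐ[k⟦X⟧] Hat k B') (x : HatTensor k A B) :
    hatTensorAlg f g x = hatTensorMap f.toLinearMap g.toLinearMap x := by
  rw [hatTensorAlg, hatLift_eq, hatTensorMap]
  congr 2
  refine TensorProduct.ext' fun a b => ?_
  simp only [AlgHom.toLinearMap_apply, LinearMap.comp_apply,
    TensorProduct.map_tmul, TensorProduct.lift.tmul, boxTensor_eq]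
  rfl

theorem hatTensorAlg_toHat {A' B' : Type*} [Ring A'] [Algebra k⟦X⟧ A'] [Ring B'] [Algebra k⟦X⟧ B']
    (f : A →ₐ[k⟦X⟧] Hat k A') (g : B →ₐ[k⟦X⟧] Hat k B') (a : A) (b : B) :
    hatTensorAlg f g (toHat (k := k) (a ⊗ₜ b)) = boxL k A' B' (f a) * boxR k A' B' (g b) := by
  rw [hatTensorAlg, hatLift_toHat, Algebra.TensorProduct.lift_tmul]
  rfl

end HatAlgebra

/-! ### Exponentials -/

section Exp

variable {k : Type*} [Field k]
variable {A B : Type*} [Ring A] [Algebra k⟦X⟧ A] [Ring B] [Algebra k⟦X⟧ B]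
  [IsAdicComplete (hIdeal k) A] [IsAdicComplete (hIdeal k) B]

theorem map_hexp (f : A →ₐ[k⟦X⟧] B) (x : A) : f (hexp (k := k) x) = hexp (k := k) (f x) := by
  have := map_hSeries f.toLinearMap fun j => (C ((j.factorial : k)⁻¹) : k⟦X⟧) • x ^ j
  simpa [hexp] using this

theorem map_hexpDiv (f : A →ₐ[k⟦X⟧] B) (x : A) :
    f (hexpDiv (k := k) x) = hexpDiv (k := k) (f x) := by
  have := map_hSeries f.toLinearMap fun j => (C (((j + 1).factorial : k)⁻¹) : k⟦X⟧) • x ^ (j + 1)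
  simpa [hexpDiv] using this

theorem hexp_mul_of_mul_eq {a b x : A} (h : a * x = x * b) :
    hexp (k := k) a * x = x * hexp (k := k) b := by
  have h1 (j : ℕ) : a ^ j * x = x * b ^ j := by
    induction j with
    | zero => simp
    | succ j ih => rw [pow_succ, mul_assoc, h, ← mul_assoc, ih, mul_assoc, ← pow_succ]
  have h2 := map_hSeries (LinearMap.mulRight k⟦X⟧ x) fun j => (C ((j.factorial : k)⁻¹) : k⟦X⟧) • a ^ j
  have h3 := map_hSeries (LinearMap.mulLeft k⟦X⟧ x) fun j => (C ((j.factorial : k)⁻¹) : k⟦X⟧) • b ^ j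
  simp only [LinearMap.mulRight_apply, LinearMap.mulLeft_apply, smul_mul_assoc, mul_smul_comm, h1]
    at h2 h3
  rw [hexp, h2, hexp, h3]

theorem hexpDiv_mul_of_mul_eq {a b x : A} (h : a * x = x * b) :
    hexpDiv (k := k) a * x = x * hexpDiv (k := k) b := by
  have h1 (j : ℕ) : a ^ j * x = x * b ^ j := by
    induction j with
    | zero => simp
    | succ j ih => rw [pow_succ, mul_assoc, h, ← mul_assoc, ih, mul_assoc, ← pow_succ]
  have h2 := map_hSeries (LinearMap.mulRight k⟦X⟧ x)
    fun j => (C (((j + 1).factorial : k)⁻¹) : k⟦X⟧) • a ^ (j + 1)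
  have h3 := map_hSeries (LinearMap.mulLeft k⟦X⟧ x)
    fun j => (C (((j + 1).factorial : k)⁻¹) : k⟦X⟧) • b ^ (j + 1)
  simp only [LinearMap.mulRight_apply, LinearMap.mulLeft_apply, smul_mul_assoc, mul_smul_comm, h1]
    at h2 h3
  rw [hexpDiv, h2, hexpDiv, h3]

theorem commute_hexp_left {a b : A} (h : Commute a b) : Commute (hexp (k := k) a) b :=
  hexp_mul_of_mul_eq h

theorem commute_hexp {a b : A} (h : Commute a b) : Commute (hexp (k := k) a) (hexp (k := k) b) :=
  commute_hexp_left (commute_hexp_left h.symm).symm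

theorem commute_hexpDiv_left {a b : A} (h : Commute a b) : Commute (hexpDiv (k := k) a) b :=
  hexpDiv_mul_of_mul_eq h

theorem hSeries_zero_tail (u : ℕ → A) (hu : ∀ j, u (j + 1) = 0) : hSeries (k := k) u = u 0 := by
  refine Eq.symm <| hSeries_unique fun n => ?_
  cases n with
  | zero => exact ⟨u 0, by simp⟩
  | succ n => exact ⟨0, by simp [Finset.sum_range_succ', hu]⟩

@[simp] theorem hexp_zero : hexp (k := k) (0 : A) = 1 := by
  rw [hexp, hSeries_zero_tail _ (by simp)]
  simp

@[simp] theorem hexpDiv_zero : hexpDiv (k := k) (0 : A) = 0 := by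
  rw [hexpDiv, hSeries_zero_tail _ (by simp)]
  simp

theorem hexp_sub_one (x : A) :
    hexp (k := k) x - 1 = (PowerSeries.X : k⟦X⟧) • hexpDiv (k := k) x := (smul_hexpDiv x).symm

theorem hSeries_mul (u v : ℕ → A) : hSeries (k := k) u * hSeries (k := k) v =
    hSeries (k := k) fun m => ∑ p ∈ Finset.HasAntidiagonal.antidiagonal m, u p.1 * v p.2 := by
  refine hSeries_unique fun n => ?_
  obtain ⟨y, hy⟩ := hSeries_sub (k := k) u n
  obtain ⟨y', hy'⟩ := hSeries_sub (k := k) v n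
  rw [sub_eq_iff_eq_add] at hy hy'
  have h1 : ∃ w, (∑ i ∈ Finset.range n, (PowerSeries.X ^ i : k⟦X⟧) • u i) *
      (∑ i ∈ Finset.range n, (PowerSeries.X ^ i : k⟦X⟧) • v i) -
      ∑ m ∈ Finset.range n, (PowerSeries.X ^ m : k⟦X⟧) •
        ∑ p ∈ Finset.HasAntidiagonal.antidiagonal m, u p.1 * v p.2 =
      (PowerSeries.X ^ n : k⟦X⟧) • w := by
    have h2 : ∑ m ∈ Finset.range n, (PowerSeries.X ^ m : k⟦X⟧) •
        ∑ p ∈ Finset.HasAntidiagonal.antidiagonal m, u p.1 * v p.2 =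
        ∑ p ∈ (Finset.range n ×ˢ Finset.range n) with p.1 + p.2 < n,
          (PowerSeries.X ^ (p.1 + p.2) : k⟦X⟧) • (u p.1 * v p.2) := by
      simp only [Finset.smul_sum]
      rw [Finset.sum_sigma']
      refine Finset.sum_bij' (fun a _ => a.2) (fun p _ => ⟨p.1 + p.2, p⟩) ?_ ?_ ?_ ?_ ?_
      · rintro ⟨m, p⟩ hp
        simp only [Finset.mem_sigma, Finset.mem_range, Finset.HasAntidiagonal.mem_antidiagonal] at hp
        simp only [Finset.mem_filter, Finset.mem_product, Finset.mem_range]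
        omega
      · rintro p hp
        simp only [Finset.mem_filter, Finset.mem_product, Finset.mem_range] at hp
        simp [hp.2]
      · rintro ⟨m, p⟩ hp
        simp only [Finset.mem_sigma, Finset.mem_range, Finset.HasAntidiagonal.mem_antidiagonal] at hp
        obtain ⟨_, rfl⟩ := hp
        rfl
      · intros; rfl
      · rintro ⟨m, p⟩ hp
        simp only [Finset.mem_sigma, Finset.mem_range, Finset.HasAntidiagonal.mem_antidiagonal] at hp
        rw [hp.2]
    rw [h2, Finset.sum_mul_sum, ← Finset.sum_product',
      ← Finset.sum_filter_add_sum_filter_not (Finset.range n ×ˢ Finset.range n)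
        (fun p => p.1 + p.2 < n)]
    simp only [smul_mul_smul_comm, ← pow_add, add_sub_cancel_left]
    refine ⟨∑ p ∈ (Finset.range n ×ˢ Finset.range n) with ¬ (p.1 + p.2 < n),
      (PowerSeries.X ^ (p.1 + p.2 - n) : k⟦X⟧) • (u p.1 * v p.2), ?_⟩
    rw [Finset.smul_sum]
    refine Finset.sum_congr rfl fun p hp => ?_
    rw [smul_smul, ← pow_add, Nat.add_sub_cancel' (not_lt.1 (Finset.mem_filter.1 hp).2)]
  obtain ⟨w, hw⟩ := h1
  rw [sub_eq_iff_eq_add] at hw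
  refine ⟨y * hSeries (k := k) v + (∑ i ∈ Finset.range n, (PowerSeries.X ^ i : k⟦X⟧) • u i) * y' + w,
    ?_⟩
  rw [sub_eq_iff_eq_add]
  have h3 : hSeries (k := k) u * hSeries (k := k) v =
      (PowerSeries.X ^ n : k⟦X⟧) • (y * hSeries (k := k) v) +
        (∑ i ∈ Finset.range n, (PowerSeries.X ^ i : k⟦X⟧) • u i) * hSeries (k := k) v := by
    conv_lhs => rw [hy, add_mul, smul_mul_assoc]
  rw [h3, hy']
  simp only [mul_add, hw, smul_add, mul_smul_comm]
  abel

theorem hexp_add [CharZero k] {a b : A} (h : Commute a b) :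
    hexp (k := k) (a + b) = hexp (k := k) a * hexp (k := k) b := by
  rw [hexp, hexp, hexp, hSeries_mul]
  congr 1
  ext m
  rw [h.add_pow', Finset.smul_sum]
  refine Finset.sum_congr rfl fun p hp => ?_
  obtain ⟨i, j⟩ := p
  obtain rfl := Finset.HasAntidiagonal.mem_antidiagonal.1 hp
  rw [smul_mul_smul_comm, ← Nat.cast_smul_eq_nsmul k⟦X⟧, smul_smul]
  congr 1
  rw [← map_natCast (C (R := k)), ← map_mul, ← map_mul]
  congr 1
  have := Nat.add_choose_mul_factorial_mul_factorial i j
  have h1 : ((i + j).factorial : k) ≠ 0 := Nat.cast_ne_zero.2 (Nat.factorial_ne_zero _)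
  have h2 : (i.factorial : k) ≠ 0 := Nat.cast_ne_zero.2 (Nat.factorial_ne_zero _)
  have h3 : (j.factorial : k) ≠ 0 := Nat.cast_ne_zero.2 (Nat.factorial_ne_zero _)
  rw [Nat.choose_symm_add]
  field_simp
  rw [← this]
  push_cast
  ring

theorem hSeries_add (u v : ℕ → A) : hSeries (k := k) u + hSeries (k := k) v =
    hSeries (k := k) fun m => u m + v m := by
  refine hSeries_unique fun n => ?_
  obtain ⟨y, hy⟩ := hSeries_sub (k := k) u n
  obtain ⟨y', hy'⟩ := hSeries_sub (k := k) v n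
  refine ⟨y + y', ?_⟩
  rw [smul_add, ← hy, ← hy']
  simp only [smul_add, Finset.sum_add_distrib]
  abel

theorem hexpDiv_add [CharZero k] {a b : A} (h : Commute a b) :
    hexpDiv (k := k) (a + b) = hexpDiv (k := k) a + hexp (k := k) a * hexpDiv (k := k) b := by
  rw [hexp, hexpDiv, hexpDiv, hexpDiv, hSeries_mul, hSeries_add]
  congr 1
  ext m
  rw [h.add_pow', Finset.smul_sum, Finset.Nat.antidiagonal_succ', Finset.sum_cons, Finset.sum_map]
  congr 1
  · simp
  refine Finset.sum_congr rfl fun p hp => ?_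
  obtain ⟨i, j⟩ := p
  obtain rfl := Finset.HasAntidiagonal.mem_antidiagonal.1 hp
  simp only [Function.Embedding.prodMap, Function.Embedding.coeFn_mk, Prod.map,
    Function.Embedding.refl_apply, Nat.succ_eq_add_one]
  rw [smul_mul_smul_comm, ← Nat.cast_smul_eq_nsmul k⟦X⟧, smul_smul]
  congr 1
  rw [← map_natCast (C (R := k)), ← map_mul, ← map_mul]
  congr 1
  have := Nat.add_choose_mul_factorial_mul_factorial i (j + 1)
  have h1 : ((i + j + 1).factorial : k) ≠ 0 := Nat.cast_ne_zero.2 (Nat.factorial_ne_zero _)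
  have h2 : (i.factorial : k) ≠ 0 := Nat.cast_ne_zero.2 (Nat.factorial_ne_zero _)
  have h3 : ((j + 1).factorial : k) ≠ 0 := Nat.cast_ne_zero.2 (Nat.factorial_ne_zero _)
  rw [← add_assoc] at this
  have h4 : (i + (j + 1)).choose i = (i + j + 1).choose (j + 1) := Nat.choose_symm_add
  rw [← add_assoc] at h4
  simp only [h4]
  field_simp
  rw [← this]
  push_cast
  ring

theorem hexp_neg_mul [CharZero k] (a : A) : hexp (k := k) (-a) * hexp (k := k) a = 1 := by
  rw [← hexp_add (Commute.refl a).neg_left, neg_add_cancel, hexp_zero]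

theorem hexp_mul_neg [CharZero k] (a : A) : hexp (k := k) a * hexp (k := k) (-a) = 1 := by
  rw [← hexp_add (Commute.refl a).neg_right, add_neg_cancel, hexp_zero]

theorem hexp_algebraMap (c : k⟦X⟧) :
    hexp (k := k) (algebraMap k⟦X⟧ A c) = algebraMap k⟦X⟧ A (hexp (k := k) (B := k⟦X⟧) c) :=
  (map_hexp (Algebra.ofId k⟦X⟧ A) c).symm

/-- The exponential of an element shifted by a scalar. -/
theorem hexp_add_algebraMap [CharZero k] (a : A) (c : k⟦X⟧) :
    hexp (k := k) (a + algebraMap k⟦X⟧ A c) =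
      hexp (k := k) (B := k⟦X⟧) c • hexp (k := k) a := by
  rw [hexp_add (Algebra.commutes c a).symm, hexp_algebraMap, ← Algebra.commutes, Algebra.smul_def]

theorem hexp_mul_comm_of_smul [CharZero k] {a x : A} {c : k⟦X⟧} (h : a * x - x * a = c • x) :
    hexp (k := k) a * x = hexp (k := k) (B := k⟦X⟧) c • (x * hexp (k := k) a) := by
  rw [hexp_mul_of_mul_eq (b := a + algebraMap k⟦X⟧ A c), hexp_add_algebraMap, mul_smul_comm]
  rw [mul_add, ← Algebra.commutes, ← Algebra.smul_def, ← h]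
  abel

end Exp

/-! ### The universal property of `U_{P,ħ}^R(g)` -/

section Universal

variable {k : Type*} [Field k] {n : ℕ}
variable {h : Type*} [AddCommGroup h] [Module k⟦X⟧ h]
variable (A : Matrix (Fin n) (Fin n) ℤ) (d : Fin n → ℕ) {P : Matrix (Fin n) (Fin n) k⟦X⟧}
  (R : Realization P h)
variable {B : Type*} [Ring B] [Algebra k⟦X⟧ B] [IsAdicComplete (hIdeal k) B]

variable (k) in
/-- The scalar `(q_i - q_i⁻¹) / ħ`, inverted. -/
def efCoeff (d : ℕ) : k⟦X⟧ :=
  (hexpDiv (k := k) (B := k⟦X⟧) (d : k⟦X⟧) - hexpDiv (k := k) (B := k⟦X⟧) (-(d : k⟦X⟧)))⁻¹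

/-- The quantum Serre element of `x` and `y`. -/
def serre (d m : ℕ) (p p' : k⟦X⟧) (x y : B) : B :=
  ∑ r ∈ Finset.range (m + 1), serreCoeff d m r p p' • (x ^ (m - r) * y * x ^ r)

/-- The defining relations of `U_{P,ħ}^R(g)`, for elements of a complete algebra. -/
structure IsGenRel (τ : h →ₗ[k⟦X⟧] B) (e f : Fin n → B) : Prop where
  comm : ∀ T T', τ T * τ T' = τ T' * τ T
  tor_E : ∀ T j, τ T * e j - e j * τ T = R.α j T • e j
  tor_F : ∀ T j, τ T * f j - f j * τ T = -(R.α j T • f j)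
  E_F_ne : ∀ i j, i ≠ j → e i * f j - f j * e i = 0
  E_F : ∀ i, e i * f i - f i * e i =
    efCoeff k (d i) • (hexpDiv (k := k) (τ (R.Tpos i)) - hexpDiv (k := k) (-τ (R.Tneg i)))
  serre_E : ∀ i j, i ≠ j → serre (d i) (1 - A i j).toNat (P i j) (P j i) (e i) (e j) = 0
  serre_F : ∀ i j, i ≠ j → serre (d i) (1 - A i j).toNat (P j i) (P i j) (f i) (f j) = 0

/-- The values of an algebra homomorphism on the generators. -/
def genMap (τ : h → B) (e f : Fin n → B) : Gen n h → B
  | .tor T => τ T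
  | .E i => e i
  | .F i => f i

variable (k) in
/-- The homomorphism from the free complete algebra with given values on the generators. -/
def freeLift (g : Gen n h → B) : FreeTop k n h →ₐ[k⟦X⟧] B := hatLift (FreeAlgebra.lift k⟦X⟧ g)

@[simp] theorem freeLift_gen (g : Gen n h → B) (x : Gen n h) : freeLift k g (gen k x) = g x := by
  rw [freeLift, gen, hatLift_toHat, FreeAlgebra.lift_ι_apply]

variable {A d R}

theorem IsGenRel.freeLift_rel {τ : h →ₗ[k⟦X⟧] B} {e f : Fin n → B} (H : IsGenRel A d R τ e f)
    {a b : FreeTop k n h} (hab : Rel A d R a b) :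
    freeLift k (genMap τ e f) a = freeLift k (genMap τ e f) b := by
  induction hab with
  | tor_add T T' => simp [genMap]
  | tor_smul c T => simp [genMap]
  | tor_comm T T' => simpa [genMap] using H.comm T T'
  | tor_E T j => simpa [genMap] using H.tor_E T j
  | tor_F T j => simpa [genMap] using H.tor_F T j
  | E_F_ne i j hij => simpa [genMap] using H.E_F_ne i j hij
  | E_F i => simpa [genMap, map_hexpDiv, efCoeff] using H.E_F i
  | serre_E i j hij => simpa [genMap, serre] using H.serre_E i j hij
  | serre_F i j hij => simpa [genMap, serre] using H.serre_F i j hij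

/-- The universal property of `U_{P,ħ}^R(g)`. -/
def IsGenRel.lift {τ : h →ₗ[k⟦X⟧] B} {e f : Fin n → B} (H : IsGenRel A d R τ e f) :
    UAlg A d R →ₐ[k⟦X⟧] B :=
  (hatLift (RingQuot.liftAlgHom k⟦X⟧ ⟨freeLift k (genMap τ e f), fun _ _ => H.freeLift_rel⟩) :
    Hat k (RingQuot (Rel A d R)) →ₐ[k⟦X⟧] B)

theorem UAlg.toHat_mul (a b : RingQuot (Rel A d R)) : (toHat (k := k) (a * b) : UAlg A d R) =
    (toHat (k := k) a : UAlg A d R) * (toHat (k := k) b : UAlg A d R) :=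
  (FoMpQUEA.toHat_mul (k := k) a b).symm

theorem UAlg.toHat_add (a b : RingQuot (Rel A d R)) : (toHat (k := k) (a + b) : UAlg A d R) =
    (toHat (k := k) a : UAlg A d R) + (toHat (k := k) b : UAlg A d R) :=
  map_add (toHat (k := k)) a b

theorem UAlg.toHat_smul (c : k⟦X⟧) (b : RingQuot (Rel A d R)) :
    (toHat (k := k) (c • b) : UAlg A d R) = c • (toHat (k := k) b : UAlg A d R) :=
  map_smul (toHat (k := k)) c b

variable (A d R) in
/-- The canonical homomorphism from the uncompleted algebra. -/
def UAlg.ofQuot : RingQuot (Rel A d R) →ₐ[k⟦X⟧] UAlg A d R :=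
  AlgHom.ofLinearMap
    { toFun := fun a => (toHat (k := k) a : Hat k (RingQuot (Rel A d R)))
      map_add' := UAlg.toHat_add
      map_smul' := UAlg.toHat_smul } rfl UAlg.toHat_mul

variable (A d R) in
/-- The canonical homomorphism from the free complete algebra. -/
def UAlg.ofFree : FreeTop k n h →ₐ[k⟦X⟧] UAlg A d R :=
  (UAlg.ofQuot A d R).comp (RingQuot.mkAlgHom k⟦X⟧ (Rel A d R))

theorem UAlg.ofFree_gen (x : Gen n h) : UAlg.ofFree A d R (FoMpQUEA.gen k x) = UAlg.gen A d R x := rfl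

theorem UAlg.ofFree_rel {a b : FreeTop k n h} (hab : Rel A d R a b) :
    UAlg.ofFree A d R a = UAlg.ofFree A d R b :=
  congrArg (UAlg.ofQuot A d R) (RingQuot.mkAlgHom_rel k⟦X⟧ hab)

theorem IsGenRel.lift_gen {τ : h →ₗ[k⟦X⟧] B} {e f : Fin n → B} (H : IsGenRel A d R τ e f)
    (x : Gen n h) : H.lift (UAlg.gen A d R x) = genMap τ e f x := by
  refine (hatLift_toHat (k := k) (RingQuot.liftAlgHom k⟦X⟧
    ⟨freeLift k (genMap τ e f), fun _ _ => H.freeLift_rel⟩) _).trans ?_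
  rw [RingQuot.liftAlgHom_mkAlgHom_apply]
  exact freeLift_gen _ _

@[simp] theorem IsGenRel.lift_tor {τ : h →ₗ[k⟦X⟧] B} {e f : Fin n → B} (H : IsGenRel A d R τ e f)
    (T : h) : H.lift (UAlg.tor A d R T) = τ T := H.lift_gen _

@[simp] theorem IsGenRel.lift_E {τ : h →ₗ[k⟦X⟧] B} {e f : Fin n → B} (H : IsGenRel A d R τ e f)
    (i : Fin n) : H.lift (UAlg.E A d R i) = e i := H.lift_gen _

@[simp] theorem IsGenRel.lift_F {τ : h →ₗ[k⟦X⟧] B} {e f : Fin n → B} (H : IsGenRel A d R τ e f)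
    (i : Fin n) : H.lift (UAlg.F A d R i) = f i := H.lift_gen _

variable (A d R)

/-- The toral part, as a linear map. -/
def UAlg.torₗ : h →ₗ[k⟦X⟧] UAlg A d R where
  toFun := UAlg.tor A d R
  map_add' T T' := by
    have := UAlg.ofFree_rel (Rel.tor_add (A := A) (d := d) (R := R) T T')
    simpa only [map_add, UAlg.ofFree_gen] using this
  map_smul' c T := by
    have := UAlg.ofFree_rel (Rel.tor_smul (A := A) (d := d) (R := R) c T)
    simpa only [map_smul, UAlg.ofFree_gen, RingHom.id_apply] using this

@[simp] theorem UAlg.torₗ_apply (T : h) : UAlg.torₗ A d R T = UAlg.tor A d R T := rfl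

theorem UAlg.isGenRel : IsGenRel A d R (UAlg.torₗ A d R) (UAlg.E A d R) (UAlg.F A d R) where
  comm T T' := by
    have := UAlg.ofFree_rel (Rel.tor_comm (A := A) (d := d) (R := R) T T')
    simp only [map_mul, UAlg.ofFree_gen] at this
    exact this
  tor_E T j := by
    have := UAlg.ofFree_rel (Rel.tor_E (A := A) (d := d) (R := R) T j)
    simp only [map_mul, map_sub, map_smul, UAlg.ofFree_gen] at this
    exact this
  tor_F T j := by
    have := UAlg.ofFree_rel (Rel.tor_F (A := A) (d := d) (R := R) T j)
    simp only [map_mul, map_sub, map_smul, map_neg, UAlg.ofFree_gen] at this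
    exact this
  E_F_ne i j hij := by
    have := UAlg.ofFree_rel (Rel.E_F_ne (A := A) (d := d) (R := R) i j hij)
    simp only [map_mul, map_sub, map_zero, UAlg.ofFree_gen] at this
    exact this
  E_F i := by
    have := UAlg.ofFree_rel (Rel.E_F (A := A) (d := d) (R := R) i)
    simp only [map_mul, map_sub, map_smul, map_neg, map_hexpDiv, UAlg.ofFree_gen] at this
    exact this
  serre_E i j hij := by
    have := UAlg.ofFree_rel (Rel.serre_E (A := A) (d := d) (R := R) i j hij)
    simp only [map_mul, map_sum, map_smul, map_pow, map_zero, UAlg.ofFree_gen] at this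
    exact this
  serre_F i j hij := by
    have := UAlg.ofFree_rel (Rel.serre_F (A := A) (d := d) (R := R) i j hij)
    simp only [map_mul, map_sum, map_smul, map_pow, map_zero, UAlg.ofFree_gen] at this
    exact this

variable {A d R}

theorem UAlg.exists_free_add (x : UAlg A d R) (m : ℕ) :
    ∃ (v : FreeAlgebra k⟦X⟧ (Gen n h)) (y : UAlg A d R),
      x = UAlg.ofFree A d R (toHat (k := k) v) + (PowerSeries.X ^ m : k⟦X⟧) • y := by
  obtain ⟨r, y, e⟩ : ∃ (r : RingQuot (Rel A d R)) (y : UAlg A d R),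
      x = UAlg.ofQuot A d R r + (PowerSeries.X ^ m : k⟦X⟧) • y :=
    exists_toHat_add (k := k) (M := RingQuot (Rel A d R)) x m
  obtain ⟨w, rfl⟩ := RingQuot.mkAlgHom_surjective k⟦X⟧ (Rel A d R) r
  obtain ⟨v, w', rfl⟩ := exists_toHat_add (k := k) w m
  refine ⟨v, UAlg.ofFree A d R w' + y, ?_⟩
  rw [smul_add, ← map_smul, ← add_assoc, ← map_add]
  exact e

/-- Induction on the elements of `U_{P,ħ}^R(g)`. -/
theorem UAlg.induction {S : Submodule k⟦X⟧ (UAlg A d R)} (hS : HClosed S) (h1 : 1 ∈ S)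
    (hT : ∀ T, ∀ x ∈ S, UAlg.tor A d R T * x ∈ S) (hE : ∀ i, ∀ x ∈ S, UAlg.E A d R i * x ∈ S)
    (hF : ∀ i, ∀ x ∈ S, UAlg.F A d R i * x ∈ S) (x : UAlg A d R) : x ∈ S := by
  have key (v : FreeAlgebra k⟦X⟧ (Gen n h)) :
      ∀ x ∈ S, UAlg.ofFree A d R (toHat (k := k) v) * x ∈ S := by
    induction v using FreeAlgebra.induction with
    | grade0 c =>
      intro x hx
      rw [← toHatAlg_apply, AlgHom.commutes, AlgHom.commutes, ← Algebra.smul_def]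
      exact S.smul_mem _ hx
    | grade1 g =>
      intro x hx
      cases g with
      | tor T => exact hT T x hx
      | E i => exact hE i x hx
      | F i => exact hF i x hx
    | mul a b ha hb =>
      intro x hx
      rw [← toHatAlg_apply, map_mul, map_mul, mul_assoc]
      exact ha _ (hb _ hx)
    | add a b ha hb =>
      intro x hx
      rw [map_add, map_add, add_mul]
      exact S.add_mem (ha _ hx) (hb _ hx)
  refine hS x fun m => ?_
  obtain ⟨v, y, e⟩ := UAlg.exists_free_add x m
  exact ⟨_, by simpa using key v 1 h1, y, e⟩

/-- Induction on the elements of `U_{P,ħ}^R(g)`, for subalgebras. -/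
theorem UAlg.induction_subalgebra {S : Subalgebra k⟦X⟧ (UAlg A d R)}
    (hS : HClosed (Subalgebra.toSubmodule S)) (hT : ∀ T, UAlg.tor A d R T ∈ S)
    (hE : ∀ i, UAlg.E A d R i ∈ S) (hF : ∀ i, UAlg.F A d R i ∈ S) (x : UAlg A d R) : x ∈ S :=
  UAlg.induction (S := Subalgebra.toSubmodule S) hS S.one_mem
    (fun T _ hx => S.mul_mem (hT T) hx) (fun i _ hx => S.mul_mem (hE i) hx)
    (fun i _ hx => S.mul_mem (hF i) hx) x

end Universal

/-! ### Iterated `q`-commutators and the quantum Serre elements -/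

section QAd

variable {k : Type*} [Field k]
variable {B : Type*} [Ring B] [Algebra k⟦X⟧ B]

/-- The iterated `q`-commutator `(ad_{c (m-1)} x) ⋯ (ad_{c 0} x) y`, with
`(ad_c x) w = x w - c w x`. -/
def qAd (c : ℕ → k⟦X⟧) (x y : B) : ℕ → B
  | 0 => y
  | m + 1 => x * qAd c x y m - c m • (qAd c x y m * x)

theorem map_qAd {B' : Type*} [Ring B'] [Algebra k⟦X⟧ B'] (f : B →ₐ[k⟦X⟧] B') (c : ℕ → k⟦X⟧)
    (x y : B) (m : ℕ) : f (qAd c x y m) = qAd c (f x) (f y) m := by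
  induction m with
  | zero => rfl
  | succ m ih => simp [qAd, ih]

theorem qAd_add_of_mul_eq {c : ℕ → k⟦X⟧} {x y u : B} {t : k⟦X⟧} (hyx : y * x = t • (x * y))
    (hyu : y * u = c 0 • (u * y)) (hc : ∀ l, c (l + 1) = t * c l) (m : ℕ) :
    qAd c (x + y) u m = qAd c x u m := by
  have h1 (l : ℕ) : y * qAd c x u l = c l • (qAd c x u l * y) := by
    induction l with
    | zero => exact hyu
    | succ l ih =>
      have e1 : y * (x * qAd c x u l) = (t * c l) • (x * qAd c x u l * y) := by
        rw [← mul_assoc, hyx, smul_mul_assoc, mul_assoc, ih, mul_smul_comm, smul_smul, mul_assoc]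
      have e2 : y * (qAd c x u l * x) = (t * c l) • (qAd c x u l * x * y) := by
        rw [← mul_assoc, ih, smul_mul_assoc, mul_assoc, hyx, mul_smul_comm, smul_smul,
          mul_comm t, mul_assoc]
      rw [qAd, mul_sub, mul_smul_comm, e1, e2, hc, sub_mul, smul_mul_assoc, smul_sub,
        smul_comm (c l)]
  induction m with
  | zero => rfl
  | succ m ih =>
    rw [qAd, ih, qAd, add_mul, mul_add, h1, smul_add]
    abel

theorem qAd_mul_of_commute {c : ℕ → k⟦X⟧} {a b x y : B} (hab : Commute a b) (hax : Commute a x)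
    (hay : Commute a y) (hbx : Commute b x) (m : ℕ) :
    qAd c (a * x) (b * y) m = a ^ m * b * qAd c x y m := by
  have h1 (l : ℕ) : Commute a (qAd c x y l) := by
    induction l with
    | zero => exact hay
    | succ l ih => exact ((hax.mul_right ih).sub_right ((ih.mul_right hax).smul_right _))
  induction m with
  | zero => simp [qAd]
  | succ m ih =>
    have e1 : a * x * (a ^ m * b * qAd c x y m) = a ^ (m + 1) * b * (x * qAd c x y m) := by
      have : Commute x (a ^ m * b) := (hax.symm.pow_right m).mul_right hbx.symm
      rw [mul_assoc a, ← mul_assoc x, this.eq, pow_succ']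
      simp only [mul_assoc]
    have e2 : a ^ m * b * qAd c x y m * (a * x) = a ^ (m + 1) * b * (qAd c x y m * x) := by
      rw [mul_assoc (a ^ m * b), ← mul_assoc _ a x, ← (h1 m).eq, pow_succ]
      simp only [← mul_assoc]
      rw [mul_assoc (a ^ m) b a, ← hab.eq]
      simp only [← mul_assoc]
    rw [qAd, ih, e1, e2, qAd, mul_sub, mul_smul_comm]

open Polynomial in
/-- The polynomial `∏ (1 - c l Z)`. -/
def qPoly (c : ℕ → k⟦X⟧) (m : ℕ) : Polynomial k⟦X⟧ :=
  ∏ l ∈ Finset.range m, (1 - Polynomial.C (c l) * Polynomial.X)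

theorem qPoly_succ (c : ℕ → k⟦X⟧) (m : ℕ) :
    qPoly c (m + 1) = qPoly c m - Polynomial.C (c m) * (qPoly c m * Polynomial.X) := by
  rw [qPoly, Finset.prod_range_succ, ← qPoly]
  ring

theorem qPoly_natDegree_le (c : ℕ → k⟦X⟧) (m : ℕ) : (qPoly c m).natDegree ≤ m := by
  induction m with
  | zero => simp [qPoly]
  | succ m ih =>
    rw [qPoly_succ]
    refine (Polynomial.natDegree_sub_le _ _).trans (max_le (ih.trans (Nat.le_succ _)) ?_)
    refine (Polynomial.natDegree_C_mul_le _ _).trans ?_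
    refine Polynomial.natDegree_mul_le.trans ?_
    exact add_le_add ih Polynomial.natDegree_X_le

theorem qAd_eq_sum (c : ℕ → k⟦X⟧) (x y : B) (m : ℕ) : qAd c x y m =
    ∑ r ∈ Finset.range (m + 1), (qPoly c m).coeff r • (x ^ (m - r) * y * x ^ r) := by
  induction m with
  | zero => simp [qAd, qPoly]
  | succ m ih =>
    have e0 : (qPoly c m).coeff (m + 1) = 0 :=
      Polynomial.coeff_eq_zero_of_natDegree_lt (Nat.lt_succ_of_le (qPoly_natDegree_le c m))
    have e1 : x * qAd c x y m = ∑ r ∈ Finset.range (m + 2),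
        (qPoly c m).coeff r • (x ^ (m + 1 - r) * y * x ^ r) := by
      rw [Finset.sum_range_succ, e0, zero_smul, add_zero, ih, Finset.mul_sum]
      refine Finset.sum_congr rfl fun r hr => ?_
      have : m + 1 - r = m - r + 1 := by have := Finset.mem_range.1 hr; omega
      rw [this, pow_succ', mul_smul_comm]
      simp only [mul_assoc]
    have e2 : c m • (qAd c x y m * x) = ∑ r ∈ Finset.range (m + 2),
        (Polynomial.C (c m) * (qPoly c m * Polynomial.X)).coeff r •
          (x ^ (m + 1 - r) * y * x ^ r) := by
      rw [Finset.sum_range_succ', Polynomial.coeff_C_mul, Polynomial.mul_coeff_zero,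
        Polynomial.coeff_X_zero, mul_zero, mul_zero, zero_smul, add_zero, ih, Finset.sum_mul,
        Finset.smul_sum]
      refine Finset.sum_congr rfl fun r hr => ?_
      rw [Polynomial.coeff_C_mul, Polynomial.coeff_mul_X, Nat.add_sub_add_right, pow_succ,
        smul_mul_assoc, smul_smul]
      simp only [mul_assoc]
    rw [qAd, e1, e2, ← Finset.sum_sub_distrib]
    refine Finset.sum_congr rfl fun r _ => ?_
    rw [qPoly_succ, Polynomial.coeff_sub, sub_smul]

/-- The factors of an iterated `q`-commutator may be reversed. -/
theorem qAd_reflect {c c' : ℕ → k⟦X⟧} {m : ℕ} (h : ∀ l < m, c' l = c (m - 1 - l)) (x y : B) :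
    qAd c' x y m = qAd c x y m := by
  have : qPoly c' m = qPoly c m := by
    rw [qPoly, qPoly, ← Finset.prod_range_reflect]
    exact Finset.prod_congr rfl fun l hl => by
      rw [h _ (by have := Finset.mem_range.1 hl; omega)]
      have : m - 1 - (m - 1 - l) = l := by have := Finset.mem_range.1 hl; omega
      rw [this]
  rw [qAd_eq_sum, qAd_eq_sum, this]

end QAd

section QBinomial

variable {k : Type*} [Field k]

variable (k) in
/-- The exponential `e ^ {ħ z}` of a scalar. -/
abbrev sexp (z : k⟦X⟧) : k⟦X⟧ := hexp (k := k) (B := k⟦X⟧) z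

theorem constantCoeff_sexp (z : k⟦X⟧) : PowerSeries.constantCoeff (sexp k z) = 1 := by
  have := hexp_sub_one (k := k) (A := k⟦X⟧) z
  rw [sub_eq_iff_eq_add] at this
  rw [sexp, this]
  simp

variable [CharZero k]

theorem sexp_add (a b : k⟦X⟧) : sexp k (a + b) = sexp k a * sexp k b := hexp_add (Commute.all _ _)

theorem sexp_nsmul (r : ℕ) (a : k⟦X⟧) : sexp k (r * a) = sexp k a ^ r := by
  induction r with
  | zero => simp
  | succ r ih => rw [Nat.cast_succ, add_mul, one_mul, sexp_add, ih, pow_succ]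

theorem sexp_mul_neg (a : k⟦X⟧) : sexp k a * sexp k (-a) = 1 := hexp_mul_neg a

theorem sexp_neg_mul (a : k⟦X⟧) : sexp k (-a) * sexp k a = 1 := hexp_neg_mul a

theorem constantCoeff_qInt (d m : ℕ) : PowerSeries.constantCoeff (qInt k d m) = m := by
  rw [qInt, map_sum]
  simp only [constantCoeff_sexp]
  simp

theorem constantCoeff_qFact (d m : ℕ) : PowerSeries.constantCoeff (qFact k d m) = m.factorial := by
  rw [qFact, map_prod]
  simp only [constantCoeff_qInt]
  rw [← Finset.prod_range_add_one_eq_factorial]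
  push_cast
  rfl

theorem constantCoeff_qFact_ne (d m : ℕ) : PowerSeries.constantCoeff (qFact k d m) ≠ 0 := by
  rw [constantCoeff_qFact]
  exact Nat.cast_ne_zero.2 (Nat.factorial_ne_zero m)

theorem qFact_ne_zero (d m : ℕ) : qFact k d m ≠ 0 := fun h0 =>
  constantCoeff_qFact_ne (k := k) d m (by rw [h0, map_zero])

theorem qInt_add (d a b : ℕ) : qInt k d (a + b) =
    sexp k (d * (b : k⟦X⟧)) * qInt k d a + sexp k (d * (-(a : k⟦X⟧))) * qInt k d b := by
  rw [qInt, add_comm a b, Finset.sum_range_add, qInt, qInt, Finset.mul_sum, Finset.mul_sum, add_comm]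
  congr 1 <;> refine Finset.sum_congr rfl fun s _ => ?_ <;> rw [← sexp_add] <;> congr 1 <;>
    push_cast <;> ring

theorem qFact_succ (d m : ℕ) : qFact k d (m + 1) = qFact k d m * qInt k d (m + 1) :=
  Finset.prod_range_succ _ _

theorem qBinom_mul (d m r : ℕ) :
    qBinom k d m r * (qFact k d r * qFact k d (m - r)) = qFact k d m := by
  rw [qBinom, mul_assoc, PowerSeries.inv_mul_cancel, mul_one]
  rw [map_mul]
  exact mul_ne_zero (constantCoeff_qFact_ne d r) (constantCoeff_qFact_ne d _)

theorem qBinom_zero (d m : ℕ) : qBinom k d m 0 = 1 := by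
  have := qBinom_mul (k := k) d m 0
  have h0 : qFact k d 0 = 1 := rfl
  rw [h0, one_mul, Nat.sub_zero] at this
  exact mul_right_cancel₀ (qFact_ne_zero d m) (by rw [this, one_mul])

theorem qBinom_self (d m : ℕ) : qBinom k d m m = 1 := by
  have := qBinom_mul (k := k) d m m
  have h0 : qFact k d 0 = 1 := rfl
  rw [Nat.sub_self, h0, mul_one] at this
  exact mul_right_cancel₀ (qFact_ne_zero d m) (by rw [this, one_mul])

theorem qBinom_succ (d m r : ℕ) (hr : r < m) : qBinom k d (m + 1) (r + 1) =
    sexp k (d * ((r : k⟦X⟧) + 1)) * qBinom k d m (r + 1) +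
      sexp k (d * ((r : k⟦X⟧) - m)) * qBinom k d m r := by
  obtain ⟨a, rfl⟩ : ∃ a, m = r + 1 + a := ⟨m - (r + 1), by omega⟩
  have h1 := qBinom_mul (k := k) d (r + 1 + a + 1) (r + 1)
  have h2 := qBinom_mul (k := k) d (r + 1 + a) (r + 1)
  have h3 := qBinom_mul (k := k) d (r + 1 + a) r
  have e1 : r + 1 + a + 1 - (r + 1) = a + 1 := by omega
  have e2 : r + 1 + a - (r + 1) = a := by omega
  have e3 : r + 1 + a - r = a + 1 := by omega
  rw [e1] at h1
  rw [e2] at h2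
  rw [e3] at h3
  refine mul_right_cancel₀ (mul_ne_zero (qFact_ne_zero (k := k) d (r + 1))
    (qFact_ne_zero (k := k) d (a + 1))) ?_
  rw [h1, qFact_succ d (r + 1 + a), show r + 1 + a + 1 = (a + 1) + (r + 1) by omega, qInt_add]
  rw [add_mul]
  have e4 : sexp k (d * ((r : k⟦X⟧) + 1)) * qBinom k d (r + 1 + a) (r + 1) *
      (qFact k d (r + 1) * qFact k d (a + 1)) =
      sexp k (d * ((r : k⟦X⟧) + 1)) * qInt k d (a + 1) * qFact k d (r + 1 + a) := by
    rw [qFact_succ d a, ← h2]; ring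
  have e5 : sexp k (d * ((r : k⟦X⟧) - (r + 1 + a : ℕ))) * qBinom k d (r + 1 + a) r *
      (qFact k d (r + 1) * qFact k d (a + 1)) =
      sexp k (d * ((r : k⟦X⟧) - (r + 1 + a : ℕ))) * qInt k d (r + 1) * qFact k d (r + 1 + a) := by
    rw [qFact_succ d r, ← h3]; ring
  rw [e4, e5]
  push_cast
  rw [show (d : k⟦X⟧) * (-((a : k⟦X⟧) + 1)) = d * ((r : k⟦X⟧) - (r + 1 + a)) by ring]
  ring

/-- The scalars of the factors of a quantum Serre element. -/
def serreScalar (d m : ℕ) (p p' : k⟦X⟧) (l : ℕ) : k⟦X⟧ :=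
  sexp k (C (2⁻¹ : k) * (p - p') + d * ((m : k⟦X⟧) - 1 - 2 * l))

/-- The scalars of the factors of a quantum Serre element, in the opposite order. -/
def serreScalar' (d m : ℕ) (p p' : k⟦X⟧) (l : ℕ) : k⟦X⟧ :=
  sexp k (C (2⁻¹ : k) * (p - p') + d * (1 - (m : k⟦X⟧) + 2 * l))

theorem serreCoeff_eq (d m r : ℕ) (p p' : k⟦X⟧) : serreCoeff d m r p p' =
    (-1) ^ r * qBinom k d m r * sexp k (C (2⁻¹ : k) * (p - p')) ^ r := by
  rw [serreCoeff, ← hexp_add (Commute.all _ _), ← sexp_nsmul]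
  congr 2
  rw [div_eq_mul_inv, map_mul, map_natCast]
  ring

theorem coeff_qPoly_serreScalar (d M : ℕ) (p p' : k⟦X⟧) (m : ℕ) : ∀ r ≤ m,
    (qPoly (serreScalar d M p p') m).coeff r = (-1) ^ r * qBinom k d m r *
      sexp k (r * (C (2⁻¹ : k) * (p - p') + d * ((M : k⟦X⟧) - m))) := by
  induction m with
  | zero =>
    intro r hr
    obtain rfl : r = 0 := by omega
    simp [qPoly, qBinom_zero]
  | succ m ih =>
    intro r hr
    rw [qPoly_succ, Polynomial.coeff_sub, Polynomial.coeff_C_mul]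
    cases r with
    | zero => simp [ih 0 (Nat.zero_le _), qBinom_zero]
    | succ r =>
      rw [Polynomial.coeff_mul_X, ih r (by omega), serreScalar]
      rcases Nat.lt_or_ge r m with hrm | hrm
      · rw [ih (r + 1) hrm, qBinom_succ d m r hrm]
        have e1 : sexp k (d * ((r : k⟦X⟧) + 1)) * sexp k ((r + 1 : ℕ) *
            (C (2⁻¹ : k) * (p - p') + d * ((M : k⟦X⟧) - (m + 1 : ℕ)))) =
            sexp k ((r + 1 : ℕ) * (C (2⁻¹ : k) * (p - p') + d * ((M : k⟦X⟧) - m))) := by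
          rw [← sexp_add]; congr 1; push_cast; ring
        have e2 : sexp k (d * ((r : k⟦X⟧) - m)) * sexp k ((r + 1 : ℕ) *
            (C (2⁻¹ : k) * (p - p') + d * ((M : k⟦X⟧) - (m + 1 : ℕ)))) =
            sexp k (C (2⁻¹ : k) * (p - p') + d * ((M : k⟦X⟧) - 1 - 2 * m)) *
            sexp k (r * (C (2⁻¹ : k) * (p - p') + d * ((M : k⟦X⟧) - m))) := by
          rw [← sexp_add, ← sexp_add]; congr 1; push_cast; ring
        rw [← e1]
        linear_combination (-1 : k⟦X⟧) ^ r * qBinom k d m r * e2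
      · obtain rfl : r = m := by omega
        rw [Polynomial.coeff_eq_zero_of_natDegree_lt
          (Nat.lt_succ_of_le (qPoly_natDegree_le _ r)), qBinom_self, qBinom_self]
        have e2 : sexp k ((r + 1 : ℕ) *
            (C (2⁻¹ : k) * (p - p') + d * ((M : k⟦X⟧) - (r + 1 : ℕ)))) =
            sexp k (C (2⁻¹ : k) * (p - p') + d * ((M : k⟦X⟧) - 1 - 2 * r)) *
            sexp k (r * (C (2⁻¹ : k) * (p - p') + d * ((M : k⟦X⟧) - r))) := by
          rw [← sexp_add]; congr 1; push_cast; ring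
        rw [e2]
        ring

variable {B : Type*} [Ring B] [Algebra k⟦X⟧ B]

theorem serre_eq_qAd (d m : ℕ) (p p' : k⟦X⟧) (x y : B) :
    serre d m p p' x y = qAd (serreScalar d m p p') x y m := by
  rw [qAd_eq_sum, serre]
  refine Finset.sum_congr rfl fun r hr => ?_
  rw [coeff_qPoly_serreScalar d m p p' m r (Nat.lt_succ_iff.1 (Finset.mem_range.1 hr)),
    serreCoeff_eq, sub_self, mul_zero, add_zero, sexp_nsmul]

theorem qAd_serreScalar' (d m : ℕ) (p p' : k⟦X⟧) (x y : B) :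
    qAd (serreScalar' d m p p') x y m = qAd (serreScalar d m p p') x y m := by
  refine qAd_reflect (fun l hl => ?_) x y
  rw [serreScalar, serreScalar']
  obtain ⟨a, rfl⟩ : ∃ a, m = l + 1 + a := ⟨m - (l + 1), by omega⟩
  rw [show l + 1 + a - 1 - l = a by omega]
  congr 2
  push_cast
  ring

theorem serre_eq_qAd' (d m : ℕ) (p p' : k⟦X⟧) (x y : B) :
    serre d m p p' x y = qAd (serreScalar' d m p p') x y m := by
  rw [serre_eq_qAd, qAd_serreScalar']

theorem serreScalar_succ (d m : ℕ) (p p' : k⟦X⟧) (l : ℕ) :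
    serreScalar d m p p' (l + 1) = sexp k (-(2 * d)) * serreScalar d m p p' l := by
  rw [serreScalar, serreScalar, ← sexp_add]
  congr 1
  push_cast
  ring

theorem serreScalar'_succ (d m : ℕ) (p p' : k⟦X⟧) (l : ℕ) :
    serreScalar' d m p p' (l + 1) = sexp k (2 * d) * serreScalar' d m p p' l := by
  rw [serreScalar', serreScalar', ← sexp_add]
  congr 1
  push_cast
  ring

/-- Additivity of the quantum Serre elements for skew-primitive elements. -/
theorem serre_add {d m : ℕ} {p p' : k⟦X⟧} (hp : p + p' = 2 * (d * (1 - (m : k⟦X⟧))))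
    {x y u v : B} (hyx : y * x = sexp k (2 * d) • (x * y)) (hyu : y * u = sexp k p • (u * y))
    (hvx : v * x = sexp k p' • (x * v)) :
    serre d m p p' (x + y) (u + v) = serre d m p p' x u + serre d m p p' y v := by
  have h2 : (C (2⁻¹ : k) : k⟦X⟧) * 2 = 1 := by
    rw [← map_ofNat (C (R := k)) 2, ← map_mul, inv_mul_cancel₀ two_ne_zero, map_one]
  have hadd : serre d m p p' (x + y) (u + v) =
      serre d m p p' (x + y) u + serre d m p p' (x + y) v := by
    simp only [serre, mul_add, add_mul, smul_add, Finset.sum_add_distrib]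
  have hxy : x * y = sexp k (-(2 * d)) • (y * x) := by
    rw [hyx, smul_smul, sexp_neg_mul, one_smul]
  have hxv : x * v = sexp k (-p') • (v * x) := by
    rw [hvx, smul_smul, sexp_neg_mul, one_smul]
  rw [hadd]
  congr 1
  · rw [serre_eq_qAd', serre_eq_qAd']
    refine qAd_add_of_mul_eq hyx ?_ (serreScalar'_succ d m p p') m
    rw [hyu, serreScalar']
    congr 2
    push_cast
    linear_combination (C (2⁻¹ : k)) * hp + (d * (1 - (m : k⟦X⟧)) - p) * h2
  · rw [serre_eq_qAd, serre_eq_qAd, add_comm]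
    refine qAd_add_of_mul_eq hxy ?_ (serreScalar_succ d m p p') m
    rw [hxv, serreScalar]
    congr 2
    push_cast
    linear_combination -(C (2⁻¹ : k)) * hp + (p' - d * (1 - (m : k⟦X⟧))) * h2

theorem serre_eq_zero_of_commute {d m : ℕ} {p p' : k⟦X⟧} {a b x y : B} (hab : Commute a b)
    (hax : Commute a x) (hay : Commute a y) (hbx : Commute b x) (h0 : serre d m p p' x y = 0) :
    serre d m p p' (a * x) (b * y) = 0 := by
  rw [serre_eq_qAd] at h0 ⊢
  rw [qAd_mul_of_commute hab hax hay hbx, h0, mul_zero]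

theorem map_serre {B' : Type*} [Ring B'] [Algebra k⟦X⟧ B'] (f : B →ₐ[k⟦X⟧] B') (d m : ℕ)
    (p p' : k⟦X⟧) (x y : B) : f (serre d m p p' x y) = serre d m p p' (f x) (f y) := by
  rw [serre_eq_qAd, serre_eq_qAd, map_qAd]

end QBinomial

/-! ### The coproduct, the counit and the antipode respect the defining relations -/

section Relations

variable {k : Type*} [Field k] [CharZero k] {n : ℕ}
variable {h : Type*} [AddCommGroup h] [Module k⟦X⟧ h]
variable {A : Matrix (Fin n) (Fin n) ℤ} {d : Fin n → ℕ} {P : Matrix (Fin n) (Fin n) k⟦X⟧}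
  {R : Realization P h}
variable {B : Type*} [Ring B] [Algebra k⟦X⟧ B] [IsAdicComplete (hIdeal k) B]

theorem IsCartanType.add_eq (hA : IsSymmetrizableGCM A d) (hP : IsCartanType A d P) {i j : Fin n}
    (hij : i ≠ j) :
    P i j + P j i = 2 * ((d i : k⟦X⟧) * (1 - ((1 - A i j).toNat : k⟦X⟧))) := by
  rw [hP i j]
  have h1 : (((1 - A i j).toNat : ℤ) : k⟦X⟧) = ((1 - A i j : ℤ) : k⟦X⟧) := by
    rw [Int.toNat_of_nonneg]
    have := hA.nonpos i j hij
    omega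
  rw [Int.cast_natCast] at h1
  rw [h1]
  push_cast
  ring

theorem IsCartanType.diag_eq (hA : IsSymmetrizableGCM A d) (hP : IsCartanType A d P) (i : Fin n) :
    P i i = 2 * (d i : k⟦X⟧) := by
  have h1 := hP i i
  rw [hA.diag] at h1
  have h2 : (C (2⁻¹ : k) : k⟦X⟧) * 2 = 1 := by
    rw [← map_ofNat (C (R := k)) 2, ← map_mul, inv_mul_cancel₀ two_ne_zero, map_one]
  push_cast at h1
  linear_combination (C (2⁻¹ : k)) * h1 + (2 * (d i : k⟦X⟧) - P i i) * h2

namespace IsGenRel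

variable {τ : h →ₗ[k⟦X⟧] B} {e f : Fin n → B} (H : IsGenRel A d R τ e f)

include H

theorem commute_tor (T T' : h) : Commute (τ T) (τ T') := H.comm T T'

theorem hexp_mul_E (T : h) (j : Fin n) :
    hexp (k := k) (τ T) * e j = sexp k (R.α j T) • (e j * hexp (k := k) (τ T)) :=
  hexp_mul_comm_of_smul (H.tor_E T j)

theorem hexp_mul_F (T : h) (j : Fin n) :
    hexp (k := k) (τ T) * f j = sexp k (-R.α j T) • (f j * hexp (k := k) (τ T)) :=
  hexp_mul_comm_of_smul (by rw [H.tor_F, neg_smul])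

theorem hexp_neg_mul_E (T : h) (j : Fin n) :
    hexp (k := k) (-τ T) * e j = sexp k (-R.α j T) • (e j * hexp (k := k) (-τ T)) := by
  rw [← map_neg, H.hexp_mul_E, map_neg]

theorem hexp_neg_mul_F (T : h) (j : Fin n) :
    hexp (k := k) (-τ T) * f j = sexp k (R.α j T) • (f j * hexp (k := k) (-τ T)) := by
  rw [← map_neg, H.hexp_mul_F, map_neg, neg_neg]

theorem map {D : Type*} [Ring D] [Algebra k⟦X⟧ D] [IsAdicComplete (hIdeal k) D]
    (L : B →ₐ[k⟦X⟧] D) :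
    IsGenRel A d R (L.toLinearMap ∘ₗ τ) (fun i => L (e i)) (fun i => L (f i)) where
  comm T T' := by simpa using congrArg L (H.comm T T')
  tor_E T j := by simpa using congrArg L (H.tor_E T j)
  tor_F T j := by simpa using congrArg L (H.tor_F T j)
  E_F_ne i j hij := by simpa using congrArg L (H.E_F_ne i j hij)
  E_F i := by simpa [map_hexpDiv] using congrArg L (H.E_F i)
  serre_E i j hij := by simpa [map_serre] using congrArg L (H.serre_E i j hij)
  serre_F i j hij := by simpa [map_serre] using congrArg L (H.serre_F i j hij)

end IsGenRel

theorem hexp_eq_one_add (a : B) :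
    hexp (k := k) a = 1 + (PowerSeries.X : k⟦X⟧) • hexpDiv (k := k) a := by
  rw [← hexp_sub_one]; abel

theorem commute_hexpDiv {a b : B} (hab : Commute a b) :
    Commute (hexpDiv (k := k) a) (hexpDiv (k := k) b) :=
  commute_hexpDiv_left (commute_hexpDiv_left hab.symm).symm

theorem hexpDiv_sub_hexpDiv {a b c e : B} (hab : Commute a b) (hce : Commute c e) :
    hexpDiv (k := k) (a + b) - hexpDiv (k := k) (c + e) =
      (hexpDiv (k := k) a - hexpDiv (k := k) c) * hexp (k := k) e +
        hexp (k := k) a * (hexpDiv (k := k) b - hexpDiv (k := k) e) := by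
  have h1 := (commute_hexpDiv (k := k) hce).eq
  rw [hexpDiv_add hab, add_comm c, hexpDiv_add hce.symm, hexp_eq_one_add a, hexp_eq_one_add e]
  simp only [add_mul, mul_add, one_mul, mul_one, smul_mul_assoc, mul_smul_comm, mul_sub, sub_mul, h1,
    smul_sub]
  abel

theorem hexpDiv_neg (a : B) :
    hexpDiv (k := k) (-a) = -(hexp (k := k) (-a) * hexpDiv (k := k) a) := by
  have := hexpDiv_add (k := k) (Commute.refl a).neg_left
  rw [neg_add_cancel, hexpDiv_zero] at this
  exact eq_neg_of_add_eq_zero_left this.symm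

theorem hexpDiv_sub_mul_hexp {a b : B} (hab : Commute a b) :
    -((hexpDiv (k := k) a - hexpDiv (k := k) (-b)) * (hexp (k := k) b * hexp (k := k) (-a))) =
      hexpDiv (k := k) (-a) - hexpDiv (k := k) b := by
  have e1 : hexpDiv (k := k) (-b) * hexp (k := k) b = -hexpDiv (k := k) b := by
    have h1 := hexpDiv_neg (k := k) (-b)
    rw [neg_neg] at h1
    rw [h1, neg_neg, (commute_hexp_left (commute_hexpDiv_left (Commute.refl b).neg_left).symm).eq]
  have e2 : hexpDiv (k := k) a * hexp (k := k) (-a) = -hexpDiv (k := k) (-a) := by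
    rw [hexpDiv_neg (k := k) a, neg_neg,
      (commute_hexp_left (commute_hexpDiv_left (Commute.refl a).neg_right).symm).eq]
  have e3 : Commute (hexp (k := k) b) (hexp (k := k) (-a)) := commute_hexp hab.symm.neg_right
  have e4 := (commute_hexpDiv (k := k) hab.neg_left).eq
  rw [sub_mul, ← mul_assoc (hexpDiv (k := k) (-b)), e1, e3.eq, ← mul_assoc, e2, hexp_eq_one_add b,
    hexp_eq_one_add (-a)]
  simp only [mul_add, mul_one, mul_smul_comm, neg_mul, e4]
  abel

theorem cross_commutator {B : Type*} [Ring B] [Algebra k⟦X⟧ B] {E K F E' K' F' : B} {s : k⟦X⟧}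
    (h1 : Commute E K') (h2 : Commute E F') (h3 : Commute K E') (h4 : Commute K K')
    (h5 : Commute K F') (h6 : Commute F E') (hK : K * F = s • (F * K))
    (hK' : K' * E' = s • (E' * K')) :
    (E + K * E') * (F * K' + F') - (F * K' + F') * (E + K * E') =
      (E * F - F * E) * K' + K * (E' * F' - F' * E') := by
  have e1 : K * E' * (F * K') = s • (F * K * (E' * K')) := by
    rw [mul_assoc, ← mul_assoc E', ← h6.eq, mul_assoc F, ← mul_assoc, hK, smul_mul_assoc]
  have e2 : F * K' * (K * E') = s • (F * K * (E' * K')) := by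
    rw [mul_assoc, ← mul_assoc K', ← h4.eq, mul_assoc K, hK', mul_smul_comm, mul_smul_comm,
      ← mul_assoc]
  have e3 : F * K' * E = F * E * K' := by rw [mul_assoc, ← h1.eq, mul_assoc]
  have e4 : F' * (K * E') = K * (F' * E') := by rw [← mul_assoc, ← h5.eq, mul_assoc]
  simp only [add_mul, mul_add, sub_mul, mul_sub, e1, e2, e3, e4, h2.eq]
  simp only [mul_assoc]
  abel

namespace IsGenRel

variable {τ : h →ₗ[k⟦X⟧] B} {e f : Fin n → B} (H : IsGenRel A d R τ e f)

theorem zero : IsGenRel A d R (0 : h →ₗ[k⟦X⟧] B) (fun _ => 0) (fun _ => 0) where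
  comm T T' := by simp
  tor_E T j := by simp
  tor_F T j := by simp
  E_F_ne i j hij := by simp
  E_F i := by simp
  serre_E i j hij := by simp [serre]
  serre_F i j hij := by simp [serre]

include H

theorem comul_commutator {D : Type*} [Ring D] [Algebra k⟦X⟧ D] [IsAdicComplete (hIdeal k) D]
    (L L' : B →ₐ[k⟦X⟧] D) (hL : ∀ x y, Commute (L x) (L' y)) (i j : Fin n) :
    (L (e i) + L (hexp (k := k) (τ (R.Tpos i))) * L' (e i)) *
        (L (f j) * L' (hexp (k := k) (-τ (R.Tneg j))) + L' (f j)) -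
      (L (f j) * L' (hexp (k := k) (-τ (R.Tneg j))) + L' (f j)) *
        (L (e i) + L (hexp (k := k) (τ (R.Tpos i))) * L' (e i)) =
      L (e i * f j - f j * e i) * L' (hexp (k := k) (-τ (R.Tneg j))) +
        L (hexp (k := k) (τ (R.Tpos i))) * L' (e i * f j - f j * e i) := by
  rw [cross_commutator (k := k) (hL _ _) (hL _ _) (hL _ _) (hL _ _) (hL _ _) (hL _ _)
    (s := sexp k (-P i j)), map_sub, map_mul, map_mul, map_sub, map_mul, map_mul]
  · rw [← map_mul, H.hexp_mul_F, map_smul, map_mul, R.α_Tpos]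
  · rw [← map_mul, H.hexp_neg_mul_E, map_smul, map_mul, R.α_Tneg]

theorem comul {D : Type*} [Ring D] [Algebra k⟦X⟧ D] [IsAdicComplete (hIdeal k) D]
    (hA : IsSymmetrizableGCM A d) (hP : IsCartanType A d P)
    (L L' : B →ₐ[k⟦X⟧] D) (hL : ∀ x y, Commute (L x) (L' y)) :
    IsGenRel A d R (L.toLinearMap ∘ₗ τ + L'.toLinearMap ∘ₗ τ)
      (fun i => L (e i) + L (hexp (k := k) (τ (R.Tpos i))) * L' (e i))
      (fun i => L (f i) * L' (hexp (k := k) (-τ (R.Tneg i))) + L' (f i)) where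
  comm T T' := by
    have h1 := (hL (τ T) (τ T')).eq
    have h2 := (hL (τ T') (τ T)).eq
    have h3 := congrArg L (H.comm T T')
    have h4 := congrArg L' (H.comm T T')
    simp only [map_mul] at h3 h4
    simp only [LinearMap.add_apply, LinearMap.comp_apply, AlgHom.toLinearMap_apply, add_mul, mul_add,
      h1, h2, h3, h4]
    abel
  tor_E T j := by
    have h1 := (hL (e j) (τ T)).eq
    have h3 := congrArg L (H.tor_E T j)
    have h4 := congrArg L' (H.tor_E T j)
    have h5 : L (τ T) * L (hexp (k := k) (τ (R.Tpos j))) =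
        L (hexp (k := k) (τ (R.Tpos j))) * L (τ T) := by
      rw [← map_mul, ← map_mul, (commute_hexp_left (H.commute_tor (R.Tpos j) T)).eq]
    have h6 := (hL (hexp (k := k) (τ (R.Tpos j))) (τ T)).eq
    have h7 := (hL (τ T) (e j)).eq
    simp only [map_mul, map_sub, map_smul] at h3 h4
    simp only [LinearMap.add_apply, LinearMap.comp_apply, AlgHom.toLinearMap_apply]
    rw [smul_add, ← h3, ← mul_smul_comm, ← h4]
    simp only [add_mul, mul_add, mul_sub]
    rw [← mul_assoc, h5, ← mul_assoc (L' (τ T)), ← h6]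
    simp only [mul_assoc, h1, ← h7]
    abel
  tor_F T j := by
    have h1 := (hL (τ T) (f j)).eq
    have h3 := congrArg L (H.tor_F T j)
    have h4 := congrArg L' (H.tor_F T j)
    have h5 : L' (τ T) * L' (hexp (k := k) (-τ (R.Tneg j))) =
        L' (hexp (k := k) (-τ (R.Tneg j))) * L' (τ T) := by
      rw [← map_mul, ← map_mul, (commute_hexp_left (H.commute_tor (R.Tneg j) T).neg_left).eq]
    have h6 := (hL (τ T) (hexp (k := k) (-τ (R.Tneg j)))).eq
    have h7 := (hL (f j) (τ T)).eq
    simp only [map_mul, map_sub, map_smul, map_neg] at h3 h4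
    simp only [LinearMap.add_apply, LinearMap.comp_apply, AlgHom.toLinearMap_apply]
    rw [smul_add, neg_add, ← smul_mul_assoc, ← neg_mul, ← h3, ← h4]
    simp only [add_mul, mul_add, sub_mul]
    rw [← mul_assoc (L' (τ T)), ← h7, mul_assoc (L (f j)) (L' (τ T)), h5, mul_assoc (L (f j)) _ (L (τ T)),
      ← h6]
    simp only [mul_assoc, h1]
    abel
  E_F_ne i j hij := by
    rw [H.comul_commutator L L' hL, H.E_F_ne i j hij, map_zero, map_zero, zero_mul, mul_zero, add_zero]
  E_F i := by
    have h1 : Commute (-L (τ (R.Tneg i))) (-L' (τ (R.Tneg i))) := (hL _ _).neg_left.neg_right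
    rw [H.comul_commutator L L' hL, H.E_F]
    simp only [LinearMap.add_apply, LinearMap.comp_apply, AlgHom.toLinearMap_apply]
    rw [neg_add, hexpDiv_sub_hexpDiv (hL _ _) h1]
    simp only [map_smul, map_sub, map_hexpDiv, map_hexp, map_neg, smul_mul_assoc, mul_smul_comm,
      smul_add]
  serre_E i j hij := by
    have hK (a b : Fin n) : L (hexp (k := k) (τ (R.Tpos a))) * L' (e a) * L (e b) =
        sexp k (P a b) • (L (e b) * (L (hexp (k := k) (τ (R.Tpos a))) * L' (e a))) := by
      rw [mul_assoc, ← (hL _ _).eq, ← mul_assoc, ← map_mul, H.hexp_mul_E, map_smul, map_mul, R.α_Tpos,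
        smul_mul_assoc, mul_assoc]
    rw [serre_add (hP.add_eq hA hij) (by rw [hK, hP.diag_eq hA]) (hK i j) (hK j i), ← map_serre,
      H.serre_E i j hij, map_zero, zero_add]
    refine serre_eq_zero_of_commute ?_ (hL _ _) (hL _ _) (hL _ _) ?_
    · exact (commute_hexp (H.commute_tor _ _)).map L
    · rw [← map_serre, H.serre_E i j hij, map_zero]
  serre_F i j hij := by
    have hK (a b : Fin n) : L' (hexp (k := k) (-τ (R.Tneg a))) * L (f a) * L' (f b) =
        sexp k (P b a) • (L' (f b) * (L' (hexp (k := k) (-τ (R.Tneg a))) * L (f a))) := by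
      rw [mul_assoc, (hL _ _).eq, ← mul_assoc, ← map_mul, H.hexp_neg_mul_F, map_smul, map_mul,
        R.α_Tneg, smul_mul_assoc, mul_assoc]
    rw [(hL _ _).eq, (hL _ _).eq, add_comm, add_comm _ (L' (f j)),
      serre_add ((add_comm _ _).trans (hP.add_eq hA hij)) (by rw [hK, hP.diag_eq hA]) (hK i j)
      (hK j i), ← map_serre, H.serre_F i j hij, map_zero, zero_add]
    refine serre_eq_zero_of_commute ?_ (hL _ _).symm (hL _ _).symm (hL _ _).symm ?_
    · exact (commute_hexp (H.commute_tor _ _).neg_left.neg_right).map L'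
    · rw [← map_serre, H.serre_F i j hij, map_zero]

end IsGenRel

/-! Antipode -/

theorem serre_smul_smul (d m : ℕ) (p p' c c' : k⟦X⟧) (x y : B) :
    serre d m p p' (c • x) (c' • y) = (c ^ m * c') • serre d m p p' x y := by
  rw [serre, serre, Finset.smul_sum]
  refine Finset.sum_congr rfl fun r hr => ?_
  have h1 : c ^ (m - r) * c ^ r = c ^ m := by
    rw [← pow_add, Nat.sub_add_cancel (Nat.lt_succ_iff.1 (Finset.mem_range.1 hr))]
  simp only [smul_pow, smul_mul_assoc, mul_smul_comm, smul_smul]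
  congr 1
  rw [← h1]
  ring

theorem qBinom_symm (d m r : ℕ) (hr : r ≤ m) : qBinom k d m (m - r) = qBinom k d m r := by
  rw [qBinom, qBinom, Nat.sub_sub_self hr, mul_comm (qFact k d (m - r))]

theorem serre_op (d m : ℕ) (p p' : k⟦X⟧) (x y : B) :
    serre d m p p' (MulOpposite.op x) (MulOpposite.op y) =
      ((-1) ^ m * sexp k (C (2⁻¹ : k) * (p - p')) ^ m) • MulOpposite.op (serre d m p' p x y) := by
  change _ = _ • MulOpposite.opLinearEquiv k⟦X⟧ (serre d m p' p x y)
  rw [serre, serre, ← Finset.sum_range_reflect, map_sum, Finset.smul_sum]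
  refine Finset.sum_congr rfl fun r hr => ?_
  have hr' : r ≤ m := Nat.lt_succ_iff.1 (Finset.mem_range.1 hr)
  rw [show m + 1 - 1 - r = m - r by omega, Nat.sub_sub_self hr', map_smul, smul_smul]
  congr 1
  · obtain ⟨a, rfl⟩ := Nat.exists_eq_add_of_le hr'
    have h1 : (sexp k (C (2⁻¹ : k) * (p - p'))) * (sexp k (C (2⁻¹ : k) * (p' - p))) = 1 := by
      rw [← sexp_add, ← mul_add]; simp
    have h2 : (sexp k (C (2⁻¹ : k) * (p - p'))) ^ r * (sexp k (C (2⁻¹ : k) * (p' - p))) ^ r = 1 := by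
      rw [← mul_pow, h1, one_pow]
    have h3 : ((-1 : k⟦X⟧) ^ r) * (-1) ^ r = 1 := by rw [← mul_pow]; simp
    rw [serreCoeff_eq, serreCoeff_eq, qBinom_symm d _ r hr', Nat.add_sub_cancel_left, pow_add, pow_add]
    linear_combination (-(-1) ^ a * qBinom k d (r + a) r * sexp k (C (2⁻¹ : k) * (p - p')) ^ a) *
      ((-1) ^ r * (-1) ^ r * h2 + h3)
  · simp [mul_assoc]

theorem qAd_twist {c c' : ℕ → k⟦X⟧} {a b x y : B} {t u v : k⟦X⟧} (hab : Commute a b)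
    (hxa : x * a = t • (a * x)) (hxb : x * b = u • (b * x)) (hya : y * a = v • (a * y))
    (hc : ∀ l, c l * v = c' l * u) (m : ℕ) :
    ∃ w : k⟦X⟧, qAd c (a * x) (b * y) m = w • (a ^ m * b * qAd c' x y m) := by
  have h1 (l : ℕ) : qAd c' x y l * a = (t ^ l * v) • (a * qAd c' x y l) := by
    induction l with
    | zero => simpa [qAd] using hya
    | succ l ih =>
      have e1 : x * qAd c' x y l * a = (t ^ (l + 1) * v) • (a * (x * qAd c' x y l)) := by
        rw [mul_assoc, ih, mul_smul_comm, ← mul_assoc, hxa, smul_mul_assoc, smul_smul, mul_assoc a x]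
        congr 1; ring
      have e2 : qAd c' x y l * x * a = (t ^ (l + 1) * v) • (a * (qAd c' x y l * x)) := by
        rw [mul_assoc, hxa, mul_smul_comm, ← mul_assoc, ih, smul_mul_assoc, smul_smul, mul_assoc]
        congr 1; ring
      rw [qAd, sub_mul, mul_sub, smul_mul_assoc, e1, e2, mul_smul_comm, smul_sub, smul_comm (c' l)]
  have h2 (l : ℕ) : x * (a ^ l * b) = (t ^ l * u) • (a ^ l * b * x) := by
    induction l with
    | zero => simpa using hxb
    | succ l ih =>
      rw [pow_succ', mul_assoc a, ← mul_assoc x, hxa, smul_mul_assoc, mul_assoc a, ih, mul_smul_comm,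
        smul_smul]
      simp only [mul_assoc]
      congr 1; ring
  induction m with
  | zero => exact ⟨1, by simp [qAd]⟩
  | succ m ih =>
    obtain ⟨w, hw⟩ := ih
    refine ⟨w * (t ^ m * u), ?_⟩
    have e1 : a * x * (a ^ m * b * qAd c' x y m) =
        (t ^ m * u) • (a ^ (m + 1) * b * (x * qAd c' x y m)) := by
      rw [mul_assoc, ← mul_assoc x, h2, smul_mul_assoc, mul_smul_comm, pow_succ']
      simp only [mul_assoc]
    have e2 : a ^ m * b * qAd c' x y m * (a * x) =
        (t ^ m * v) • (a ^ (m + 1) * b * (qAd c' x y m * x)) := by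
      rw [mul_assoc, ← mul_assoc _ a x, h1, smul_mul_assoc, mul_smul_comm, pow_succ]
      congr 1
      rw [mul_assoc (a ^ m) a b, hab.eq]
      simp only [mul_assoc]
    rw [qAd, hw, mul_smul_comm, smul_mul_assoc, e1, e2, qAd, mul_sub, smul_sub, mul_smul_comm,
      smul_smul, smul_smul, smul_smul, smul_smul]
    congr 2
    linear_combination w * t ^ m * hc m

theorem serre_twist {d m : ℕ} {p p' q q' s r t : k⟦X⟧} {a b x y : B} (hab : Commute a b)
    (hxa : x * a = t • (a * x)) (hxb : x * b = sexp k s • (b * x))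
    (hya : y * a = sexp k r • (a * y))
    (hc : C (2⁻¹ : k) * (q - q') + r = C (2⁻¹ : k) * (p - p') + s)
    (h0 : serre d m p p' x y = 0) : serre d m q q' (a * x) (b * y) = 0 := by
  rw [serre_eq_qAd] at h0 ⊢
  have hc (l : ℕ) : serreScalar d m q q' l * sexp k r = serreScalar d m p p' l * sexp k s := by
    rw [serreScalar, serreScalar, ← sexp_add, ← sexp_add]
    congr 1
    linear_combination hc
  obtain ⟨w, hw⟩ := qAd_twist hab hxa hxb hya hc m
  rw [hw, h0, mul_zero, smul_zero]

theorem C_half_mul_two : (C (2⁻¹ : k) : k⟦X⟧) * 2 = 1 := by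
  rw [← map_ofNat (C (R := k)) 2, ← map_mul, inv_mul_cancel₀ two_ne_zero, map_one]

namespace IsGenRel

variable {τ : h →ₗ[k⟦X⟧] B} {e f : Fin n → B} (H : IsGenRel A d R τ e f)

include H

open MulOpposite in
theorem antipode :
    IsGenRel A d R (-((opLinearEquiv k⟦X⟧).toLinearMap ∘ₗ τ))
      (fun i => op (-(hexp (k := k) (-τ (R.Tpos i)) * e i)))
      (fun i => op (-(f i * hexp (k := k) (τ (R.Tneg i))))) := by
  have hEF (i j : Fin n) : hexp (k := k) (-τ (R.Tpos i)) * e i * (f j * hexp (k := k) (τ (R.Tneg j))) -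
      f j * hexp (k := k) (τ (R.Tneg j)) * (hexp (k := k) (-τ (R.Tpos i)) * e i) =
      sexp k (P i j - P i i) • ((e i * f j - f j * e i) *
        (hexp (k := k) (τ (R.Tneg j)) * hexp (k := k) (-τ (R.Tpos i)))) := by
    have h1 : Commute (hexp (k := k) (τ (R.Tneg j))) (hexp (k := k) (-τ (R.Tpos i))) :=
      commute_hexp (H.commute_tor _ _).neg_right
    have e1 : hexp (k := k) (-τ (R.Tpos i)) * e i * (f j * hexp (k := k) (τ (R.Tneg j))) =
        sexp k (P i j - P i i) • (e i * f j *
          (hexp (k := k) (τ (R.Tneg j)) * hexp (k := k) (-τ (R.Tpos i)))) := by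
      rw [H.hexp_neg_mul_E, smul_mul_assoc, mul_assoc (e i), ← mul_assoc _ (f j), H.hexp_neg_mul_F,
        smul_mul_assoc, mul_smul_comm, smul_smul, ← sexp_add, R.α_Tpos, R.α_Tpos, h1.eq,
        neg_add_eq_sub]
      simp only [mul_assoc]
    have e2 : f j * hexp (k := k) (τ (R.Tneg j)) * (hexp (k := k) (-τ (R.Tpos i)) * e i) =
        sexp k (P i j - P i i) • (f j * e i *
          (hexp (k := k) (τ (R.Tneg j)) * hexp (k := k) (-τ (R.Tpos i)))) := by
      rw [H.hexp_neg_mul_E, mul_smul_comm, mul_assoc (f j), ← mul_assoc _ (e i), H.hexp_mul_E,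
        smul_mul_assoc, mul_smul_comm, smul_smul, ← sexp_add, R.α_Tpos, R.α_Tneg, neg_add_eq_sub]
      simp only [mul_assoc]
    rw [e1, e2, ← smul_sub, sub_mul]
  constructor
  · intro T T'
    simp [← op_mul, (H.comm T T')]
  · intro T j
    have h1 : Commute (hexp (k := k) (-τ (R.Tpos j))) (τ T) :=
      commute_hexp_left (H.commute_tor _ _).neg_left
    have h2 := congrArg (hexp (k := k) (-τ (R.Tpos j)) * ·) (H.tor_E T j)
    simp only [mul_sub, mul_smul_comm, ← mul_assoc] at h2
    rw [h1.eq] at h2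
    apply unop_injective
    simp only [LinearMap.neg_apply, LinearMap.comp_apply, LinearEquiv.coe_coe, coe_opLinearEquiv,
      unop_sub, unop_mul, unop_neg, unop_op, unop_smul, neg_mul_neg, smul_neg, ← h2]
    simp only [mul_assoc]
    abel
  · intro T j
    have h1 : Commute (hexp (k := k) (τ (R.Tneg j))) (τ T) :=
      commute_hexp_left (H.commute_tor _ _)
    have h2 := congrArg (· * hexp (k := k) (τ (R.Tneg j))) (H.tor_F T j)
    simp only [sub_mul, smul_mul_assoc, neg_mul, mul_assoc] at h2
    rw [← h1.eq] at h2
    apply unop_injective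
    simp only [LinearMap.neg_apply, LinearMap.comp_apply, LinearEquiv.coe_coe, coe_opLinearEquiv,
      unop_sub, unop_mul, unop_neg, unop_op, unop_smul, neg_mul_neg, smul_neg, ← h2]
    simp only [mul_assoc]
    abel
  · intro i j hij
    apply unop_injective
    simp only [unop_sub, unop_mul, unop_op, neg_mul_neg, unop_zero]
    rw [← neg_sub, hEF, H.E_F_ne i j hij, zero_mul, smul_zero, neg_zero]
  · intro i
    apply unop_injective
    have h3 (x : B) : unop (hexpDiv (k := k) (op x)) = hexpDiv (k := k) x := by
      have h4 := map_hSeries (opLinearEquiv (M := B) k⟦X⟧).symm.toLinearMap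
        fun j => (C (((j + 1).factorial : k)⁻¹) : k⟦X⟧) • (op x) ^ (j + 1)
      exact h4
    have h5 : sexp k 0 = 1 := hexp_zero
    simp only [LinearMap.neg_apply, LinearMap.comp_apply, LinearEquiv.coe_coe, coe_opLinearEquiv,
      unop_sub, unop_mul, unop_op, neg_mul_neg, unop_smul, neg_neg, ← op_neg, h3]
    rw [← neg_sub, hEF, H.E_F, sub_self, h5, one_smul, smul_mul_assoc, ← smul_neg,
      hexpDiv_sub_mul_hexp (H.commute_tor _ _)]
  · intro i j hij
    have h1 (a b : Fin n) : e a * hexp (k := k) (-τ (R.Tpos b)) =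
        sexp k (P b a) • (hexp (k := k) (-τ (R.Tpos b)) * e a) := by
      rw [H.hexp_neg_mul_E, smul_smul, R.α_Tpos, sexp_mul_neg, one_smul]
    rw [serre_op, ← neg_one_smul k⟦X⟧ (_ * e i), ← neg_one_smul k⟦X⟧ (_ * e j), serre_smul_smul,
      serre_twist (commute_hexp (H.commute_tor _ _).neg_left.neg_right) (h1 i i) (h1 i j) (h1 j i)
        (by linear_combination (P j i - P i j) * C_half_mul_two (k := k)) (H.serre_E i j hij), smul_zero, op_zero, smul_zero]
  · intro i j hij
    have h1 (a b : Fin n) : f a * hexp (k := k) (τ (R.Tneg b)) =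
        sexp k (P a b) • (hexp (k := k) (τ (R.Tneg b)) * f a) := by
      rw [H.hexp_mul_F, smul_smul, R.α_Tneg, sexp_mul_neg, one_smul]
    rw [serre_op, h1, h1, ← neg_smul, ← neg_smul, serre_smul_smul,
      serre_twist (commute_hexp (H.commute_tor _ _)) (h1 i i) (h1 i j) (h1 j i)
        (by linear_combination (P i j - P j i) * C_half_mul_two (k := k)) (H.serre_F i j hij), smul_zero, op_zero, smul_zero]

end IsGenRel

end Relations

/-! ### Topological Hopf algebras given by algebra homomorphisms -/

section OfAlg

variable {k : Type*} [Field k]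
variable {B : Type*} [Ring B] [Algebra k⟦X⟧ B] [IsAdicComplete (hIdeal k) B]

open MulOpposite in
/-- The structure maps given by a coproduct, a counit and an antipode that are (anti)homomorphisms
of algebras. -/
def HopfData.ofAlg (Δ : B →ₐ[k⟦X⟧] HatTensor k B B) (ε : B →ₐ[k⟦X⟧] k⟦X⟧) (S : B →ₐ[k⟦X⟧] Bᵐᵒᵖ) :
    HopfData k B where
  mul := LinearMap.mul' k⟦X⟧ B
  one := 1
  comul := Δ.toLinearMap
  counit := ε.toLinearMap
  antipode := (opLinearEquiv k⟦X⟧).symm.toLinearMap ∘ₗ S.toLinearMap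

variable {Δ : B →ₐ[k⟦X⟧] HatTensor k B B} {ε : B →ₐ[k⟦X⟧] k⟦X⟧} {S : B →ₐ[k⟦X⟧] Bᵐᵒᵖ}

@[simp] theorem HopfData.ofAlg_mul (x y : B) : (HopfData.ofAlg Δ ε S).mul (x ⊗ₜ y) = x * y := rfl
@[simp] theorem HopfData.ofAlg_one : (HopfData.ofAlg Δ ε S).one = 1 := rfl
@[simp] theorem HopfData.ofAlg_comul (x : B) : (HopfData.ofAlg Δ ε S).comul x = Δ x := rfl
@[simp] theorem HopfData.ofAlg_counit (x : B) : (HopfData.ofAlg Δ ε S).counit x = ε x := rfl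
@[simp] theorem HopfData.ofAlg_antipode (x : B) :
    (HopfData.ofAlg Δ ε S).antipode x = (S x).unop := rfl

theorem hatTensor_mul_eq (u v : HatTensor k B B) :
    hatMap (TensorProduct.map (LinearMap.mul' k⟦X⟧ B) (LinearMap.mul' k⟦X⟧ B) ∘ₗ
      (TensorProduct.tensorTensorTensorComm k⟦X⟧ B B B B).toLinearMap) (boxTensor u v) = u * v := by
  rw [hat_mul_def]
  congr 2
  refine TensorProduct.ext_fourfold' fun a b c e => ?_
  simp

/-- The map `x ⊗ y ↦ S x y`. -/
def antipodeMulLeft (S : B →ₐ[k⟦X⟧] Bᵐᵒᵖ) : HatTensor k B B →ₗ[k⟦X⟧] B :=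
  hatExtend (LinearMap.mul' k⟦X⟧ B ∘ₗ TensorProduct.map
    ((MulOpposite.opLinearEquiv k⟦X⟧).symm.toLinearMap ∘ₗ S.toLinearMap) LinearMap.id)

/-- The map `x ⊗ y ↦ x S y`. -/
def antipodeMulRight (S : B →ₐ[k⟦X⟧] Bᵐᵒᵖ) : HatTensor k B B →ₗ[k⟦X⟧] B :=
  hatExtend (LinearMap.mul' k⟦X⟧ B ∘ₗ TensorProduct.map LinearMap.id
    ((MulOpposite.opLinearEquiv k⟦X⟧).symm.toLinearMap ∘ₗ S.toLinearMap))

@[simp] theorem antipodeMulLeft_toHat (a b : B) :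
    antipodeMulLeft S (toHat (k := k) (a ⊗ₜ b)) = (S a).unop * b := hatExtend_toHat _ _

@[simp] theorem antipodeMulRight_toHat (a b : B) :
    antipodeMulRight S (toHat (k := k) (a ⊗ₜ b)) = a * (S b).unop := hatExtend_toHat _ _

theorem antipodeMulLeft_mul (w : HatTensor k B B) (a b : B) :
    antipodeMulLeft S (w * toHat (k := k) (a ⊗ₜ b)) = (S a).unop * antipodeMulLeft S w * b := by
  have : antipodeMulLeft S ∘ₗ LinearMap.mulRight k⟦X⟧ (toHat (k := k) (a ⊗ₜ b) : HatTensor k B B) =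
      LinearMap.mulRight k⟦X⟧ b ∘ₗ LinearMap.mulLeft k⟦X⟧ (S a).unop ∘ₗ antipodeMulLeft S := by
    refine hat_ext fun x => ?_
    induction x using TensorProduct.induction_on with
    | zero => simp
    | tmul x y => simp [toHat_mul, mul_assoc]
    | add x y hx hy => simp only [map_add, hx, hy]
  exact LinearMap.congr_fun this w

theorem antipodeMulRight_mul (w : HatTensor k B B) (a b : B) :
    antipodeMulRight S (toHat (k := k) (a ⊗ₜ b) * w) = a * antipodeMulRight S w * (S b).unop := by
  have : antipodeMulRight S ∘ₗ LinearMap.mulLeft k⟦X⟧ (toHat (k := k) (a ⊗ₜ b) : HatTensor k B B) =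
      LinearMap.mulRight k⟦X⟧ (S b).unop ∘ₗ LinearMap.mulLeft k⟦X⟧ a ∘ₗ antipodeMulRight S := by
    refine hat_ext fun x => ?_
    induction x using TensorProduct.induction_on with
    | zero => simp
    | tmul x y => simp [toHat_mul, mul_assoc]
    | add x y hx hy => simp only [map_add, hx, hy]
  exact LinearMap.congr_fun this w

theorem antipodeMulLeft_mul_of_eq {w : HatTensor k B B} {c : k⟦X⟧}
    (hw : antipodeMulLeft S w = c • 1) (v : HatTensor k B B) :
    antipodeMulLeft S (w * v) = c • antipodeMulLeft S v := by
  have : antipodeMulLeft S ∘ₗ LinearMap.mulLeft k⟦X⟧ w = c • antipodeMulLeft S := by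
    refine hat_ext fun x => ?_
    induction x using TensorProduct.induction_on with
    | zero => simp
    | tmul x y =>
      rw [LinearMap.comp_apply, LinearMap.mulLeft_apply, antipodeMulLeft_mul, hw]
      simp
    | add x y hx hy => simp only [map_add, hx, hy]
  exact LinearMap.congr_fun this v

theorem antipodeMulRight_mul_of_eq {w : HatTensor k B B} {c : k⟦X⟧}
    (hw : antipodeMulRight S w = c • 1) (v : HatTensor k B B) :
    antipodeMulRight S (v * w) = c • antipodeMulRight S v := by
  have : antipodeMulRight S ∘ₗ LinearMap.mulRight k⟦X⟧ w = c • antipodeMulRight S := by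
    refine hat_ext fun x => ?_
    induction x using TensorProduct.induction_on with
    | zero => simp
    | tmul x y =>
      rw [LinearMap.comp_apply, LinearMap.mulRight_apply, antipodeMulRight_mul, hw]
      simp
    | add x y hx hy => simp only [map_add, hx, hy]
  exact LinearMap.congr_fun this v

theorem hat_tensor_one : (1 : HatTensor k B B) = toHat (k := k) ((1 : B) ⊗ₜ[k⟦X⟧] (1 : B)) := rfl

/-- The subalgebra on which the left antipode identity holds. -/
def antipodeLeftSub (Δ : B →ₐ[k⟦X⟧] HatTensor k B B) (ε : B →ₐ[k⟦X⟧] k⟦X⟧)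
    (S : B →ₐ[k⟦X⟧] Bᵐᵒᵖ) : Subalgebra k⟦X⟧ B where
  carrier := {x | antipodeMulLeft S (Δ x) = ε x • 1}
  mul_mem' {x y} hx hy := by
    simp only [Set.mem_ofPred_eq] at hx hy ⊢
    rw [map_mul, antipodeMulLeft_mul_of_eq hx, hy, map_mul, smul_smul]
  add_mem' {x y} hx hy := by
    simp only [Set.mem_ofPred_eq] at hx hy ⊢
    rw [map_add, map_add, map_add, hx, hy, add_smul]
  algebraMap_mem' c := by
    simp only [Set.mem_ofPred_eq, Algebra.algebraMap_eq_smul_one, map_smul, map_one]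
    rw [hat_tensor_one, antipodeMulLeft_toHat]
    simp

/-- The subalgebra on which the right antipode identity holds. -/
def antipodeRightSub (Δ : B →ₐ[k⟦X⟧] HatTensor k B B) (ε : B →ₐ[k⟦X⟧] k⟦X⟧)
    (S : B →ₐ[k⟦X⟧] Bᵐᵒᵖ) : Subalgebra k⟦X⟧ B where
  carrier := {x | antipodeMulRight S (Δ x) = ε x • 1}
  mul_mem' {x y} hx hy := by
    simp only [Set.mem_ofPred_eq] at hx hy ⊢
    rw [map_mul, antipodeMulRight_mul_of_eq hy, hx, map_mul, smul_smul, mul_comm]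
  add_mem' {x y} hx hy := by
    simp only [Set.mem_ofPred_eq] at hx hy ⊢
    rw [map_add, map_add, map_add, hx, hy, add_smul]
  algebraMap_mem' c := by
    simp only [Set.mem_ofPred_eq, Algebra.algebraMap_eq_smul_one, map_smul, map_one]
    rw [hat_tensor_one, antipodeMulRight_toHat]
    simp

theorem hClosed_antipodeLeftSub :
    HClosed (Subalgebra.toSubmodule (antipodeLeftSub Δ ε S)) :=
  hClosed_eqLocus (antipodeMulLeft S ∘ₗ Δ.toLinearMap)
    (LinearMap.toSpanSingleton k⟦X⟧ B 1 ∘ₗ ε.toLinearMap)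

theorem hClosed_antipodeRightSub :
    HClosed (Subalgebra.toSubmodule (antipodeRightSub Δ ε S)) :=
  hClosed_eqLocus (antipodeMulRight S ∘ₗ Δ.toLinearMap)
    (LinearMap.toSpanSingleton k⟦X⟧ B 1 ∘ₗ ε.toLinearMap)

theorem HopfData.isTopHopf_ofAlg
    (h1 : (hatMapAlg (Algebra.TensorProduct.assoc k⟦X⟧ k⟦X⟧ k⟦X⟧ B B B).toAlgHom).comp
      ((hatTensorAlg Δ (toHatAlg k B)).comp Δ) = (hatTensorAlg (toHatAlg k B) Δ).comp Δ)
    (h2 : (hatLift ((Algebra.TensorProduct.lid k⟦X⟧ B).toAlgHom.comp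
      (Algebra.TensorProduct.map ε (AlgHom.id k⟦X⟧ B)))).comp Δ = AlgHom.id k⟦X⟧ B)
    (h3 : (hatLift ((Algebra.TensorProduct.rid k⟦X⟧ k⟦X⟧ B).toAlgHom.comp
      (Algebra.TensorProduct.map (AlgHom.id k⟦X⟧ B) ε))).comp Δ = AlgHom.id k⟦X⟧ B)
    (h4 : antipodeLeftSub Δ ε S = ⊤) (h5 : antipodeRightSub Δ ε S = ⊤) :
    IsTopHopf (HopfData.ofAlg Δ ε S) where
  mul_assoc x y z := mul_assoc x y z
  one_mul x := one_mul x
  mul_one x := mul_one x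
  coassoc x := by
    have := DFunLike.congr_fun h1 x
    simp only [AlgHom.comp_apply, hatMapAlg_eq, hatTensorAlg_eq] at this
    exact this
  counit_comul x := DFunLike.congr_fun h2 x
  comul_counit x := DFunLike.congr_fun h3 x
  comul_mul x y := (map_mul Δ x y).trans (hatTensor_mul_eq _ _).symm
  comul_one := map_one Δ
  counit_mul x y := map_mul ε x y
  counit_one := map_one ε
  antipode_left x := by
    have : x ∈ antipodeLeftSub Δ ε S := by rw [h4]; trivial
    exact this
  antipode_right x := by
    have : x ∈ antipodeRightSub Δ ε S := by rw [h5]; trivial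
    exact this

end OfAlg

/-- A complete algebra topologically generated by given elements. -/
structure IsTopGen {k : Type*} [Field k] {n : ℕ} {h : Type*} {B : Type*} [Ring B] [Algebra k⟦X⟧ B]
    (τ : h → B) (e f : Fin n → B) : Prop where
  mem : ∀ S : Subalgebra k⟦X⟧ B, HClosed (Subalgebra.toSubmodule S) → (∀ T, τ T ∈ S) →
    (∀ i, e i ∈ S) → (∀ i, f i ∈ S) → ∀ x, x ∈ S

section Standard

variable {k : Type*} [Field k] [CharZero k] {n : ℕ}
variable {h : Type*} [AddCommGroup h] [Module k⟦X⟧ h]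
variable {A : Matrix (Fin n) (Fin n) ℤ} {d : Fin n → ℕ} {P : Matrix (Fin n) (Fin n) k⟦X⟧}
variable {R : Realization P h}
variable {B : Type*} [Ring B] [Algebra k⟦X⟧ B] [IsAdicComplete (hIdeal k) B]

theorem IsTopGen.hom_ext {τ : h → B} {e f : Fin n → B} (hg : IsTopGen (k := k) τ e f) {D : Type*}
    [Ring D] [Algebra k⟦X⟧ D] [IsHausdorff (hIdeal k) D] {φ ψ : B →ₐ[k⟦X⟧] D}
    (hT : ∀ T, φ (τ T) = ψ (τ T)) (hE : ∀ i, φ (e i) = ψ (e i)) (hF : ∀ i, φ (f i) = ψ (f i)) :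
    φ = ψ :=
  AlgHom.ext <| hg.mem (AlgHom.equalizer φ ψ) (hClosed_eqLocus φ.toLinearMap ψ.toLinearMap) hT hE hF

theorem commute_includes {B : Type*} [Ring B] [Algebra k⟦X⟧ B] (x y : B) :
    Commute (((toHatAlg k (B ⊗[k⟦X⟧] B)).comp Algebra.TensorProduct.includeLeft) x)
      (((toHatAlg k (B ⊗[k⟦X⟧] B)).comp Algebra.TensorProduct.includeRight) y) := by
  refine Commute.map ?_ (toHatAlg k (B ⊗[k⟦X⟧] B))
  simp [Commute, SemiconjBy]

theorem hexp_tmul_add (x y : B) :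
    hexp (k := k) (toHat (k := k) (x ⊗ₜ[k⟦X⟧] (1 : B) + (1 : B) ⊗ₜ[k⟦X⟧] y) : HatTensor k B B) =
      toHat (k := k) (hexp (k := k) x ⊗ₜ[k⟦X⟧] hexp (k := k) y) := by
  have h1 := map_hexp ((toHatAlg k (B ⊗[k⟦X⟧] B)).comp Algebra.TensorProduct.includeLeft) x
  have h2 := map_hexp ((toHatAlg k (B ⊗[k⟦X⟧] B)).comp Algebra.TensorProduct.includeRight) y
  rw [map_add]
  refine (hexp_add (commute_includes x y)).trans ?_
  refine (congrArg₂ (· * ·) h1.symm h2.symm).trans ?_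
  exact (toHat_mul (k := k) (hexp (k := k) x ⊗ₜ[k⟦X⟧] (1 : B))
    ((1 : B) ⊗ₜ[k⟦X⟧] hexp (k := k) y)).trans
      (by rw [Algebra.TensorProduct.tmul_mul_tmul, one_mul, mul_one])

open MulOpposite in
theorem hexp_op (x : B) : hexp (k := k) (op x) = op (hexp (k := k) x) := by
  have h4 := map_hSeries (opLinearEquiv (M := B) k⟦X⟧).toLinearMap
    fun j => (C ((j.factorial : k)⁻¹) : k⟦X⟧) • x ^ j
  exact h4.symm

variable (R) in
/-- The values on the generators of the standard coproduct, counit and antipode. -/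
structure IsStdHopf (τ : h →ₗ[k⟦X⟧] B) (e f : Fin n → B) (Δ : B →ₐ[k⟦X⟧] HatTensor k B B)
    (ε : B →ₐ[k⟦X⟧] k⟦X⟧) (S : B →ₐ[k⟦X⟧] Bᵐᵒᵖ) : Prop where
  gen : IsTopGen (k := k) τ e f
  comul_tor : ∀ T, Δ (τ T) = toHat (k := k) (τ T ⊗ₜ[k⟦X⟧] (1 : B) + (1 : B) ⊗ₜ[k⟦X⟧] τ T)
  comul_E : ∀ i, Δ (e i) = toHat (k := k) (e i ⊗ₜ[k⟦X⟧] (1 : B) +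
    hexp (k := k) (τ (R.Tpos i)) ⊗ₜ[k⟦X⟧] e i)
  comul_F : ∀ i, Δ (f i) = toHat (k := k) (f i ⊗ₜ[k⟦X⟧] hexp (k := k) (-τ (R.Tneg i)) +
    (1 : B) ⊗ₜ[k⟦X⟧] f i)
  counit_tor : ∀ T, ε (τ T) = 0
  counit_E : ∀ i, ε (e i) = 0
  counit_F : ∀ i, ε (f i) = 0
  antipode_tor : ∀ T, S (τ T) = MulOpposite.op (-τ T)
  antipode_E : ∀ i, S (e i) = MulOpposite.op (-(hexp (k := k) (-τ (R.Tpos i)) * e i))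
  antipode_F : ∀ i, S (f i) = MulOpposite.op (-(f i * hexp (k := k) (τ (R.Tneg i))))

namespace IsStdHopf

variable {τ : h →ₗ[k⟦X⟧] B} {e f : Fin n → B} {Δ : B →ₐ[k⟦X⟧] HatTensor k B B}
  {ε : B →ₐ[k⟦X⟧] k⟦X⟧} {S : B →ₐ[k⟦X⟧] Bᵐᵒᵖ} (H : IsStdHopf R τ e f Δ ε S)

include H

theorem comul_hexp (T : h) : Δ (hexp (k := k) (τ T)) =
    toHat (k := k) (hexp (k := k) (τ T) ⊗ₜ[k⟦X⟧] hexp (k := k) (τ T)) := by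
  rw [map_hexp, H.comul_tor, hexp_tmul_add]

theorem comul_hexp_neg (T : h) : Δ (hexp (k := k) (-τ T)) =
    toHat (k := k) (hexp (k := k) (-τ T) ⊗ₜ[k⟦X⟧] hexp (k := k) (-τ T)) := by
  rw [← map_neg, H.comul_hexp]

theorem antipode_hexp (T : h) : S (hexp (k := k) (τ T)) =
    MulOpposite.op (hexp (k := k) (-τ T)) := by
  rw [map_hexp, H.antipode_tor, hexp_op]

theorem antipode_hexp_neg (T : h) : S (hexp (k := k) (-τ T)) =
    MulOpposite.op (hexp (k := k) (τ T)) := by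
  rw [← map_neg, H.antipode_hexp, map_neg, neg_neg]

theorem counit_hexp (T : h) : ε (hexp (k := k) (τ T)) = 1 := by
  rw [map_hexp, H.counit_tor, hexp_zero]

theorem counit_hexp_neg (T : h) : ε (hexp (k := k) (-τ T)) = 1 := by
  rw [← map_neg, H.counit_hexp]

omit H in
theorem assoc_hatTensorAlg_toHat (Δ : B →ₐ[k⟦X⟧] HatTensor k B B) {a b : B} {u : B ⊗[k⟦X⟧] B}
    (ha : Δ a = toHat (k := k) u) :
    hatMapAlg (Algebra.TensorProduct.assoc k⟦X⟧ k⟦X⟧ k⟦X⟧ B B B).toAlgHom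
      (hatTensorAlg Δ (toHatAlg k B) (toHat (k := k) (a ⊗ₜ[k⟦X⟧] b))) =
      toHat (k := k) (TensorProduct.assoc k⟦X⟧ B B B (u ⊗ₜ b)) := by
  rw [hatTensorAlg_toHat, ha, toHatAlg_apply, boxL_toHat, boxR_toHat, toHat_mul,
    Algebra.TensorProduct.tmul_mul_tmul, one_mul, mul_one, hatMapAlg_toHat]
  rfl

omit H in
theorem hatTensorAlg_toHat_right (Δ : B →ₐ[k⟦X⟧] HatTensor k B B) {a b : B} {u : B ⊗[k⟦X⟧] B}
    (hb : Δ b = toHat (k := k) u) :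
    hatTensorAlg (toHatAlg k B) Δ (toHat (k := k) (a ⊗ₜ[k⟦X⟧] b)) = toHat (k := k) (a ⊗ₜ u) := by
  rw [hatTensorAlg_toHat, hb, toHatAlg_apply, boxL_toHat, boxR_toHat, toHat_mul,
    Algebra.TensorProduct.tmul_mul_tmul, one_mul, mul_one]

omit H in
theorem comul_one : Δ 1 = toHat (k := k) ((1 : B) ⊗ₜ[k⟦X⟧] (1 : B)) := map_one _

theorem coassoc : (hatMapAlg (Algebra.TensorProduct.assoc k⟦X⟧ k⟦X⟧ k⟦X⟧ B B B).toAlgHom).comp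
      ((hatTensorAlg Δ (toHatAlg k B)).comp Δ) = (hatTensorAlg (toHatAlg k B) Δ).comp Δ := by
  refine H.gen.hom_ext (fun T => ?_) (fun i => ?_) (fun i => ?_)
  · simp only [AlgHom.comp_apply]
    rw [H.comul_tor, map_add, map_add, map_add, map_add,
      assoc_hatTensorAlg_toHat _ (H.comul_tor T), assoc_hatTensorAlg_toHat _ comul_one,
      hatTensorAlg_toHat_right _ (H.comul_tor T), hatTensorAlg_toHat_right _ comul_one,
      ← map_add, ← map_add]
    simp [TensorProduct.add_tmul, TensorProduct.tmul_add, add_assoc]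
  · simp only [AlgHom.comp_apply]
    rw [H.comul_E, map_add, map_add, map_add, map_add,
      assoc_hatTensorAlg_toHat _ (H.comul_E i), assoc_hatTensorAlg_toHat _ (H.comul_hexp _),
      hatTensorAlg_toHat_right _ (H.comul_E i), hatTensorAlg_toHat_right _ comul_one,
      ← map_add, ← map_add]
    simp [TensorProduct.add_tmul, TensorProduct.tmul_add, add_assoc]
  · simp only [AlgHom.comp_apply]
    rw [H.comul_F, map_add, map_add, map_add, map_add,
      assoc_hatTensorAlg_toHat _ (H.comul_F i), assoc_hatTensorAlg_toHat _ comul_one,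
      hatTensorAlg_toHat_right _ (H.comul_F i), hatTensorAlg_toHat_right _ (H.comul_hexp_neg _),
      ← map_add, ← map_add]
    simp [TensorProduct.add_tmul, TensorProduct.tmul_add, add_assoc]

theorem isTopHopf : IsTopHopf (HopfData.ofAlg Δ ε S) := by
  refine HopfData.isTopHopf_ofAlg H.coassoc ?_ ?_ ?_ ?_
  · refine H.gen.hom_ext (fun T => ?_) (fun i => ?_) (fun i => ?_) <;>
      simp only [AlgHom.comp_apply, H.comul_tor, H.comul_E, H.comul_F, map_add, hatLift_toHat] <;>
      simp [H.counit_hexp, H.counit_tor, H.counit_E, H.counit_F]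
  · refine H.gen.hom_ext (fun T => ?_) (fun i => ?_) (fun i => ?_) <;>
      simp only [AlgHom.comp_apply, H.comul_tor, H.comul_E, H.comul_F, map_add, hatLift_toHat] <;>
      simp [H.counit_hexp_neg, H.counit_tor, H.counit_E, H.counit_F]
  · refine eq_top_iff.2 fun x _ => H.gen.mem _ hClosed_antipodeLeftSub
      (fun T => ?_) (fun i => ?_) (fun i => ?_) x
    · change antipodeMulLeft S (Δ (τ T)) = ε (τ T) • (1 : B)
      rw [H.comul_tor, map_add, map_add, antipodeMulLeft_toHat, antipodeMulLeft_toHat,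
        H.antipode_tor, H.counit_tor]
      simp
    · change antipodeMulLeft S (Δ (e i)) = ε (e i) • (1 : B)
      rw [H.comul_E, map_add, map_add, antipodeMulLeft_toHat, antipodeMulLeft_toHat,
        H.antipode_hexp, H.antipode_E, H.counit_E]
      simp
    · change antipodeMulLeft S (Δ (f i)) = ε (f i) • (1 : B)
      rw [H.comul_F, map_add, map_add, antipodeMulLeft_toHat, antipodeMulLeft_toHat, H.antipode_F,
        H.counit_F]
      simp [mul_assoc, hexp_mul_neg]
  · refine eq_top_iff.2 fun x _ => H.gen.mem _ hClosed_antipodeRightSub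
      (fun T => ?_) (fun i => ?_) (fun i => ?_) x
    · change antipodeMulRight S (Δ (τ T)) = ε (τ T) • (1 : B)
      rw [H.comul_tor, map_add, map_add, antipodeMulRight_toHat, antipodeMulRight_toHat,
        H.antipode_tor, H.counit_tor]
      simp
    · change antipodeMulRight S (Δ (e i)) = ε (e i) • (1 : B)
      rw [H.comul_E, map_add, map_add, antipodeMulRight_toHat, antipodeMulRight_toHat, H.antipode_E,
        H.counit_E]
      simp [← mul_assoc, hexp_mul_neg]
    · change antipodeMulRight S (Δ (f i)) = ε (f i) • (1 : B)
      rw [H.comul_F, map_add, map_add, antipodeMulRight_toHat, antipodeMulRight_toHat,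
        H.antipode_hexp_neg, H.antipode_F, H.counit_F]
      simp

end IsStdHopf

section Construction

variable {τ : h →ₗ[k⟦X⟧] B} {e f : Fin n → B} (H : IsGenRel A d R τ e f)

include H

theorem IsGenRel.comul_hatTensor (hA : IsSymmetrizableGCM A d) (hP : IsCartanType A d P) :
    IsGenRel A d R (B := HatTensor k B B)
      (toHat (k := k) ∘ₗ ((TensorProduct.mk k⟦X⟧ B B).flip 1 ∘ₗ τ + TensorProduct.mk k⟦X⟧ B B 1 ∘ₗ τ))
      (fun i => toHat (k := k) (e i ⊗ₜ[k⟦X⟧] (1 : B) + hexp (k := k) (τ (R.Tpos i)) ⊗ₜ[k⟦X⟧] e i))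
      (fun i => toHat (k := k) (f i ⊗ₜ[k⟦X⟧] hexp (k := k) (-τ (R.Tneg i)) +
        (1 : B) ⊗ₜ[k⟦X⟧] f i)) := by
  have h1 : toHat (k := k) ∘ₗ ((TensorProduct.mk k⟦X⟧ B B).flip 1 ∘ₗ τ +
      TensorProduct.mk k⟦X⟧ B B 1 ∘ₗ τ) =
      ((toHatAlg k (B ⊗[k⟦X⟧] B)).comp Algebra.TensorProduct.includeLeft).toLinearMap ∘ₗ τ +
      ((toHatAlg k (B ⊗[k⟦X⟧] B)).comp Algebra.TensorProduct.includeRight).toLinearMap ∘ₗ τ := by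
    rw [LinearMap.comp_add]
    rfl
  have h2 (x y z : B) : (toHat (k := k) (x ⊗ₜ[k⟦X⟧] (1 : B) + y ⊗ₜ[k⟦X⟧] z) : HatTensor k B B) =
      ((toHatAlg k (B ⊗[k⟦X⟧] B)).comp Algebra.TensorProduct.includeLeft) x +
      ((toHatAlg k (B ⊗[k⟦X⟧] B)).comp Algebra.TensorProduct.includeLeft) y *
      ((toHatAlg k (B ⊗[k⟦X⟧] B)).comp Algebra.TensorProduct.includeRight) z := by
    rw [map_add]
    refine congrArg₂ (· + ·) rfl (Eq.symm ?_)
    exact (toHat_mul (k := k) (y ⊗ₜ[k⟦X⟧] (1 : B)) ((1 : B) ⊗ₜ[k⟦X⟧] z)).trans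
      (by rw [Algebra.TensorProduct.tmul_mul_tmul, one_mul, mul_one])
  have h3 (x y z : B) : (toHat (k := k) (y ⊗ₜ[k⟦X⟧] z + (1 : B) ⊗ₜ[k⟦X⟧] x) : HatTensor k B B) =
      ((toHatAlg k (B ⊗[k⟦X⟧] B)).comp Algebra.TensorProduct.includeLeft) y *
      ((toHatAlg k (B ⊗[k⟦X⟧] B)).comp Algebra.TensorProduct.includeRight) z +
      ((toHatAlg k (B ⊗[k⟦X⟧] B)).comp Algebra.TensorProduct.includeRight) x := by
    rw [map_add]
    refine congrArg₂ (· + ·) (Eq.symm ?_) rfl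
    exact (toHat_mul (k := k) (y ⊗ₜ[k⟦X⟧] (1 : B)) ((1 : B) ⊗ₜ[k⟦X⟧] z)).trans
      (by rw [Algebra.TensorProduct.tmul_mul_tmul, one_mul, mul_one])
  rw [h1, funext fun i => h2 (e i) (hexp (k := k) (τ (R.Tpos i))) (e i),
    funext fun i => h3 (f i) (f i) (hexp (k := k) (-τ (R.Tneg i)))]
  exact H.comul hA hP _ _ commute_includes

end Construction

theorem UAlg.isTopGen (A : Matrix (Fin n) (Fin n) ℤ) (d : Fin n → ℕ) (R : Realization P h) :
    IsTopGen (k := k) (UAlg.torₗ A d R) (UAlg.E A d R) (UAlg.F A d R) where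
  mem _ hS hT hE hF := UAlg.induction_subalgebra hS hT hE hF

variable (hA : IsSymmetrizableGCM A d) (hP : IsCartanType A d P) (R : Realization P h)

/-- The coproduct of `U_{P,ħ}^R(g)`. -/
def UAlg.comul : UAlg A d R →ₐ[k⟦X⟧] HatTensor k (UAlg A d R) (UAlg A d R) :=
  ((UAlg.isGenRel A d R).comul_hatTensor hA hP).lift

variable (A d) in
/-- The counit of `U_{P,ħ}^R(g)`. -/
def UAlg.counit : UAlg A d R →ₐ[k⟦X⟧] k⟦X⟧ := IsGenRel.zero.lift

variable (A d) in
/-- The antipode of `U_{P,ħ}^R(g)`. -/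
def UAlg.antipode : UAlg A d R →ₐ[k⟦X⟧] (UAlg A d R)ᵐᵒᵖ := (UAlg.isGenRel A d R).antipode.lift

theorem UAlg.isStdHopf : IsStdHopf R (UAlg.torₗ A d R) (UAlg.E A d R) (UAlg.F A d R)
    (UAlg.comul hA hP R) (UAlg.counit A d R) (UAlg.antipode A d R) where
  gen := UAlg.isTopGen A d R
  comul_tor T := IsGenRel.lift_tor _ T
  comul_E i := IsGenRel.lift_E _ i
  comul_F i := IsGenRel.lift_F _ i
  counit_tor T := IsGenRel.lift_tor _ T
  counit_E i := IsGenRel.lift_E _ i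
  counit_F i := IsGenRel.lift_F _ i
  antipode_tor T := IsGenRel.lift_tor _ T
  antipode_E i := IsGenRel.lift_E _ i
  antipode_F i := IsGenRel.lift_F _ i

/-- The standard topological Hopf structure of `U_{P,ħ}^R(g)`. -/
def UAlg.hopf : HopfData k (UAlg A d R) :=
  HopfData.ofAlg (UAlg.comul hA hP R) (UAlg.counit A d R) (UAlg.antipode A d R)

theorem UAlg.isFoMpHopf : IsFoMpHopf A d R (UAlg.hopf hA hP R) where
  isTopHopf := (UAlg.isStdHopf hA hP R).isTopHopf
  mul_eq _ _ := rfl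
  one_eq := rfl
  comul_E := (UAlg.isStdHopf hA hP R).comul_E
  comul_tor := (UAlg.isStdHopf hA hP R).comul_tor
  comul_F := (UAlg.isStdHopf hA hP R).comul_F
  counit_E := (UAlg.isStdHopf hA hP R).counit_E
  counit_tor := (UAlg.isStdHopf hA hP R).counit_tor
  counit_F := (UAlg.isStdHopf hA hP R).counit_F
  antipode_E i := congrArg MulOpposite.unop ((UAlg.isStdHopf hA hP R).antipode_E i)
  antipode_tor T := congrArg MulOpposite.unop ((UAlg.isStdHopf hA hP R).antipode_tor T)
  antipode_F i := congrArg MulOpposite.unop ((UAlg.isStdHopf hA hP R).antipode_F i)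

end Standard

/-! ### Borel subalgebras -/

section Borel

variable {k : Type*} [Field k]
variable {B : Type*} [Ring B] [Algebra k⟦X⟧ B]

/-- The closure of a subalgebra. -/
def closureSub (S : Subalgebra k⟦X⟧ B) : Subalgebra k⟦X⟧ B where
  __ := hClosure (Subalgebra.toSubmodule S)
  mul_mem' {x y} hx hy := by
    refine mem_hClosure.2 fun n => ?_
    obtain ⟨a, ha, v, rfl⟩ := mem_hClosure.1 hx n
    obtain ⟨b, hb, w, rfl⟩ := mem_hClosure.1 hy n
    refine ⟨a * b, S.mul_mem ha hb, a * w + v * (b + (PowerSeries.X ^ n : k⟦X⟧) • w), ?_⟩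
    simp only [add_mul, mul_add, smul_mul_assoc, mul_smul_comm, smul_add]
    abel
  algebraMap_mem' c := le_hClosure _ (S.algebraMap_mem c)

theorem hClosed_closureSub (S : Subalgebra k⟦X⟧ B) : HClosed (Subalgebra.toSubmodule (closureSub S)) :=
  hClosed_hClosure _

theorem le_closureSub (S : Subalgebra k⟦X⟧ B) : S ≤ closureSub S := fun _ hx => le_hClosure _ hx

theorem closureSub_le {S S' : Subalgebra k⟦X⟧ B} (hle : S ≤ S')
    (hS' : HClosed (Subalgebra.toSubmodule S')) : closureSub S ≤ S' :=
  fun _ hx => hClosure_le (S' := Subalgebra.toSubmodule S') hle hS' hx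

variable [IsAdicComplete (hIdeal k) B]

theorem hexp_mem {S : Subalgebra k⟦X⟧ B} (hS : HClosed (Subalgebra.toSubmodule S)) {x : B}
    (hx : x ∈ S) : hexp (k := k) x ∈ S :=
  HClosed.hSeries_mem hS fun j => S.smul_mem (S.pow_mem hx j) _

/-- The closure of the tensor square of a subalgebra. -/
def tensorSub (S : Subalgebra k⟦X⟧ B) : Subalgebra k⟦X⟧ (HatTensor k B B) :=
  closureSub ((Algebra.TensorProduct.map S.val S.val).range.map (toHatAlg k (B ⊗[k⟦X⟧] B)))

theorem toHat_mem_tensorSub {S : Subalgebra k⟦X⟧ B} {x y : B} (hx : x ∈ S) (hy : y ∈ S) :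
    toHat (k := k) (x ⊗ₜ[k⟦X⟧] y) ∈ tensorSub S :=
  le_closureSub _ ⟨_, ⟨(⟨x, hx⟩ : S) ⊗ₜ (⟨y, hy⟩ : S), rfl⟩, rfl⟩

theorem isHopfSub_ofAlg {Δ : B →ₐ[k⟦X⟧] HatTensor k B B} {ε : B →ₐ[k⟦X⟧] k⟦X⟧}
    {S : B →ₐ[k⟦X⟧] Bᵐᵒᵖ} {G : Set B}
    (hΔ : ∀ g ∈ G, Δ g ∈ tensorSub (closureSub (Algebra.adjoin k⟦X⟧ G)))
    (hS : ∀ g ∈ G, (S g).unop ∈ closureSub (Algebra.adjoin k⟦X⟧ G)) :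
    IsHopfSub (HopfData.ofAlg Δ ε S)
      (hClosure (Subalgebra.toSubmodule (Algebra.adjoin k⟦X⟧ G))) where
  closed := (hClosed_hClosure _).hClosure_eq
  one_mem := (closureSub (Algebra.adjoin k⟦X⟧ G)).one_mem
  mul_mem x hx y hy := (closureSub (Algebra.adjoin k⟦X⟧ G)).mul_mem hx hy
  antipode_mem x hx := by
    have h1 : closureSub (Algebra.adjoin k⟦X⟧ G) ≤
        (closureSub (Algebra.adjoin k⟦X⟧ G)).op.comap S :=
      closureSub_le (Algebra.adjoin_le hS) ((hClosed_closureSub _).comap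
        ((MulOpposite.opLinearEquiv k⟦X⟧).symm.toLinearMap ∘ₗ S.toLinearMap))
    exact h1 hx
  comul_mem x hx := by
    have h1 : closureSub (Algebra.adjoin k⟦X⟧ G) ≤
        (tensorSub (closureSub (Algebra.adjoin k⟦X⟧ G))).comap Δ :=
      closureSub_le (Algebra.adjoin_le hΔ) ((hClosed_closureSub _).comap Δ.toLinearMap)
    exact h1 hx

variable [CharZero k] {n : ℕ}
variable {h : Type*} [AddCommGroup h] [Module k⟦X⟧ h]
variable {P : Matrix (Fin n) (Fin n) k⟦X⟧} {R : Realization P h}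
variable {τ : h →ₗ[k⟦X⟧] B} {e f : Fin n → B} {Δ : B →ₐ[k⟦X⟧] HatTensor k B B}
  {ε : B →ₐ[k⟦X⟧] k⟦X⟧} {S : B →ₐ[k⟦X⟧] Bᵐᵒᵖ}

theorem IsStdHopf.isHopfSub_pos (H : IsStdHopf R τ e f Δ ε S) {t : Submodule k⟦X⟧ h}
    (ht : ∀ i, R.Tpos i ∈ t) : IsHopfSub (HopfData.ofAlg Δ ε S)
      (hClosure (Subalgebra.toSubmodule (Algebra.adjoin k⟦X⟧ (τ '' (t : Set h) ∪ Set.range e)))) := by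
  set V := closureSub (Algebra.adjoin k⟦X⟧ (τ '' (t : Set h) ∪ Set.range e)) with hV
  have hτ (T : h) (hT : T ∈ t) : τ T ∈ V :=
    le_closureSub _ (Algebra.subset_adjoin (Or.inl ⟨T, hT, rfl⟩))
  have he (i : Fin n) : e i ∈ V := le_closureSub _ (Algebra.subset_adjoin (Or.inr ⟨i, rfl⟩))
  refine isHopfSub_ofAlg ?_ ?_
  · rintro _ (⟨T, hT, rfl⟩ | ⟨i, rfl⟩)
    · rw [H.comul_tor, map_add]
      exact add_mem (toHat_mem_tensorSub (hτ T hT) V.one_mem) (toHat_mem_tensorSub V.one_mem (hτ T hT))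
    · rw [H.comul_E, map_add]
      exact add_mem (toHat_mem_tensorSub (he i) V.one_mem)
        (toHat_mem_tensorSub (hexp_mem (hClosed_closureSub _) (hτ _ (ht i))) (he i))
  · rintro _ (⟨T, hT, rfl⟩ | ⟨i, rfl⟩)
    · rw [H.antipode_tor, MulOpposite.unop_op]
      exact V.neg_mem (hτ T hT)
    · rw [H.antipode_E, MulOpposite.unop_op]
      exact V.neg_mem (V.mul_mem (hexp_mem (hClosed_closureSub _) (V.neg_mem (hτ _ (ht i)))) (he i))

theorem IsStdHopf.isHopfSub_neg (H : IsStdHopf R τ e f Δ ε S) {t : Submodule k⟦X⟧ h}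
    (ht : ∀ i, R.Tneg i ∈ t) : IsHopfSub (HopfData.ofAlg Δ ε S)
      (hClosure (Subalgebra.toSubmodule (Algebra.adjoin k⟦X⟧ (τ '' (t : Set h) ∪ Set.range f)))) := by
  set V := closureSub (Algebra.adjoin k⟦X⟧ (τ '' (t : Set h) ∪ Set.range f)) with hV
  have hτ (T : h) (hT : T ∈ t) : τ T ∈ V :=
    le_closureSub _ (Algebra.subset_adjoin (Or.inl ⟨T, hT, rfl⟩))
  have he (i : Fin n) : f i ∈ V := le_closureSub _ (Algebra.subset_adjoin (Or.inr ⟨i, rfl⟩))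
  refine isHopfSub_ofAlg ?_ ?_
  · rintro _ (⟨T, hT, rfl⟩ | ⟨i, rfl⟩)
    · rw [H.comul_tor, map_add]
      exact add_mem (toHat_mem_tensorSub (hτ T hT) V.one_mem) (toHat_mem_tensorSub V.one_mem (hτ T hT))
    · rw [H.comul_F, map_add]
      exact add_mem (toHat_mem_tensorSub (he i)
        (hexp_mem (hClosed_closureSub _) (V.neg_mem (hτ _ (ht i)))))
        (toHat_mem_tensorSub V.one_mem (he i))
  · rintro _ (⟨T, hT, rfl⟩ | ⟨i, rfl⟩)
    · rw [H.antipode_tor, MulOpposite.unop_op]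
      exact V.neg_mem (hτ T hT)
    · rw [H.antipode_F, MulOpposite.unop_op]
      exact V.neg_mem (V.mul_mem (he i) (hexp_mem (hClosed_closureSub _) (hτ _ (ht i))))

variable {A : Matrix (Fin n) (Fin n) ℤ} {d : Fin n → ℕ}

theorem UAlg.isHopfSub_borelPos (hA : IsSymmetrizableGCM A d) (hP : IsCartanType A d P)
    (R : Realization P h) {t : Submodule k⟦X⟧ h} (ht : ∀ i, R.Tpos i ∈ t) :
    IsHopfSub (UAlg.hopf hA hP R) (borelPos A d R t) :=
  (UAlg.isStdHopf hA hP R).isHopfSub_pos ht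

theorem UAlg.isHopfSub_borelNeg (hA : IsSymmetrizableGCM A d) (hP : IsCartanType A d P)
    (R : Realization P h) {t : Submodule k⟦X⟧ h} (ht : ∀ i, R.Tneg i ∈ t) :
    IsHopfSub (UAlg.hopf hA hP R) (borelNeg A d R t) :=
  (UAlg.isStdHopf hA hP R).isHopfSub_neg ht

end Borel

/-! ### Rescaling of the generators -/

section Scale

variable {k : Type*} [Field k] [CharZero k] {n : ℕ}
variable {h : Type*} [AddCommGroup h] [Module k⟦X⟧ h]
variable {A : Matrix (Fin n) (Fin n) ℤ} {d : Fin n → ℕ} {P : Matrix (Fin n) (Fin n) k⟦X⟧}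
variable {R : Realization P h}
variable {B : Type*} [Ring B] [Algebra k⟦X⟧ B] [IsAdicComplete (hIdeal k) B]
variable {τ : h →ₗ[k⟦X⟧] B} {e f : Fin n → B}

theorem serre_eq_zero_of_central {d m : ℕ} {p p' : k⟦X⟧} {a b x y : B} (ha : ∀ z, Commute a z)
    (hb : ∀ z, Commute b z) (h0 : serre d m p p' x y = 0) : serre d m p p' (a * x) (b * y) = 0 :=
  serre_eq_zero_of_commute (ha b) (ha x) (ha y) (hb x) h0

theorem scale_commutator {u v x y : B} (hu : ∀ z, Commute u z) (hv : ∀ z, Commute v z) :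
    u * x * (v * y) - v * y * (u * x) = u * v * (x * y - y * x) := by
  have e1 : u * x * (v * y) = u * v * (x * y) := by
    rw [mul_assoc, ← mul_assoc x, ← (hv x).eq]
    simp only [mul_assoc]
  have e2 : v * y * (u * x) = u * v * (y * x) := by
    rw [mul_assoc, ← mul_assoc y, ← (hu y).eq, ← mul_assoc, ← mul_assoc, ← (hu v).eq]
    simp only [mul_assoc]
  rw [e1, e2, mul_sub]

theorem IsGenRel.scale (H : IsGenRel A d R τ e f) (l : h →ₗ[k⟦X⟧] B) (u v : Fin n → B)
    (hl : ∀ T x, Commute (l T) x) (hu : ∀ i x, Commute (u i) x) (hv : ∀ i x, Commute (v i) x)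
    (huv : ∀ i, u i * v i = hexp (k := k) (l (R.Tpos i))) (hneg : ∀ i, l (R.Tneg i) = -l (R.Tpos i)) :
    IsGenRel A d R (τ + l) (fun i => u i * e i) (fun i => v i * f i) where
  comm T T' := by
    simp only [LinearMap.add_apply, add_mul, mul_add, H.comm T T', (hl T _).eq, (hl T' (τ T)).eq]
    abel
  tor_E T j := by
    rw [← mul_smul_comm, ← H.tor_E, LinearMap.add_apply, add_mul, mul_add, (hl T _).eq, mul_sub,
      ← mul_assoc, ← (hu j (τ T)).eq]
    simp only [mul_assoc]
    abel
  tor_F T j := by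
    rw [← mul_smul_comm, ← mul_neg, ← H.tor_F, LinearMap.add_apply, add_mul, mul_add, (hl T _).eq,
      mul_sub, ← mul_assoc, ← (hv j (τ T)).eq]
    simp only [mul_assoc]
    abel
  E_F_ne i j hij := by
    rw [scale_commutator (hu i) (hv j), H.E_F_ne i j hij, mul_zero]
  E_F i := by
    have h2 : Commute (-τ (R.Tneg i)) (l (R.Tpos i)) := (hl _ _).symm
    rw [scale_commutator (hu i) (hv i), H.E_F, huv, LinearMap.add_apply,
      LinearMap.add_apply, hneg, neg_add, neg_neg, hexpDiv_sub_hexpDiv (hl _ _).symm h2, sub_self,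
      mul_zero, add_zero, mul_smul_comm, (commute_hexp_left (hl _ _)).eq]
  serre_E i j hij := serre_eq_zero_of_central (hu i) (hu j) (H.serre_E i j hij)
  serre_F i j hij := serre_eq_zero_of_central (hv i) (hv j) (H.serre_F i j hij)

theorem IsTopGen.induction (hg : IsTopGen (k := k) τ e f) {S : Submodule k⟦X⟧ B} (hS : HClosed S)
    (h1 : 1 ∈ S) (hT : ∀ T, ∀ x ∈ S, τ T * x ∈ S) (hE : ∀ i, ∀ x ∈ S, e i * x ∈ S)
    (hF : ∀ i, ∀ x ∈ S, f i * x ∈ S) (x : B) : x ∈ S := by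
  let V : Subalgebra k⟦X⟧ B :=
    { carrier := {x | ∀ y ∈ S, x * y ∈ S}
      mul_mem' := fun {a b} ha hb y hy => by rw [mul_assoc]; exact ha _ (hb _ hy)
      add_mem' := fun {a b} ha hb y hy => by rw [add_mul]; exact S.add_mem (ha _ hy) (hb _ hy)
      algebraMap_mem' := fun c y hy => by rw [← Algebra.smul_def]; exact S.smul_mem _ hy }
  have hV : HClosed (Subalgebra.toSubmodule V) := fun x hx y hy => hS _ fun m => by
    obtain ⟨a, ha, v, rfl⟩ := hx m
    exact ⟨_, ha y hy, v * y, by rw [add_mul, smul_mul_assoc]⟩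
  simpa using hg.mem V hV hT hE hF x 1 h1

theorem IsTopGen.linearMap_ext (hg : IsTopGen (k := k) τ e f) {M : Type*} [AddCommGroup M]
    [Module k⟦X⟧ M] [IsHausdorff (hIdeal k) M] {φ ψ : B →ₗ[k⟦X⟧] M} (h1 : φ 1 = ψ 1)
    (hT : ∀ T x, φ x = ψ x → φ (τ T * x) = ψ (τ T * x))
    (hE : ∀ i x, φ x = ψ x → φ (e i * x) = ψ (e i * x))
    (hF : ∀ i x, φ x = ψ x → φ (f i * x) = ψ (f i * x)) : φ = ψ :=
  LinearMap.ext <| hg.induction (hClosed_eqLocus φ ψ) h1 hT hE hF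

/-- The operators by which the deformed algebra acts: `a j` and `b j` rescale the generators, and
`D T` is a derivation for which the generators are eigenvectors. -/
structure IsTwistOps (η : h →ₗ[k⟦X⟧] h →ₗ[k⟦X⟧] k⟦X⟧) (Tp : Fin n → h) (τ : h →ₗ[k⟦X⟧] B)
    (e f : Fin n → B) (a b : Fin n → B →ₐ[k⟦X⟧] B) (D : h →ₗ[k⟦X⟧] Module.End k⟦X⟧ B) : Prop where
  a_tor : ∀ j T, a j (τ T) = τ T + algebraMap k⟦X⟧ B (η (Tp j) T)
  a_E : ∀ j i, a j (e i) = sexp k (η (Tp j) (Tp i)) • e i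
  a_F : ∀ j i, a j (f i) = f i
  b_tor : ∀ j T, b j (τ T) = τ T - algebraMap k⟦X⟧ B (η (Tp j) T)
  b_E : ∀ j i, b j (e i) = e i
  b_F : ∀ j i, b j (f i) = sexp k (-η (Tp j) (Tp i)) • f i
  D_one : ∀ T, D T 1 = 0
  D_tor : ∀ T T' x, D T (τ T' * x) = τ T' * D T x
  D_E : ∀ T i x, D T (e i * x) = e i * (D T x + η T (Tp i) • x)
  D_F : ∀ T i x, D T (f i * x) = f i * (D T x - η T (Tp i) • x)

theorem exists_derivation (hg : IsTopGen (k := k) τ e f) (c : Fin n → k⟦X⟧)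
    (δ : B →ₐ[k⟦X⟧] Ser B) (hT : ∀ T, δ (τ T) = Ser.const (k := k) (τ T))
    (hE : ∀ i, δ (e i) = (1 + Ser.single (algebraMap k⟦X⟧ B (c i))) * Ser.const (k := k) (e i))
    (hF : ∀ i, δ (f i) = (Ser.mk fun m => algebraMap k⟦X⟧ B ((-c i) ^ m)) * Ser.const (k := k) (f i)) :
    ∃ D : Module.End k⟦X⟧ B, D 1 = 0 ∧ (∀ T x, D (τ T * x) = τ T * D x) ∧
      (∀ i x, D (e i * x) = e i * (D x + c i • x)) ∧ (∀ i x, D (f i * x) = f i * (D x - c i • x)) := by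
  have h0 (x : B) : Ser.coeff 0 (δ x) = x := by
    have : (Ser.coeffₗ (k := k) 0 ∘ₗ δ.toLinearMap) = LinearMap.id := by
      refine hg.linearMap_ext ?_ (fun T x hx => ?_) (fun i x hx => ?_) (fun i x hx => ?_)
      · simp [Ser.coeff_one]
      all_goals
        simp only [LinearMap.comp_apply, AlgHom.toLinearMap_apply, Ser.coeffₗ_apply, map_mul,
          LinearMap.id_apply, Ser.coeff_mul, Finset.Nat.antidiagonal_zero, Finset.sum_singleton,
          hT, hE, hF] at hx ⊢
        simp [hx, Ser.coeff_const, Ser.coeff_one, Ser.coeff_single]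
    exact LinearMap.congr_fun this x
  refine ⟨Ser.coeffₗ (k := k) 1 ∘ₗ δ.toLinearMap, ?_, fun T x => ?_, fun i x => ?_, fun i x => ?_⟩
  · simp [Ser.coeff_one]
  · simp [hT, Ser.coeff_const_mul]
  · simp only [LinearMap.comp_apply, AlgHom.toLinearMap_apply, Ser.coeffₗ_apply, map_mul, hE]
    simp [Ser.coeff_mul, Finset.Nat.antidiagonal_succ, h0, Ser.coeff_const, Ser.coeff_one,
      Ser.coeff_single, mul_add, Algebra.smul_def, Algebra.commutes, mul_assoc]
  · simp only [LinearMap.comp_apply, AlgHom.toLinearMap_apply, Ser.coeffₗ_apply, map_mul, hF]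
    simp [Ser.coeff_mul, Finset.Nat.antidiagonal_succ, h0, Ser.coeff_const, mul_add,
      Algebra.smul_def, Algebra.commutes, mul_assoc, sub_eq_add_neg]

variable {η : h →ₗ[k⟦X⟧] h →ₗ[k⟦X⟧] k⟦X⟧}

theorem IsGenRel.twistA (H : IsGenRel A d R τ e f)
    (hη : ∀ i x, η x (R.Tneg i) = -η x (R.Tpos i)) (x : h) :
    IsGenRel A d R (τ + Algebra.linearMap k⟦X⟧ B ∘ₗ η x) (fun i => sexp k (η x (R.Tpos i)) • e i) f := by
  have := H.scale (Algebra.linearMap k⟦X⟧ B ∘ₗ η x)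
    (fun i => algebraMap k⟦X⟧ B (sexp k (η x (R.Tpos i)))) (fun _ => 1)
    (fun T y => Algebra.commutes _ _) (fun i y => Algebra.commutes _ _) (fun i y => Commute.one_left y)
    (fun i => by simp [hexp_algebraMap]) (fun i => by simp [hη])
  simpa only [one_mul, ← Algebra.smul_def] using this

theorem IsGenRel.twistB (H : IsGenRel A d R τ e f)
    (hη : ∀ i x, η x (R.Tneg i) = -η x (R.Tpos i)) (x : h) :
    IsGenRel A d R (τ - Algebra.linearMap k⟦X⟧ B ∘ₗ η x) e
      (fun i => sexp k (-η x (R.Tpos i)) • f i) := by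
  have := H.scale (Algebra.linearMap k⟦X⟧ B ∘ₗ (-η x)) (fun _ => 1)
    (fun i => algebraMap k⟦X⟧ B (sexp k (-η x (R.Tpos i))))
    (fun T y => Algebra.commutes _ _) (fun i y => Commute.one_left y) (fun i y => Algebra.commutes _ _)
    (fun i => by
      rw [one_mul, LinearMap.comp_apply, Algebra.linearMap_apply, hexp_algebraMap]; rfl)
    (fun i => by simp [hη])
  simpa only [one_mul, ← Algebra.smul_def, LinearMap.comp_neg, ← sub_eq_add_neg] using this

theorem geom_mul (c : k⟦X⟧) : (1 + Ser.single (algebraMap k⟦X⟧ B c)) *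
    (Ser.mk fun m => algebraMap k⟦X⟧ B ((-c) ^ m)) = 1 := by
  refine Ser.ext fun m => ?_
  rw [add_mul, one_mul, map_add, Ser.single_eq (k := k), mul_assoc, Ser.coeff_const_mul]
  rw [Ser.coeff_mul]
  cases m with
  | zero => simp [Ser.coeff_single, Ser.coeff_one]
  | succ m =>
    rw [Finset.Nat.antidiagonal_succ, Finset.sum_cons, Finset.sum_map,
      Finset.sum_eq_single_of_mem (⟨0, m⟩ : ℕ × ℕ)]
    · simp [Ser.coeff_single, Ser.coeff_one, pow_succ']
    · simp
    · rintro ⟨a, b⟩ _ hab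
      have : a ≠ 0 := by rintro rfl; simp_all
      simp [Ser.coeff_single, this]

theorem IsGenRel.infinitesimal (H : IsGenRel A d R τ e f) (c : Fin n → k⟦X⟧) :
    IsGenRel A d R ((Ser.const (k := k) (A := B)).toLinearMap ∘ₗ τ)
      (fun i => (1 + Ser.single (algebraMap k⟦X⟧ B (c i))) * Ser.const (k := k) (e i))
      (fun i => (Ser.mk fun m => algebraMap k⟦X⟧ B ((-c i) ^ m)) * Ser.const (k := k) (f i)) := by
  have hc (a : ℕ → k⟦X⟧) (y : Ser B) : Commute (Ser.mk fun m => algebraMap k⟦X⟧ B (a m)) y :=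
    Ser.commute_of_forall fun m m' => by rw [Ser.coeff_mk]; exact Algebra.commutes _ _
  have := (H.map (Ser.const (k := k))).scale 0 (fun i => 1 + Ser.single (algebraMap k⟦X⟧ B (c i)))
    (fun i => Ser.mk fun m => algebraMap k⟦X⟧ B ((-c i) ^ m)) (fun T y => Commute.zero_left y)
    (fun i y => (Commute.one_left y).add_left (Ser.commute_of_forall fun m m' => by
      rw [Ser.coeff_single]
      split_ifs
      · exact Algebra.commutes _ _
      · exact Commute.zero_left _))
    (fun i y => hc _ y)
    (fun i => by rw [geom_mul, LinearMap.zero_apply, hexp_zero]) (fun i => by simp)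
  simpa only [add_zero] using this

variable (A d R) in
/-- The existence of the operators of `IsTwistOps`, for homomorphisms with given values. -/
theorem exists_isTwistOps (hg : IsTopGen (k := k) τ e f) {Tp : Fin n → h}
    (ha : ∀ x, ∃ a : B →ₐ[k⟦X⟧] B, (∀ T, a (τ T) = (τ + Algebra.linearMap k⟦X⟧ B ∘ₗ η x) T) ∧
      (∀ i, a (e i) = sexp k (η x (Tp i)) • e i) ∧ ∀ i, a (f i) = f i)
    (hb : ∀ x, ∃ a : B →ₐ[k⟦X⟧] B, (∀ T, a (τ T) = (τ - Algebra.linearMap k⟦X⟧ B ∘ₗ η x) T) ∧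
      (∀ i, a (e i) = e i) ∧ ∀ i, a (f i) = sexp k (-η x (Tp i)) • f i)
    (hδ : ∀ c : Fin n → k⟦X⟧, ∃ δ : B →ₐ[k⟦X⟧] Ser B,
      (∀ T, δ (τ T) = ((Ser.const (k := k) (A := B)).toLinearMap ∘ₗ τ) T) ∧
      (∀ i, δ (e i) = (1 + Ser.single (algebraMap k⟦X⟧ B (c i))) * Ser.const (k := k) (e i)) ∧
      ∀ i, δ (f i) = (Ser.mk fun m => algebraMap k⟦X⟧ B ((-c i) ^ m)) * Ser.const (k := k) (f i)) :
    ∃ (a b : Fin n → B →ₐ[k⟦X⟧] B) (D : h →ₗ[k⟦X⟧] Module.End k⟦X⟧ B),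
      IsTwistOps η Tp τ e f a b D := by
  choose a a1 a2 a3 using ha
  choose b b1 b2 b3 using hb
  choose δ δ1 δ2 δ3 using hδ
  choose D D1 D2 D3 D4 using fun T => exists_derivation hg (fun i => η T (Tp i)) (δ _) (δ1 _) (δ2 _) (δ3 _)
  refine ⟨fun j => a (Tp j), fun j => b (Tp j),
    { toFun := D
      map_add' := fun T T' => hg.linearMap_ext ?_ ?_ ?_ ?_
      map_smul' := fun c T => hg.linearMap_ext ?_ ?_ ?_ ?_ }, ?_⟩
  · simp [D1]
  · intro T'' x hx
    rw [D2, hx]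
    simp only [LinearMap.add_apply, D2, mul_add]
  · intro i x hx
    rw [D3, hx]
    simp only [LinearMap.add_apply, D3, mul_add, map_add, add_smul]
    abel
  · intro i x hx
    rw [D4, hx]
    simp only [LinearMap.add_apply, D4, mul_add, map_add, add_smul, mul_sub]
    abel
  · simp [D1]
  · intro T'' x hx
    rw [D2, hx]
    simp [D2]
  · intro i x hx
    rw [D3, hx]
    simp [D3, mul_smul, ← smul_add]
  · intro i x hx
    rw [D4, hx]
    simp [D4, mul_smul, ← smul_sub]
  · exact
    { a_tor := fun j T => a1 _ T
      a_E := fun j i => a2 _ i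
      a_F := fun j i => a3 _ i
      b_tor := fun j T => b1 _ T
      b_E := fun j i => b2 _ i
      b_F := fun j i => b3 _ i
      D_one := D1
      D_tor := D2
      D_E := D3
      D_F := D4 }

variable (A d R) in
theorem UAlg.exists_isTwistOps (hη : ∀ i x, η x (R.Tneg i) = -η x (R.Tpos i)) :
    ∃ (a b : Fin n → UAlg A d R →ₐ[k⟦X⟧] UAlg A d R) (D : h →ₗ[k⟦X⟧] Module.End k⟦X⟧ (UAlg A d R)),
      IsTwistOps η R.Tpos (UAlg.torₗ A d R) (UAlg.E A d R) (UAlg.F A d R) a b D :=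
  FoMpQUEA.exists_isTwistOps (UAlg.isTopGen A d R)
    (fun x => ⟨((UAlg.isGenRel A d R).twistA hη x).lift, IsGenRel.lift_tor _, IsGenRel.lift_E _,
      IsGenRel.lift_F _⟩)
    (fun x => ⟨((UAlg.isGenRel A d R).twistB hη x).lift, IsGenRel.lift_tor _, IsGenRel.lift_E _,
      IsGenRel.lift_F _⟩)
    (fun c => ⟨((UAlg.isGenRel A d R).infinitesimal c).lift, IsGenRel.lift_tor _, IsGenRel.lift_E _,
      IsGenRel.lift_F _⟩)

end Scale

/-! ### The deformed algebra acts on the original one -/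

section Action

variable {k : Type*} [Field k] [CharZero k] {n : ℕ}
variable {h : Type*} [AddCommGroup h] [Module k⟦X⟧ h]
variable {A : Matrix (Fin n) (Fin n) ℤ} {d : Fin n → ℕ} {P P' : Matrix (Fin n) (Fin n) k⟦X⟧}
variable {R : Realization P h} {R' : Realization P' h}
variable {B : Type*} [Ring B] [Algebra k⟦X⟧ B] [IsAdicComplete (hIdeal k) B]
variable {τ : h →ₗ[k⟦X⟧] B} {e f : Fin n → B}
variable {η : h →ₗ[k⟦X⟧] h →ₗ[k⟦X⟧] k⟦X⟧}

variable (R R' η) in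
/-- `R'` is the deformation of `R` by the antisymmetric form `2 η`. -/
structure IsDeformation : Prop where
  Tpos_eq : R'.Tpos = R.Tpos
  Tneg_eq : R'.Tneg = R.Tneg
  α_eq : ∀ j T, R'.α j T = R.α j T + 2 * η T (R.Tpos j)
  antisymm : ∀ x y, η x y = -η y x
  right_Tneg : ∀ i x, η x (R.Tneg i) = -η x (R.Tpos i)

namespace IsDeformation

variable (hR : IsDeformation R R' η)

include hR

theorem symm : IsDeformation R' R (-η) where
  Tpos_eq := hR.Tpos_eq.symm
  Tneg_eq := hR.Tneg_eq.symm
  α_eq j T := by rw [hR.α_eq, hR.Tpos_eq]; simp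
  antisymm x y := by
    change -η x y = -(-η y x)
    rw [hR.antisymm x y]
  right_Tneg i x := by
    change -η x (R'.Tneg i) = -(-η x (R'.Tpos i))
    rw [hR.Tneg_eq, hR.Tpos_eq, hR.right_Tneg]

theorem P_eq (i j : Fin n) : P' i j = P i j + 2 * η (R.Tpos i) (R.Tpos j) := by
  rw [← R'.α_Tpos, hR.α_eq, hR.Tpos_eq, R.α_Tpos]

theorem self (x : h) : η x x = 0 := by
  have h1 := hR.antisymm x x
  linear_combination (C (2⁻¹ : k)) * h1 - η x x * C_half_mul_two (k := k)

theorem left_Tneg (i : Fin n) : η (R.Tneg i) = -η (R.Tpos i) := by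
  ext x : 1
  rw [hR.antisymm, hR.right_Tneg, neg_neg, LinearMap.neg_apply, ← hR.antisymm]

end IsDeformation

theorem hexp_apply_of_eq_zero {X' : Module.End k⟦X⟧ B} {y : B} (hX : X' y = 0) :
    hexp (k := k) X' y = y := by
  have := map_hSeries (LinearMap.applyₗ (R := k⟦X⟧) (M₂ := B) y)
    fun j => (C ((j.factorial : k)⁻¹) : k⟦X⟧) • X' ^ j
  refine this.trans ?_
  rw [hSeries_zero_tail]
  · simp
  · intro j
    simp [pow_succ, hX]

namespace IsTwistOps

variable {a b : Fin n → B →ₐ[k⟦X⟧] B} {D : h →ₗ[k⟦X⟧] Module.End k⟦X⟧ B} {Tp : Fin n → h}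
  (hO : IsTwistOps η Tp τ e f a b D)

theorem algHom_mul_lmul (φ : B →ₐ[k⟦X⟧] B) (x : B) :
    φ.toLinearMap * Algebra.lmul k⟦X⟧ B x = Algebra.lmul k⟦X⟧ B (φ x) * φ.toLinearMap := by
  ext y
  simp

include hO

theorem D_mul_lmul_tor (T T' : h) :
    D T * Algebra.lmul k⟦X⟧ B (τ T') = Algebra.lmul k⟦X⟧ B (τ T') * D T := by
  ext y
  simp [hO.D_tor]

theorem D_mul_lmul_E (T : h) (i : Fin n) : D T * Algebra.lmul k⟦X⟧ B (e i) =
    Algebra.lmul k⟦X⟧ B (e i) * (D T + algebraMap k⟦X⟧ _ (η T (Tp i))) := by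
  ext y
  simp [hO.D_E]

theorem D_mul_lmul_F (T : h) (i : Fin n) : D T * Algebra.lmul k⟦X⟧ B (f i) =
    Algebra.lmul k⟦X⟧ B (f i) * (D T + algebraMap k⟦X⟧ _ (-η T (Tp i))) := by
  ext y
  simp [hO.D_F, sub_eq_add_neg]

variable (hg : IsTopGen (k := k) τ e f)

include hg

theorem a_comm (i j : Fin n) : (a i).comp (a j) = (a j).comp (a i) :=
  hg.hom_ext (fun T => by simp [hO.a_tor, add_right_comm])
    (fun l => by simp [hO.a_E, smul_smul, mul_comm]) (fun l => by simp [hO.a_F])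

theorem b_comm (i j : Fin n) : (b i).comp (b j) = (b j).comp (b i) :=
  hg.hom_ext (fun T => by simp [hO.b_tor, sub_right_comm])
    (fun l => by simp [hO.b_E]) (fun l => by simp [hO.b_F, smul_smul, mul_comm])

theorem a_b_comm (i j : Fin n) : (a i).comp (b j) = (b j).comp (a i) :=
  hg.hom_ext (fun T => by simp [hO.a_tor, hO.b_tor, add_sub_right_comm])
    (fun l => by simp [hO.a_E, hO.b_E]) (fun l => by simp [hO.a_F, hO.b_F])

theorem D_comm (T T' : h) : D T * D T' = D T' * D T := by
  refine hg.linearMap_ext (by simp [hO.D_one]) (fun T'' x hx => ?_) (fun i x hx => ?_)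
    (fun i x hx => ?_) <;> rw [Module.End.mul_apply, Module.End.mul_apply] at hx ⊢
  · simp only [hO.D_tor, hx]
  · simp only [hO.D_E, map_add, map_smul, hx, smul_add, smul_smul, mul_comm (η T _)]
    abel_nf
  · simp only [hO.D_F, map_sub, map_smul, hx, smul_sub, smul_smul, mul_comm (η T _)]
    abel_nf

theorem D_scale_comm (T : h) (φ : B →ₐ[k⟦X⟧] B) {u v : Fin n → k⟦X⟧} {l : h → k⟦X⟧}
    (hT : ∀ T, φ (τ T) = τ T + algebraMap k⟦X⟧ B (l T)) (hE : ∀ i, φ (e i) = u i • e i)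
    (hF : ∀ i, φ (f i) = v i • f i) : D T * φ.toLinearMap = φ.toLinearMap * D T := by
  refine hg.linearMap_ext (by simp [hO.D_one]) (fun T'' x hx => ?_) (fun i x hx => ?_)
    (fun i x hx => ?_) <;> simp only [Module.End.mul_apply, AlgHom.toLinearMap_apply] at hx ⊢
  · simp only [map_mul, hO.D_tor, hT, add_mul, map_add, ← Algebra.smul_def, map_smul, hx]
  · simp only [map_mul, hO.D_E, hE, smul_mul_assoc, map_smul, hx, map_add]
  · simp only [map_mul, hO.D_F, hF, smul_mul_assoc, map_smul, hx, map_sub]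

theorem D_a_comm (T : h) (j : Fin n) : D T * (a j).toLinearMap = (a j).toLinearMap * D T :=
  hO.D_scale_comm hg T (a j) (v := fun _ => 1) (hO.a_tor j) (hO.a_E j) (by simp [hO.a_F])

theorem D_b_comm (T : h) (j : Fin n) : D T * (b j).toLinearMap = (b j).toLinearMap * D T :=
  hO.D_scale_comm hg T (b j) (u := fun _ => 1) (l := fun T => -η (Tp j) T)
    (by simp [hO.b_tor, sub_eq_add_neg]) (by simp [hO.b_E]) (hO.b_F j)

theorem hexp_D (j : Fin n) : hexp (k := k) (D (Tp j)) = (a j).toLinearMap * (b j).toLinearMap := by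
  refine hg.linearMap_ext ?_ (fun T'' x hx => ?_) (fun i x hx => ?_) (fun i x hx => ?_)
  · rw [hexp_apply_of_eq_zero (hO.D_one _)]
    simp
  · have h1 := LinearMap.congr_fun (hexp_mul_of_mul_eq (k := k) (hO.D_mul_lmul_tor (Tp j) T'')) x
    refine h1.trans ?_
    rw [Module.End.mul_apply, hx]
    simp [hO.a_tor, hO.b_tor]
  · have h1 := LinearMap.congr_fun (hexp_mul_of_mul_eq (k := k) (hO.D_mul_lmul_E (Tp j) i)) x
    refine h1.trans ?_
    rw [Module.End.mul_apply, hexp_add_algebraMap, LinearMap.smul_apply, hx]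
    simp [hO.a_E, hO.b_E]
  · have h1 := LinearMap.congr_fun (hexp_mul_of_mul_eq (k := k) (hO.D_mul_lmul_F (Tp j) i)) x
    refine h1.trans ?_
    rw [Module.End.mul_apply, hexp_add_algebraMap, LinearMap.smul_apply, hx]
    simp [hO.a_F, hO.b_F]

theorem D_eq_neg {T T' : h} (hT : η T = -η T') : D T = -D T' := by
  refine hg.linearMap_ext (by simp [hO.D_one]) (fun T'' x hx => ?_) (fun i x hx => ?_)
    (fun i x hx => ?_) <;> rw [LinearMap.neg_apply] at hx ⊢
  · rw [hO.D_tor, hO.D_tor, hx, mul_neg]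
  · rw [hO.D_E, hO.D_E, hx, hT, ← mul_neg, neg_add, LinearMap.neg_apply, neg_smul]
  · rw [hO.D_F, hO.D_F, hx, hT, ← mul_neg, neg_sub, LinearMap.neg_apply, neg_smul]
    congr 1
    abel

omit hg in
theorem lmul_tor_mul_a (T : h) (j : Fin n) :
    Algebra.lmul k⟦X⟧ B (τ T) * (a j).toLinearMap =
      (a j).toLinearMap * Algebra.lmul k⟦X⟧ B (τ T) - η (Tp j) T • (a j).toLinearMap := by
  rw [algHom_mul_lmul, hO.a_tor, map_add, add_mul, AlgHom.commutes, ← Algebra.smul_def,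
    add_sub_cancel_right]

omit hg in
theorem lmul_tor_mul_b (T : h) (j : Fin n) :
    Algebra.lmul k⟦X⟧ B (τ T) * (b j).toLinearMap =
      (b j).toLinearMap * Algebra.lmul k⟦X⟧ B (τ T) + η (Tp j) T • (b j).toLinearMap := by
  rw [algHom_mul_lmul, hO.b_tor, map_sub, sub_mul, AlgHom.commutes, ← Algebra.smul_def,
    sub_add_cancel]

omit hg in
theorem lmul_E_mul_a (i j : Fin n) : Algebra.lmul k⟦X⟧ B (e i) * (a j).toLinearMap =
    sexp k (-η (Tp j) (Tp i)) • ((a j).toLinearMap * Algebra.lmul k⟦X⟧ B (e i)) := by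
  rw [algHom_mul_lmul, hO.a_E, map_smul, smul_mul_assoc, smul_smul, sexp_neg_mul, one_smul]

omit hg in
theorem lmul_F_mul_b (i j : Fin n) : Algebra.lmul k⟦X⟧ B (f i) * (b j).toLinearMap =
    sexp k (η (Tp j) (Tp i)) • ((b j).toLinearMap * Algebra.lmul k⟦X⟧ B (f i)) := by
  rw [algHom_mul_lmul, hO.b_F, map_smul, smul_mul_assoc, smul_smul, sexp_mul_neg, one_smul]

omit hg in
theorem lmul_F_mul_a (i j : Fin n) : Algebra.lmul k⟦X⟧ B (f i) * (a j).toLinearMap =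
    (a j).toLinearMap * Algebra.lmul k⟦X⟧ B (f i) := by
  rw [algHom_mul_lmul, hO.a_F]

omit hg in
theorem lmul_E_mul_b (i j : Fin n) : Algebra.lmul k⟦X⟧ B (e i) * (b j).toLinearMap =
    (b j).toLinearMap * Algebra.lmul k⟦X⟧ B (e i) := by
  rw [algHom_mul_lmul, hO.b_E]

end IsTwistOps

namespace IsDeformation

variable {a b : Fin n → B →ₐ[k⟦X⟧] B} {D : h →ₗ[k⟦X⟧] Module.End k⟦X⟧ B}

/-- Twisting the generators by operators that rescale them. -/
theorem isGenRel_twist (hR : IsDeformation R R' η) (H : IsGenRel A d R τ e f) {a b : Fin n → B}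
    {D : h →ₗ[k⟦X⟧] B} (haa : ∀ i j, Commute (a i) (a j)) (hbb : ∀ i j, Commute (b i) (b j))
    (hab : ∀ i j, Commute (a i) (b j)) (hDa : ∀ T j, Commute (D T) (a j))
    (hDb : ∀ T j, Commute (D T) (b j)) (hDD : ∀ T T', Commute (D T) (D T'))
    (hDt : ∀ T T', Commute (D T) (τ T'))
    (hDe : ∀ T i, D T * e i = e i * D T + η T (R.Tpos i) • e i)
    (hDf : ∀ T i, D T * f i = f i * D T - η T (R.Tpos i) • f i)
    (hDneg : ∀ i, D (R.Tneg i) = -D (R.Tpos i))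
    (hDexp : ∀ i, hexp (k := k) (D (R.Tpos i)) = a i * b i)
    (hta : ∀ T j, τ T * a j = a j * τ T - η (R.Tpos j) T • a j)
    (htb : ∀ T j, τ T * b j = b j * τ T + η (R.Tpos j) T • b j)
    (hea : ∀ i j, e i * a j = sexp k (-η (R.Tpos j) (R.Tpos i)) • (a j * e i))
    (hfb : ∀ i j, f i * b j = sexp k (η (R.Tpos j) (R.Tpos i)) • (b j * f i))
    (hfa : ∀ i j, Commute (f i) (a j)) (heb : ∀ i j, Commute (e i) (b j)) :
    IsGenRel A d R' (τ + D) (fun j => a j * e j) (fun j => b j * f j) := by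
  have hEF (i j : Fin n) : a i * e i * (b j * f j) - b j * f j * (a i * e i) =
      a i * b j * (e i * f j - f j * e i) := by
    have e1 : a i * e i * (b j * f j) = a i * b j * (e i * f j) := by
      rw [mul_assoc, ← mul_assoc (e i), (heb i j).eq]
      simp only [mul_assoc]
    have e2 : b j * f j * (a i * e i) = a i * b j * (f j * e i) := by
      rw [mul_assoc, ← mul_assoc (f j), (hfa j i).eq, (hab i j).eq]
      simp only [mul_assoc]
    rw [e1, e2, mul_sub]
  constructor
  · intro T T'
    rw [LinearMap.add_apply, LinearMap.add_apply]
    simp only [add_mul, mul_add, H.comm T T', (hDD T T').eq, (hDt T T').eq, (hDt T' T).eq]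
    abel
  · intro T j
    have h1 : τ T * e j = e j * τ T + R.α j T • e j := sub_eq_iff_eq_add'.mp (H.tor_E T j)
    have h2 : τ T * (a j * e j) = a j * e j * τ T + (R.α j T + η T (R.Tpos j)) • (a j * e j) := by
      rw [← mul_assoc, hta, sub_mul, Algebra.smul_mul_assoc, mul_assoc, h1, mul_add, mul_smul_comm,
        hR.antisymm, neg_smul, add_smul, mul_assoc]
      abel
    have h3 : D T * (a j * e j) = a j * e j * D T + η T (R.Tpos j) • (a j * e j) := by
      rw [← mul_assoc, (hDa T j).eq, mul_assoc, hDe, mul_add, mul_smul_comm, mul_assoc]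
    rw [LinearMap.add_apply, add_mul, h2, h3, hR.α_eq, two_mul, mul_add]
    simp only [add_smul]
    abel
  · intro T j
    have h1 : τ T * f j = f j * τ T - R.α j T • f j := by
      rw [sub_eq_add_neg]
      exact sub_eq_iff_eq_add'.mp (H.tor_F T j)
    have h2 : τ T * (b j * f j) = b j * f j * τ T - (R.α j T + η T (R.Tpos j)) • (b j * f j) := by
      rw [← mul_assoc, htb, add_mul, Algebra.smul_mul_assoc, mul_assoc, h1, mul_sub, mul_smul_comm,
        hR.antisymm, neg_smul, add_smul, mul_assoc]
      abel
    have h3 : D T * (b j * f j) = b j * f j * D T - η T (R.Tpos j) • (b j * f j) := by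
      rw [← mul_assoc, (hDb T j).eq, mul_assoc, hDf, mul_sub, mul_smul_comm, mul_assoc]
    rw [LinearMap.add_apply, add_mul, h2, h3, hR.α_eq, two_mul, mul_add]
    simp only [add_smul]
    abel
  · intro i j hij
    rw [hEF, H.E_F_ne i j hij, mul_zero]
  · intro i
    rw [hEF, H.E_F i, hR.Tpos_eq, hR.Tneg_eq, LinearMap.add_apply, LinearMap.add_apply, hDneg, neg_add,
      neg_neg, hexpDiv_sub_hexpDiv (hDt _ _).symm (hDt _ _).symm.neg_left, sub_self, mul_zero, add_zero,
      ← hDexp, mul_smul_comm]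
    congr 1
    have h4 : Commute (D (R.Tpos i)) (hexpDiv (k := k) (τ (R.Tpos i)) -
        hexpDiv (k := k) (-τ (R.Tneg i))) :=
      (commute_hexpDiv_left (hDt _ _).symm).symm.sub_right
        (commute_hexpDiv_left (hDt _ _).symm.neg_left).symm
    exact (commute_hexp_left h4).eq
  · intro i j hij
    refine serre_twist (haa i j) (hea i i) (hea i j) (hea j i) ?_ (H.serre_E i j hij)
    rw [hR.P_eq, hR.P_eq, hR.antisymm (R.Tpos j)]
    linear_combination 2 * η (R.Tpos i) (R.Tpos j) * C_half_mul_two (k := k)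
  · intro i j hij
    refine serre_twist (hbb i j) (hfb i i) (hfb i j) (hfb j i) ?_ (H.serre_F i j hij)
    rw [hR.P_eq, hR.P_eq, hR.antisymm (R.Tpos j)]
    linear_combination -2 * η (R.Tpos i) (R.Tpos j) * C_half_mul_two (k := k)

/-- The deformed algebra acts on the original one. -/
theorem isGenRel_end (hR : IsDeformation R R' η) (H : IsGenRel A d R τ e f)
    (hg : IsTopGen (k := k) τ e f) (hO : IsTwistOps η R.Tpos τ e f a b D) :
    IsGenRel A d R' ((Algebra.lmul k⟦X⟧ B).toLinearMap ∘ₗ τ + D)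
      (fun j => (a j).toLinearMap * Algebra.lmul k⟦X⟧ B (e j))
      (fun j => (b j).toLinearMap * Algebra.lmul k⟦X⟧ B (f j)) :=
  hR.isGenRel_twist (H.map (Algebra.lmul k⟦X⟧ B))
    (fun i j => congrArg AlgHom.toLinearMap (hO.a_comm hg i j))
    (fun i j => congrArg AlgHom.toLinearMap (hO.b_comm hg i j))
    (fun i j => congrArg AlgHom.toLinearMap (hO.a_b_comm hg i j))
    (hO.D_a_comm hg) (hO.D_b_comm hg) (hO.D_comm hg) hO.D_mul_lmul_tor
    (fun T i => by ext y; simp [hO.D_E, mul_add]) (fun T i => by ext y; simp [hO.D_F, mul_sub])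
    (fun i => hO.D_eq_neg hg (hR.left_Tneg i)) (hO.hexp_D hg) hO.lmul_tor_mul_a hO.lmul_tor_mul_b
    hO.lmul_E_mul_a hO.lmul_F_mul_b hO.lmul_F_mul_a hO.lmul_E_mul_b

end IsDeformation
end Action

/-! ### The comparison map -/

section Comparison

variable {k : Type*} [Field k] [CharZero k] {n : ℕ}
variable {h : Type*} [AddCommGroup h] [Module k⟦X⟧ h]
variable {A : Matrix (Fin n) (Fin n) ℤ} {d : Fin n → ℕ} {P P' : Matrix (Fin n) (Fin n) k⟦X⟧}
variable {R : Realization P h} {R' : Realization P' h}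
variable {B : Type*} [Ring B] [Algebra k⟦X⟧ B] [IsAdicComplete (hIdeal k) B]
variable {B' : Type*} [Ring B'] [Algebra k⟦X⟧ B'] [IsAdicComplete (hIdeal k) B']
variable {τ : h →ₗ[k⟦X⟧] B} {e f : Fin n → B} {τ' : h →ₗ[k⟦X⟧] B'} {e' f' : Fin n → B'}
variable {a b : Fin n → B →ₐ[k⟦X⟧] B} {D : h →ₗ[k⟦X⟧] Module.End k⟦X⟧ B}
variable {a' b' : Fin n → B' →ₐ[k⟦X⟧] B'} {D' : h →ₗ[k⟦X⟧] Module.End k⟦X⟧ B'}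
variable {η : h →ₗ[k⟦X⟧] h →ₗ[k⟦X⟧] k⟦X⟧} {Tp : Fin n → h}

/-- The map from the deformed algebra to the original one that is given by the action on `1`. -/
structure IsTwistMap (τ' : h →ₗ[k⟦X⟧] B') (e' f' : Fin n → B') (τ : h →ₗ[k⟦X⟧] B) (e f : Fin n → B)
    (a b : Fin n → B →ₐ[k⟦X⟧] B) (D : h →ₗ[k⟦X⟧] Module.End k⟦X⟧ B) (ψ : B' →ₗ[k⟦X⟧] B) : Prop where
  map_one : ψ 1 = 1
  map_tor : ∀ T y, ψ (τ' T * y) = τ T * ψ y + D T (ψ y)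
  map_E : ∀ j y, ψ (e' j * y) = a j (e j * ψ y)
  map_F : ∀ j y, ψ (f' j * y) = b j (f j * ψ y)

theorem IsDeformation.exists_isTwistMap (hR : IsDeformation R R' η) (H : IsGenRel A d R τ e f)
    (hg : IsTopGen (k := k) τ e f) (hO : IsTwistOps η R.Tpos τ e f a b D) :
    ∃ ψ, IsTwistMap (UAlg.torₗ A d R') (UAlg.E A d R') (UAlg.F A d R') τ e f a b D ψ := by
  let ρ := (hR.isGenRel_end H hg hO).lift
  refine ⟨LinearMap.applyₗ (R := k⟦X⟧) (M₂ := B) 1 ∘ₗ ρ.toLinearMap, ?_, fun T y => ?_,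
    fun j y => ?_, fun j y => ?_⟩
  · change ρ 1 1 = 1
    rw [map_one ρ, Module.End.one_apply]
  · change ρ (UAlg.tor A d R' T * y) 1 = _
    rw [map_mul, IsGenRel.lift_tor]
    rfl
  · change ρ (UAlg.E A d R' j * y) 1 = _
    rw [map_mul, IsGenRel.lift_E]
    rfl
  · change ρ (UAlg.F A d R' j * y) 1 = _
    rw [map_mul, IsGenRel.lift_F]
    rfl

namespace IsTwistMap

variable {ψ : B' →ₗ[k⟦X⟧] B} {φ : B →ₗ[k⟦X⟧] B'}
variable (hφ : IsTwistMap τ e f τ' e' f' a' b' D' φ) (hg : IsTopGen (k := k) τ e f)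
  (hg' : IsTopGen (k := k) τ' e' f') (hO : IsTwistOps η Tp τ e f a b D)
  (hO' : IsTwistOps (-η) Tp τ' e' f' a' b' D')

include hφ hg hg' hO hO'

theorem comp_D (T : h) : φ ∘ₗ D T = -(D' T ∘ₗ φ) := by
  refine hg.linearMap_ext ?_ (fun T' x hx => ?_) (fun i x hx => ?_) (fun i x hx => ?_)
  · simp [hO.D_one, hO'.D_one, hφ.map_one]
  all_goals rw [LinearMap.neg_apply, LinearMap.comp_apply, LinearMap.comp_apply] at hx ⊢
  · have h1 := LinearMap.congr_fun (hO'.D_comm hg' T T') (φ x)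
    simp only [Module.End.mul_apply] at h1
    rw [hO.D_tor, hφ.map_tor, hφ.map_tor, hx, map_neg, map_add, hO'.D_tor, h1]
    simp only [mul_neg]
    abel
  · have h1 := LinearMap.congr_fun (hO'.D_a_comm hg' T i) (e' i * φ x)
    simp only [Module.End.mul_apply, AlgHom.toLinearMap_apply] at h1
    rw [hO.D_E, hφ.map_E, hφ.map_E, h1, hO'.D_E, map_add, hx, map_smul]
    simp only [LinearMap.neg_apply, neg_smul, mul_add, mul_neg, map_add, map_neg]
    abel
  · have h1 := LinearMap.congr_fun (hO'.D_b_comm hg' T i) (f' i * φ x)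
    simp only [Module.End.mul_apply, AlgHom.toLinearMap_apply] at h1
    rw [hO.D_F, hφ.map_F, hφ.map_F, h1, hO'.D_F, map_sub, hx, map_smul]
    simp only [LinearMap.neg_apply, neg_smul, mul_sub, mul_neg, map_sub, map_neg]
    abel

theorem comp_a (j : Fin n) : (a' j).toLinearMap ∘ₗ φ ∘ₗ (a j).toLinearMap = φ := by
  refine hg.linearMap_ext ?_ (fun T x hx => ?_) (fun i x hx => ?_) (fun i x hx => ?_)
  · simp [hφ.map_one]
  all_goals simp only [LinearMap.comp_apply, AlgHom.toLinearMap_apply] at hx ⊢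
  · have h1 := LinearMap.congr_fun (hO'.D_a_comm hg' T j) (φ (a j x))
    simp only [Module.End.mul_apply, AlgHom.toLinearMap_apply] at h1
    simp only [map_mul, hO.a_tor, add_mul, map_add, ← Algebra.smul_def, map_smul, hφ.map_tor, ← h1, hx,
      hO'.a_tor]
    simp
    abel
  · have h1 := DFunLike.congr_fun (hO'.a_comm hg' j i) (e' i * φ (a j x))
    simp only [AlgHom.comp_apply] at h1
    simp only [map_mul (a j), hO.a_E, smul_mul_assoc, map_smul, hφ.map_E, h1]
    rw [map_mul (a' j), hO'.a_E, hx, smul_mul_assoc, map_smul, smul_smul, LinearMap.neg_apply,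
      LinearMap.neg_apply, sexp_mul_neg, one_smul]
  · have h1 := DFunLike.congr_fun (hO'.a_b_comm hg' j i) (f' i * φ (a j x))
    simp only [AlgHom.comp_apply] at h1
    simp only [map_mul (a j), hO.a_F, hφ.map_F, h1]
    rw [map_mul (a' j), hO'.a_F, hx]

theorem comp_b (j : Fin n) : (b' j).toLinearMap ∘ₗ φ ∘ₗ (b j).toLinearMap = φ := by
  refine hg.linearMap_ext ?_ (fun T x hx => ?_) (fun i x hx => ?_) (fun i x hx => ?_)
  · simp [hφ.map_one]
  all_goals simp only [LinearMap.comp_apply, AlgHom.toLinearMap_apply] at hx ⊢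
  · have h1 := LinearMap.congr_fun (hO'.D_b_comm hg' T j) (φ (b j x))
    simp only [Module.End.mul_apply, AlgHom.toLinearMap_apply] at h1
    simp only [map_mul, hO.b_tor, sub_mul, map_sub, ← Algebra.smul_def, map_smul, hφ.map_tor, map_add,
      ← h1, hx, hO'.b_tor]
    simp
    abel
  · have h1 := DFunLike.congr_fun (hO'.a_b_comm hg' i j) (e' i * φ (b j x))
    simp only [AlgHom.comp_apply] at h1
    simp only [map_mul (b j), hO.b_E, hφ.map_E, ← h1]
    rw [map_mul (b' j), hO'.b_E, hx]
  · have h1 := DFunLike.congr_fun (hO'.b_comm hg' j i) (f' i * φ (b j x))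
    simp only [AlgHom.comp_apply] at h1
    simp only [map_mul (b j), hO.b_F, smul_mul_assoc, map_smul, hφ.map_F, h1]
    rw [map_mul (b' j), hO'.b_F, hx, smul_mul_assoc, map_smul, smul_smul, LinearMap.neg_apply,
      LinearMap.neg_apply, neg_neg, sexp_neg_mul, one_smul]

theorem comp_eq_id (hη : ∀ T, η T T = 0) (hψ : IsTwistMap τ' e' f' τ e f a b D ψ) :
    φ ∘ₗ ψ = LinearMap.id := by
  refine hg'.linearMap_ext ?_ (fun T x hx => ?_) (fun i x hx => ?_) (fun i x hx => ?_)
  · simp [hφ.map_one, hψ.map_one]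
  all_goals simp only [LinearMap.comp_apply, LinearMap.id_apply] at hx ⊢
  · have h1 := LinearMap.congr_fun (hφ.comp_D hg hg' hO hO' T) (ψ x)
    simp only [LinearMap.comp_apply, LinearMap.neg_apply] at h1
    rw [hψ.map_tor, map_add, hφ.map_tor, h1, hx]
    abel
  · have h1 := LinearMap.congr_fun (hφ.comp_a hg hg' hO hO' i) (ψ x)
    simp only [LinearMap.comp_apply, AlgHom.toLinearMap_apply] at h1
    have h0 : sexp k 0 = 1 := hexp_zero
    rw [hψ.map_E, map_mul, hO.a_E, hη, h0, one_smul, hφ.map_E, map_mul, hO'.a_E, LinearMap.neg_apply,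
      LinearMap.neg_apply, hη, neg_zero, h0, one_smul, h1, hx]
  · have h1 := LinearMap.congr_fun (hφ.comp_b hg hg' hO hO' i) (ψ x)
    simp only [LinearMap.comp_apply, AlgHom.toLinearMap_apply] at h1
    have h0 : sexp k 0 = 1 := hexp_zero
    rw [hψ.map_F, map_mul, hO.b_F, hη, neg_zero, h0, one_smul, hφ.map_F, map_mul, hO'.b_F,
      LinearMap.neg_apply, LinearMap.neg_apply, hη, neg_zero, neg_zero, h0, one_smul, h1, hx]

end IsTwistMap

/-! ### Compatibility with the coproducts -/

theorem hexp_intertwine {M N : Type*} [AddCommGroup M] [Module k⟦X⟧ M] [AddCommGroup N]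
    [Module k⟦X⟧ N] [IsAdicComplete (hIdeal k) M] [IsAdicComplete (hIdeal k) N] {ψ : M →ₗ[k⟦X⟧] N}
    {X' : Module.End k⟦X⟧ M} {Y : Module.End k⟦X⟧ N} (hXY : ∀ x, ψ (X' x) = Y (ψ x)) (x : M) :
    ψ (hexp (k := k) X' x) = hexp (k := k) Y (ψ x) := by
  have h1 := map_hSeries (ψ ∘ₗ LinearMap.applyₗ (R := k⟦X⟧) (M₂ := M) x)
    fun j => (C ((j.factorial : k)⁻¹) : k⟦X⟧) • X' ^ j
  have h2 := map_hSeries (LinearMap.applyₗ (R := k⟦X⟧) (M₂ := N) (ψ x))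
    fun j => (C ((j.factorial : k)⁻¹) : k⟦X⟧) • Y ^ j
  refine h1.trans (Eq.trans ?_ h2.symm)
  congr 1
  funext j
  have h3 (j : ℕ) : ψ ((X' ^ j) x) = (Y ^ j) (ψ x) := by
    induction j with
    | zero => rfl
    | succ j ih => rw [pow_succ', pow_succ', Module.End.mul_apply, Module.End.mul_apply, hXY, ih]
  simp [h3]

namespace IsTwistOps

variable (hO : IsTwistOps η R.Tpos τ e f a b D)

include hO

theorem a_hexp (j : Fin n) (T : h) :
    a j (hexp (k := k) (τ T)) = sexp k (η (R.Tpos j) T) • hexp (k := k) (τ T) := by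
  rw [map_hexp, hO.a_tor, hexp_add_algebraMap]

theorem b_hexp (j : Fin n) (T : h) :
    b j (hexp (k := k) (τ T)) = sexp k (-η (R.Tpos j) T) • hexp (k := k) (τ T) := by
  rw [map_hexp, hO.b_tor, sub_eq_add_neg, ← map_neg, hexp_add_algebraMap]

theorem D_hexp_mul (T T' : h) (x : B) :
    D T (hexp (k := k) (τ T') * x) = hexp (k := k) (τ T') * D T x := by
  have h1 : Commute (Algebra.lmul k⟦X⟧ B (τ T')) (D T) := (hO.D_mul_lmul_tor T T').symm
  have h2 := LinearMap.congr_fun (commute_hexp_left (k := k) h1).eq x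
  rw [← map_hexp] at h2
  exact h2.symm

end IsTwistOps

namespace IsStdHopf

variable {Δ : B →ₐ[k⟦X⟧] HatTensor k B B} {ε : B →ₐ[k⟦X⟧] k⟦X⟧} {S : B →ₐ[k⟦X⟧] Bᵐᵒᵖ}
  (H : IsStdHopf R τ e f Δ ε S) (hO : IsTwistOps η R.Tpos τ e f a b D)
  (hη : ∀ i x, η x (R.Tneg i) = -η x (R.Tpos i))

include H hO

theorem comul_a (j : Fin n) (x : B) : Δ (a j x) =
    hatMapAlg (Algebra.TensorProduct.map (a j) (AlgHom.id k⟦X⟧ B)) (Δ x) := by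
  have : Δ.comp (a j) = (hatMapAlg (Algebra.TensorProduct.map (a j) (AlgHom.id k⟦X⟧ B))).comp Δ := by
    refine H.gen.hom_ext (fun T => ?_) (fun i => ?_) (fun i => ?_) <;> simp only [AlgHom.comp_apply]
    · rw [hO.a_tor, map_add, AlgHom.commutes, H.comul_tor, hatMapAlg_toHat]
      simp [hO.a_tor, TensorProduct.add_tmul, Algebra.algebraMap_eq_smul_one, hat_tensor_one]
      abel
    · rw [hO.a_E, map_smul, H.comul_E, hatMapAlg_toHat]
      simp [hO.a_E, hO.a_hexp, ← TensorProduct.smul_tmul']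
    · rw [hO.a_F, H.comul_F, hatMapAlg_toHat]
      simp [hO.a_F]
  exact DFunLike.congr_fun this x

include hη

theorem comul_b (j : Fin n) (x : B) : Δ (b j x) =
    hatMapAlg (Algebra.TensorProduct.map (AlgHom.id k⟦X⟧ B) (b j)) (Δ x) := by
  have : Δ.comp (b j) = (hatMapAlg (Algebra.TensorProduct.map (AlgHom.id k⟦X⟧ B) (b j))).comp Δ := by
    refine H.gen.hom_ext (fun T => ?_) (fun i => ?_) (fun i => ?_) <;> simp only [AlgHom.comp_apply]
    · rw [hO.b_tor, map_sub, AlgHom.commutes, H.comul_tor, hatMapAlg_toHat]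
      simp [hO.b_tor, TensorProduct.tmul_sub, Algebra.algebraMap_eq_smul_one, hat_tensor_one]
      abel
    · rw [hO.b_E, H.comul_E, hatMapAlg_toHat]
      simp [hO.b_E]
    · have h1 := hO.b_hexp j (-R.Tneg i)
      rw [map_neg, map_neg, hη, neg_neg] at h1
      rw [hO.b_F, map_smul, H.comul_F, hatMapAlg_toHat]
      simp [hO.b_F, h1, TensorProduct.tmul_smul]
  exact DFunLike.congr_fun this x

theorem comul_ba (j : Fin n) (x : B) :
    hatMapAlg (Algebra.TensorProduct.map (b j) (a j)) (Δ x) = Δ x := by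
  have : (hatMapAlg (Algebra.TensorProduct.map (b j) (a j))).comp Δ = Δ := by
    refine H.gen.hom_ext (fun T => ?_) (fun i => ?_) (fun i => ?_) <;> simp only [AlgHom.comp_apply]
    · rw [H.comul_tor, hatMapAlg_toHat]
      simp [hO.b_tor, hO.a_tor, TensorProduct.tmul_add, TensorProduct.sub_tmul,
        Algebra.algebraMap_eq_smul_one, TensorProduct.smul_tmul']
    · rw [H.comul_E, hatMapAlg_toHat]
      simp [hO.b_E, hO.a_E, hO.b_hexp, TensorProduct.smul_tmul', TensorProduct.tmul_smul, smul_smul,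
        sexp_mul_neg]
    · have h1 := hO.a_hexp j (-R.Tneg i)
      rw [map_neg, map_neg, hη, neg_neg] at h1
      rw [H.comul_F, hatMapAlg_toHat]
      simp [hO.b_F, hO.a_F, h1, TensorProduct.smul_tmul', TensorProduct.tmul_smul, smul_smul,
        sexp_mul_neg]
  exact DFunLike.congr_fun this x

end IsStdHopf

end Comparison

section Comparison

variable {k : Type*} [Field k] [CharZero k] {n : ℕ}
variable {h : Type*} [AddCommGroup h] [Module k⟦X⟧ h]
variable {A : Matrix (Fin n) (Fin n) ℤ} {d : Fin n → ℕ} {P P' : Matrix (Fin n) (Fin n) k⟦X⟧}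
variable {R : Realization P h} {R' : Realization P' h}
variable {B : Type*} [Ring B] [Algebra k⟦X⟧ B] [IsAdicComplete (hIdeal k) B]
variable {B' : Type*} [Ring B'] [Algebra k⟦X⟧ B'] [IsAdicComplete (hIdeal k) B']
variable {τ : h →ₗ[k⟦X⟧] B} {e f : Fin n → B} {τ' : h →ₗ[k⟦X⟧] B'} {e' f' : Fin n → B'}
variable {a b : Fin n → B →ₐ[k⟦X⟧] B} {D : h →ₗ[k⟦X⟧] Module.End k⟦X⟧ B}
variable {a' b' : Fin n → B' →ₐ[k⟦X⟧] B'} {D' : h →ₗ[k⟦X⟧] Module.End k⟦X⟧ B'}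
variable {η : h →ₗ[k⟦X⟧] h →ₗ[k⟦X⟧] k⟦X⟧} {Tp : Fin n → h}
variable {Δ : B →ₐ[k⟦X⟧] HatTensor k B B} {ε : B →ₐ[k⟦X⟧] k⟦X⟧} {S : B →ₐ[k⟦X⟧] Bᵐᵒᵖ}
variable {Δ' : B' →ₐ[k⟦X⟧] HatTensor k B' B'} {ε' : B' →ₐ[k⟦X⟧] k⟦X⟧} {S' : B' →ₐ[k⟦X⟧] B'ᵐᵒᵖ}

/-- The extension to `B ⊗̂ B` of a derivation of `B`. -/
def hatDeriv (D : Module.End k⟦X⟧ B) : Module.End k⟦X⟧ (HatTensor k B B) :=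
  hatMap (TensorProduct.map D LinearMap.id) + hatMap (TensorProduct.map LinearMap.id D)

theorem hatDeriv_toHat (D : Module.End k⟦X⟧ B) (x y : B) :
    hatDeriv D (toHat (k := k) (x ⊗ₜ[k⟦X⟧] y)) = toHat (k := k) (D x ⊗ₜ[k⟦X⟧] y + x ⊗ₜ[k⟦X⟧] D y) := rfl

/-- Two linear maps on `B ⊗̂ B` that agree on the tensors `x ⊗ y` agree. -/
theorem hatTensor_ext {M : Type*} [AddCommGroup M] [Module k⟦X⟧ M] [IsHausdorff (hIdeal k) M]
    {f g : HatTensor k B B →ₗ[k⟦X⟧] M}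
    (hfg : ∀ x y, f (toHat (k := k) (x ⊗ₜ[k⟦X⟧] y)) = g (toHat (k := k) (x ⊗ₜ[k⟦X⟧] y))) : f = g := by
  refine hat_ext fun u => ?_
  induction u using TensorProduct.induction_on with
  | zero => simp
  | tmul x y => exact hfg x y
  | add x y hx hy => simp only [map_add, hx, hy]

theorem hatDeriv_mul {D : Module.End k⟦X⟧ B} {x₁ x₂ y₁ y₂ : B} {c₁ c₂ c₁' c₂' c : k⟦X⟧}
    (h1 : ∀ x, D (x₁ * x) = x₁ * (D x + c₁ • x)) (h2 : ∀ x, D (x₂ * x) = x₂ * (D x + c₂ • x))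
    (h1' : ∀ x, D (y₁ * x) = y₁ * (D x + c₁' • x)) (h2' : ∀ x, D (y₂ * x) = y₂ * (D x + c₂' • x))
    (hc : c₁ + c₁' = c) (hc' : c₂ + c₂' = c) (u : HatTensor k B B) :
    hatDeriv D (toHat (k := k) (x₁ ⊗ₜ[k⟦X⟧] y₁ + x₂ ⊗ₜ[k⟦X⟧] y₂) * u) =
      toHat (k := k) (x₁ ⊗ₜ[k⟦X⟧] y₁ + x₂ ⊗ₜ[k⟦X⟧] y₂) * (hatDeriv D u + c • u) := by
  have h3 {x y : B} {c₁ c₂ : k⟦X⟧} (h1 : ∀ z, D (x * z) = x * (D z + c₁ • z))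
      (h2 : ∀ z, D (y * z) = y * (D z + c₂ • z)) (hc : c₁ + c₂ = c) :
      hatDeriv D ∘ₗ LinearMap.mulLeft k⟦X⟧ (toHat (k := k) (x ⊗ₜ[k⟦X⟧] y) : HatTensor k B B) =
      LinearMap.mulLeft k⟦X⟧ (toHat (k := k) (x ⊗ₜ[k⟦X⟧] y) : HatTensor k B B) ∘ₗ
        (hatDeriv D + c • LinearMap.id) := by
    refine hatTensor_ext fun z w => ?_
    rw [LinearMap.comp_apply, LinearMap.comp_apply, LinearMap.mulLeft_apply, LinearMap.mulLeft_apply,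
      toHat_mul, Algebra.TensorProduct.tmul_mul_tmul, hatDeriv_toHat, LinearMap.add_apply,
      hatDeriv_toHat, LinearMap.smul_apply, LinearMap.id_apply, ← map_smul, ← map_add, toHat_mul, h1, h2,
      ← hc]
    congr 1
    simp only [mul_add, TensorProduct.add_tmul, TensorProduct.tmul_add, add_smul,
      Algebra.TensorProduct.tmul_mul_tmul, mul_smul_comm, TensorProduct.tmul_smul,
      TensorProduct.smul_tmul']
    abel
  rw [map_add, add_mul, map_add, add_mul]
  exact congrArg₂ (· + ·) (LinearMap.congr_fun (h3 h1 h1' hc) u) (LinearMap.congr_fun (h3 h2 h2' hc') u)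

theorem IsStdHopf.comul_D (H : IsStdHopf R τ e f Δ ε S) (hO : IsTwistOps η R.Tpos τ e f a b D) (T : h)
    (x : B) : Δ (D T x) = hatDeriv (D T) (Δ x) := by
  have h0 (x : B) : D T (1 * x) = 1 * (D T x + (0 : k⟦X⟧) • x) := by simp
  have h1 (T' : h) (x : B) : D T (τ T' * x) = τ T' * (D T x + (0 : k⟦X⟧) • x) := by simp [hO.D_tor]
  have h2 (T' : h) (x : B) : D T (hexp (k := k) (τ T') * x) =
    hexp (k := k) (τ T') * (D T x + (0 : k⟦X⟧) • x) := by simp [hO.D_hexp_mul]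
  have h3 : Δ.toLinearMap ∘ₗ D T = hatDeriv (D T) ∘ₗ Δ.toLinearMap := by
    refine H.gen.linearMap_ext ?_ (fun T' x hx => ?_) (fun i x hx => ?_) (fun i x hx => ?_)
    · simp only [LinearMap.comp_apply, AlgHom.toLinearMap_apply]
      rw [hO.D_one, map_zero, comul_one, hatDeriv_toHat]
      simp [hO.D_one]
    all_goals simp only [LinearMap.comp_apply, AlgHom.toLinearMap_apply] at hx ⊢
    · rw [hO.D_tor, map_mul, map_mul, H.comul_tor,
        hatDeriv_mul (h1 T') h0 h0 (h1 T') (zero_add 0) (zero_add 0), hx, zero_smul, add_zero]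
    · rw [hO.D_E, map_mul, map_mul, H.comul_E, map_add Δ, map_smul Δ,
        hatDeriv_mul (hO.D_E T i) (h2 _) h0 (hO.D_E T i) (add_zero _) (zero_add _), hx]
    · have h4 := h2 (-R.Tneg i)
      have h5 (x : B) : D T (f i * x) = f i * (D T x + (-η T (R.Tpos i)) • x) := by
        rw [hO.D_F, sub_eq_add_neg, neg_smul]
      rw [map_neg] at h4
      rw [h5, map_mul, map_mul, H.comul_F, map_add Δ, map_smul Δ,
        hatDeriv_mul h5 h0 h4 h5 (add_zero _) (zero_add _), hx]
  exact LinearMap.congr_fun h3 x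

theorem IsStdHopf.counit_D (H : IsStdHopf R τ e f Δ ε S) (hO : IsTwistOps η R.Tpos τ e f a b D) (T : h)
    (x : B) : ε (D T x) = 0 := by
  have h3 : ε.toLinearMap ∘ₗ D T = 0 := by
    refine H.gen.linearMap_ext ?_ (fun T' x hx => ?_) (fun i x hx => ?_) (fun i x hx => ?_) <;>
      simp only [LinearMap.comp_apply, AlgHom.toLinearMap_apply]
    · simp [hO.D_one]
    · rw [hO.D_tor, map_mul, H.counit_tor, zero_mul, LinearMap.zero_apply]
    · rw [hO.D_E, map_mul, H.counit_E, zero_mul, LinearMap.zero_apply]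
    · rw [hO.D_F, map_mul, H.counit_F, zero_mul, LinearMap.zero_apply]
  exact LinearMap.congr_fun h3 x

namespace IsTwistMap

variable {ψ : B' →ₗ[k⟦X⟧] B} (hψ : IsTwistMap τ' e' f' τ e f a b D ψ)
  (H : IsStdHopf R τ e f Δ ε S) (hO : IsTwistOps η R.Tpos τ e f a b D)

include hψ H hO

theorem map_hexp_mul {T : h} {j : Fin n} (hT : D T = D (R.Tpos j)) (y : B') :
    ψ (hexp (k := k) (τ' T) * y) = hexp (k := k) (τ T) * a j (b j (ψ y)) := by
  have h1 := hexp_intertwine (X' := Algebra.lmul k⟦X⟧ B' (τ' T))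
    (Y := Algebra.lmul k⟦X⟧ B (τ T) + D T) (ψ := ψ) (hψ.map_tor T) y
  have h2 : Commute (Algebra.lmul k⟦X⟧ B (τ T)) (D T) := (hO.D_mul_lmul_tor T T).symm
  rw [hexp_add h2, ← map_hexp, ← map_hexp, hT, hO.hexp_D H.gen] at h1
  exact h1

theorem map_comul_E_mul (hη : ∀ T, η T T = 0) (j : Fin n) (u : HatTensor k B' B') :
    hatMap (TensorProduct.map ψ ψ) (toHat (k := k) (e' j ⊗ₜ[k⟦X⟧] (1 : B') +
      hexp (k := k) (τ' (R.Tpos j)) ⊗ₜ[k⟦X⟧] e' j) * u) =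
    toHat (k := k) (e j ⊗ₜ[k⟦X⟧] (1 : B)) * hatMapAlg
      (Algebra.TensorProduct.map (a j) (AlgHom.id k⟦X⟧ B)) (hatMap (TensorProduct.map ψ ψ) u) +
    toHat (k := k) (hexp (k := k) (τ (R.Tpos j)) ⊗ₜ[k⟦X⟧] e j) * hatMapAlg
      (Algebra.TensorProduct.map (a j) (AlgHom.id k⟦X⟧ B)) (hatMapAlg
        (Algebra.TensorProduct.map (b j) (a j)) (hatMap (TensorProduct.map ψ ψ) u)) := by
  have h0 : sexp k 0 = 1 := hexp_zero
  have h1 : a j (e j) = e j := by rw [hO.a_E, hη, h0, one_smul]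
  refine LinearMap.congr_fun (f := hatMap (TensorProduct.map ψ ψ) ∘ₗ LinearMap.mulLeft k⟦X⟧ _)
    (g := LinearMap.mulLeft k⟦X⟧ _ ∘ₗ (hatMapAlg (Algebra.TensorProduct.map (a j) (AlgHom.id k⟦X⟧ B))).toLinearMap ∘ₗ
      hatMap (TensorProduct.map ψ ψ) +
      LinearMap.mulLeft k⟦X⟧ _ ∘ₗ (hatMapAlg (Algebra.TensorProduct.map (a j) (AlgHom.id k⟦X⟧ B))).toLinearMap ∘ₗ
        (hatMapAlg (Algebra.TensorProduct.map (b j) (a j))).toLinearMap ∘ₗ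
        hatMap (TensorProduct.map ψ ψ)) (hatTensor_ext fun x y => ?_) u
  simp only [LinearMap.comp_apply, LinearMap.add_apply, LinearMap.mulLeft_apply,
    AlgHom.toLinearMap_apply, hatMap_toHat, hatMapAlg_toHat, TensorProduct.map_tmul,
    Algebra.TensorProduct.map_tmul, toHat_mul, add_mul, Algebra.TensorProduct.tmul_mul_tmul, map_add,
    hψ.map_E, one_mul, map_mul, h1, AlgHom.id_apply, hψ.map_hexp_mul H hO (j := j) rfl]

theorem map_comul_F_mul (hη : ∀ T, η T T = 0) {j : Fin n} (hD : D (R.Tneg j) = -D (R.Tpos j))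
    (u : HatTensor k B' B') :
    hatMap (TensorProduct.map ψ ψ) (toHat (k := k) (f' j ⊗ₜ[k⟦X⟧] hexp (k := k) (-τ' (R.Tneg j)) +
      (1 : B') ⊗ₜ[k⟦X⟧] f' j) * u) =
    toHat (k := k) (f j ⊗ₜ[k⟦X⟧] hexp (k := k) (-τ (R.Tneg j))) * hatMapAlg
      (Algebra.TensorProduct.map (AlgHom.id k⟦X⟧ B) (b j)) (hatMapAlg
        (Algebra.TensorProduct.map (b j) (a j)) (hatMap (TensorProduct.map ψ ψ) u)) +
    toHat (k := k) ((1 : B) ⊗ₜ[k⟦X⟧] f j) * hatMapAlg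
      (Algebra.TensorProduct.map (AlgHom.id k⟦X⟧ B) (b j)) (hatMap (TensorProduct.map ψ ψ) u) := by
  have h0 : sexp k 0 = 1 := hexp_zero
  have h1 : b j (f j) = f j := by rw [hO.b_F, hη, neg_zero, h0, one_smul]
  have h2 (y : B') := hψ.map_hexp_mul H hO (j := j) (T := -R.Tneg j) (by rw [map_neg, hD, neg_neg]) y
  have h3 (z : B) : a j (b j z) = b j (a j z) := DFunLike.congr_fun (hO.a_b_comm H.gen j j) z
  simp only [map_neg] at h2
  refine LinearMap.congr_fun (f := hatMap (TensorProduct.map ψ ψ) ∘ₗ LinearMap.mulLeft k⟦X⟧ _)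
    (g := LinearMap.mulLeft k⟦X⟧ _ ∘ₗ (hatMapAlg (Algebra.TensorProduct.map (AlgHom.id k⟦X⟧ B) (b j))).toLinearMap ∘ₗ
        (hatMapAlg (Algebra.TensorProduct.map (b j) (a j))).toLinearMap ∘ₗ
        hatMap (TensorProduct.map ψ ψ) +
      LinearMap.mulLeft k⟦X⟧ _ ∘ₗ (hatMapAlg (Algebra.TensorProduct.map (AlgHom.id k⟦X⟧ B) (b j))).toLinearMap ∘ₗ
      hatMap (TensorProduct.map ψ ψ))
    (hatTensor_ext fun x y => ?_) u
  simp only [LinearMap.comp_apply, LinearMap.add_apply, LinearMap.mulLeft_apply,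
    AlgHom.toLinearMap_apply, hatMap_toHat, hatMapAlg_toHat, TensorProduct.map_tmul,
    Algebra.TensorProduct.map_tmul, toHat_mul, add_mul, Algebra.TensorProduct.tmul_mul_tmul, map_add,
    hψ.map_F, one_mul, map_mul, h1, AlgHom.id_apply, h2, h3]

theorem map_comul_tor_mul (T : h) (u : HatTensor k B' B') :
    hatMap (TensorProduct.map ψ ψ) (toHat (k := k) (τ' T ⊗ₜ[k⟦X⟧] (1 : B') +
      (1 : B') ⊗ₜ[k⟦X⟧] τ' T) * u) =
    toHat (k := k) (τ T ⊗ₜ[k⟦X⟧] (1 : B) + (1 : B) ⊗ₜ[k⟦X⟧] τ T) *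
      hatMap (TensorProduct.map ψ ψ) u + hatDeriv (D T) (hatMap (TensorProduct.map ψ ψ) u) := by
  refine LinearMap.congr_fun (f := hatMap (TensorProduct.map ψ ψ) ∘ₗ LinearMap.mulLeft k⟦X⟧ _)
    (g := LinearMap.mulLeft k⟦X⟧ _ ∘ₗ hatMap (TensorProduct.map ψ ψ) +
      hatDeriv (D T) ∘ₗ hatMap (TensorProduct.map ψ ψ)) (hatTensor_ext fun x y => ?_) u
  simp only [LinearMap.comp_apply, LinearMap.add_apply, LinearMap.mulLeft_apply,
    hatMap_toHat, TensorProduct.map_tmul, toHat_mul, add_mul, Algebra.TensorProduct.tmul_mul_tmul,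
    map_add, hψ.map_tor, one_mul, TensorProduct.add_tmul, TensorProduct.tmul_add, hatDeriv_toHat]
  abel

theorem map_comul (hR : IsDeformation R R' η) (H' : IsStdHopf R' τ' e' f' Δ' ε' S') (y : B') :
    Δ (ψ y) = hatMap (TensorProduct.map ψ ψ) (Δ' y) := by
  have h0 : sexp k 0 = 1 := hexp_zero
  have h3 : Δ.toLinearMap ∘ₗ ψ = hatMap (TensorProduct.map ψ ψ) ∘ₗ Δ'.toLinearMap := by
    refine H'.gen.linearMap_ext ?_ (fun T x hx => ?_) (fun j x hx => ?_) (fun j x hx => ?_)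
    · simp only [LinearMap.comp_apply, AlgHom.toLinearMap_apply]
      rw [hψ.map_one, IsStdHopf.comul_one, IsStdHopf.comul_one, hatMap_toHat, TensorProduct.map_tmul,
        hψ.map_one]
    all_goals simp only [LinearMap.comp_apply, AlgHom.toLinearMap_apply] at hx ⊢
    · rw [hψ.map_tor, map_add, map_mul, map_mul, H.comul_D hO, H.comul_tor, H'.comul_tor,
        hψ.map_comul_tor_mul H hO, hx]
    · rw [hψ.map_E, H.comul_a hO, map_mul, map_mul, map_mul, H.comul_E, H'.comul_E, hR.Tpos_eq,
        hψ.map_comul_E_mul H hO hR.self, ← hx, H.comul_ba hO hR.right_Tneg, ← add_mul, ← map_add,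
        hatMapAlg_toHat]
      simp only [map_add, Algebra.TensorProduct.map_tmul, hO.a_E, hO.a_hexp, hR.self, h0, one_smul,
        AlgHom.id_apply]
    · have h4 := hO.b_hexp j (-R.Tneg j)
      rw [map_neg, map_neg, hR.right_Tneg, hR.self, neg_zero, neg_zero, neg_zero, h0, one_smul] at h4
      rw [hψ.map_F, H.comul_b hO hR.right_Tneg, map_mul, map_mul, map_mul, H.comul_F, H'.comul_F,
        hR.Tneg_eq, hψ.map_comul_F_mul H hO hR.self (hO.D_eq_neg H.gen (hR.left_Tneg j)), ← hx,
        H.comul_ba hO hR.right_Tneg, ← add_mul, ← map_add, hatMapAlg_toHat]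
      simp only [map_add, Algebra.TensorProduct.map_tmul, hO.b_F, h4, hR.self, neg_zero, h0, one_smul,
        AlgHom.id_apply]
  exact LinearMap.congr_fun h3 y

theorem map_counit (H' : IsStdHopf R' τ' e' f' Δ' ε' S') (y : B') : ε (ψ y) = ε' y := by
  have h3 : ε.toLinearMap ∘ₗ ψ = ε'.toLinearMap := by
    refine H'.gen.linearMap_ext ?_ (fun T x hx => ?_) (fun j x hx => ?_) (fun j x hx => ?_)
    · simp only [LinearMap.comp_apply, AlgHom.toLinearMap_apply]
      rw [hψ.map_one, _root_.map_one ε, _root_.map_one ε']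
    all_goals simp only [LinearMap.comp_apply, AlgHom.toLinearMap_apply] at hx ⊢
    · rw [hψ.map_tor, map_add, map_mul, H.counit_D hO, H.counit_tor, map_mul, H'.counit_tor]
      simp
    · rw [hψ.map_E, map_mul, hO.a_E, map_mul, map_mul, map_smul, H.counit_E, H'.counit_E]
      simp
    · rw [hψ.map_F, map_mul, hO.b_F, map_mul, map_mul, map_smul, H.counit_F, H'.counit_F]
      simp
  exact LinearMap.congr_fun h3 y

end IsTwistMap
end Comparison

/-! ### Transport of topological Hopf structures -/

section Transport

variable {k : Type*} [Field k]
variable {M N Q : Type*} [AddCommGroup M] [Module k⟦X⟧ M] [AddCommGroup N] [Module k⟦X⟧ N]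
variable [AddCommGroup Q] [Module k⟦X⟧ Q]
variable {M' N' : Type*} [AddCommGroup M'] [Module k⟦X⟧ M'] [AddCommGroup N'] [Module k⟦X⟧ N']

theorem hatMap_comp_apply (g : N →ₗ[k⟦X⟧] Q) (f : M →ₗ[k⟦X⟧] N) (x : Hat k M) :
    hatMap g (hatMap f x) = hatMap (g ∘ₗ f) x := by
  have h1 : hatMap g ∘ₗ hatMap f = hatMap (g ∘ₗ f) := hat_ext fun a => by
    rw [LinearMap.comp_apply, hatMap_toHat, hatMap_toHat, hatMap_toHat, LinearMap.comp_apply]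
  rw [← h1, LinearMap.comp_apply]

theorem hatMap_id_apply (x : Hat k M) : hatMap (LinearMap.id : M →ₗ[k⟦X⟧] M) x = x := by
  have h1 : hatMap (LinearMap.id : M →ₗ[k⟦X⟧] M) = LinearMap.id := hat_ext fun a => by
    rw [hatMap_toHat, LinearMap.id_apply, LinearMap.id_apply]
  rw [h1, LinearMap.id_apply]

theorem hatMap_injective {g : N →ₗ[k⟦X⟧] M} {f : M →ₗ[k⟦X⟧] N} (hgf : g ∘ₗ f = LinearMap.id) :
    Function.Injective (hatMap f) := fun x y hxy => by
  have := congrArg (hatMap g) hxy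
  rwa [hatMap_comp_apply, hatMap_comp_apply, hgf, hatMap_id_apply, hatMap_id_apply] at this

theorem hatTensor_hom_ext [IsHausdorff (hIdeal k) Q] {f g : HatTensor k M N →ₗ[k⟦X⟧] Q}
    (hfg : ∀ x y, f (toHat (k := k) (x ⊗ₜ[k⟦X⟧] y)) = g (toHat (k := k) (x ⊗ₜ[k⟦X⟧] y))) : f = g := by
  refine hat_ext fun u => ?_
  induction u using TensorProduct.induction_on with
  | zero => simp
  | tmul x y => exact hfg x y
  | add x y hx hy => simp only [map_add, hx, hy]

theorem hatMap_map_boxTensor (f : M →ₗ[k⟦X⟧] M') (g : N →ₗ[k⟦X⟧] N') (x : Hat k M) (y : Hat k N) :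
    hatMap (TensorProduct.map f g) (boxTensor x y) = boxTensor (hatMap f x) (hatMap g y) := by
  have h1 (a : M) : hatMap (TensorProduct.map f g) ∘ₗ boxTensor (toHat a) =
      boxTensor (toHat (f a)) ∘ₗ hatMap g := hat_ext fun b => by
    simp only [LinearMap.comp_apply, boxTensor_toHat, hatMap_toHat, TensorProduct.map_tmul]
  have h2 : (hatMap (TensorProduct.map f g) ∘ₗ boxTensor.flip y) = boxTensor.flip (hatMap g y) ∘ₗ hatMap f :=
    hat_ext fun a => LinearMap.congr_fun (h1 a) y
  exact LinearMap.congr_fun h2 x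

theorem hatTensorMap_toHat (f : M →ₗ[k⟦X⟧] Hat k M') (g : N →ₗ[k⟦X⟧] Hat k N') (x : M) (y : N) :
    hatTensorMap f g (toHat (k := k) (x ⊗ₜ[k⟦X⟧] y)) = boxTensor (f x) (g y) :=
  hatExtend_toHat _ _

variable {U U' : Type*} [AddCommGroup U] [Module k⟦X⟧ U] [IsAdicComplete (hIdeal k) U]
variable [AddCommGroup U'] [Module k⟦X⟧ U'] [IsAdicComplete (hIdeal k) U']
variable {H : HopfData k U} {H' : HopfData k U'} {φ : U ≃ₗ[k⟦X⟧] U'}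

namespace IsHopfIso

variable (hφ : IsHopfIso H H' φ)

include hφ

theorem map_conv {f g : U →ₗ[k⟦X⟧] U} {f' g' : U' →ₗ[k⟦X⟧] U'} (hf : ∀ x, φ (f x) = f' (φ x))
    (hg : ∀ x, φ (g x) = g' (φ x)) (x : U) :
    φ (conv H.comul H.mul f g x) = conv H'.comul H'.mul f' g' (φ x) := by
  have h1 : φ.toLinearMap ∘ₗ hatExtend (H.mul ∘ₗ TensorProduct.map f g) =
      hatExtend (H'.mul ∘ₗ TensorProduct.map f' g') ∘ₗ
        hatMap (TensorProduct.map φ.toLinearMap φ.toLinearMap) := hatTensor_hom_ext fun x y => by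
    simp only [LinearMap.comp_apply, hatExtend_toHat, hatMap_toHat, TensorProduct.map_tmul,
      LinearEquiv.coe_coe, hφ.map_mul, hf, hg]
  rw [conv, conv, LinearMap.comp_apply, LinearMap.comp_apply, ← hφ.map_comul]
  exact LinearMap.congr_fun h1 _

theorem isTopHopf (hH : IsTopHopf H') : IsTopHopf H where
  mul_assoc x y z := φ.injective (by simp only [hφ.map_mul, hH.mul_assoc])
  one_mul x := φ.injective (by rw [hφ.map_mul, hφ.map_one, hH.one_mul])
  mul_one x := φ.injective (by rw [hφ.map_mul, hφ.map_one, hH.mul_one])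
  coassoc x := by
    refine hatMap_injective (f := TensorProduct.map φ.toLinearMap
      (TensorProduct.map φ.toLinearMap φ.toLinearMap)) (g := TensorProduct.map φ.symm.toLinearMap
        (TensorProduct.map φ.symm.toLinearMap φ.symm.toLinearMap)) ?_ ?_
    · refine TensorProduct.ext_threefold' fun x y z => ?_
      simp
    · have h1 : hatMap (TensorProduct.map φ.toLinearMap
          (TensorProduct.map φ.toLinearMap φ.toLinearMap)) ∘ₗ
          hatMap (TensorProduct.assoc k⟦X⟧ U U U).toLinearMap ∘ₗ hatTensorMap H.comul toHat =
          hatMap (TensorProduct.assoc k⟦X⟧ U' U' U').toLinearMap ∘ₗ hatTensorMap H'.comul toHat ∘ₗ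
          hatMap (TensorProduct.map φ.toLinearMap φ.toLinearMap) := by
        refine hatTensor_hom_ext fun x y => ?_
        simp only [LinearMap.comp_apply, hatTensorMap_toHat, hatMap_toHat, TensorProduct.map_tmul,
          LinearEquiv.coe_coe, ← hφ.map_comul]
        rw [← LinearEquiv.coe_coe φ, ← hatMap_toHat φ.toLinearMap y, ← hatMap_map_boxTensor,
          hatMap_comp_apply, hatMap_comp_apply]
        congr 2
        refine TensorProduct.ext_threefold fun x y z => ?_
        simp
      have h2 : hatMap (TensorProduct.map φ.toLinearMap
          (TensorProduct.map φ.toLinearMap φ.toLinearMap)) ∘ₗ hatTensorMap toHat H.comul =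
          hatTensorMap toHat H'.comul ∘ₗ
          hatMap (TensorProduct.map φ.toLinearMap φ.toLinearMap) := by
        refine hatTensor_hom_ext fun x y => ?_
        simp only [LinearMap.comp_apply, hatTensorMap_toHat, hatMap_toHat, TensorProduct.map_tmul,
          LinearEquiv.coe_coe, ← hφ.map_comul, hatMap_map_boxTensor]
      refine (LinearMap.congr_fun h1 (H.comul x)).trans
        (Eq.trans ?_ (LinearMap.congr_fun h2 (H.comul x)).symm)
      simp only [LinearMap.comp_apply, hφ.map_comul, hH.coassoc]
  counit_comul x := by
    have h1 : φ.toLinearMap ∘ₗ hatExtend ((TensorProduct.lid k⟦X⟧ U).toLinearMap ∘ₗ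
        TensorProduct.map H.counit LinearMap.id) = hatExtend ((TensorProduct.lid k⟦X⟧ U').toLinearMap ∘ₗ
        TensorProduct.map H'.counit LinearMap.id) ∘ₗ
        hatMap (TensorProduct.map φ.toLinearMap φ.toLinearMap) := hatTensor_hom_ext fun x y => by
      simp [hatExtend_toHat, hatMap_toHat, hφ.map_counit]
    refine φ.injective ((LinearMap.congr_fun h1 _).trans ?_)
    rw [LinearMap.comp_apply, hφ.map_comul, hH.counit_comul]
  comul_counit x := by
    have h1 : φ.toLinearMap ∘ₗ hatExtend ((TensorProduct.rid k⟦X⟧ U).toLinearMap ∘ₗ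
        TensorProduct.map LinearMap.id H.counit) = hatExtend ((TensorProduct.rid k⟦X⟧ U').toLinearMap ∘ₗ
        TensorProduct.map LinearMap.id H'.counit) ∘ₗ
        hatMap (TensorProduct.map φ.toLinearMap φ.toLinearMap) := hatTensor_hom_ext fun x y => by
      simp [hatExtend_toHat, hatMap_toHat, hφ.map_counit]
    refine φ.injective ((LinearMap.congr_fun h1 _).trans ?_)
    rw [LinearMap.comp_apply, hφ.map_comul, hH.comul_counit]
  comul_mul x y := by
    refine hatMap_injective (f := TensorProduct.map φ.toLinearMap φ.toLinearMap)
      (g := TensorProduct.map φ.symm.toLinearMap φ.symm.toLinearMap)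
      (TensorProduct.ext' fun x y => by simp) ?_
    rw [hφ.map_comul, hφ.map_mul, hH.comul_mul, ← hφ.map_comul, ← hφ.map_comul, ← hatMap_map_boxTensor,
      hatMap_comp_apply, hatMap_comp_apply]
    congr 2
    refine TensorProduct.ext_fourfold' fun x y z w => ?_
    simp [hφ.map_mul]
  comul_one := by
    refine hatMap_injective (f := TensorProduct.map φ.toLinearMap φ.toLinearMap)
      (g := TensorProduct.map φ.symm.toLinearMap φ.symm.toLinearMap)
      (TensorProduct.ext' fun x y => by simp) ?_
    rw [hφ.map_comul, hφ.map_one, hH.comul_one, hatMap_toHat, TensorProduct.map_tmul,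
      LinearEquiv.coe_coe, hφ.map_one]
  counit_mul x y := by
    rw [← hφ.map_counit, hφ.map_mul, hH.counit_mul, hφ.map_counit, hφ.map_counit]
  counit_one := by rw [← hφ.map_counit, hφ.map_one, hH.counit_one]
  antipode_left x := φ.injective (by
    rw [hφ.map_conv (f' := H'.antipode) (g' := LinearMap.id) hφ.map_antipode (fun _ => rfl),
      hH.antipode_left, hφ.map_counit, map_smul, hφ.map_one])
  antipode_right x := φ.injective (by
    rw [hφ.map_conv (f' := LinearMap.id) (g' := H'.antipode) (fun _ => rfl) hφ.map_antipode,
      hH.antipode_right, hφ.map_counit, map_smul, hφ.map_one])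

theorem isHopfSub {V : Submodule k⟦X⟧ U} {V' : Submodule k⟦X⟧ U'} (hV : V.map φ.toLinearMap = V')
    (hH : IsHopfSub H' V') : IsHopfSub H V := by
  have hmem (x : U) : x ∈ V ↔ φ x ∈ V' := by
    rw [← hV]
    exact ⟨fun hx => ⟨x, hx, rfl⟩, fun ⟨y, hy, hxy⟩ => φ.injective hxy ▸ hy⟩
  refine ⟨?_, ?_, fun x hx y hy => ?_, fun x hx => ?_, fun x hx => ?_⟩
  · refine HClosed.hClosure_eq fun x hx => (hmem x).2 ?_
    refine hClosed_of_hClosure_eq hH.closed _ fun n => ?_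
    obtain ⟨y, hy, v, rfl⟩ := hx n
    exact ⟨φ y, (hmem y).1 hy, φ v, by rw [map_add, map_smul]⟩
  · rw [hmem, hφ.map_one]
    exact hH.one_mem
  · rw [hmem, hφ.map_mul]
    exact hH.mul_mem _ ((hmem x).1 hx) _ ((hmem y).1 hy)
  · rw [hmem, hφ.map_antipode]
    exact hH.antipode_mem _ ((hmem x).1 hx)
  · have h1 := hH.comul_mem _ ((hmem x).1 hx)
    rw [← hφ.map_comul] at h1
    have h2 : H.comul x = hatMap (TensorProduct.map φ.symm.toLinearMap φ.symm.toLinearMap)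
        (hatMap (TensorProduct.map φ.toLinearMap φ.toLinearMap) (H.comul x)) := by
      rw [hatMap_comp_apply]
      have : TensorProduct.map φ.symm.toLinearMap φ.symm.toLinearMap ∘ₗ
        TensorProduct.map φ.toLinearMap φ.toLinearMap = LinearMap.id :=
          TensorProduct.ext' fun x y => by simp
      rw [this, hatMap_id_apply]
    rw [h2]
    refine (hClosure_le (fun w hw => ?_) ((hClosed_hClosure _).comap (hatMap
      (TensorProduct.map φ.symm.toLinearMap φ.symm.toLinearMap)))) h1
    obtain ⟨_, ⟨u, rfl⟩, rfl⟩ := hw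
    rw [Submodule.mem_comap, hatMap_toHat]
    refine le_hClosure _ ⟨_, ?_, rfl⟩
    induction u using TensorProduct.induction_on with
    | zero => simp
    | tmul a b =>
      obtain ⟨a, ha⟩ := a
      obtain ⟨b, hb⟩ := b
      have ha' : φ.symm a ∈ V := (hmem _).2 (by rwa [φ.apply_symm_apply])
      have hb' : φ.symm b ∈ V := (hmem _).2 (by rwa [φ.apply_symm_apply])
      exact ⟨(⟨_, ha'⟩ : V) ⊗ₜ (⟨_, hb'⟩ : V), rfl⟩
    | add a b ha hb =>
      rw [map_add, map_add]
      exact add_mem ha hb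

end IsHopfIso

variable (H) in
/-- The structure on `U` with the product and the antipode of `H'` and the coproduct, unit and counit
of `H`. -/
def HopfData.twist (H' : HopfData k U') (φ : U ≃ₗ[k⟦X⟧] U') : HopfData k U where
  mul := φ.symm.toLinearMap ∘ₗ H'.mul ∘ₗ TensorProduct.map φ.toLinearMap φ.toLinearMap
  one := H.one
  comul := H.comul
  counit := H.counit
  antipode := φ.symm.toLinearMap ∘ₗ H'.antipode ∘ₗ φ.toLinearMap

theorem HopfData.isHopfIso_twist (h1 : φ H.one = H'.one)
    (h2 : ∀ x, hatMap (TensorProduct.map φ.toLinearMap φ.toLinearMap) (H.comul x) = H'.comul (φ x))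
    (h3 : ∀ x, H'.counit (φ x) = H.counit x) : IsHopfIso (H.twist H' φ) H' φ where
  map_mul x y := by simp [HopfData.twist]
  map_one := h1
  map_comul := h2
  map_counit := h3
  map_antipode x := by simp [HopfData.twist]

end Transport

/-! ### The deformed product -/

section TwistedMul

variable {k : Type*} [Field k] [CharZero k] {n : ℕ}
variable {h : Type*} [AddCommGroup h] [Module k⟦X⟧ h]
variable {A : Matrix (Fin n) (Fin n) ℤ} {d : Fin n → ℕ} {P P' : Matrix (Fin n) (Fin n) k⟦X⟧}
variable {R : Realization P h} {R' : Realization P' h}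
variable {B : Type*} [Ring B] [Algebra k⟦X⟧ B] [IsAdicComplete (hIdeal k) B]
variable {B' : Type*} [Ring B'] [Algebra k⟦X⟧ B'] [IsAdicComplete (hIdeal k) B']
variable {τ : h →ₗ[k⟦X⟧] B} {e f : Fin n → B} {τ' : h →ₗ[k⟦X⟧] B'} {e' f' : Fin n → B'}
variable {a b : Fin n → B →ₐ[k⟦X⟧] B} {D : h →ₗ[k⟦X⟧] Module.End k⟦X⟧ B}
variable {a' b' : Fin n → B' →ₐ[k⟦X⟧] B'} {D' : h →ₗ[k⟦X⟧] Module.End k⟦X⟧ B'}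
variable {η : h →ₗ[k⟦X⟧] h →ₗ[k⟦X⟧] k⟦X⟧} {Tp : Fin n → h}

theorem form_neg_neg (η : h →ₗ[k⟦X⟧] h →ₗ[k⟦X⟧] k⟦X⟧) : -(-η) = η :=
  LinearMap.ext fun x => LinearMap.ext fun y => neg_neg (η x y)

theorem IsTwistOps.D_mul (hO : IsTwistOps η Tp τ e f a b D) (hg : IsTopGen (k := k) τ e f) (T : h)
    (x y : B) : D T (x * y) = D T x * y + x * D T y := by
  have h1 : D T ∘ₗ LinearMap.mulRight k⟦X⟧ y = LinearMap.mulRight k⟦X⟧ y ∘ₗ D T +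
      LinearMap.mulRight k⟦X⟧ (D T y) := by
    refine hg.linearMap_ext ?_ (fun T' x hx => ?_) (fun i x hx => ?_) (fun i x hx => ?_)
    · simp [hO.D_one]
    all_goals
      simp only [LinearMap.comp_apply, LinearMap.mulRight_apply, LinearMap.add_apply] at hx ⊢
    · rw [mul_assoc, hO.D_tor, hx, hO.D_tor, mul_add, mul_assoc, mul_assoc]
    · rw [mul_assoc, hO.D_E, hx, hO.D_E, mul_assoc, mul_assoc, ← mul_add, add_mul, smul_mul_assoc]
      congr 1
      abel
    · rw [mul_assoc, hO.D_F, hx, hO.D_F, mul_assoc, mul_assoc, ← mul_add, sub_mul, smul_mul_assoc]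
      congr 1
      abel
  exact LinearMap.congr_fun h1 x

/-- The rules for the deformed product. -/
structure IsTwistMul (τ : h →ₗ[k⟦X⟧] B) (e f : Fin n → B) (a b : Fin n → B →ₐ[k⟦X⟧] B)
    (D : h →ₗ[k⟦X⟧] Module.End k⟦X⟧ B) (μ : B →ₗ[k⟦X⟧] B →ₗ[k⟦X⟧] B) : Prop where
  one_apply : ∀ y, μ 1 y = y
  tor_apply : ∀ T x y, μ (τ T * x) y = τ T * μ x y + μ x (D T y)
  E_apply : ∀ i x y, μ (e i * x) y = e i * μ x (a i y)
  F_apply : ∀ i x y, μ (f i * x) y = f i * μ x (b i y)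

theorem IsTwistMap.isTwistMul {ψ : B' →ₗ[k⟦X⟧] B} {φ : B →ₗ[k⟦X⟧] B'}
    (hφ : IsTwistMap τ e f τ' e' f' a' b' D' φ) (hψ : IsTwistMap τ' e' f' τ e f a b D ψ)
    (hg : IsTopGen (k := k) τ e f) (hg' : IsTopGen (k := k) τ' e' f')
    (hO : IsTwistOps η Tp τ e f a b D) (hO' : IsTwistOps (-η) Tp τ' e' f' a' b' D')
    (hη : ∀ T, η T T = 0) :
    IsTwistMul τ e f a b D ((LinearMap.mul k⟦X⟧ B').compl₁₂ φ φ |>.compr₂ ψ) := by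
  have hO'' : IsTwistOps (-(-η)) Tp τ e f a b D := by rwa [form_neg_neg]
  have h0 : sexp k 0 = 1 := hexp_zero
  have hψφ (y : B) : ψ (φ y) = y := LinearMap.congr_fun (hψ.comp_eq_id hg' hg hO' hO''
    (fun T => by rw [LinearMap.neg_apply, LinearMap.neg_apply, hη, neg_zero]) hφ) y
  refine ⟨fun y => ?_, fun T x y => ?_, fun i x y => ?_, fun i x y => ?_⟩ <;>
    simp only [LinearMap.compr₂_apply, LinearMap.compl₁₂_apply, LinearMap.mul_apply']
  · rw [hφ.map_one, one_mul, hψφ]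
  · have h1 (z : B) : φ (D T z) = -D' T (φ z) :=
      LinearMap.congr_fun (hφ.comp_D hg hg' hO hO' T) z
    have h2 (z : B') : ψ (D' T z) = -D T (ψ z) :=
      LinearMap.congr_fun (hψ.comp_D hg' hg hO' hO'' T) z
    have h3 : ψ (D' T (φ x) * φ y) = -D T (ψ (φ x * φ y)) + ψ (φ x * φ (D T y)) := by
      rw [← h2, hO'.D_mul hg', map_add, h1, mul_neg, map_neg]
      abel
    rw [hφ.map_tor, add_mul, mul_assoc, map_add, hψ.map_tor, h3]
    abel
  · have h1 : φ y = a' i (φ (a i y)) := (LinearMap.congr_fun (hφ.comp_a hg hg' hO hO' i) y).symm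
    have h2 (z : B') : a i (ψ (a' i z)) = ψ z :=
      LinearMap.congr_fun (hψ.comp_a hg' hg hO' hO'' i) z
    rw [hφ.map_E, h1, ← map_mul, mul_assoc, map_mul, hO'.a_E, LinearMap.neg_apply, LinearMap.neg_apply,
      hη, neg_zero, h0, one_smul, hψ.map_E, map_mul, h2, hO.a_E, hη, h0, one_smul]
  · have h1 : φ y = b' i (φ (b i y)) := (LinearMap.congr_fun (hφ.comp_b hg hg' hO hO' i) y).symm
    have h2 (z : B') : b i (ψ (b' i z)) = ψ z :=
      LinearMap.congr_fun (hψ.comp_b hg' hg hO' hO'' i) z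
    rw [hφ.map_F, h1, ← map_mul, mul_assoc, map_mul, hO'.b_F, LinearMap.neg_apply, LinearMap.neg_apply,
      hη, neg_zero, neg_zero, h0, one_smul, hψ.map_F, map_mul, h2, hO.b_F, hη, neg_zero, h0, one_smul]

/-! ### Borel subalgebras and the comparison map -/

theorem closureSub_adjoin_le {G : Set B} {S : Submodule k⟦X⟧ B} (hS : HClosed S) (h1 : 1 ∈ S)
    (hG : ∀ g ∈ G, ∀ x ∈ S, g * x ∈ S) :
    hClosure (Subalgebra.toSubmodule (Algebra.adjoin k⟦X⟧ G)) ≤ S := by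
  refine hClosure_le (fun x hx => ?_) hS
  have h2 : ∀ y ∈ S, x * y ∈ S := by
    change x ∈ Algebra.adjoin k⟦X⟧ G at hx
    induction hx using Algebra.adjoin_induction with
    | mem g hg => exact hG g hg
    | algebraMap c =>
      intro y hy
      rw [← Algebra.smul_def]
      exact S.smul_mem _ hy
    | add x z _ _ hx hz =>
      intro y hy
      rw [add_mul]
      exact S.add_mem (hx y hy) (hz y hy)
    | mul x z _ _ hx hz =>
      intro y hy
      rw [mul_assoc]
      exact hx _ (hz _ hy)
  simpa using h2 1 h1

namespace IsTwistMap

variable {ψ : B' →ₗ[k⟦X⟧] B} (hψ : IsTwistMap τ' e' f' τ e f a b D ψ)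
  (hO : IsTwistOps η Tp τ e f a b D) (t : Submodule k⟦X⟧ h)

include hψ hO

theorem map_borelPos_le : (hClosure (Subalgebra.toSubmodule
      (Algebra.adjoin k⟦X⟧ (τ' '' (t : Set h) ∪ Set.range e')))).map ψ ≤
    hClosure (Subalgebra.toSubmodule (Algebra.adjoin k⟦X⟧ (τ '' (t : Set h) ∪ Set.range e))) := by
  set V := closureSub (Algebra.adjoin k⟦X⟧ (τ '' (t : Set h) ∪ Set.range e)) with hV
  have hτ (T : h) (hT : T ∈ t) : τ T ∈ V :=
    le_closureSub _ (Algebra.subset_adjoin (Or.inl ⟨T, hT, rfl⟩))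
  have he (i : Fin n) : e i ∈ V := le_closureSub _ (Algebra.subset_adjoin (Or.inr ⟨i, rfl⟩))
  have ha (j : Fin n) : V ≤ V.comap (a j) := by
    refine closureSub_le (Algebra.adjoin_le ?_) ((hClosed_closureSub _).comap (a j).toLinearMap)
    rintro _ (⟨T, hT, rfl⟩ | ⟨i, rfl⟩)
    · change a j (τ T) ∈ V
      rw [hO.a_tor]
      exact V.add_mem (hτ T hT) (V.algebraMap_mem _)
    · change a j (e i) ∈ V
      rw [hO.a_E]
      exact V.smul_mem (he i) _
  have hD (T : h) : ∀ x ∈ V, x ∈ V ∧ D T x ∈ V := by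
    refine closureSub_adjoin_le (S := Subalgebra.toSubmodule V ⊓ (Subalgebra.toSubmodule V).comap (D T))
      ?_ ⟨V.one_mem, ?_⟩ ?_
    · intro x hx
      refine ⟨hClosed_closureSub _ _ fun m => ?_, ((hClosed_closureSub _).comap (D T)) _ fun m => ?_⟩ <;>
      obtain ⟨y, hy, v, e⟩ := hx m
      exacts [⟨y, hy.1, v, e⟩, ⟨y, hy.2, v, e⟩]
    · change D T 1 ∈ V
      rw [hO.D_one]
      exact V.zero_mem
    · rintro _ (⟨T', hT, rfl⟩ | ⟨i, rfl⟩) x ⟨hx, hx'⟩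
      · refine ⟨V.mul_mem (hτ _ hT) hx, ?_⟩
        change D T (τ T' * x) ∈ V
        rw [hO.D_tor]
        exact V.mul_mem (hτ _ hT) hx'
      · refine ⟨V.mul_mem (he i) hx, ?_⟩
        change D T (e i * x) ∈ V
        rw [hO.D_E]
        exact V.mul_mem (he i) (V.add_mem hx' (V.smul_mem hx _))
  rw [Submodule.map_le_iff_le_comap]
  refine closureSub_adjoin_le ((hClosed_closureSub _).comap ψ) ?_ ?_
  · change ψ 1 ∈ V
    rw [hψ.map_one]
    exact V.one_mem
  · rintro _ (⟨T, hT, rfl⟩ | ⟨i, rfl⟩) x hx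
    · change ψ (τ' T * x) ∈ V
      rw [hψ.map_tor]
      exact V.add_mem (V.mul_mem (hτ T hT) hx) (hD T _ hx).2
    · change ψ (e' i * x) ∈ V
      rw [hψ.map_E]
      exact ha i (V.mul_mem (he i) hx)

theorem map_borelNeg_le : (hClosure (Subalgebra.toSubmodule
      (Algebra.adjoin k⟦X⟧ (τ' '' (t : Set h) ∪ Set.range f')))).map ψ ≤
    hClosure (Subalgebra.toSubmodule (Algebra.adjoin k⟦X⟧ (τ '' (t : Set h) ∪ Set.range f))) := by
  set V := closureSub (Algebra.adjoin k⟦X⟧ (τ '' (t : Set h) ∪ Set.range f)) with hV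
  have hτ (T : h) (hT : T ∈ t) : τ T ∈ V :=
    le_closureSub _ (Algebra.subset_adjoin (Or.inl ⟨T, hT, rfl⟩))
  have hf (i : Fin n) : f i ∈ V := le_closureSub _ (Algebra.subset_adjoin (Or.inr ⟨i, rfl⟩))
  have hb (j : Fin n) : V ≤ V.comap (b j) := by
    refine closureSub_le (Algebra.adjoin_le ?_) ((hClosed_closureSub _).comap (b j).toLinearMap)
    rintro _ (⟨T, hT, rfl⟩ | ⟨i, rfl⟩)
    · change b j (τ T) ∈ V
      rw [hO.b_tor]
      exact V.sub_mem (hτ T hT) (V.algebraMap_mem _)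
    · change b j (f i) ∈ V
      rw [hO.b_F]
      exact V.smul_mem (hf i) _
  have hD (T : h) : ∀ x ∈ V, x ∈ V ∧ D T x ∈ V := by
    refine closureSub_adjoin_le (S := Subalgebra.toSubmodule V ⊓ (Subalgebra.toSubmodule V).comap (D T))
      ?_ ⟨V.one_mem, ?_⟩ ?_
    · intro x hx
      refine ⟨hClosed_closureSub _ _ fun m => ?_, ((hClosed_closureSub _).comap (D T)) _ fun m => ?_⟩ <;>
      obtain ⟨y, hy, v, e⟩ := hx m
      exacts [⟨y, hy.1, v, e⟩, ⟨y, hy.2, v, e⟩]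
    · change D T 1 ∈ V
      rw [hO.D_one]
      exact V.zero_mem
    · rintro _ (⟨T', hT, rfl⟩ | ⟨i, rfl⟩) x ⟨hx, hx'⟩
      · refine ⟨V.mul_mem (hτ _ hT) hx, ?_⟩
        change D T (τ T' * x) ∈ V
        rw [hO.D_tor]
        exact V.mul_mem (hτ _ hT) hx'
      · refine ⟨V.mul_mem (hf i) hx, ?_⟩
        change D T (f i * x) ∈ V
        rw [hO.D_F]
        exact V.mul_mem (hf i) (V.sub_mem hx' (V.smul_mem hx _))
  rw [Submodule.map_le_iff_le_comap]
  refine closureSub_adjoin_le ((hClosed_closureSub _).comap ψ) ?_ ?_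
  · change ψ 1 ∈ V
    rw [hψ.map_one]
    exact V.one_mem
  · rintro _ (⟨T, hT, rfl⟩ | ⟨i, rfl⟩) x hx
    · change ψ (τ' T * x) ∈ V
      rw [hψ.map_tor]
      exact V.add_mem (V.mul_mem (hτ T hT) hx) (hD T _ hx).2
    · change ψ (f' i * x) ∈ V
      rw [hψ.map_F]
      exact hb i (V.mul_mem (hf i) hx)

end IsTwistMap

/-- The isomorphism of the twisted Hopf algebra with the deformed one. -/
theorem UAlg.exists_hopfIso (hA : IsSymmetrizableGCM A d) (hP : IsCartanType A d P)
    (hP' : IsCartanType A d P') (hR : IsDeformation R R' η) :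
    ∃ (a b : Fin n → UAlg A d R →ₐ[k⟦X⟧] UAlg A d R) (D : h →ₗ[k⟦X⟧] Module.End k⟦X⟧ (UAlg A d R))
      (φ : UAlg A d R ≃ₗ[k⟦X⟧] UAlg A d R'),
      IsTwistOps η R.Tpos (UAlg.torₗ A d R) (UAlg.E A d R) (UAlg.F A d R) a b D ∧
      IsHopfIso ((UAlg.hopf hA hP R).twist (UAlg.hopf hA hP' R') φ) (UAlg.hopf hA hP' R') φ ∧
      (∀ i, φ (UAlg.E A d R i) = UAlg.E A d R' i) ∧ (∀ i, φ (UAlg.F A d R i) = UAlg.F A d R' i) ∧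
      (∀ T, φ (UAlg.tor A d R T) = UAlg.tor A d R' T) ∧
      (∀ t, (borelPos A d R t).map φ.toLinearMap = borelPos A d R' t) ∧
      (∀ t, (borelNeg A d R t).map φ.toLinearMap = borelNeg A d R' t) ∧
      IsTwistMul (UAlg.torₗ A d R) (UAlg.E A d R) (UAlg.F A d R) a b D
        (TensorProduct.curry ((UAlg.hopf hA hP R).twist (UAlg.hopf hA hP' R') φ).mul) := by
  have h0 : sexp k 0 = 1 := hexp_zero
  obtain ⟨a, b, D, hO⟩ := UAlg.exists_isTwistOps A d R hR.right_Tneg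
  obtain ⟨a', b', D', hO'⟩ := UAlg.exists_isTwistOps A d R' hR.symm.right_Tneg
  obtain ⟨ψ, hψ⟩ := hR.exists_isTwistMap (UAlg.isGenRel A d R) (UAlg.isTopGen A d R) hO
  obtain ⟨φ, hφ⟩ := hR.symm.exists_isTwistMap (UAlg.isGenRel A d R') (UAlg.isTopGen A d R') hO'
  rw [hR.Tpos_eq] at hO'
  have hO'' : IsTwistOps (-(-η)) R.Tpos (UAlg.torₗ A d R) (UAlg.E A d R) (UAlg.F A d R) a b D := by
    rwa [form_neg_neg]
  have hφψ := hφ.comp_eq_id (UAlg.isTopGen A d R) (UAlg.isTopGen A d R') hO hO' hR.self hψ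
  have hψφ := hψ.comp_eq_id (UAlg.isTopGen A d R') (UAlg.isTopGen A d R) hO' hO'' hR.symm.self hφ
  have hmul := hφ.isTwistMul hψ (UAlg.isTopGen A d R) (UAlg.isTopGen A d R') hO hO' hR.self
  have hcomul := hψ.map_comul (UAlg.isStdHopf hA hP R) hO hR (UAlg.isStdHopf hA hP' R')
  have hcounit := hψ.map_counit (UAlg.isStdHopf hA hP R) hO (UAlg.isStdHopf hA hP' R')
  let Φ : UAlg A d R ≃ₗ[k⟦X⟧] UAlg A d R' := LinearEquiv.ofLinearMap φ ψ hφψ hψφ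
  have h1 (x : UAlg A d R) : ψ (φ x) = x := LinearMap.congr_fun hψφ x
  refine ⟨a, b, D, Φ, hO, HopfData.isHopfIso_twist hφ.map_one (fun x => ?_) (fun x => ?_), fun i => ?_,
    fun i => ?_, fun T => ?_, fun t => ?_, fun t => ?_, hmul⟩
  · have h2 := hcomul (φ x)
    rw [h1] at h2
    change hatMap (TensorProduct.map φ φ) (UAlg.comul hA hP R x) = UAlg.comul hA hP' R' (φ x)
    rw [h2, hatMap_comp_apply, ← TensorProduct.map_comp, hφψ, TensorProduct.map_id, hatMap_id_apply]
  · have h2 := hcounit (φ x)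
    rw [h1] at h2
    exact h2.symm
  · have := hφ.map_E i 1
    rw [mul_one, hφ.map_one, mul_one, hO'.a_E] at this
    exact this.trans (by
      rw [LinearMap.neg_apply, LinearMap.neg_apply, hR.self, neg_zero, h0, one_smul])
  · have := hφ.map_F i 1
    rw [mul_one, hφ.map_one, mul_one, hO'.b_F] at this
    exact this.trans (by
      rw [LinearMap.neg_apply, LinearMap.neg_apply, hR.self, neg_zero, neg_zero, h0, one_smul])
  · have := hφ.map_tor T 1
    rw [mul_one, hφ.map_one, mul_one, hO'.D_one, add_zero] at this
    exact this
  · refine le_antisymm (hφ.map_borelPos_le hO' t) fun y hy => ?_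
    exact ⟨ψ y, hψ.map_borelPos_le hO t ⟨y, hy, rfl⟩, LinearMap.congr_fun hφψ y⟩
  · refine le_antisymm (hφ.map_borelNeg_le hO' t) fun y hy => ?_
    exact ⟨ψ y, hψ.map_borelNeg_le hO t ⟨y, hy, rfl⟩, LinearMap.congr_fun hφψ y⟩

end TwistedMul

/-! ### Forms on symmetric algebras -/

section SymForm

open Coalgebra SymmetricAlgebra

variable {K M : Type*} [CommRing K] [AddCommGroup M] [Module K M]

theorem symmetricAlgebra_induction {S : Submodule K (SymmetricAlgebra K M)} (h1 : 1 ∈ S)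
    (hι : ∀ w, ∀ x ∈ S, ι K M w * x ∈ S) (x : SymmetricAlgebra K M) : x ∈ S := by
  have h2 : ∀ y ∈ S, x * y ∈ S := by
    induction x using SymmetricAlgebra.induction with
    | algebraMap c =>
      intro y hy
      rw [← Algebra.smul_def]
      exact S.smul_mem _ hy
    | ι w => exact hι w
    | mul x z hx hz =>
      intro y hy
      rw [mul_assoc]
      exact hx _ (hz _ hy)
    | add x z hx hz =>
      intro y hy
      rw [add_mul]
      exact S.add_mem (hx y hy) (hz y hy)
  simpa using h2 1 h1

theorem symmetricAlgebra_linearMap_ext {Q : Type*} [AddCommGroup Q] [Module K Q]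
    {f g : SymmetricAlgebra K M →ₗ[K] Q} (h1 : f 1 = g 1)
    (hι : ∀ w x, f x = g x → f (ι K M w * x) = g (ι K M w * x)) : f = g :=
  LinearMap.ext <| symmetricAlgebra_induction (S := LinearMap.eqLocus f g) h1 hι

theorem symDegOne_ι_mul (w : M) (x : SymmetricAlgebra K M) :
    symDegOne K M (ι K M w * x) = counit (R := K) x • w := by
  have : symDegOne K M ∘ₗ LinearMap.mulLeft K (ι K M w) =
      LinearMap.toSpanSingleton K M w ∘ₗ counit (R := K) := by
    refine symmetricAlgebra_linearMap_ext ?_ fun v x _ => ?_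
    · simp [symDegOne_ι]
    · simp [← mul_assoc, symDegOne_ι_mul_ι_mul]
  exact LinearMap.congr_fun this x

variable (β : M →ₗ[K] M →ₗ[K] K)

/-- The bilinear form on the symmetric algebra that is `β` in bidegree `(1, 1)` and `0` in all other
bidegrees. -/
def symForm : SymmetricAlgebra K M ⊗[K] SymmetricAlgebra K M →ₗ[K] K :=
  TensorProduct.lift β ∘ₗ TensorProduct.map (symDegOne K M) (symDegOne K M)

theorem symForm_tmul (x y : SymmetricAlgebra K M) :
    symForm β (x ⊗ₜ y) = β (symDegOne K M x) (symDegOne K M y) := rfl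

/-- The derivation of the symmetric algebra with `ι v ↦ β w v`. -/
def symDeriv (w : M) : SymmetricAlgebra K M →ₗ[K] SymmetricAlgebra K M :=
  (TensorProduct.lid K _).toLinearMap ∘ₗ
    TensorProduct.map (β w ∘ₗ symDegOne K M) LinearMap.id ∘ₗ comul (R := K)

theorem symDeriv_one (w : M) : symDeriv β w 1 = 0 := by
  simp [symDeriv, Algebra.TensorProduct.one_def, symDegOne_one]

theorem comul_ι_mul {y : SymmetricAlgebra K M} {N : Type*} {s : Finset N}
    {a b : N → SymmetricAlgebra K M} (hy : comul (R := K) y = ∑ i ∈ s, a i ⊗ₜ b i) (v : M) :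
    comul (R := K) (ι K M v * y) =
      ∑ i ∈ s, ((ι K M v * a i) ⊗ₜ[K] b i + a i ⊗ₜ[K] (ι K M v * b i)) := by
  rw [Bialgebra.comul_mul, hy, comul_ι, Finset.mul_sum]
  simp [add_mul]

theorem symDeriv_eq {y : SymmetricAlgebra K M} {N : Type*} {s : Finset N}
    {a b : N → SymmetricAlgebra K M} (hy : comul (R := K) y = ∑ i ∈ s, a i ⊗ₜ b i) (w : M) :
    symDeriv β w y = ∑ i ∈ s, β w (symDegOne K M (a i)) • b i := by
  simp [symDeriv, hy]

theorem symDeriv_ι_mul (w v : M) (y : SymmetricAlgebra K M) :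
    symDeriv β w (ι K M v * y) = ι K M v * symDeriv β w y + β w v • y := by
  have hy := (Coalgebra.Repr.arbitrary K y).eq.symm
  have h2 := Coalgebra.sum_counit_smul (Coalgebra.Repr.arbitrary K y)
  simp only [symDeriv, LinearMap.comp_apply, comul_ι_mul hy, map_sum, map_add, TensorProduct.map_tmul,
    symDegOne_ι_mul, map_smul]
  have h3 : β w v • y = ∑ i ∈ (Coalgebra.Repr.arbitrary K y).index,
      (counit (R := K) ((Coalgebra.Repr.arbitrary K y).left i) * β w v) •
        (Coalgebra.Repr.arbitrary K y).right i := by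
    conv_lhs => rw [← h2]
    simp only [Finset.smul_sum, smul_smul, mul_comm]
  rw [h3, hy]
  simp [Finset.sum_add_distrib, Finset.mul_sum, add_comm]

theorem comul_symDeriv (w : M) (y : SymmetricAlgebra K M) :
    comul (R := K) (symDeriv β w y) = TensorProduct.map LinearMap.id (symDeriv β w) (comul (R := K) y) := by
  have h1 : comul (R := K) ∘ₗ symDeriv β w =
      TensorProduct.map LinearMap.id (symDeriv β w) ∘ₗ comul (R := K) := by
    refine symmetricAlgebra_linearMap_ext ?_ fun v x hx => ?_
    · simp [symDeriv_one, Algebra.TensorProduct.one_def]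
    · have hy := (Coalgebra.Repr.arbitrary K x).eq.symm
      rw [LinearMap.comp_apply, LinearMap.comp_apply] at hx ⊢
      rw [comul_ι_mul hy, symDeriv_ι_mul, map_add, Bialgebra.comul_mul, hx, map_smul, hy]
      simp [symDeriv_ι_mul, Finset.mul_sum, add_mul, Finset.sum_add_distrib, TensorProduct.tmul_add,
        Finset.smul_sum, add_assoc]
  exact LinearMap.congr_fun h1 y

theorem conv_apply_tmul (f g : SymmetricAlgebra K M ⊗[K] SymmetricAlgebra K M →ₗ[K] K)
    {x y : SymmetricAlgebra K M} {N N' : Type*} {s : Finset N} {t : Finset N'}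
    {a b : N → SymmetricAlgebra K M} {c e : N' → SymmetricAlgebra K M}
    (hx : comul (R := K) x = ∑ i ∈ s, a i ⊗ₜ b i) (hy : comul (R := K) y = ∑ i ∈ t, c i ⊗ₜ e i) :
    (WithConv.toConv f * WithConv.toConv g).ofConv (x ⊗ₜ y) =
      ∑ i ∈ s, ∑ j ∈ t, f (a i ⊗ₜ c j) * g (b i ⊗ₜ e j) := by
  change (WithConv.toConv f * WithConv.toConv g) (x ⊗ₜ y) = _
  rw [LinearMap.convMul_apply, TensorProduct.comul_tmul, hx, hy]
  simp [TensorProduct.sum_tmul, TensorProduct.tmul_sum]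
  exact Finset.sum_comm

/-- The convolution powers of `symForm β`. -/
def symPow (m : ℕ) : SymmetricAlgebra K M ⊗[K] SymmetricAlgebra K M →ₗ[K] K :=
  (WithConv.toConv (symForm β) ^ m).ofConv

theorem symPow_zero_tmul (x y : SymmetricAlgebra K M) :
    symPow β 0 (x ⊗ₜ y) = counit (R := K) x * counit (R := K) y := by
  change (1 : WithConv (SymmetricAlgebra K M ⊗[K] SymmetricAlgebra K M →ₗ[K] K)) (x ⊗ₜ y) = _
  rw [LinearMap.convOne_apply]
  simp [TensorProduct.counit_tmul, mul_comm]

theorem symPow_succ_tmul (m : ℕ) {x y : SymmetricAlgebra K M} {N N' : Type*} {s : Finset N}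
    {t : Finset N'} {a b : N → SymmetricAlgebra K M} {c e : N' → SymmetricAlgebra K M}
    (hx : comul (R := K) x = ∑ i ∈ s, a i ⊗ₜ b i) (hy : comul (R := K) y = ∑ i ∈ t, c i ⊗ₜ e i) :
    symPow β (m + 1) (x ⊗ₜ y) =
      ∑ i ∈ s, ∑ j ∈ t, symForm β (a i ⊗ₜ c j) * symPow β m (b i ⊗ₜ e j) := by
  rw [symPow, pow_succ']
  exact conv_apply_tmul (symForm β) (symPow β m) hx hy

theorem symPow_one_tmul (m : ℕ) (y : SymmetricAlgebra K M) :
    symPow β m (1 ⊗ₜ y) = if m = 0 then counit (R := K) y else 0 := by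
  cases m with
  | zero => simp [symPow_zero_tmul]
  | succ m =>
    rw [symPow_succ_tmul β m (s := {()}) (a := fun _ => 1) (b := fun _ => 1)
      (by simp [Algebra.TensorProduct.one_def]) (Coalgebra.Repr.arbitrary K y).eq.symm]
    simp [symForm_tmul, symDegOne_one]

theorem symPow_ι_mul (m : ℕ) (w : M) (x y : SymmetricAlgebra K M) :
    symPow β m ((ι K M w * x) ⊗ₜ y) = m * symPow β (m - 1) (x ⊗ₜ symDeriv β w y) := by
  induction m generalizing x y with
  | zero => simp [symPow_zero_tmul]
  | succ m ih =>
    have hx := (Coalgebra.Repr.arbitrary K x).eq.symm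
    have hy := (Coalgebra.Repr.arbitrary K y).eq.symm
    set s := (Coalgebra.Repr.arbitrary K x).index
    set a := (Coalgebra.Repr.arbitrary K x).left
    set b := (Coalgebra.Repr.arbitrary K x).right
    set t := (Coalgebra.Repr.arbitrary K y).index
    set c := (Coalgebra.Repr.arbitrary K y).left
    set e := (Coalgebra.Repr.arbitrary K y).right
    have h1 := comul_ι_mul hx w
    have h2 : ∑ i ∈ s, counit (R := K) (a i) • b i = x :=
      Coalgebra.sum_counit_smul (Coalgebra.Repr.arbitrary K x)
    have h3 : (WithConv.toConv (symForm β) * WithConv.toConv (symPow β m)).ofConv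
        ((ι K M w * x) ⊗ₜ y) = ∑ i ∈ s, ∑ j ∈ t,
          (symForm β ((ι K M w * a i) ⊗ₜ c j) * symPow β m (b i ⊗ₜ e j) +
          symForm β (a i ⊗ₜ c j) * symPow β m ((ι K M w * b i) ⊗ₜ e j)) := by
      change (WithConv.toConv (symForm β) * WithConv.toConv (symPow β m)) ((ι K M w * x) ⊗ₜ y) = _
      rw [LinearMap.convMul_apply, TensorProduct.comul_tmul, h1, hy]
      simp [TensorProduct.sum_tmul, TensorProduct.tmul_sum, TensorProduct.add_tmul]
      exact Finset.sum_comm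
    have h4 : symPow β (m + 1) ((ι K M w * x) ⊗ₜ y) = (WithConv.toConv (symForm β) *
        WithConv.toConv (symPow β m)).ofConv ((ι K M w * x) ⊗ₜ y) := by
      rw [symPow, pow_succ']
      rfl
    have h5 : ∑ i ∈ s, ∑ j ∈ t, symForm β ((ι K M w * a i) ⊗ₜ c j) * symPow β m (b i ⊗ₜ e j) =
        symPow β m (x ⊗ₜ symDeriv β w y) := by
      conv_rhs => rw [← h2, symDeriv_eq β hy]
      simp [symForm_tmul, symDegOne_ι_mul, TensorProduct.sum_tmul, TensorProduct.tmul_sum,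
        ← TensorProduct.smul_tmul', TensorProduct.tmul_smul, mul_assoc]
      rw [Finset.sum_comm]
      simp only [Finset.mul_sum, mul_left_comm]
    have h6 : ∑ i ∈ s, ∑ j ∈ t, symForm β (a i ⊗ₜ c j) * symPow β m ((ι K M w * b i) ⊗ₜ e j) =
        m * symPow β m (x ⊗ₜ symDeriv β w y) := by
      cases m with
      | zero => simp [ih]
      | succ m =>
        have h7 : comul (R := K) (symDeriv β w y) = ∑ i ∈ t, c i ⊗ₜ symDeriv β w (e i) := by
          rw [comul_symDeriv, hy]
          simp
        rw [symPow_succ_tmul β m hx h7, Finset.mul_sum]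
        simp only [ih, Finset.mul_sum, Nat.add_sub_cancel, mul_left_comm]
    rw [h4, h3]
    simp only [Finset.sum_add_distrib]
    rw [h5, h6]
    push_cast
    ring

end SymForm

/-! ### Exponential series and their sums -/

namespace Ser

section Exponential

variable {k : Type*} [Field k] {A : Type*} [Ring A] [Algebra k⟦X⟧ A]

variable (k) in
/-- The exponential series `∑ a ^ m z ^ m / m!`. -/
def expS (a : A) : Ser A := mk fun m => (C ((m.factorial : k)⁻¹) : k⟦X⟧) • a ^ m

theorem coeff_expS (a : A) (m : ℕ) :
    coeff m (expS k a) = (C ((m.factorial : k)⁻¹) : k⟦X⟧) • a ^ m := coeff_mk _ _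

theorem coeff_single_mul_zero (a : A) (f : Ser A) : coeff 0 (single a * f) = 0 := by
  simp [coeff_mul, coeff_single]

theorem coeff_single_mul_succ (a : A) (f : Ser A) (m : ℕ) :
    coeff (m + 1) (single a * f) = a * coeff m f := by
  simp [coeff_mul, coeff_single, Finset.Nat.sum_antidiagonal_eq_sum_range_succ_mk]

theorem coeff_single_pow (a : A) (j m : ℕ) :
    coeff m (single a ^ j) = if m = j then a ^ j else 0 := by
  induction j generalizing m with
  | zero => simp [coeff_one]
  | succ j ih =>
    rw [pow_succ']
    cases m with
    | zero => simp [coeff_single_mul_zero]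
    | succ m =>
      rw [coeff_single_mul_succ, ih]
      split_ifs <;> simp_all [pow_succ']

theorem commute_single {a b : A} (h : Commute a b) : Commute (single a) (single b) :=
  commute_of_forall fun m m' => by
    rw [coeff_single, coeff_single]
    split_ifs <;> simp [h]

theorem single_add (a b : A) : single (a + b) = single a + single b := ext fun m => by
  simp only [map_add, coeff_single]
  split_ifs <;> simp

theorem single_smul (c : k⟦X⟧) (a : A) : single (c • a) = c • single a := ext fun m => by
  simp only [coeff_smul, coeff_single]
  split_ifs <;> simp

theorem single_neg (a : A) : single (-a) = -single a := ext fun m => by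
  simp only [map_neg, coeff_single]
  split_ifs <;> simp

theorem single_smul_eq_rescale (c : k⟦X⟧) (a : A) : single (c • a) = rescale c (single a) :=
  ext fun m => by
    simp only [coeff_rescale, coeff_single]
    split_ifs <;> simp_all

theorem hexp_single [IsAdicComplete (hIdeal k) A] (a : A) :
    hexp (k := k) (single a) = rescale (PowerSeries.X : k⟦X⟧) (expS k a) := ext fun m => by
  have h1 := map_hSeries (coeffₗ (k := k) (A := A) m)
    fun j => (C ((j.factorial : k)⁻¹) : k⟦X⟧) • single a ^ j
  refine h1.trans (Eq.symm (hSeries_unique fun n => ?_))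
  simp only [coeff_rescale, coeff_expS, coeffₗ_apply, coeff_smul, coeff_single_pow, smul_ite, smul_zero]
  rw [Finset.sum_ite_eq]
  split_ifs with hm
  · exact ⟨0, by simp⟩
  · rw [Finset.mem_range, not_lt] at hm
    refine ⟨(PowerSeries.X ^ (m - n) : k⟦X⟧) • (C ((m.factorial : k)⁻¹) : k⟦X⟧) • a ^ m, ?_⟩
    rw [sub_zero, smul_smul (PowerSeries.X ^ n : k⟦X⟧), ← pow_add, Nat.add_sub_cancel' hm]

theorem expS_add [CharZero k] {a b : A} (h : Commute a b) : expS k (a + b) = expS k a * expS k b :=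
  ext fun m => by
    rw [coeff_mul, coeff_expS, h.add_pow', Finset.smul_sum]
    refine Finset.sum_congr rfl fun p hp => ?_
    obtain ⟨i, j⟩ := p
    obtain rfl := Finset.HasAntidiagonal.mem_antidiagonal.1 hp
    rw [coeff_expS, coeff_expS, smul_mul_smul_comm, ← Nat.cast_smul_eq_nsmul k⟦X⟧, smul_smul]
    congr 1
    rw [← map_natCast (C (R := k)), ← map_mul, ← map_mul]
    congr 1
    have := Nat.add_choose_mul_factorial_mul_factorial i j
    have h1 : ((i + j).factorial : k) ≠ 0 := Nat.cast_ne_zero.2 (Nat.factorial_ne_zero _)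
    have h2 : (i.factorial : k) ≠ 0 := Nat.cast_ne_zero.2 (Nat.factorial_ne_zero _)
    have h3 : (j.factorial : k) ≠ 0 := Nat.cast_ne_zero.2 (Nat.factorial_ne_zero _)
    rw [Nat.choose_symm_add]
    field_simp
    rw [← this]
    push_cast
    ring

end Exponential

section Sums

variable {k : Type*} [Field k] {M : Type*} [AddCommGroup M] [Module k⟦X⟧ M]

variable (k) in
/-- The sum of the coefficients of the series `f` of operators, applied to `y`, converges to `v`. -/
def SumsAt (f : Ser (Module.End k⟦X⟧ M)) (y v : M) : Prop :=
  ∀ r : ℕ, ∃ N₀ : ℕ, ∀ N ≥ N₀, v - ∑ m ∈ Finset.range N, coeff m f y ∈ (hIdeal k ^ r • ⊤ : Submodule k⟦X⟧ M)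

theorem map_mem_hIdeal {N : Type*} [AddCommGroup N] [Module k⟦X⟧ N] (g : M →ₗ[k⟦X⟧] N) {r : ℕ} {x : M}
    (hx : x ∈ (hIdeal k ^ r • ⊤ : Submodule k⟦X⟧ M)) : g x ∈ (hIdeal k ^ r • ⊤ : Submodule k⟦X⟧ N) := by
  rw [mem_hIdeal_pow_smul_top] at hx ⊢
  obtain ⟨y, rfl⟩ := hx
  exact ⟨g y, map_smul g _ _⟩

theorem SumsAt.add {f g : Ser (Module.End k⟦X⟧ M)} {y v w : M} (hf : SumsAt k f y v)
    (hg : SumsAt k g y w) : SumsAt k (f + g) y (v + w) := fun r => by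
  obtain ⟨N, hN⟩ := hf r
  obtain ⟨N', hN'⟩ := hg r
  refine ⟨max N N', fun m hm => ?_⟩
  have := Submodule.add_mem _ (hN m (le_of_max_le_left hm)) (hN' m (le_of_max_le_right hm))
  convert this using 1
  simp only [map_add, LinearMap.add_apply, Finset.sum_add_distrib]
  abel

theorem SumsAt.smul {f : Ser (Module.End k⟦X⟧ M)} {y v : M} (hf : SumsAt k f y v) (c : k⟦X⟧) :
    SumsAt k (c • f) y (c • v) := fun r => by
  obtain ⟨N, hN⟩ := hf r
  refine ⟨N, fun m hm => ?_⟩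
  have := Submodule.smul_mem _ c (hN m hm)
  convert this using 1
  simp only [coeff_smul, LinearMap.smul_apply, smul_sub, Finset.smul_sum]

theorem sumsAt_const (g : Module.End k⟦X⟧ M) (y : M) : SumsAt k (const (k := k) g) y (g y) := fun r => by
  refine ⟨1, fun N hN => ?_⟩
  obtain ⟨N, rfl⟩ := Nat.exists_eq_add_of_le hN
  have : ∑ m ∈ Finset.range (1 + N), coeff m (const (k := k) g) y = g y := by
    rw [add_comm, Finset.sum_range_succ']
    simp [coeff_const]
  rw [this, sub_self]
  exact zero_mem _

theorem sumsAt_single (g : Module.End k⟦X⟧ M) (y : M) : SumsAt k (single g) y (g y) := fun r => by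
  refine ⟨2, fun N hN => ?_⟩
  obtain ⟨N, rfl⟩ := Nat.exists_eq_add_of_le hN
  have : ∑ m ∈ Finset.range (2 + N), coeff m (single g) y = g y := by
    rw [Finset.sum_eq_single 1]
    · simp [coeff_single]
    · intro m _ hm
      simp [coeff_single, hm]
    · exact fun h => absurd (Finset.mem_range.2 (by omega)) h
  rw [this, sub_self]
  exact zero_mem _

theorem SumsAt.mul {f f' : Ser (Module.End k⟦X⟧ M)} {g : Module.End k⟦X⟧ M} {y v : M}
    (hf : ∀ y, SumsAt k f y (g y)) (hf' : SumsAt k f' y v) : SumsAt k (f * f') y (g v) := fun r => by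
  obtain ⟨Q, hQ⟩ := hf' r
  choose N hN using fun q => hf (coeff q f' y) r
  refine ⟨Q + (Finset.range Q).sup N, fun m hm => ?_⟩
  have h1 : ∑ p ∈ Finset.range m, coeff p (f * f') y =
      ∑ q ∈ Finset.range m, ∑ p ∈ Finset.range (m - q), coeff p f (coeff q f' y) := by
    rw [← Finset.sum_range_diag_flip]
    refine Finset.sum_congr rfl fun p _ => ?_
    rw [coeff_mul, LinearMap.sum_apply, ← Finset.Nat.sum_antidiagonal_swap,
      Finset.Nat.sum_antidiagonal_eq_sum_range_succ_mk]
    rfl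
  have h2 (q : ℕ) (hq : Q ≤ q) : coeff q f' y ∈ (hIdeal k ^ r • ⊤ : Submodule k⟦X⟧ M) := by
    have := Submodule.sub_mem _ (hQ q hq) (hQ (q + 1) (hq.trans (Nat.le_succ q)))
    rw [Finset.sum_range_succ] at this
    convert this using 1
    abel
  have hQm : Q ≤ m := (Nat.le_add_right _ _).trans hm
  have h3 : ∑ q ∈ Finset.range m, ∑ p ∈ Finset.range (m - q), coeff p f (coeff q f' y) =
      ∑ q ∈ Finset.range Q, ∑ p ∈ Finset.range (m - q), coeff p f (coeff q f' y) +
      ∑ q ∈ Finset.Ico Q m, ∑ p ∈ Finset.range (m - q), coeff p f (coeff q f' y) :=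
    (Finset.sum_range_add_sum_Ico _ hQm).symm
  have h4 : g v - ∑ p ∈ Finset.range m, coeff p (f * f') y =
      g (v - ∑ q ∈ Finset.range Q, coeff q f' y) +
      ∑ q ∈ Finset.range Q, (g (coeff q f' y) - ∑ p ∈ Finset.range (m - q), coeff p f (coeff q f' y)) -
      ∑ q ∈ Finset.Ico Q m, ∑ p ∈ Finset.range (m - q), coeff p f (coeff q f' y) := by
    rw [h1, h3, map_sub, map_sum, Finset.sum_sub_distrib]
    abel
  rw [h4]
  refine Submodule.sub_mem _ (Submodule.add_mem _ (map_mem_hIdeal g (hQ Q le_rfl))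
    (Submodule.sum_mem _ fun q hq => hN q _ ?_))
    (Submodule.sum_mem _ fun q hq => Submodule.sum_mem _ fun p _ =>
      map_mem_hIdeal _ (h2 q (Finset.mem_Ico.1 hq).1))
  have h5 := Finset.le_sup (f := N) hq
  have h6 := Finset.mem_range.1 hq
  omega

theorem sumsAt_rescale [IsAdicComplete (hIdeal k) M] (f : Ser (Module.End k⟦X⟧ M)) (y : M) :
    SumsAt k (rescale (PowerSeries.X : k⟦X⟧) f) y (hSeries (k := k) (fun m => coeff m f) y) := fun r => by
  refine ⟨r, fun N hN => ?_⟩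
  obtain ⟨g, hg⟩ := hSeries_sub (k := k) (fun m => coeff m f) N
  have h1 := LinearMap.congr_fun hg y
  rw [mem_hIdeal_pow_smul_top]
  refine ⟨(PowerSeries.X ^ (N - r) : k⟦X⟧) • g y, ?_⟩
  rw [smul_smul, ← pow_add, Nat.add_sub_cancel' hN, ← LinearMap.smul_apply, ← h1]
  simp

theorem sumsAt_hexp_single [IsAdicComplete (hIdeal k) M] (g : Module.End k⟦X⟧ M) (y : M) :
    SumsAt k (hexp (k := k) (single g)) y (hexp (k := k) g y) := by
  rw [hexp_single]
  have h1 := sumsAt_rescale (expS k g) y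
  simp only [coeff_expS] at h1
  exact h1

end Sums

end Ser

/-! ### Tame series and their values at `z = 1 / ħ` -/

namespace Ser

section Tame

variable {k : Type*} [Field k] {A : Type*} [Ring A] [Algebra k⟦X⟧ A]

/-- The series `∑ a m z ^ m` for which some `ħ ^ c a m` lie in `S ^ m` for all `m`. -/
def tame (S : Submodule k⟦X⟧ A) : Subalgebra k⟦X⟧ (Ser A) where
  carrier := {f | ∃ c : ℕ, ∀ m, (PowerSeries.X ^ c : k⟦X⟧) • coeff m f ∈ S ^ m}
  mul_mem' := by
    rintro f g ⟨c, hc⟩ ⟨c', hc'⟩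
    refine ⟨c + c', fun m => ?_⟩
    rw [coeff_mul, Finset.smul_sum]
    refine Submodule.sum_mem _ fun p hp => ?_
    rw [← Finset.HasAntidiagonal.mem_antidiagonal.1 hp, pow_add, pow_add, ← smul_mul_smul_comm]
    exact Submodule.mul_mem_mul (hc _) (hc' _)
  add_mem' := by
    rintro f g ⟨c, hc⟩ ⟨c', hc'⟩
    refine ⟨c + c', fun m => ?_⟩
    rw [map_add, smul_add]
    refine Submodule.add_mem _ ?_ ?_
    · rw [pow_add, mul_comm, mul_smul]
      exact Submodule.smul_mem _ _ (hc m)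
    · rw [pow_add, mul_smul]
      exact Submodule.smul_mem _ _ (hc' m)
  algebraMap_mem' a := by
    refine ⟨0, fun m => ?_⟩
    rw [← AlgHom.commutes (const (k := k) (A := A)), coeff_const]
    split_ifs with hm
    · rw [hm, pow_zero, pow_zero, one_smul]
      exact Submodule.algebraMap_mem a
    · rw [smul_zero]
      exact zero_mem _

theorem mem_tame {S : Submodule k⟦X⟧ A} {f : Ser A} :
    f ∈ tame S ↔ ∃ c : ℕ, ∀ m, (PowerSeries.X ^ c : k⟦X⟧) • coeff m f ∈ S ^ m := Iff.rfl

theorem single_mem_tame {S : Submodule k⟦X⟧ A} {a : A} {c : ℕ} (ha : (PowerSeries.X ^ c : k⟦X⟧) • a ∈ S) :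
    single a ∈ tame S := by
  refine ⟨c, fun m => ?_⟩
  rw [coeff_single]
  split_ifs with hm
  · rw [hm, pow_one]
    exact ha
  · rw [smul_zero]
    exact zero_mem _

theorem hexp_single_mem_tame [IsAdicComplete (hIdeal k) A] {S : Submodule k⟦X⟧ A} {a : A}
    (ha : (PowerSeries.X : k⟦X⟧) • a ∈ S) : hexp (k := k) (single a) ∈ tame S := by
  refine ⟨0, fun m => ?_⟩
  rw [hexp_single, coeff_rescale, coeff_expS, pow_zero, one_smul, smul_comm, ← _root_.smul_pow]
  exact Submodule.smul_mem _ _ (Submodule.pow_mem_pow _ ha m)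

end Tame

section Eval

variable {k : Type*} [Field k]

variable (k) in
/-- The ideal `(ħ ^ 2)`. -/
abbrev hSq : Submodule k⟦X⟧ k⟦X⟧ := Submodule.span k⟦X⟧ {PowerSeries.X ^ 2}

theorem mem_hSq_pow {m : ℕ} {a : k⟦X⟧} : a ∈ hSq k ^ m ↔ ∃ b, a = PowerSeries.X ^ (2 * m) * b := by
  rw [hSq, Submodule.span_pow, Set.singleton_pow, ← pow_mul, Submodule.mem_span_singleton]
  constructor
  · rintro ⟨b, rfl⟩
    exact ⟨b, by rw [smul_eq_mul, mul_comm]⟩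
  · rintro ⟨b, rfl⟩
    exact ⟨b, by rw [smul_eq_mul, mul_comm]⟩

theorem mem_tame_hSq {f : Ser k⟦X⟧} : f ∈ tame (hSq k) ↔
    ∃ (c : ℕ) (g : Ser k⟦X⟧), (PowerSeries.X ^ c : k⟦X⟧) • f = rescale (PowerSeries.X ^ 2 : k⟦X⟧) g := by
  constructor
  · rintro ⟨c, hc⟩
    choose g hg using fun m => mem_hSq_pow.1 (hc m)
    refine ⟨c, mk g, ext fun m => ?_⟩
    rw [coeff_smul, hg, coeff_rescale, coeff_mk, ← pow_mul, smul_eq_mul]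
  · rintro ⟨c, g, hg⟩
    refine ⟨c, fun m => mem_hSq_pow.2 ⟨coeff m g, ?_⟩⟩
    rw [← coeff_smul, hg, coeff_rescale, ← pow_mul, smul_eq_mul]

variable (k) in
/-- The value of a series at `z = ħ`. -/
def sumX (A : Type*) [Ring A] [Algebra k⟦X⟧ A] [IsAdicComplete (hIdeal k) A] : Ser A →ₐ[k⟦X⟧] A :=
  AlgHom.ofLinearMap
    { toFun := fun f => hSeries (k := k) fun m => coeff m f
      map_add' := fun f g => by
        rw [hSeries_add]
        simp only [map_add]
      map_smul' := fun c f => by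
        exact (map_hSeries (c • (LinearMap.id : A →ₗ[k⟦X⟧] A)) fun m => coeff m f).symm }
    ((hSeries_zero_tail _ fun j => by simp [coeff_one]).trans (by simp [coeff_one]))
    fun f g => by
      refine Eq.trans ?_ (hSeries_mul (k := k) (fun m => coeff m f) fun m => coeff m g).symm
      exact congrArg (hSeries (k := k)) (funext fun m => coeff_mul m f g)

theorem sumX_eq {A : Type*} [Ring A] [Algebra k⟦X⟧ A] [IsAdicComplete (hIdeal k) A] (f : Ser A) :
    sumX k A f = hSeries (k := k) fun m => coeff m f := rfl

/-- The inverse of `ħ ^ c` in `k((ħ))`. -/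
def hInv (k : Type*) [Field k] (c : ℕ) : LaurentSeries k := HahnSeries.single (-(c : ℤ)) 1

theorem hInv_mul_X_pow (c : ℕ) :
    hInv k c * algebraMap k⟦X⟧ (LaurentSeries k) (PowerSeries.X ^ c) = 1 := by
  rw [hInv, map_pow, LaurentSeries.coe_algebraMap, HahnSeries.ofPowerSeries_X, HahnSeries.single_pow,
    HahnSeries.single_mul_single]
  simp

theorem hInv_add (c c' : ℕ) : hInv k (c + c') = hInv k c * hInv k c' := by
  rw [hInv, hInv, hInv, HahnSeries.single_mul_single]
  push_cast
  rw [neg_add, mul_one]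

theorem hInv_mul_cancel (c c' : ℕ) (a : k⟦X⟧) :
    hInv k (c + c') * algebraMap k⟦X⟧ (LaurentSeries k) (PowerSeries.X ^ c * a) =
      hInv k c' * algebraMap k⟦X⟧ (LaurentSeries k) a := by
  rw [hInv_add, _root_.map_mul, mul_assoc, mul_left_comm, ← mul_assoc (hInv k c), hInv_mul_X_pow, one_mul]

theorem rescale_injective {c : k⟦X⟧} (hc : c ≠ 0) :
    Function.Injective (rescale c : Ser k⟦X⟧ →ₐ[k⟦X⟧] Ser k⟦X⟧) := fun f g hfg => ext fun m => by
  have h1 := congrArg (coeff m) hfg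
  rw [coeff_rescale, coeff_rescale, smul_eq_mul, smul_eq_mul] at h1
  exact mul_left_cancel₀ (pow_ne_zero _ hc) h1

/-- The value of a tame series at `z = 1 / ħ`. -/
def evalInv (f : tame (hSq k)) : LaurentSeries k :=
  hInv k (mem_tame_hSq.1 f.2).choose *
    algebraMap k⟦X⟧ (LaurentSeries k) (sumX k k⟦X⟧ (mem_tame_hSq.1 f.2).choose_spec.choose)

theorem evalInv_eq {f : tame (hSq k)} {c : ℕ} {g : Ser k⟦X⟧}
    (hg : (PowerSeries.X ^ c : k⟦X⟧) • (f : Ser k⟦X⟧) = rescale (PowerSeries.X ^ 2 : k⟦X⟧) g) :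
    evalInv f = hInv k c * algebraMap k⟦X⟧ (LaurentSeries k) (sumX k k⟦X⟧ g) := by
  have h1 := (mem_tame_hSq.1 f.2).choose_spec.choose_spec
  rw [evalInv]
  set c' := (mem_tame_hSq.1 f.2).choose
  set g' := (mem_tame_hSq.1 f.2).choose_spec.choose
  have h2 : (PowerSeries.X ^ c : k⟦X⟧) • g' = (PowerSeries.X ^ c' : k⟦X⟧) • g := by
    refine rescale_injective (pow_ne_zero 2 PowerSeries.X_ne_zero) ?_
    rw [map_smul, map_smul, ← hg, ← h1, smul_comm]
  have h3 := congrArg (sumX k k⟦X⟧) h2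
  rw [map_smul, map_smul, smul_eq_mul, smul_eq_mul] at h3
  rw [← hInv_mul_cancel c c', h3, add_comm c c', hInv_mul_cancel]

variable (k) in
/-- Evaluation of tame series at `z = 1 / ħ`. -/
def evalInvHom : tame (hSq k) →ₐ[k⟦X⟧] LaurentSeries k where
  toFun := evalInv
  map_one' := by
    rw [evalInv_eq (c := 0) (g := 1) (by simp), map_one, map_one, mul_one]
    simp [hInv]
  map_zero' := by
    rw [evalInv_eq (c := 0) (g := 0) (by simp), map_zero, map_zero, mul_zero]
  map_mul' f f' := by
    obtain ⟨c, g, hg⟩ := mem_tame_hSq.1 f.2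
    obtain ⟨c', g', hg'⟩ := mem_tame_hSq.1 f'.2
    rw [evalInv_eq hg, evalInv_eq hg', evalInv_eq (c := c + c') (g := g * g'), hInv_add,
      _root_.map_mul, _root_.map_mul, mul_mul_mul_comm]
    rw [_root_.map_mul, ← hg, ← hg', smul_mul_smul_comm, pow_add]
    rfl
  map_add' f f' := by
    obtain ⟨c, g, hg⟩ := mem_tame_hSq.1 f.2
    obtain ⟨c', g', hg'⟩ := mem_tame_hSq.1 f'.2
    rw [evalInv_eq hg, evalInv_eq hg', evalInv_eq (c := c + c')
      (g := (PowerSeries.X ^ c' : k⟦X⟧) • g + (PowerSeries.X ^ c : k⟦X⟧) • g'), map_add, map_smul,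
      map_smul, map_add, mul_add, smul_eq_mul, smul_eq_mul, hInv_mul_cancel, add_comm c c', hInv_mul_cancel]
    rw [map_add, map_smul, map_smul, ← hg, ← hg', smul_smul, smul_smul, ← pow_add, ← pow_add,
      add_comm c' c, ← smul_add]
    rfl
  commutes' a := by
    rw [evalInv_eq (c := 0) (g := algebraMap k⟦X⟧ _ a), AlgHom.commutes]
    · simp [hInv]
    · rw [AlgHom.commutes, pow_zero, one_smul]
      rfl

theorem evalInvHom_eq {f : tame (hSq k)} {c : ℕ} {g : Ser k⟦X⟧}
    (hg : (PowerSeries.X ^ c : k⟦X⟧) • (f : Ser k⟦X⟧) = rescale (PowerSeries.X ^ 2 : k⟦X⟧) g) :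
    evalInvHom k f = hInv k c * algebraMap k⟦X⟧ (LaurentSeries k) (sumX k k⟦X⟧ g) := evalInv_eq hg

theorem evalInvHom_sub_sum (f : tame (hSq k)) (r : ℕ) : ∃ M₀ : ℕ, ∀ M ≥ M₀, ∃ v : k⟦X⟧,
    evalInvHom k f - ∑ m ∈ Finset.range M, hInv k m *
      algebraMap k⟦X⟧ (LaurentSeries k) (coeff m (f : Ser k⟦X⟧)) =
    algebraMap k⟦X⟧ (LaurentSeries k) (PowerSeries.X ^ r * v) := by
  obtain ⟨c, g, hg⟩ := mem_tame_hSq.1 f.2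
  refine ⟨c + r, fun M hM => ?_⟩
  obtain ⟨v, hv⟩ := hSeries_sub (k := k) (fun m => coeff m g) M
  have h1 (m : ℕ) : hInv k m * algebraMap k⟦X⟧ (LaurentSeries k) (coeff m (f : Ser k⟦X⟧)) =
      hInv k c * algebraMap k⟦X⟧ (LaurentSeries k) (PowerSeries.X ^ m * coeff m g) := by
    have h2 := congrArg (coeff m) hg
    rw [coeff_smul, coeff_rescale, smul_eq_mul, smul_eq_mul, ← pow_mul, two_mul, pow_add, mul_assoc] at h2
    rw [← hInv_mul_cancel c m, h2, add_comm c m, hInv_mul_cancel]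
  rw [evalInvHom_eq hg, Finset.sum_congr rfl fun m _ => h1 m, ← Finset.mul_sum, ← mul_sub, ← map_sum,
    ← map_sub, sumX_eq]
  simp only [smul_eq_mul] at hv
  rw [hv]
  obtain ⟨s, rfl⟩ := Nat.exists_eq_add_of_le hM
  refine ⟨PowerSeries.X ^ s * v, ?_⟩
  have h3 := hInv_mul_cancel c 0 (PowerSeries.X ^ r * (PowerSeries.X ^ s * v))
  rw [add_zero] at h3
  rw [pow_add, pow_add, mul_assoc, mul_assoc, h3]
  simp [hInv]

end Eval

end Ser

/-! ### Toral derivations -/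

section ToralDer

variable {k : Type*} [Field k] [CharZero k] {n : ℕ}
variable {h : Type*} [AddCommGroup h] [Module k⟦X⟧ h]
variable {A : Matrix (Fin n) (Fin n) ℤ} {d : Fin n → ℕ} {P : Matrix (Fin n) (Fin n) k⟦X⟧}
variable {R : Realization P h}
variable {B : Type*} [Ring B] [Algebra k⟦X⟧ B] [IsAdicComplete (hIdeal k) B]
variable {τ : h →ₗ[k⟦X⟧] B} {e f : Fin n → B}
variable {η : h →ₗ[k⟦X⟧] h →ₗ[k⟦X⟧] k⟦X⟧} {w w' v v' : h →ₗ[k⟦X⟧] Fin n → k⟦X⟧}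
variable {L M : h →ₗ[k⟦X⟧] Module.End k⟦X⟧ B}

/-- Derivations along a homomorphism are determined by their values on topological generators. -/
theorem IsTopGen.derivation_ext (hg : IsTopGen (k := k) τ e f) {Q : Type*} [Ring Q] [Algebra k⟦X⟧ Q]
    [IsHausdorff (hIdeal k) Q] (φ : B →ₐ[k⟦X⟧] Q) {δ δ' : B →ₗ[k⟦X⟧] Q}
    (hδ : ∀ x y, δ (x * y) = δ x * φ y + φ x * δ y) (hδ' : ∀ x y, δ' (x * y) = δ' x * φ y + φ x * δ' y)
    (hT : ∀ T, δ (τ T) = δ' (τ T)) (hE : ∀ i, δ (e i) = δ' (e i)) (hF : ∀ i, δ (f i) = δ' (f i)) :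
    δ = δ' := by
  have h1 {δ : B →ₗ[k⟦X⟧] Q} (hδ : ∀ x y, δ (x * y) = δ x * φ y + φ x * δ y) : δ 1 = 0 := by
    have := hδ 1 1
    rw [mul_one, map_one φ, mul_one, one_mul] at this
    exact left_eq_add.1 this
  refine hg.linearMap_ext ((h1 hδ).trans (h1 hδ').symm) ?_ ?_ ?_
  · intro T x hx
    rw [hδ, hδ', hT, hx]
  · intro T x hx
    rw [hδ, hδ', hE, hx]
  · intro T x hx
    rw [hδ, hδ', hF, hx]

/-- The extension of a derivation to the completion is a derivation. -/
theorem hatMap_derivation {A : Type*} [Ring A] [Algebra k⟦X⟧ A] {δ : A →ₗ[k⟦X⟧] A}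
    (hδ : ∀ x y, δ (x * y) = δ x * y + x * δ y) (u v : Hat k A) :
    hatMap δ (u * v) = hatMap δ u * v + u * hatMap δ v := by
  have h0 (a b : A) : hatMap δ ((toHat (k := k) a : Hat k A) * toHat (k := k) b) =
      hatMap δ (toHat (k := k) a) * toHat (k := k) b + toHat (k := k) a * hatMap δ (toHat (k := k) b) := by
    rw [hatMap_toHat, hatMap_toHat, toHat_mul, toHat_mul, toHat_mul, hatMap_toHat, hδ, map_add]
  have h1 := hat_ext₂ (f := (LinearMap.mul k⟦X⟧ (Hat k A)).compr₂ (hatMap δ))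
    (g := (LinearMap.mul k⟦X⟧ (Hat k A)).compl₁₂ (hatMap δ) LinearMap.id +
      (LinearMap.mul k⟦X⟧ (Hat k A)).compl₁₂ LinearMap.id (hatMap δ)) (fun a b => by
      rw [LinearMap.compr₂_apply, LinearMap.add_apply, LinearMap.add_apply, LinearMap.compl₁₂_apply,
        LinearMap.compl₁₂_apply]
      exact h0 a b) u v
  rw [LinearMap.compr₂_apply, LinearMap.add_apply, LinearMap.add_apply, LinearMap.compl₁₂_apply,
    LinearMap.compl₁₂_apply] at h1
  exact h1

theorem tensorMap_derivation_left {A : Type*} [Ring A] [Algebra k⟦X⟧ A] {δ : A →ₗ[k⟦X⟧] A}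
    (hδ : ∀ x y, δ (x * y) = δ x * y + x * δ y) (u v : A ⊗[k⟦X⟧] A) :
    TensorProduct.map δ LinearMap.id (u * v) =
      TensorProduct.map δ LinearMap.id u * v + u * TensorProduct.map δ LinearMap.id v := by
  induction u using TensorProduct.induction_on with
  | zero => simp
  | add u u' hu hu' => simp only [add_mul, map_add, hu, hu']; abel
  | tmul a b =>
    induction v using TensorProduct.induction_on with
    | zero => simp
    | add u u' hu hu' => simp only [mul_add, map_add, hu, hu']; abel
    | tmul a' b' => simp [hδ, TensorProduct.add_tmul]

theorem tensorMap_derivation_right {A : Type*} [Ring A] [Algebra k⟦X⟧ A] {δ : A →ₗ[k⟦X⟧] A}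
    (hδ : ∀ x y, δ (x * y) = δ x * y + x * δ y) (u v : A ⊗[k⟦X⟧] A) :
    TensorProduct.map LinearMap.id δ (u * v) =
      TensorProduct.map LinearMap.id δ u * v + u * TensorProduct.map LinearMap.id δ v := by
  induction u using TensorProduct.induction_on with
  | zero => simp
  | add u u' hu hu' => simp only [add_mul, map_add, hu, hu']; abel
  | tmul a b =>
    induction v using TensorProduct.induction_on with
    | zero => simp
    | add u u' hu hu' => simp only [mul_add, map_add, hu, hu']; abel
    | tmul a' b' => simp [hδ, TensorProduct.tmul_add]

theorem derivation_hexp {δ : B →ₗ[k⟦X⟧] B} (hδ : ∀ x y, δ (x * y) = δ x * y + x * δ y) {x : B}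
    {c : k⟦X⟧} (hx : δ x = algebraMap k⟦X⟧ B c) :
    δ (hexp (k := k) x) = (PowerSeries.X * c : k⟦X⟧) • hexp (k := k) x := by
  have h1 (j : ℕ) : δ ((C (((j + 1).factorial : k)⁻¹) : k⟦X⟧) • x ^ (j + 1)) =
      c • (C ((j.factorial : k)⁻¹) : k⟦X⟧) • x ^ j := by
    have h2 : ∀ j : ℕ, δ (x ^ (j + 1)) = ((j + 1 : ℕ) : k⟦X⟧) • c • x ^ j := fun j => by
      induction j with
      | zero => simp [hx, Algebra.smul_def]
      | succ j ih =>
        rw [pow_succ' x (j + 1), hδ, ih, hx, mul_smul_comm, mul_smul_comm, ← pow_succ', ← Algebra.smul_def]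
        rw [Nat.cast_succ (j + 1), add_smul, one_smul, add_comm]
    have h3 : (C (((j + 1).factorial : k)⁻¹) : k⟦X⟧) * ((j + 1 : ℕ) : k⟦X⟧) = C ((j.factorial : k)⁻¹) := by
      rw [← map_natCast (C (R := k)), ← map_mul, Nat.factorial_succ]
      congr 1
      have h4 : ((j + 1 : ℕ) : k) ≠ 0 := Nat.cast_ne_zero.2 (Nat.succ_ne_zero j)
      push_cast at h4 ⊢
      have h5 : (j.factorial : k) ≠ 0 := Nat.cast_ne_zero.2 (Nat.factorial_ne_zero _)
      field_simp
    rw [map_smul, h2, smul_smul, h3, smul_comm]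
  have h0 : δ 1 = 0 := by
    have := hδ 1 1
    rw [mul_one, mul_one, one_mul] at this
    exact left_eq_add.1 this
  refine (map_hSeries δ fun j => (C ((j.factorial : k)⁻¹) : k⟦X⟧) • x ^ j).trans (hSeries_unique (k := k) (s := (PowerSeries.X * c : k⟦X⟧) • hexp (k := k) x) fun m => ?_).symm
  cases m with
  | zero => exact ⟨(PowerSeries.X * c : k⟦X⟧) • hexp (k := k) x, by simp⟩
  | succ m =>
    obtain ⟨y, hy⟩ := hSeries_sub (k := k) (fun j => (C ((j.factorial : k)⁻¹) : k⟦X⟧) • x ^ j) m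
    rw [← hexp] at hy
    refine ⟨c • y, ?_⟩
    rw [smul_comm (PowerSeries.X ^ (m + 1) : k⟦X⟧), pow_succ', mul_smul (PowerSeries.X : k⟦X⟧) (PowerSeries.X ^ m : k⟦X⟧), ← hy, Finset.sum_range_succ']
    simp only [h1, pow_zero, Nat.factorial_zero, map_smul, h0, smul_zero, add_zero, smul_sub,
      Finset.smul_sum, hexp]
    congr 1
    · rw [mul_smul, smul_comm]
    · refine Finset.sum_congr rfl fun j _ => ?_
      simp only [smul_smul]
      congr 1
      ring

/-- The derivations `L T` that map `T'` to `η (T, T')` and rescale the generators `e i` and `f i`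
by multiples of `ħ`. -/
structure IsToralDer (η : h →ₗ[k⟦X⟧] h →ₗ[k⟦X⟧] k⟦X⟧) (w w' : h →ₗ[k⟦X⟧] Fin n → k⟦X⟧)
    (τ : h →ₗ[k⟦X⟧] B) (e f : Fin n → B) (L : h →ₗ[k⟦X⟧] Module.End k⟦X⟧ B) : Prop where
  mul : ∀ T x y, L T (x * y) = L T x * y + x * L T y
  tor : ∀ T T', L T (τ T') = algebraMap k⟦X⟧ B (η T T')
  E : ∀ T i, L T (e i) = (PowerSeries.X * w T i : k⟦X⟧) • e i
  F : ∀ T i, L T (f i) = (PowerSeries.X * w' T i : k⟦X⟧) • f i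

theorem Ser.coeff_hexp_single_algebraMap (c : k⟦X⟧) (m : ℕ) :
    Ser.coeff m (hexp (k := k) (Ser.single (algebraMap k⟦X⟧ B c))) =
      algebraMap k⟦X⟧ B (PowerSeries.X ^ m * (C ((m.factorial : k)⁻¹) * c ^ m)) := by
  rw [Ser.hexp_single, Ser.coeff_rescale, Ser.coeff_expS, ← map_pow, Algebra.smul_def,
    Algebra.smul_def, ← map_mul, ← map_mul]

theorem Ser.commute_single_algebraMap (c : k⟦X⟧) (x : Ser B) :
    Commute (Ser.single (algebraMap k⟦X⟧ B c)) x := Ser.commute_of_forall fun m m' => by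
  rw [Ser.coeff_single]
  split_ifs
  · exact Algebra.commute_algebraMap_left _ _
  · exact Commute.zero_left _

theorem exists_isToralDer (hg : IsTopGen (k := k) τ e f)
    (hφ : ∀ T, ∃ φ : B →ₐ[k⟦X⟧] Ser B,
      (∀ T', φ (τ T') = Ser.const (k := k) (τ T') + Ser.single (algebraMap k⟦X⟧ B (η T T'))) ∧
      (∀ i, φ (e i) = hexp (k := k) (Ser.single (algebraMap k⟦X⟧ B (w T i))) * Ser.const (k := k) (e i)) ∧
      ∀ i, φ (f i) = hexp (k := k) (Ser.single (algebraMap k⟦X⟧ B (w' T i))) *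
        Ser.const (k := k) (f i)) :
    ∃ L : h →ₗ[k⟦X⟧] Module.End k⟦X⟧ B, IsToralDer η w w' τ e f L := by
  choose φ h1 h2 h3 using hφ
  have h0 (T : h) (x : B) : Ser.coeff 0 (φ T x) = x := by
    have : (Ser.coeffₗ (k := k) 0 ∘ₗ (φ T).toLinearMap) = LinearMap.id := by
      refine hg.linearMap_ext ?_ (fun T x hx => ?_) (fun i x hx => ?_) (fun i x hx => ?_)
      · simp [Ser.coeff_one]
      all_goals
        simp only [LinearMap.comp_apply, AlgHom.toLinearMap_apply, Ser.coeffₗ_apply, map_mul,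
          LinearMap.id_apply, Ser.coeff_mul, Finset.Nat.antidiagonal_zero, Finset.sum_singleton,
          h1, h2, h3] at hx ⊢
        simp [hx, Ser.coeff_const, Ser.coeff_single, Ser.coeff_hexp_single_algebraMap]
    exact LinearMap.congr_fun this x
  let L (T : h) : Module.End k⟦X⟧ B := Ser.coeffₗ (k := k) 1 ∘ₗ (φ T).toLinearMap
  have hL (T : h) (x : B) : L T x = Ser.coeff 1 (φ T x) := rfl
  have hmul (T : h) (x y : B) : L T (x * y) = L T x * y + x * L T y := by
    simp only [hL, map_mul]
    simp [Ser.coeff_mul, Finset.Nat.antidiagonal_succ, h0, add_comm]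
  have htor (T T' : h) : L T (τ T') = algebraMap k⟦X⟧ B (η T T') := by
    simp [hL, h1, Ser.coeff_const, Ser.coeff_single]
  have hE (T : h) (i : Fin n) : L T (e i) = (PowerSeries.X * w T i : k⟦X⟧) • e i := by
    rw [hL, h2, Ser.coeff_mul_const, Ser.coeff_hexp_single_algebraMap, ← Algebra.smul_def]
    simp
  have hF (T : h) (i : Fin n) : L T (f i) = (PowerSeries.X * w' T i : k⟦X⟧) • f i := by
    rw [hL, h3, Ser.coeff_mul_const, Ser.coeff_hexp_single_algebraMap, ← Algebra.smul_def]
    simp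
  refine ⟨{ toFun := L
            map_add' := fun T T' => hg.derivation_ext (AlgHom.id k⟦X⟧ B) (hmul _) (fun x y => ?_)
              (fun T'' => ?_) (fun i => ?_) (fun i => ?_)
            map_smul' := fun c T => hg.derivation_ext (AlgHom.id k⟦X⟧ B) (hmul _) (fun x y => ?_)
              (fun T'' => ?_) (fun i => ?_) (fun i => ?_) }, hmul, htor, hE, hF⟩
  · simp only [LinearMap.add_apply, hmul, AlgHom.coe_id, id_eq, add_mul, mul_add]
    abel
  · simp [htor]
  · simp [hE, mul_add, add_smul]
  · simp [hF, mul_add, add_smul]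
  · simp [hmul]
  · simp [htor, Algebra.smul_def]
  · simp [hE, smul_smul, mul_left_comm]
  · simp [hF, smul_smul, mul_left_comm]

variable (A d R) in
theorem UAlg.exists_isToralDer (hη : ∀ i x, η x (R.Tneg i) = -η x (R.Tpos i))
    (hw : ∀ T i, w T i + w' T i = η T (R.Tpos i)) :
    ∃ L, IsToralDer η w w' (UAlg.torₗ A d R) (UAlg.E A d R) (UAlg.F A d R) L := by
  refine FoMpQUEA.exists_isToralDer (UAlg.isTopGen A d R) fun T => ?_
  let l : h →ₗ[k⟦X⟧] Ser (UAlg A d R) :=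
    { toFun := fun T' => Ser.single (algebraMap k⟦X⟧ (UAlg A d R) (η T T'))
      map_add' := fun x y => by rw [map_add, map_add, Ser.single_add]
      map_smul' := fun c x => by
        rw [map_smul, smul_eq_mul, map_mul, ← Algebra.smul_def, Ser.single_smul, RingHom.id_apply] }
  have h1 := ((UAlg.isGenRel A d R).map (Ser.const (k := k) (A := UAlg A d R))).scale l
    (fun i => hexp (k := k) (Ser.single (algebraMap k⟦X⟧ (UAlg A d R) (w T i))))
    (fun i => hexp (k := k) (Ser.single (algebraMap k⟦X⟧ (UAlg A d R) (w' T i))))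
    (fun T' x => Ser.commute_single_algebraMap _ x)
    (fun i x => commute_hexp_left (Ser.commute_single_algebraMap _ x))
    (fun i x => commute_hexp_left (Ser.commute_single_algebraMap _ x))
    (fun i => by
      rw [← hexp_add (Ser.commute_single_algebraMap _ _), ← Ser.single_add, ← map_add, hw]
      rfl)
    (fun i => by
      change Ser.single _ = -Ser.single _
      rw [hη, map_neg, Ser.single_neg])
  exact ⟨h1.lift, IsGenRel.lift_tor _, IsGenRel.lift_E _, IsGenRel.lift_F _⟩

namespace IsToralDer

variable (hL : IsToralDer η w w' τ e f L)

include hL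

theorem map_one (T : h) : L T 1 = 0 := by
  have := hL.mul T 1 1
  rw [mul_one, mul_one, one_mul] at this
  exact left_eq_add.1 this

theorem map_algebraMap (T : h) (c : k⟦X⟧) : L T (algebraMap k⟦X⟧ B c) = 0 := by
  rw [Algebra.algebraMap_eq_smul_one, map_smul, hL.map_one, smul_zero]

theorem eq_of (hg : IsTopGen (k := k) τ e f) {T : h} {δ : Module.End k⟦X⟧ B}
    (hδ : ∀ x y, δ (x * y) = δ x * y + x * δ y) (hT : ∀ T', δ (τ T') = algebraMap k⟦X⟧ B (η T T'))
    (hE : ∀ i, δ (e i) = (PowerSeries.X * w T i : k⟦X⟧) • e i)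
    (hF : ∀ i, δ (f i) = (PowerSeries.X * w' T i : k⟦X⟧) • f i) : L T = δ :=
  hg.derivation_ext (AlgHom.id k⟦X⟧ B) (hL.mul T) hδ (fun T' => by rw [hL.tor, hT])
    (fun i => by rw [hL.E, hE]) (fun i => by rw [hL.F, hF])

theorem eq_neg (hg : IsTopGen (k := k) τ e f) {T T' : h} (h1 : η T = -η T') (h2 : w T = -w T')
    (h3 : w' T = -w' T') : L T = -L T' := by
  refine hL.eq_of hg (fun x y => ?_) (fun S => ?_) (fun i => ?_) (fun i => ?_)
  · simp only [LinearMap.neg_apply, hL.mul, neg_add, neg_mul, mul_neg]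
  · rw [LinearMap.neg_apply, hL.tor, h1, LinearMap.neg_apply, map_neg]
  · rw [LinearMap.neg_apply, hL.E, h2, Pi.neg_apply, mul_neg, neg_smul]
  · rw [LinearMap.neg_apply, hL.F, h3, Pi.neg_apply, mul_neg, neg_smul]

theorem commute (hg : IsTopGen (k := k) τ e f) (hM : IsToralDer η v v' τ e f M) (T T' : h) :
    Commute (L T) (M T') := by
  change L T * M T' = M T' * L T
  rw [← sub_eq_zero]
  refine hg.derivation_ext (AlgHom.id k⟦X⟧ B) (fun x y => ?_) (fun x y => ?_) (fun S => ?_) (fun i => ?_)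
    (fun i => ?_)
  · simp only [LinearMap.sub_apply, Module.End.mul_apply, hL.mul, hM.mul, map_add, AlgHom.coe_id, id_eq,
      sub_mul, mul_sub]
    abel
  · simp
  · rw [LinearMap.sub_apply, Module.End.mul_apply, Module.End.mul_apply, hL.tor, hM.tor,
      hL.map_algebraMap, hM.map_algebraMap, sub_self, LinearMap.zero_apply]
  · rw [LinearMap.sub_apply, Module.End.mul_apply, Module.End.mul_apply, hL.E, hM.E, map_smul, map_smul,
      hL.E, hM.E, smul_comm, sub_self, LinearMap.zero_apply]
  · rw [LinearMap.sub_apply, Module.End.mul_apply, Module.End.mul_apply, hL.F, hM.F, map_smul, map_smul,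
      hL.F, hM.F, smul_comm, sub_self, LinearMap.zero_apply]

theorem hexp (T T' : h) : L T (hexp (k := k) (τ T')) =
    (PowerSeries.X * η T T' : k⟦X⟧) • FoMpQUEA.hexp (k := k) (τ T') :=
  derivation_hexp (hL.mul T) (hL.tor T T')

theorem hexp_neg (T T' : h) : L T (FoMpQUEA.hexp (k := k) (-τ T')) =
    (-(PowerSeries.X * η T T') : k⟦X⟧) • FoMpQUEA.hexp (k := k) (-τ T') := by
  rw [← map_neg, hL.hexp, map_neg, mul_neg]

variable {Δ : B →ₐ[k⟦X⟧] HatTensor k B B} {ε : B →ₐ[k⟦X⟧] k⟦X⟧} {S : B →ₐ[k⟦X⟧] Bᵐᵒᵖ}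
  (H : IsStdHopf R τ e f Δ ε S)

include H

/-- The derivation that does not act on the `f i` acts on coproducts through the left factor. -/
theorem comul_left (hw : ∀ T i, w T i = η T (R.Tpos i)) (hw' : w' = 0) (T : h) (x : B) :
    Δ (L T x) = hatMap (TensorProduct.map (L T) LinearMap.id) (Δ x) := by
  have h1 := hatMap_derivation (tensorMap_derivation_left (hL.mul T))
  have h2 : Δ.toLinearMap ∘ₗ L T =
      hatMap (TensorProduct.map (L T) LinearMap.id) ∘ₗ Δ.toLinearMap := by
    refine H.gen.derivation_ext Δ (fun x y => ?_) (fun x y => ?_) (fun T' => ?_) (fun i => ?_)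
      (fun i => ?_) <;> simp only [LinearMap.comp_apply, AlgHom.toLinearMap_apply]
    · rw [hL.mul, map_add Δ, _root_.map_mul Δ, _root_.map_mul Δ]
    · rw [_root_.map_mul Δ, h1]
    · rw [hL.tor, H.comul_tor, hatMap_toHat, AlgHom.commutes, map_add, TensorProduct.map_tmul,
        TensorProduct.map_tmul, hL.tor, hL.map_one, TensorProduct.zero_tmul, add_zero,
        Algebra.algebraMap_eq_smul_one, Algebra.algebraMap_eq_smul_one, ← TensorProduct.smul_tmul', map_smul]
      rfl
    · rw [hL.E, map_smul Δ, H.comul_E, hatMap_toHat, map_add (TensorProduct.map _ _), TensorProduct.map_tmul,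
        TensorProduct.map_tmul, hL.E, hL.hexp, hw, ← map_smul, smul_add, TensorProduct.smul_tmul',
        TensorProduct.smul_tmul']
      rfl
    · rw [hL.F, H.comul_F, hatMap_toHat, map_smul Δ, map_add, TensorProduct.map_tmul,
        TensorProduct.map_tmul, hL.F, hL.map_one, hw']
      simp
  exact LinearMap.congr_fun h2 x

/-- The derivation that does not act on the `e i` acts on coproducts through the right factor. -/
theorem comul_right (hη : ∀ i x, η x (R.Tneg i) = -η x (R.Tpos i)) (hw : w = 0)
    (hw' : ∀ T i, w' T i = η T (R.Tpos i)) (T : h) (x : B) :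
    Δ (L T x) = hatMap (TensorProduct.map LinearMap.id (L T)) (Δ x) := by
  have h1 := hatMap_derivation (tensorMap_derivation_right (hL.mul T))
  have h2 : Δ.toLinearMap ∘ₗ L T =
      hatMap (TensorProduct.map LinearMap.id (L T)) ∘ₗ Δ.toLinearMap := by
    refine H.gen.derivation_ext Δ (fun x y => ?_) (fun x y => ?_) (fun T' => ?_) (fun i => ?_)
      (fun i => ?_) <;> simp only [LinearMap.comp_apply, AlgHom.toLinearMap_apply]
    · rw [hL.mul, map_add Δ, _root_.map_mul Δ, _root_.map_mul Δ]
    · rw [_root_.map_mul Δ, h1]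
    · rw [hL.tor, H.comul_tor, hatMap_toHat, AlgHom.commutes, map_add, TensorProduct.map_tmul,
        TensorProduct.map_tmul, hL.tor, hL.map_one, TensorProduct.tmul_zero, zero_add,
        Algebra.algebraMap_eq_smul_one, Algebra.algebraMap_eq_smul_one, TensorProduct.tmul_smul, map_smul]
      rfl
    · rw [hL.E, H.comul_E, hatMap_toHat, map_smul Δ, map_add, TensorProduct.map_tmul,
        TensorProduct.map_tmul, hL.E, hL.map_one, hw]
      simp
    · rw [hL.F, map_smul Δ, H.comul_F, hatMap_toHat, map_add (TensorProduct.map _ _), TensorProduct.map_tmul,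
        TensorProduct.map_tmul, hL.F, hL.hexp_neg, hη, hw', mul_neg, neg_neg, ← map_smul, smul_add,
        TensorProduct.tmul_smul, TensorProduct.tmul_smul]
      rfl
  exact LinearMap.congr_fun h2 x

theorem counit_eq (hM : IsToralDer η v v' τ e f M) (T : h) (x : B) : ε (L T x) = ε (M T x) := by
  have h2 : ε.toLinearMap ∘ₗ L T = ε.toLinearMap ∘ₗ M T := by
    refine H.gen.derivation_ext ε (fun x y => ?_) (fun x y => ?_) (fun T' => ?_) (fun i => ?_)
      (fun i => ?_) <;> simp only [LinearMap.comp_apply, AlgHom.toLinearMap_apply]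
    · rw [hL.mul, map_add ε, _root_.map_mul ε, _root_.map_mul ε]
    · rw [hM.mul, map_add ε, _root_.map_mul ε, _root_.map_mul ε]
    · rw [hL.tor, hM.tor]
    · rw [hL.E, hM.E, map_smul ε, map_smul ε, H.counit_E, smul_zero, smul_zero]
    · rw [hL.F, hM.F, map_smul ε, map_smul ε, H.counit_F, smul_zero, smul_zero]
  exact LinearMap.congr_fun h2 x

end IsToralDer

end ToralDer

/-! ### Toral representations -/

section ToralRep

variable {k : Type*} [Field k] [CharZero k] {n : ℕ}
variable {h : Type*} [AddCommGroup h] [Module k⟦X⟧ h]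
variable {A : Matrix (Fin n) (Fin n) ℤ} {d : Fin n → ℕ} {P : Matrix (Fin n) (Fin n) k⟦X⟧}
variable {R : Realization P h}
variable {B : Type*} [Ring B] [Algebra k⟦X⟧ B] [IsAdicComplete (hIdeal k) B]
variable {τ : h →ₗ[k⟦X⟧] B} {e f : Fin n → B}
variable {η : h →ₗ[k⟦X⟧] h →ₗ[k⟦X⟧] k⟦X⟧}
variable {L M : h →ₗ[k⟦X⟧] Module.End k⟦X⟧ B}
variable {Λ N : B →ₐ[k⟦X⟧] Ser (Module.End k⟦X⟧ B)}

/-- Commuting elements satisfy the relations of the toral elements, together with `e = f = 0`. -/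
theorem IsGenRel.toral {Q : Type*} [Ring Q] [Algebra k⟦X⟧ Q] [IsAdicComplete (hIdeal k) Q]
    {σ : h →ₗ[k⟦X⟧] Q} (hσ : ∀ T T', Commute (σ T) (σ T'))
    (hneg : ∀ i, σ (R.Tneg i) = -σ (R.Tpos i)) :
    IsGenRel A d R σ (fun _ => (0 : Q)) (fun _ => (0 : Q)) where
  comm T T' := hσ T T'
  tor_E T j := by simp
  tor_F T j := by simp
  E_F_ne i j _ := by simp
  E_F i := by simp [hneg]
  serre_E i j _ := by simp [serre]
  serre_F i j _ := by simp [serre]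

/-- The form `(T, i) ↦ η (T, Tp i)`. -/
def rowForm (η : h →ₗ[k⟦X⟧] h →ₗ[k⟦X⟧] k⟦X⟧) (Tp : Fin n → h) : h →ₗ[k⟦X⟧] Fin n → k⟦X⟧ :=
  LinearMap.pi fun i => η.flip (Tp i)

theorem rowForm_apply (η : h →ₗ[k⟦X⟧] h →ₗ[k⟦X⟧] k⟦X⟧) (Tp : Fin n → h) (T : h) (i : Fin n) :
    rowForm η Tp T i = η T (Tp i) := rfl

/-- The representation of the toral elements by `z L T`. -/
structure IsToralRep (τ : h →ₗ[k⟦X⟧] B) (e f : Fin n → B) (L : h →ₗ[k⟦X⟧] Module.End k⟦X⟧ B)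
    (Λ : B →ₐ[k⟦X⟧] Ser (Module.End k⟦X⟧ B)) : Prop where
  tor : ∀ T, Λ (τ T) = Ser.single (L T)
  E : ∀ i, Λ (e i) = 0
  F : ∀ i, Λ (f i) = 0

variable (A d R) in
theorem UAlg.exists_isToralRep {L : h →ₗ[k⟦X⟧] Module.End k⟦X⟧ (UAlg A d R)}
    (hL : ∀ T T', Commute (L T) (L T')) (hneg : ∀ i, L (R.Tneg i) = -L (R.Tpos i)) :
    ∃ Λ, IsToralRep (UAlg.torₗ A d R) (UAlg.E A d R) (UAlg.F A d R) L Λ := by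
  let l : h →ₗ[k⟦X⟧] Ser (Module.End k⟦X⟧ (UAlg A d R)) :=
    { toFun := fun T => Ser.single (L T)
      map_add' := fun x y => by rw [map_add, Ser.single_add]
      map_smul' := fun c x => by rw [map_smul, Ser.single_smul, RingHom.id_apply] }
  have h1 : IsGenRel A d R l (fun _ => 0) (fun _ => 0) :=
    IsGenRel.toral (fun T T' => Ser.commute_single (hL T T')) (fun i => by
      change Ser.single _ = -Ser.single _
      rw [hneg, Ser.single_neg])
  exact ⟨h1.lift, IsGenRel.lift_tor _, IsGenRel.lift_E _, IsGenRel.lift_F _⟩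

namespace IsToralRep

theorem rescale_neg_one (hΛ : IsToralRep τ e f L Λ) :
    IsToralRep τ e f (-L) ((Ser.rescale (-1 : k⟦X⟧)).comp Λ) where
  tor T := by
    rw [AlgHom.comp_apply, hΛ.tor, ← Ser.single_smul_eq_rescale, neg_one_smul, LinearMap.neg_apply]
  E i := by rw [AlgHom.comp_apply, hΛ.E, map_zero]
  F i := by rw [AlgHom.comp_apply, hΛ.F, map_zero]

theorem commute_of (hΛ : IsToralRep τ e f L Λ) (hg : IsTopGen (k := k) τ e f)
    {u : Ser (Module.End k⟦X⟧ B)} (hu : ∀ T, Commute u (Ser.single (L T))) (x : B) :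
    Commute u (Λ x) := by
  have h1 : LinearMap.mulLeft k⟦X⟧ u ∘ₗ Λ.toLinearMap = LinearMap.mulRight k⟦X⟧ u ∘ₗ Λ.toLinearMap := by
    refine hg.linearMap_ext ?_ (fun T x hx => ?_) (fun i x hx => ?_) (fun i x hx => ?_)
    · simp
    all_goals simp only [LinearMap.comp_apply, AlgHom.toLinearMap_apply, LinearMap.mulLeft_apply,
        LinearMap.mulRight_apply, map_mul] at hx ⊢
    · rw [hΛ.tor, ← mul_assoc, (hu T).eq, mul_assoc, hx, mul_assoc]
    · rw [hΛ.E, zero_mul, mul_zero, zero_mul]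
    · rw [hΛ.F, zero_mul, mul_zero, zero_mul]
  exact LinearMap.congr_fun h1 x

theorem commute (hΛ : IsToralRep τ e f L Λ) (hN : IsToralRep τ e f M N) (hg : IsTopGen (k := k) τ e f)
    (hLM : ∀ T T', Commute (L T) (M T')) (x y : B) : Commute (Λ x) (N y) :=
  hN.commute_of hg (fun T' => (hΛ.commute_of hg (fun T => Ser.commute_single (hLM T T').symm) x).symm) y

theorem commute_coeff (hΛ : IsToralRep τ e f L Λ) (hg : IsTopGen (k := k) τ e f)
    {D : Module.End k⟦X⟧ B} (hD : ∀ T, Commute D (L T)) (m : ℕ) (x y : B) :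
    D (Ser.coeff m (Λ x) y) = Ser.coeff m (Λ x) (D y) := by
  have h1 := hΛ.commute_of hg (u := Ser.const (k := k) D) (fun T => Ser.commute_of_forall fun m m' => by
    rw [Ser.coeff_const, Ser.coeff_single]
    split_ifs <;> simp [hD]) x
  have h2 := congrArg (Ser.coeff m) h1.eq
  rw [Ser.coeff_const_mul, Ser.coeff_mul_const] at h2
  exact LinearMap.congr_fun h2 y

theorem coeff_tor_mul_zero (hΛ : IsToralRep τ e f L Λ) (T : h) (x : B) :
    Ser.coeff 0 (Λ (τ T * x)) = 0 := by
  rw [map_mul, hΛ.tor, Ser.coeff_single_mul_zero]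

theorem coeff_tor_mul_succ (hΛ : IsToralRep τ e f L Λ) (T : h) (x : B) (m : ℕ) :
    Ser.coeff (m + 1) (Λ (τ T * x)) = L T * Ser.coeff m (Λ x) := by
  rw [map_mul, hΛ.tor, Ser.coeff_single_mul_succ]

theorem E_mul (hΛ : IsToralRep τ e f L Λ) (i : Fin n) (x : B) : Λ (e i * x) = 0 := by
  rw [map_mul, hΛ.E, zero_mul]

theorem F_mul (hΛ : IsToralRep τ e f L Λ) (i : Fin n) (x : B) : Λ (f i * x) = 0 := by
  rw [map_mul, hΛ.F, zero_mul]

/-- Two toral representations have the same coefficients after a map that identifies the operators. -/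
theorem apply_coeff_eq (hΛ : IsToralRep τ e f L Λ) (hN : IsToralRep τ e f M N)
    (hg : IsTopGen (k := k) τ e f) (hLM : ∀ T T', Commute (L T) (M T'))
    (hMM : ∀ T T', Commute (M T) (M T')) {Q : Type*} [AddCommGroup Q]
    [Module k⟦X⟧ Q] [IsAdicComplete (hIdeal k) Q] {φ : B →ₗ[k⟦X⟧] Q} (hφ : ∀ T y, φ (L T y) = φ (M T y))
    (m : ℕ) (x y : B) : φ (Ser.coeff m (Λ x) y) = φ (Ser.coeff m (N x) y) := by
  induction m generalizing x y with
  | zero =>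
    have h1 : φ ∘ₗ LinearMap.applyₗ y ∘ₗ Ser.coeffₗ (k := k) 0 ∘ₗ Λ.toLinearMap =
        φ ∘ₗ LinearMap.applyₗ y ∘ₗ Ser.coeffₗ (k := k) 0 ∘ₗ N.toLinearMap := by
      refine hg.linearMap_ext ?_ (fun T x hx => ?_) (fun i x hx => ?_) (fun i x hx => ?_) <;>
        simp only [LinearMap.comp_apply, AlgHom.toLinearMap_apply, LinearMap.applyₗ_apply_apply,
          Ser.coeffₗ_apply]
      · rw [map_one Λ, map_one N]
      · rw [hΛ.coeff_tor_mul_zero, hN.coeff_tor_mul_zero]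
      · rw [hΛ.E_mul, hN.E_mul]
      · rw [hΛ.F_mul, hN.F_mul]
    exact LinearMap.congr_fun h1 x
  | succ m ih =>
    have h1 : φ ∘ₗ LinearMap.applyₗ y ∘ₗ Ser.coeffₗ (k := k) (m + 1) ∘ₗ Λ.toLinearMap =
        φ ∘ₗ LinearMap.applyₗ y ∘ₗ Ser.coeffₗ (k := k) (m + 1) ∘ₗ N.toLinearMap := by
      refine hg.linearMap_ext ?_ (fun T x hx => ?_) (fun i x hx => ?_) (fun i x hx => ?_) <;>
        simp only [LinearMap.comp_apply, AlgHom.toLinearMap_apply, LinearMap.applyₗ_apply_apply,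
          Ser.coeffₗ_apply]
      · rw [map_one Λ, map_one N]
      · rw [hΛ.coeff_tor_mul_succ, hN.coeff_tor_mul_succ, Module.End.mul_apply, Module.End.mul_apply, hφ,
          hΛ.commute_coeff hg (fun T' => (hLM T' T).symm), ih,
          hN.commute_coeff hg (fun T' => hMM T T')]
      · rw [hΛ.E_mul, hN.E_mul]
      · rw [hΛ.F_mul, hN.F_mul]
    exact LinearMap.congr_fun h1 x

end IsToralRep

/-- The map `a ⊗ b ↦ g a • b`. -/
def leftAct : (B →ₗ[k⟦X⟧] k⟦X⟧) →ₗ[k⟦X⟧] HatTensor k B B →ₗ[k⟦X⟧] B :=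
  hatExtend ∘ₗ TensorProduct.uncurry (RingHom.id k⟦X⟧) B B B ∘ₗ
    LinearMap.compRight k⟦X⟧ (LinearMap.lsmul k⟦X⟧ B)

/-- The map `a ⊗ b ↦ g b • a`. -/
def rightAct : (B →ₗ[k⟦X⟧] k⟦X⟧) →ₗ[k⟦X⟧] HatTensor k B B →ₗ[k⟦X⟧] B :=
  hatExtend ∘ₗ TensorProduct.uncurry (RingHom.id k⟦X⟧) B B B ∘ₗ LinearMap.lflip.toLinearMap ∘ₗ
    LinearMap.compRight k⟦X⟧ (LinearMap.lsmul k⟦X⟧ B)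

theorem leftAct_toHat (g : B →ₗ[k⟦X⟧] k⟦X⟧) (x y : B) :
    leftAct g (toHat (k := k) (x ⊗ₜ[k⟦X⟧] y)) = g x • y :=
  hatExtend_toHat _ _

theorem rightAct_toHat (g : B →ₗ[k⟦X⟧] k⟦X⟧) (x y : B) :
    rightAct g (toHat (k := k) (x ⊗ₜ[k⟦X⟧] y)) = g y • x :=
  hatExtend_toHat _ _

theorem leftAct_hatMap (g : B →ₗ[k⟦X⟧] k⟦X⟧) (D : Module.End k⟦X⟧ B) (u : HatTensor k B B) :
    leftAct g (hatMap (TensorProduct.map D LinearMap.id) u) = leftAct (g ∘ₗ D) u := by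
  have h1 : leftAct g ∘ₗ hatMap (TensorProduct.map D LinearMap.id) = leftAct (g ∘ₗ D) :=
    hatTensor_ext fun x y => by
      rw [LinearMap.comp_apply, hatMap_toHat, TensorProduct.map_tmul, leftAct_toHat, leftAct_toHat]
      rfl
  exact LinearMap.congr_fun h1 u

theorem rightAct_hatMap (g : B →ₗ[k⟦X⟧] k⟦X⟧) (D : Module.End k⟦X⟧ B) (u : HatTensor k B B) :
    rightAct g (hatMap (TensorProduct.map LinearMap.id D) u) = rightAct (g ∘ₗ D) u := by
  have h1 : rightAct g ∘ₗ hatMap (TensorProduct.map LinearMap.id D) = rightAct (g ∘ₗ D) :=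
    hatTensor_ext fun x y => by
      rw [LinearMap.comp_apply, hatMap_toHat, TensorProduct.map_tmul, rightAct_toHat, rightAct_toHat]
      rfl
  exact LinearMap.congr_fun h1 u

/-- The series `∑ ε (f m y) z ^ m` for a series `∑ f m z ^ m` of operators. -/
def serPair (ε : B →ₗ[k⟦X⟧] k⟦X⟧) :
    Ser (Module.End k⟦X⟧ B) →ₗ[k⟦X⟧] B →ₗ[k⟦X⟧] Ser k⟦X⟧ :=
  LinearMap.mk₂ k⟦X⟧ (fun f y => Ser.mk fun m => ε (Ser.coeff m f y))
    (fun f g y => Ser.ext fun m => by simp) (fun c f y => Ser.ext fun m => by simp)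
    (fun f y z => Ser.ext fun m => by simp) (fun c f y => Ser.ext fun m => by simp)

@[simp] theorem coeff_serPair (ε : B →ₗ[k⟦X⟧] k⟦X⟧) (u : Ser (Module.End k⟦X⟧ B)) (y : B) (m : ℕ) :
    Ser.coeff m (serPair ε u y) = ε (Ser.coeff m u y) :=
  (Ser.coeff_mk (fun m => ε (Ser.coeff m u y)) m :)

namespace IsToralRep

theorem coeff_eq_act (hΛ : IsToralRep τ e f L Λ) (hg : IsTopGen (k := k) τ e f)
    (hLL : ∀ T T', Commute (L T) (L T')) {ε : B →ₗ[k⟦X⟧] k⟦X⟧}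
    {G : (B →ₗ[k⟦X⟧] k⟦X⟧) →ₗ[k⟦X⟧] Module.End k⟦X⟧ B} (hG₀ : ∀ y, G ε y = y)
    (hG : ∀ T g y, G g (L T y) = G (g ∘ₗ L T) y) (m : ℕ) (x y : B) :
    Ser.coeff m (Λ x) y = G (ε ∘ₗ Ser.coeff m (Λ x)) y := by
  let Φ (m : ℕ) : B →ₗ[k⟦X⟧] Module.End k⟦X⟧ B := Ser.coeffₗ (k := k) m ∘ₗ Λ.toLinearMap
  suffices h1 : LinearMap.applyₗ y ∘ₗ Φ m =
      LinearMap.applyₗ y ∘ₗ G ∘ₗ LinearMap.compRight k⟦X⟧ ε ∘ₗ Φ m from LinearMap.congr_fun h1 x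
  have hΦ (m : ℕ) (x : B) : Φ m x = Ser.coeff m (Λ x) := rfl
  have hΨ (u : Module.End k⟦X⟧ B) : LinearMap.compRight k⟦X⟧ ε u = ε ∘ₗ u := rfl
  have h0 (r : B) (hr : Λ r = 0) (x : B) : Φ m (r * x) = 0 := by
    rw [hΦ, map_mul, hr, zero_mul, map_zero]
  induction m generalizing x y with
  | zero =>
    refine hg.linearMap_ext ?_ (fun T x hx => ?_) (fun i x hx => ?_) (fun i x hx => ?_) <;>
      simp only [LinearMap.comp_apply, LinearMap.applyₗ_apply_apply]
    · rw [hΦ, map_one Λ, Ser.coeff_one, if_pos rfl]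
      exact (hG₀ y).symm
    · rw [hΦ, hΛ.coeff_tor_mul_zero, map_zero, map_zero]
    · rw [h0 _ (hΛ.E i), map_zero, map_zero]
    · rw [h0 _ (hΛ.F i), map_zero, map_zero]
  | succ m ih =>
    have ih (x y : B) := LinearMap.congr_fun (ih x y fun r hr x => by
      rw [hΦ, map_mul, hr, zero_mul, map_zero]) x
    simp only [LinearMap.comp_apply, LinearMap.applyₗ_apply_apply] at ih
    refine hg.linearMap_ext ?_ (fun T x hx => ?_) (fun i x hx => ?_) (fun i x hx => ?_) <;>
      simp only [LinearMap.comp_apply, LinearMap.applyₗ_apply_apply]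
    · rw [hΦ, map_one Λ, Ser.coeff_one, if_neg (Nat.succ_ne_zero m), map_zero, map_zero]
    · have h2 : L T * Ser.coeff m (Λ x) = Ser.coeff m (Λ x) * L T :=
        LinearMap.ext fun y => hΛ.commute_coeff hg (fun T' => hLL T T') m x y
      rw [hΦ, hΛ.coeff_tor_mul_succ, h2, Module.End.mul_apply, ← hΦ, ih, hG]
      rfl
    · rw [h0 _ (hΛ.E i), map_zero, map_zero]
    · rw [h0 _ (hΛ.F i), map_zero, map_zero]

variable {Δ : B →ₐ[k⟦X⟧] HatTensor k B B} {ε : B →ₐ[k⟦X⟧] k⟦X⟧} {S : B →ₐ[k⟦X⟧] Bᵐᵒᵖ}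
  (H : IsStdHopf R τ e f Δ ε S)

include H

/-- Operators that act on coproducts through the left factor are determined by their counits. -/
theorem coeff_eq_leftAct (hΛ : IsToralRep τ e f L Λ) (hLL : ∀ T T', Commute (L T) (L T'))
    (hL : ∀ T x, Δ (L T x) = hatMap (TensorProduct.map (L T) LinearMap.id) (Δ x)) (m : ℕ) (x y : B) :
    Ser.coeff m (Λ x) y = leftAct (ε.toLinearMap ∘ₗ Ser.coeff m (Λ x)) (Δ y) := by
  refine hΛ.coeff_eq_act H.gen hLL (G := LinearMap.lcomp k⟦X⟧ B Δ.toLinearMap ∘ₗ leftAct)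
    (fun y => ?_) (fun T g y => ?_) m x y
  · have h1 : leftAct ε.toLinearMap = hatExtend ((TensorProduct.lid k⟦X⟧ B).toLinearMap ∘ₗ
        TensorProduct.map ε.toLinearMap LinearMap.id) :=
      hatTensor_ext fun a b => by
        rw [leftAct_toHat, hatExtend_toHat]
        rfl
    exact (LinearMap.congr_fun h1 (Δ y)).trans (H.isTopHopf.counit_comul y)
  · change leftAct g (Δ (L T y)) = leftAct (g ∘ₗ L T) (Δ y)
    rw [hL, leftAct_hatMap]

/-- Operators that act on coproducts through the right factor are determined by their counits. -/
theorem coeff_eq_rightAct (hΛ : IsToralRep τ e f L Λ) (hLL : ∀ T T', Commute (L T) (L T'))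
    (hL : ∀ T x, Δ (L T x) = hatMap (TensorProduct.map LinearMap.id (L T)) (Δ x)) (m : ℕ) (x y : B) :
    Ser.coeff m (Λ x) y = rightAct (ε.toLinearMap ∘ₗ Ser.coeff m (Λ x)) (Δ y) := by
  refine hΛ.coeff_eq_act H.gen hLL (G := LinearMap.lcomp k⟦X⟧ B Δ.toLinearMap ∘ₗ rightAct)
    (fun y => ?_) (fun T g y => ?_) m x y
  · have h1 : rightAct ε.toLinearMap = hatExtend ((TensorProduct.rid k⟦X⟧ B).toLinearMap ∘ₗ
        TensorProduct.map LinearMap.id ε.toLinearMap) :=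
      hatTensor_ext fun a b => by
        rw [rightAct_toHat, hatExtend_toHat]
        rfl
    exact (LinearMap.congr_fun h1 (Δ y)).trans (H.isTopHopf.comul_counit y)
  · change rightAct g (Δ (L T y)) = rightAct (g ∘ₗ L T) (Δ y)
    rw [hL, rightAct_hatMap]

end IsToralRep

end ToralRep

/-! ### The pairing of a toral representation with the counit -/

section ToralPair

variable {k : Type*} [Field k] [CharZero k] {n : ℕ}
variable {h : Type*} [AddCommGroup h] [Module k⟦X⟧ h]
variable {P : Matrix (Fin n) (Fin n) k⟦X⟧} {R : Realization P h}
variable {B : Type*} [Ring B] [Algebra k⟦X⟧ B] [IsAdicComplete (hIdeal k) B]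
variable {τ : h →ₗ[k⟦X⟧] B} {e f : Fin n → B}
variable {η : h →ₗ[k⟦X⟧] h →ₗ[k⟦X⟧] k⟦X⟧}
variable {w w' v v' : h →ₗ[k⟦X⟧] Fin n → k⟦X⟧}
variable {L M : h →ₗ[k⟦X⟧] Module.End k⟦X⟧ B}
variable {Λ N : B →ₐ[k⟦X⟧] Ser (Module.End k⟦X⟧ B)}
variable {Δ : B →ₐ[k⟦X⟧] HatTensor k B B} {ε : B →ₐ[k⟦X⟧] k⟦X⟧} {S : B →ₐ[k⟦X⟧] Bᵐᵒᵖ}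

theorem IsToralRep.map_der_eq (hΛ : IsToralRep τ e f L Λ) (hg : IsTopGen (k := k) τ e f)
    (hL : IsToralDer η w w' τ e f L) (hM : IsToralDer η v v' τ e f M) (T : h) (x : B) :
    Λ (L T x) = Λ (M T x) := by
  have h2 : Λ.toLinearMap ∘ₗ L T = Λ.toLinearMap ∘ₗ M T := by
    refine hg.derivation_ext Λ (fun x y => ?_) (fun x y => ?_) (fun T' => ?_) (fun i => ?_)
      (fun i => ?_) <;> simp only [LinearMap.comp_apply, AlgHom.toLinearMap_apply]
    · rw [hL.mul, map_add Λ, _root_.map_mul Λ, _root_.map_mul Λ]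
    · rw [hM.mul, map_add Λ, _root_.map_mul Λ, _root_.map_mul Λ]
    · rw [hL.tor, hM.tor]
    · rw [hL.E, hM.E, map_smul Λ, map_smul Λ, hΛ.E, smul_zero, smul_zero]
    · rw [hL.F, hM.F, map_smul Λ, map_smul Λ, hΛ.F, smul_zero, smul_zero]
  exact LinearMap.congr_fun h2 x

theorem serPair_one (y : B) : serPair ε.toLinearMap 1 y = Ser.const (k := k) (ε y) :=
  Ser.ext fun m => by
    rw [coeff_serPair, Ser.coeff_one, Ser.coeff_const]
    split_ifs
    · rfl
    · rw [LinearMap.zero_apply, map_zero]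

/-- Two representations of the toral elements that act on coproducts through the left and through
the right factor. -/
structure IsToralPair (τ : h →ₗ[k⟦X⟧] B) (e f : Fin n → B) (Δ : B →ₐ[k⟦X⟧] HatTensor k B B)
    (ε : B →ₐ[k⟦X⟧] k⟦X⟧) (L M : h →ₗ[k⟦X⟧] Module.End k⟦X⟧ B)
    (Λ N : B →ₐ[k⟦X⟧] Ser (Module.End k⟦X⟧ B)) : Prop where
  left : IsToralRep τ e f L Λ
  right : IsToralRep τ e f M N
  comm_left : ∀ T T', Commute (L T) (L T')
  comm_right : ∀ T T', Commute (M T) (M T')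
  comm : ∀ T T', Commute (L T) (M T')
  comul_left : ∀ T x, Δ (L T x) = hatMap (TensorProduct.map (L T) LinearMap.id) (Δ x)
  comul_right : ∀ T x, Δ (M T x) = hatMap (TensorProduct.map LinearMap.id (M T)) (Δ x)
  counit_eq : ∀ T x, ε (L T x) = ε (M T x)
  map_eq : ∀ T x, Λ (L T x) = Λ (M T x)
  mul : ∀ T x y, L T (x * y) = L T x * y + x * L T y

namespace IsToralPair

variable (Z : IsToralPair τ e f Δ ε L M Λ N) (H : IsStdHopf R τ e f Δ ε S)

include Z H

theorem coeff_apply {ι : Type*} [Fintype ι] {y : B} {c c' : ι → B}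
    (hy : Δ y = toHat (∑ i, c i ⊗ₜ[k⟦X⟧] c' i)) (m : ℕ) (x : B) :
    Ser.coeff m (Λ x) y = ∑ i, ε (Ser.coeff m (Λ x) (c i)) • c' i := by
  rw [Z.left.coeff_eq_leftAct H Z.comm_left Z.comul_left, hy, map_sum, map_sum]
  exact Finset.sum_congr rfl fun i _ => leftAct_toHat _ _ _

theorem coeff_apply_right {ι : Type*} [Fintype ι] {y : B} {c c' : ι → B}
    (hy : Δ y = toHat (∑ i, c i ⊗ₜ[k⟦X⟧] c' i)) (m : ℕ) (x : B) :
    Ser.coeff m (N x) y = ∑ i, ε (Ser.coeff m (Λ x) (c' i)) • c i := by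
  rw [Z.right.coeff_eq_rightAct H Z.comm_right Z.comul_right, hy, map_sum, map_sum]
  refine Finset.sum_congr rfl fun i _ => (rightAct_toHat _ _ _).trans ?_
  rw [LinearMap.comp_apply, ← Z.left.apply_coeff_eq Z.right H.gen Z.comm Z.comm_right
    (φ := ε.toLinearMap) Z.counit_eq]
  rfl

theorem serPair_mul {ι : Type*} [Fintype ι] {y : B} {c c' : ι → B}
    (hy : Δ y = toHat (∑ i, c i ⊗ₜ[k⟦X⟧] c' i)) (u : Ser (Module.End k⟦X⟧ B)) (x : B) :
    serPair ε.toLinearMap (u * Λ x) y =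
      ∑ i, serPair ε.toLinearMap (Λ x) (c i) * serPair ε.toLinearMap u (c' i) := by
  refine Ser.ext fun m => ?_
  rw [map_sum, coeff_serPair, Ser.coeff_mul, LinearMap.sum_apply, map_sum]
  simp only [Ser.coeff_mul, coeff_serPair]
  rw [Finset.sum_comm, ← Finset.sum_comm, Finset.sum_comm, ← Finset.Nat.sum_antidiagonal_swap]
  refine Finset.sum_congr rfl fun p _ => ?_
  rw [Prod.snd_swap, Prod.fst_swap, Module.End.mul_apply, Z.coeff_apply H hy, map_sum, map_sum]
  refine Finset.sum_congr rfl fun i _ => ?_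
  rw [map_smul, map_smul, smul_eq_mul]
  rfl

theorem sum_serPair_mul_swap {ι : Type*} [Fintype ι] {y : B} {c c' : ι → B}
    (hy : Δ y = toHat (∑ i, c i ⊗ₜ[k⟦X⟧] c' i)) (x z : B) (u : Ser (Module.End k⟦X⟧ B)) :
    ∑ i, serPair ε.toLinearMap (Λ x) (c i) * serPair ε.toLinearMap (Λ (c' i) * u) z =
      ∑ i, serPair ε.toLinearMap (Λ x) (c' i) * serPair ε.toLinearMap (Λ (c i) * u) z := by
  have h2 (m : ℕ) : ∑ i, ε (Ser.coeff m (Λ x) (c i)) • Λ (c' i) =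
      ∑ i, ε (Ser.coeff m (Λ x) (c' i)) • Λ (c i) := by
    have h1 := congrArg Λ (Z.coeff_apply H hy m x)
    have h3 := congrArg Λ (Z.coeff_apply_right H hy m x)
    have h4 := Z.left.apply_coeff_eq Z.right H.gen Z.comm Z.comm_right
      (φ := Λ.toLinearMap) Z.map_eq m x y
    simp only [AlgHom.toLinearMap_apply] at h4
    rw [map_sum] at h1 h3
    simp only [map_smul] at h1 h3
    rw [← h1, ← h3, h4]
  refine Ser.ext fun m => ?_
  simp only [map_sum]
  simp only [Ser.coeff_mul]
  simp only [coeff_serPair, AlgHom.toLinearMap_apply]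
  rw [Finset.sum_comm, Finset.sum_comm (s := Finset.univ)]
  refine Finset.sum_congr rfl fun p _ => ?_
  have h5 := congrArg (fun t : Ser (Module.End k⟦X⟧ B) => ε (Ser.coeff p.2 (t * u) z)) (h2 p.1)
  simpa only [Finset.sum_mul, map_sum, smul_mul_assoc, Ser.coeff_smul, LinearMap.sum_apply,
    LinearMap.smul_apply, map_smul, smul_eq_mul] using h5

/-- The convolution inverse of a toral representation. -/
theorem map_mul_map_comul (x : B) {ι : Type*} [Fintype ι] {a b : ι → B}
    (hx : Δ x = toHat (∑ i, a i ⊗ₜ[k⟦X⟧] b i)) :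
    ∑ i, Ser.rescale (-1 : k⟦X⟧) (Λ (b i)) * Λ (a i) = algebraMap k⟦X⟧ _ (ε x) := by
  have h0 := Z.left.rescale_neg_one
  have hc : ∀ T T', Commute ((-L) T) (L T') := fun T T' => by
    rw [LinearMap.neg_apply]; exact (Z.comm_left T T').neg_left
  let J : HatTensor k B B →ₐ[k⟦X⟧] Ser (Module.End k⟦X⟧ B) :=
    hatLift (Algebra.TensorProduct.lift Λ ((Ser.rescale (-1 : k⟦X⟧)).comp Λ) fun a b =>
      (h0.commute Z.left H.gen hc b a).symm)
  have hJ (a b : B) : J (toHat (k := k) (a ⊗ₜ[k⟦X⟧] b)) = Λ a * Ser.rescale (-1 : k⟦X⟧) (Λ b) := by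
    rw [hatLift_toHat, Algebra.TensorProduct.lift_tmul]
    rfl
  have h1 : J.comp Δ = (Algebra.ofId k⟦X⟧ _).comp ε := by
    refine H.gen.hom_ext (fun T => ?_) (fun i => ?_) (fun i => ?_) <;>
      rw [AlgHom.comp_apply, AlgHom.comp_apply]
    · rw [H.comul_tor, H.counit_tor, map_zero, map_add, map_add, hJ, hJ, map_one Λ,
        map_one (Ser.rescale (-1 : k⟦X⟧)), mul_one, one_mul]
      have := h0.tor T
      rw [AlgHom.comp_apply] at this
      rw [this, Z.left.tor, LinearMap.neg_apply, Ser.single_neg, add_neg_cancel]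
    · rw [H.comul_E, H.counit_E, map_zero, map_add, map_add, hJ, hJ, Z.left.E, map_zero, zero_mul,
        mul_zero, add_zero]
    · rw [H.comul_F, H.counit_F, map_zero, map_add, map_add, hJ, hJ, Z.left.F, map_zero, zero_mul,
        mul_zero, add_zero]
  have h2 := AlgHom.congr_fun h1 x
  rw [AlgHom.comp_apply, hx, map_sum, map_sum] at h2
  simp only [hJ] at h2
  refine Eq.trans (Finset.sum_congr rfl fun i _ => ?_) h2
  exact (h0.commute Z.left H.gen hc (b i) (a i)).eq

theorem serPair_tor_mul (T : h) (x y : B) :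
    serPair ε.toLinearMap (Λ (τ T * x)) y =
      Ser.single 1 * serPair ε.toLinearMap (Λ x) (L T y) := by
  refine Ser.ext fun m => ?_
  cases m with
  | zero => rw [coeff_serPair, Z.left.coeff_tor_mul_zero, Ser.coeff_single_mul_zero, LinearMap.zero_apply, map_zero]
  | succ m =>
    rw [coeff_serPair, Z.left.coeff_tor_mul_succ, Ser.coeff_single_mul_succ, one_mul, coeff_serPair,
      Module.End.mul_apply, Z.left.commute_coeff H.gen (Z.comm_left T)]

theorem serPair_apply_mul {x : B} {ι : Type*} [Fintype ι] {a b : ι → B}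
    (hx : Δ x = toHat (∑ i, a i ⊗ₜ[k⟦X⟧] b i)) (y z : B) :
    serPair ε.toLinearMap (Λ x) (y * z) =
      ∑ i, serPair ε.toLinearMap (Λ (a i)) y * serPair ε.toLinearMap (Λ (b i)) z := by
  let pr (y : B) : B →ₗ[k⟦X⟧] Ser k⟦X⟧ := (serPair ε.toLinearMap).flip y ∘ₗ Λ.toLinearMap
  let G (y z : B) : HatTensor k B B →ₗ[k⟦X⟧] Ser k⟦X⟧ :=
    hatExtend (LinearMap.mul' k⟦X⟧ (Ser k⟦X⟧) ∘ₗ TensorProduct.map (pr y) (pr z))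
  have hG (y z a b : B) : G y z (toHat (a ⊗ₜ[k⟦X⟧] b)) =
      serPair ε.toLinearMap (Λ a) y * serPair ε.toLinearMap (Λ b) z := hatExtend_toHat _ _
  have h0 (r : B) (hr : Λ r = 0) (a y : B) : serPair ε.toLinearMap (Λ (r * a)) y = 0 := by
    rw [map_mul, hr, zero_mul, map_zero, LinearMap.zero_apply]
  have hE (i : Fin n) (u : HatTensor k B B) (y z : B) : G y z (Δ (e i) * u) = 0 := by
    have h1 : G y z ∘ₗ LinearMap.mulLeft k⟦X⟧ (Δ (e i)) = 0 := hatTensor_ext fun a b => by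
      rw [LinearMap.comp_apply, LinearMap.mulLeft_apply, H.comul_E, toHat_mul, add_mul,
        Algebra.TensorProduct.tmul_mul_tmul, Algebra.TensorProduct.tmul_mul_tmul, map_add, map_add,
        hG, hG, h0 _ (Z.left.E i), h0 _ (Z.left.E i), zero_mul, mul_zero, add_zero]
      rfl
    exact LinearMap.congr_fun h1 u
  have hF (i : Fin n) (u : HatTensor k B B) (y z : B) : G y z (Δ (f i) * u) = 0 := by
    have h1 : G y z ∘ₗ LinearMap.mulLeft k⟦X⟧ (Δ (f i)) = 0 := hatTensor_ext fun a b => by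
      rw [LinearMap.comp_apply, LinearMap.mulLeft_apply, H.comul_F, toHat_mul, add_mul,
        Algebra.TensorProduct.tmul_mul_tmul, Algebra.TensorProduct.tmul_mul_tmul, map_add, map_add,
        hG, hG, h0 _ (Z.left.F i), h0 _ (Z.left.F i), zero_mul, mul_zero, add_zero]
      rfl
    exact LinearMap.congr_fun h1 u
  have hT (T : h) (u : HatTensor k B B) (y z : B) : G y z (Δ (τ T) * u) =
      Ser.single 1 * (G (L T y) z u + G y (L T z) u) := by
    have h1 : G y z ∘ₗ LinearMap.mulLeft k⟦X⟧ (Δ (τ T)) =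
        LinearMap.mulLeft k⟦X⟧ (Ser.single 1) ∘ₗ (G (L T y) z + G y (L T z)) := hatTensor_ext fun a b => by
      rw [LinearMap.comp_apply, LinearMap.mulLeft_apply, H.comul_tor, toHat_mul, add_mul,
        Algebra.TensorProduct.tmul_mul_tmul, Algebra.TensorProduct.tmul_mul_tmul, map_add, map_add,
        hG, hG, one_mul, one_mul, Z.serPair_tor_mul H, Z.serPair_tor_mul H, LinearMap.comp_apply,
        LinearMap.mulLeft_apply, LinearMap.add_apply, hG, hG, mul_add, mul_assoc, mul_left_comm (serPair _ _ y)]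
    exact LinearMap.congr_fun h1 u
  have key (m : ℕ) : ∀ x y z : B, Ser.coeff m (serPair ε.toLinearMap (Λ x) (y * z)) =
      Ser.coeff m (G y z (Δ x)) := by
    have h2 (x y z : B) (m : ℕ) (hm : ∀ (T : h) (x : B),
        Ser.coeff m (serPair ε.toLinearMap (Λ (τ T * x)) (y * z)) =
          Ser.coeff m (Ser.single 1 * (G (L T y) z (Δ x) + G y (L T z) (Δ x)))) :
        Ser.coeff m (serPair ε.toLinearMap (Λ x) (y * z)) = Ser.coeff m (G y z (Δ x)) := by
      have h1 : Ser.coeffₗ (k := k) m ∘ₗ pr (y * z) =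
          Ser.coeffₗ (k := k) m ∘ₗ G y z ∘ₗ Δ.toLinearMap := by
        refine H.gen.linearMap_ext ?_ (fun T x hx => ?_) (fun i x hx => ?_) (fun i x hx => ?_) <;>
          simp only [LinearMap.comp_apply, AlgHom.toLinearMap_apply, Ser.coeffₗ_apply, pr,
            LinearMap.flip_apply]
        · rw [IsStdHopf.comul_one, hG, map_one Λ, serPair_one, serPair_one, serPair_one, map_mul, map_mul]
        · rw [map_mul Δ, hT, hm]
        · rw [map_mul Δ, hE, h0 _ (Z.left.E i)]
        · rw [map_mul Δ, hF, h0 _ (Z.left.F i)]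
      exact LinearMap.congr_fun h1 x
    induction m with
    | zero =>
      intro x y z
      refine h2 x y z 0 fun T x => ?_
      rw [coeff_serPair, Z.left.coeff_tor_mul_zero, Ser.coeff_single_mul_zero, LinearMap.zero_apply,
        map_zero]
    | succ m ih =>
      intro x y z
      refine h2 x y z (m + 1) fun T x => ?_
      rw [Z.serPair_tor_mul H, Ser.coeff_single_mul_succ, Ser.coeff_single_mul_succ, one_mul, one_mul,
        Z.mul, map_add, map_add, map_add, ih, ih]
  refine Ser.ext fun m => ?_
  rw [key, hx, map_sum, map_sum]
  simp only [hG]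

end IsToralPair

end ToralPair

/-! ### The projection to the completed symmetric algebra -/

section ToralProj

open SymmetricAlgebra (ι)

variable {k : Type*} [Field k] [CharZero k] {n : ℕ}
variable {h : Type*} [AddCommGroup h] [Module k⟦X⟧ h]
variable {A : Matrix (Fin n) (Fin n) ℤ} {d : Fin n → ℕ} {P : Matrix (Fin n) (Fin n) k⟦X⟧}
variable {R : Realization P h}
variable {B : Type*} [Ring B] [Algebra k⟦X⟧ B] [IsAdicComplete (hIdeal k) B]
variable {τ : h →ₗ[k⟦X⟧] B} {e f : Fin n → B}
variable {η : h →ₗ[k⟦X⟧] h →ₗ[k⟦X⟧] k⟦X⟧}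
variable {w w' : h →ₗ[k⟦X⟧] Fin n → k⟦X⟧}
variable {L M : h →ₗ[k⟦X⟧] Module.End k⟦X⟧ B}
variable {Λ N : B →ₐ[k⟦X⟧] Ser (Module.End k⟦X⟧ B)}
variable {Δ : B →ₐ[k⟦X⟧] HatTensor k B B} {ε : B →ₐ[k⟦X⟧] k⟦X⟧} {S : B →ₐ[k⟦X⟧] Bᵐᵒᵖ}
variable {W : Type*} [AddCommGroup W] [Module k⟦X⟧ W]

theorem surjective_of_toHat {V : Type*} [AddCommGroup V] [Module k⟦X⟧ V] {φ : B →ₗ[k⟦X⟧] Hat k V}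
    (hφ : ∀ x, ∃ b, φ b = toHat x) : Function.Surjective φ := by
  intro x
  choose g hg using hφ
  choose s t hst using fun x : Hat k V => exists_toHat_add x 1
  let u (j : ℕ) : Hat k V := t^[j] x
  refine ⟨hSeries (k := k) fun j => g (s (u j)), (map_hSeries φ _).trans
    (hSeries_unique (k := k) fun m => ⟨u m, ?_⟩).symm⟩
  simp only [hg]
  rw [sub_eq_iff_eq_add']
  induction m with
  | zero => simp [u]
  | succ m ih =>
    rw [Finset.sum_range_succ, add_assoc, pow_succ, mul_smul, ← smul_add]
    refine ih.trans ?_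
    congr 2
    have h1 := hst (u m)
    rw [pow_one] at h1
    have h2 : u (m + 1) = t (u m) := Function.iterate_succ_apply' t m x
    rw [h2]
    exact h1

theorem symDeriv_mul {K V : Type*} [CommRing K] [AddCommGroup V] [Module K V]
    (β : V →ₗ[K] V →ₗ[K] K) (v : V) (x y : SymmetricAlgebra K V) :
    symDeriv β v (x * y) = symDeriv β v x * y + x * symDeriv β v y := by
  have h1 : symDeriv β v ∘ₗ LinearMap.mulRight K y =
      LinearMap.mulRight K y ∘ₗ symDeriv β v + LinearMap.mulRight K (symDeriv β v y) := by
    refine symmetricAlgebra_linearMap_ext ?_ fun u x hx => ?_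
    · simp [symDeriv_one]
    · simp only [LinearMap.comp_apply, LinearMap.mulRight_apply, LinearMap.add_apply] at hx ⊢
      rw [mul_assoc, symDeriv_ι_mul, symDeriv_ι_mul, hx, add_mul, smul_mul_assoc]
      ring
  exact LinearMap.congr_fun h1 x

theorem hatMap_comul_eq {Q : Type*} [Ring Q] [Algebra k⟦X⟧ Q] (H : IsStdHopf R τ e f Δ ε S)
    {c : Q →ₐ[k⟦X⟧] Q ⊗[k⟦X⟧] Q} {σ : h → Q} {π : B →ₐ[k⟦X⟧] Hat k Q}
    (hT : ∀ T, π (τ T) = toHat (k := k) (σ T)) (hE : ∀ i, π (e i) = 0) (hF : ∀ i, π (f i) = 0)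
    (hc : ∀ T, c (σ T) = σ T ⊗ₜ 1 + 1 ⊗ₜ σ T) (x : B) :
    hatMap c.toLinearMap (π x) = hatTensorMap π.toLinearMap π.toLinearMap (Δ x) := by
  have h1 : (hatMapAlg c).comp π = (hatTensorAlg π π).comp Δ := by
    refine H.gen.hom_ext (fun T => ?_) (fun i => ?_) (fun i => ?_) <;>
      rw [AlgHom.comp_apply, AlgHom.comp_apply]
    · rw [hT, hatMapAlg_toHat, H.comul_tor, map_add, map_add (hatTensorAlg π π),
        hatTensorAlg_toHat, hatTensorAlg_toHat, hT, map_one π, map_one (boxL k _ _),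
        map_one (boxR k _ _), mul_one, one_mul, boxL_toHat, boxR_toHat, ← map_add, hc]
    · rw [hE, H.comul_E, map_zero, map_add, map_add (hatTensorAlg π π),
        hatTensorAlg_toHat, hatTensorAlg_toHat, hE, map_zero, map_zero, mul_zero, zero_mul, add_zero]
    · rw [hF, H.comul_F, map_zero, map_add, map_add (hatTensorAlg π π),
        hatTensorAlg_toHat, hatTensorAlg_toHat, hF, map_zero, map_zero, mul_zero, zero_mul, add_zero]
  have h2 := AlgHom.congr_fun h1 x
  rw [AlgHom.comp_apply, AlgHom.comp_apply, hatMapAlg_eq, hatTensorAlg_eq] at h2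
  exact h2

/-- The projection to the completed symmetric algebra that kills `e` and `f`. -/
structure IsSymProj (τ : h →ₗ[k⟦X⟧] B) (e f : Fin n → B) (p : h →ₗ[k⟦X⟧] W)
    (π : B →ₐ[k⟦X⟧] Hat k (SymmetricAlgebra k⟦X⟧ W)) : Prop where
  tor : ∀ T, π (τ T) = toHat (k := k) (ι k⟦X⟧ W (p T))
  E : ∀ i, π (e i) = 0
  F : ∀ i, π (f i) = 0

namespace IsSymProj

variable {p : h →ₗ[k⟦X⟧] W} {π : B →ₐ[k⟦X⟧] Hat k (SymmetricAlgebra k⟦X⟧ W)}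
  (hπ : IsSymProj τ e f p π)

include hπ

theorem surjective (hp : Function.Surjective p) : Function.Surjective π := by
  refine surjective_of_toHat (φ := π.toLinearMap) fun x => ?_
  induction x using SymmetricAlgebra.induction with
  | algebraMap r => exact ⟨algebraMap k⟦X⟧ B r, by
      rw [AlgHom.toLinearMap_apply, AlgHom.commutes, Algebra.algebraMap_eq_smul_one,
        Algebra.algebraMap_eq_smul_one, map_smul]
      rfl⟩
  | ι x =>
    obtain ⟨T, rfl⟩ := hp x
    exact ⟨τ T, hπ.tor T⟩
  | mul a b ha hb =>
    obtain ⟨a', ha⟩ := ha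
    obtain ⟨b', hb⟩ := hb
    refine ⟨a' * b', ?_⟩
    rw [AlgHom.toLinearMap_apply] at ha hb ⊢
    rw [map_mul π, ha, hb, toHat_mul]
  | add a b ha hb =>
    obtain ⟨a', ha⟩ := ha
    obtain ⟨b', hb⟩ := hb
    exact ⟨a' + b', by rw [map_add, ha, hb, map_add]⟩

theorem map_der (hg : IsTopGen (k := k) τ e f) (hL : IsToralDer η w w' τ e f L)
    {β : W →ₗ[k⟦X⟧] W →ₗ[k⟦X⟧] k⟦X⟧} {c : k⟦X⟧} (hβ : ∀ T T', η T T' = c * β (p T) (p T'))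
    (T : h) (x : B) : π (L T x) = c • hatMap (symDeriv β (p T)) (π x) := by
  have hD : ∀ x y, symDeriv β (p T) (x * y) = symDeriv β (p T) x * y + x * symDeriv β (p T) y :=
    symDeriv_mul β (p T)
  have h1 := hatMap_derivation hD
  have h2 : π.toLinearMap ∘ₗ L T = c • hatMap (symDeriv β (p T)) ∘ₗ π.toLinearMap := by
    refine hg.derivation_ext π (fun x y => ?_) (fun x y => ?_) (fun T' => ?_) (fun i => ?_)
      (fun i => ?_) <;>
      simp only [LinearMap.comp_apply, AlgHom.toLinearMap_apply, LinearMap.smul_apply]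
    · rw [hL.mul, map_add π, map_mul π, map_mul π]
    · rw [map_mul π, h1, smul_add]
      have h4 := (Algebra.to_smulCommClass (R := k⟦X⟧) (A := Hat k (SymmetricAlgebra k⟦X⟧ W)))
      have h5 := (IsScalarTower.right (R := k⟦X⟧) (A := Hat k (SymmetricAlgebra k⟦X⟧ W)))
      exact congrArg₂ _ (h5.smul_assoc _ _ _).symm (h4.smul_comm _ _ _)
    · have h3 : symDeriv β (p T) (ι k⟦X⟧ W (p T')) = β (p T) (p T') • 1 := by
        have := symDeriv_ι_mul β (p T) (p T') 1
        rwa [mul_one, symDeriv_one, mul_zero, zero_add] at this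
      rw [hL.tor, hπ.tor, hatMap_toHat, h3, hβ, AlgHom.commutes, map_smul, smul_smul,
        Algebra.algebraMap_eq_smul_one]
      rfl
    · rw [hL.E, hπ.E, map_smul π, hπ.E, map_zero, smul_zero, smul_zero]
    · rw [hL.F, hπ.F, map_smul π, hπ.F, map_zero, smul_zero, smul_zero]
  exact LinearMap.congr_fun h2 x

variable (H : IsStdHopf R τ e f Δ ε S)

include H

theorem map_counit (x : B) :
    hatExtend (Coalgebra.counit (R := k⟦X⟧) (A := SymmetricAlgebra k⟦X⟧ W)) (π x) = ε x := by
  have h1 : (hatLift (Bialgebra.counitAlgHom k⟦X⟧ (SymmetricAlgebra k⟦X⟧ W))).comp π = ε := by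
    refine H.gen.hom_ext (fun T => ?_) (fun i => ?_) (fun i => ?_) <;> rw [AlgHom.comp_apply]
    · rw [hπ.tor, hatLift_toHat, H.counit_tor]
      exact SymmetricAlgebra.algebraMapInv_ι _
    · rw [hπ.E, H.counit_E, map_zero]
    · rw [hπ.F, H.counit_F, map_zero]
  exact AlgHom.congr_fun h1 x

theorem map_comul (x : B) :
    hatMap (Coalgebra.comul (R := k⟦X⟧) (A := SymmetricAlgebra k⟦X⟧ W)) (π x) =
      hatTensorMap π.toLinearMap π.toLinearMap (Δ x) := by
  exact hatMap_comul_eq H (c := Bialgebra.comulAlgHom k⟦X⟧ (SymmetricAlgebra k⟦X⟧ W))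
    (σ := fun T => ι k⟦X⟧ W (p T)) (π := π) (fun T => hπ.tor T) hπ.E hπ.F
    (fun T => SymmetricAlgebra.comul_ι _ _ _) x

/-- The coefficients of a toral representation in terms of the convolution powers of a form. -/
theorem counit_coeff (hL : IsToralDer η w w' τ e f L) (hΛ : IsToralRep τ e f L Λ)
    (hLL : ∀ T T', Commute (L T) (L T'))
    {β : W →ₗ[k⟦X⟧] W →ₗ[k⟦X⟧] k⟦X⟧} {c : k⟦X⟧} (hβ : ∀ T T', η T T' = c * β (p T) (p T'))
    (m : ℕ) (x y : B) : ε (Ser.coeff m (Λ x) y) =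
      c ^ m * C ((m.factorial : k)⁻¹) * hatExtend (symPow β m) (boxTensor (π x) (π y)) := by
  let F (m : ℕ) : Hat k (SymmetricAlgebra k⟦X⟧ W) →ₗ[k⟦X⟧] Hat k (SymmetricAlgebra k⟦X⟧ W) →ₗ[k⟦X⟧] k⟦X⟧ :=
    boxTensor.compr₂ (hatExtend (symPow β m))
  have hF (m : ℕ) (s t : SymmetricAlgebra k⟦X⟧ W) : F m (toHat s) (toHat t) = symPow β m (s ⊗ₜ t) := by
    rw [LinearMap.compr₂_apply, boxTensor_toHat, hatExtend_toHat]
  have h1 (m : ℕ) (b : Hat k (SymmetricAlgebra k⟦X⟧ W)) : F m 1 b =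
      if m = 0 then hatExtend (Coalgebra.counit (R := k⟦X⟧) (A := SymmetricAlgebra k⟦X⟧ W)) b else 0 := by
    have : F m 1 = if m = 0 then hatExtend (Coalgebra.counit (R := k⟦X⟧) (A := SymmetricAlgebra k⟦X⟧ W)) else 0 :=
      hat_ext fun t => by
        refine (hF m 1 t).trans ?_
        rw [symPow_one_tmul]
        split_ifs
        · rw [hatExtend_toHat]
        · rfl
    rw [this]
    split_ifs <;> rfl
  have h2 (m : ℕ) (v : W) (a b : Hat k (SymmetricAlgebra k⟦X⟧ W)) :
      F m (hatMulₗ (toHat (ι k⟦X⟧ W v)) a) b = (m : k⟦X⟧) * F (m - 1) a (hatMap (symDeriv β v) b) := by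
    refine hat_ext₂ (f := (F m).compl₁₂ (hatMulₗ (toHat (ι k⟦X⟧ W v))) LinearMap.id)
      (g := (m : k⟦X⟧) • (F (m - 1)).compl₁₂ LinearMap.id (hatMap (symDeriv β v))) (fun s t => ?_) a b
    rw [LinearMap.compl₁₂_apply, LinearMap.smul_apply, LinearMap.smul_apply, LinearMap.compl₁₂_apply,
      hatMulₗ_apply, toHat_mul, LinearMap.id_apply, LinearMap.id_apply, hatMap_toHat, hF, hF, smul_eq_mul]
    exact symPow_ι_mul β m v s t
  have hη (T : h) : η T = c • (β (p T)).comp p := LinearMap.ext fun T' => hβ T T'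
  let cf (m : ℕ) : k⟦X⟧ := c ^ m * C ((m.factorial : k)⁻¹)
  have hcf (m : ℕ) : cf (m + 1) * ((m + 1 : ℕ) : k⟦X⟧) = cf m * c := by
    have h3 : (C (((m + 1).factorial : k)⁻¹) : k⟦X⟧) * ((m + 1 : ℕ) : k⟦X⟧) = C ((m.factorial : k)⁻¹) := by
      rw [← map_natCast (C (R := k)), ← map_mul, Nat.factorial_succ]
      congr 1
      have h4 : ((m + 1 : ℕ) : k) ≠ 0 := Nat.cast_ne_zero.2 (Nat.succ_ne_zero m)
      have h5 : (m.factorial : k) ≠ 0 := Nat.cast_ne_zero.2 (Nat.factorial_ne_zero _)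
      push_cast at h4 ⊢
      field_simp
    simp only [cf]
    rw [mul_assoc, h3, pow_succ]
    ring
  have h0 (r : B) (hr : π r = 0) (a : B) : π (r * a) = 0 := by
    rw [map_mul π, hr]
    exact LinearMap.congr_fun (map_zero hatMulₗ) (π a)
  change ε _ = cf m * F m (π x) (π y)
  have key (m : ℕ) (y : B) (hm : ∀ T x, ε (Ser.coeff m (Λ (τ T * x)) y) =
      cf m * (m * F (m - 1) (π x) (hatMap (symDeriv β (p T)) (π y)))) (x : B) :
      ε (Ser.coeff m (Λ x) y) = cf m * F m (π x) (π y) := by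
    have h3 : ε.toLinearMap ∘ₗ LinearMap.applyₗ y ∘ₗ Ser.coeffₗ (k := k) m ∘ₗ Λ.toLinearMap =
        cf m • (F m).flip (π y) ∘ₗ π.toLinearMap := by
      refine H.gen.linearMap_ext ?_ (fun T x hx => ?_) (fun i x hx => ?_) (fun i x hx => ?_) <;>
        simp only [LinearMap.comp_apply, AlgHom.toLinearMap_apply, LinearMap.applyₗ_apply_apply,
          Ser.coeffₗ_apply, LinearMap.smul_apply, LinearMap.flip_apply, smul_eq_mul]
      · rw [map_one Λ, map_one π, h1, Ser.coeff_one]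
        split_ifs with h0
        · rw [hπ.map_counit H, h0]
          simp [cf]
        · rw [LinearMap.zero_apply, map_zero, mul_zero]
      · rw [hm, map_mul π, hπ.tor]
        exact congrArg _ (h2 m (p T) (π x) (π y)).symm
      · rw [hΛ.E_mul, h0 _ (hπ.E i), map_zero, map_zero, LinearMap.zero_apply, LinearMap.zero_apply, map_zero,
          mul_zero]
      · rw [hΛ.F_mul, h0 _ (hπ.F i), map_zero, map_zero, LinearMap.zero_apply, LinearMap.zero_apply, map_zero,
          mul_zero]
    exact LinearMap.congr_fun h3 x
  induction m generalizing x y with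
  | zero =>
    refine key 0 y (fun T x => ?_) x
    rw [hΛ.coeff_tor_mul_zero, LinearMap.zero_apply, map_zero, Nat.cast_zero, zero_mul, mul_zero]
  | succ m ih =>
    refine key (m + 1) y (fun T x => ?_) x
    rw [hΛ.coeff_tor_mul_succ, Module.End.mul_apply, hΛ.commute_coeff H.gen (hLL T), ih,
      hπ.map_der H.gen hL hβ, map_smul, smul_eq_mul, ← mul_assoc, ← hcf, mul_assoc]
    rfl

end IsSymProj

theorem commute_toHat {Q : Type*} [CommRing Q] [Algebra k⟦X⟧ Q] (x y : Q) :
    Commute (toHat (k := k) x : Hat k Q) (toHat (k := k) y) :=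
  (toHat_mul x y).trans ((congrArg _ (mul_comm x y)).trans (toHat_mul y x).symm)

variable (R) in
theorem Realization.mk_Tneg (i : Fin n) : (Submodule.Quotient.mk (R.Tneg i) : R.hBar) =
    -Submodule.Quotient.mk (R.Tpos i) := by
  rw [eq_neg_iff_add_eq_zero, ← Submodule.Quotient.mk_add, Submodule.Quotient.mk_eq_zero]
  have h1 : R.Tneg i + R.Tpos i = (C (2 : k) : k⟦X⟧) • R.S i := by
    rw [Realization.S, smul_smul, ← map_mul, mul_inv_cancel₀ two_ne_zero, map_one, one_smul, add_comm]
  rw [h1]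
  exact Submodule.smul_mem _ _ (Submodule.subset_span ⟨i, rfl⟩)

variable (A d R) in
theorem UAlg.exists_isSymProj : ∃ π : UAlg A d R →ₐ[k⟦X⟧] Hat k R.symBar,
    IsSymProj (UAlg.torₗ A d R) (UAlg.E A d R) (UAlg.F A d R) R.sSpan.mkQ π := by
  let l : h →ₗ[k⟦X⟧] Hat k R.symBar := toHat (k := k) ∘ₗ ι k⟦X⟧ R.hBar ∘ₗ R.sSpan.mkQ
  have h1 : IsGenRel A d R (B := Hat k R.symBar) l (fun _ => 0) (fun _ => 0) := by
    refine IsGenRel.toral (fun T T' => ?_) (fun i => ?_)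
    · exact commute_toHat _ _
    · simp only [l, LinearMap.comp_apply, Submodule.mkQ_apply, R.mk_Tneg, map_neg]
  exact ⟨h1.lift, IsGenRel.lift_tor _, IsGenRel.lift_E _, IsGenRel.lift_F _⟩

end ToralProj

/-! ### Tameness of the toral pairing on the dense subalgebra -/

section TamePair

variable {k : Type*} [Field k]
variable {B : Type*} [Ring B] [Algebra k⟦X⟧ B]

variable (k B) in
/-- The multiples of `ħ ^ N`. -/
def hPow (N : ℕ) : Submodule k⟦X⟧ B := LinearMap.range (LinearMap.lsmul k⟦X⟧ B (PowerSeries.X ^ N))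

theorem smul_mem_hPow {N m : ℕ} {x : B} (hx : x ∈ hPow k B N) :
    (PowerSeries.X ^ m : k⟦X⟧) • x ∈ hPow k B (m + N) := by
  obtain ⟨v, rfl⟩ := hx
  exact ⟨v, by rw [LinearMap.lsmul_apply, LinearMap.lsmul_apply, smul_smul, pow_add]⟩

theorem hPow_mul_mem {N m : ℕ} {x y : B} (hx : x ∈ hPow k B N) (hy : y ∈ hPow k B m) :
    x * y ∈ hPow k B (N + m) := by
  obtain ⟨v, rfl⟩ := hx
  obtain ⟨u, rfl⟩ := hy
  exact ⟨v * u, by simp only [LinearMap.lsmul_apply, smul_mul_smul_comm, pow_add]⟩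

theorem hPow_anti {N m : ℕ} (h : N ≤ m) : hPow k B m ≤ hPow k B N := by
  rintro _ ⟨v, rfl⟩
  obtain ⟨r, rfl⟩ := Nat.exists_eq_add_of_le h
  exact ⟨(PowerSeries.X ^ r : k⟦X⟧) • v, by simp only [LinearMap.lsmul_apply, smul_smul, pow_add]⟩

theorem Submodule.mul_mem_pow_succ {K A : Type*} [CommRing K] [Ring A] [Algebra K A] {S : Submodule K A} {m : ℕ}
    {D E : A} (hD : D ∈ S ^ m) (hE : E ∈ S) : D * E ∈ S ^ (m + 1) := by
  rw [pow_succ]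
  exact Submodule.mul_mem_mul hD hE

theorem Submodule.pow_succ_le {K A : Type*} [CommRing K] [Ring A] [Algebra K A] {S V : Submodule K A} {m : ℕ}
    (h : ∀ D ∈ S ^ m, ∀ E ∈ S, D * E ∈ V) : S ^ (m + 1) ≤ V := by
  rw [pow_succ]
  exact Submodule.mul_le.2 h

theorem Submodule.pow_zero_le {K A : Type*} [CommRing K] [Ring A] [Algebra K A] {S V : Submodule K A}
    (h : 1 ∈ V) : S ^ 0 ≤ V := by
  rw [pow_zero]
  exact Submodule.one_le.2 h

theorem Submodule.one_mem_pow_zero {K A : Type*} [CommRing K] [Ring A] [Algebra K A] {S : Submodule K A} :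
    1 ∈ S ^ 0 := by
  rw [pow_zero]
  exact Submodule.one_le.1 le_rfl

/-- The operators that map `y` into `ħ ^ (N - c) B`. -/
def divOps (c N : ℕ) (y : B) : Submodule k⟦X⟧ (Module.End k⟦X⟧ B) :=
  (hPow k B N).comap ((PowerSeries.X ^ c : k⟦X⟧) • LinearMap.applyₗ y)

theorem mem_divOps {c N : ℕ} {y : B} {D : Module.End k⟦X⟧ B} :
    D ∈ divOps c N y ↔ (PowerSeries.X ^ c : k⟦X⟧) • D y ∈ hPow k B N := Iff.rfl

variable (S : Submodule k⟦X⟧ (Module.End k⟦X⟧ B))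

/-- The elements on which the products of `m` operators in `S` take values in `ħ ^ {2 (m + s) - c} B`. -/
def slowSub (c s : ℕ) : Submodule k⟦X⟧ B :=
  ⨅ (m : ℕ) (D : (S ^ m : Submodule k⟦X⟧ (Module.End k⟦X⟧ B))),
    (hPow k B (2 * (m + s))).comap ((PowerSeries.X ^ c : k⟦X⟧) • (D : Module.End k⟦X⟧ B))

variable {S}

theorem mem_slowSub {c s : ℕ} {y : B} : y ∈ slowSub S c s ↔ ∀ (m : ℕ), ∀ D ∈ S ^ m,
    (PowerSeries.X ^ c : k⟦X⟧) • D y ∈ hPow k B (2 * (m + s)) := by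
  simp only [slowSub, Submodule.mem_iInf, Submodule.mem_comap, LinearMap.smul_apply, Subtype.forall]

theorem apply_mem_slowSub {c s : ℕ} {y : B} (hy : y ∈ slowSub S c s) {D : Module.End k⟦X⟧ B} (hD : D ∈ S) :
    D y ∈ slowSub S c (s + 1) := mem_slowSub.2 fun m D' hD' => by
  have h1 := mem_slowSub.1 hy (m + 1) (D' * D) (Submodule.mul_mem_pow_succ hD' hD)
  rwa [Module.End.mul_apply, add_assoc, add_comm 1 s] at h1

theorem slowSub_mono {c c' : ℕ} (h : c ≤ c') (s : ℕ) : slowSub S c s ≤ slowSub S c' s := fun y hy =>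
  mem_slowSub.2 fun m D hD => by
    obtain ⟨r, rfl⟩ := Nat.exists_eq_add_of_le' h
    rw [pow_add, mul_smul]
    exact hPow_anti (Nat.le_add_left _ _) (smul_mem_hPow (mem_slowSub.1 hy m D hD))

theorem mul_mem_slowSub (hS : ∀ D ∈ S, ∀ x y, D (x * y) = D x * y + x * D y) {c c' s s' : ℕ} {x y : B}
    (hx : x ∈ slowSub S c s) (hy : y ∈ slowSub S c' s') : x * y ∈ slowSub S (c + c') (s + s') := by
  refine mem_slowSub.2 fun m => ?_
  change S ^ m ≤ divOps (c + c') (2 * (m + (s + s'))) (x * y)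
  induction m generalizing s s' x y with
  | zero =>
    refine Submodule.pow_zero_le (mem_divOps.2 ?_)
    have h1 := mem_slowSub.1 hx 0 1 Submodule.one_mem_pow_zero
    have h2 := mem_slowSub.1 hy 0 1 Submodule.one_mem_pow_zero
    have h3 := hPow_mul_mem h1 h2
    rwa [smul_mul_smul_comm, ← pow_add, ← mul_add, zero_add, zero_add, ← zero_add (s + s')] at h3
  | succ m ih =>
    refine Submodule.pow_succ_le fun D hD E hE => mem_divOps.2 ?_
    rw [Module.End.mul_apply, hS E hE, map_add, smul_add]
    refine Submodule.add_mem _ ?_ ?_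
    · have := mem_divOps.1 (ih (apply_mem_slowSub hx hE) hy hD)
      rwa [show m + (s + 1 + s') = m + 1 + (s + s') by ring] at this
    · have := mem_divOps.1 (ih hx (apply_mem_slowSub hy hE) hD)
      rwa [show m + (s + (s' + 1)) = m + 1 + (s + s') by ring] at this

theorem mem_slowSub_of_eigen {y : B} (hy : ∀ D ∈ S, ∃ c : k⟦X⟧, D y = (PowerSeries.X ^ 2 * c : k⟦X⟧) • y) :
    y ∈ slowSub S 0 0 := by
  refine mem_slowSub.2 fun m => ?_
  change S ^ m ≤ divOps 0 (2 * (m + 0)) y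
  induction m with
  | zero => exact Submodule.pow_zero_le (mem_divOps.2 ⟨y, by simp⟩)
  | succ m ih =>
    refine Submodule.pow_succ_le fun D hD E hE => mem_divOps.2 ?_
    obtain ⟨c, hc⟩ := hy E hE
    rw [Module.End.mul_apply, hc, map_smul, mul_comm (PowerSeries.X ^ 2 : k⟦X⟧) c, mul_smul, smul_comm]
    refine Submodule.smul_mem _ c ?_
    have h1 := smul_mem_hPow (m := 2) (mem_divOps.1 (ih hD))
    rwa [show 2 + 2 * (m + 0) = 2 * (m + 1 + 0) by ring, smul_comm] at h1

theorem mem_slowSub_of_const (hS : ∀ D ∈ S, D 1 = 0) {y : B} (hy : ∀ D ∈ S, ∃ c : k⟦X⟧, D y = c • 1) :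
    y ∈ slowSub S 2 0 := by
  have h1 : (1 : B) ∈ slowSub S 0 0 := mem_slowSub_of_eigen fun D hD => ⟨0, by rw [hS D hD]; simp⟩
  refine mem_slowSub.2 fun m => ?_
  change S ^ m ≤ divOps 2 (2 * (m + 0)) y
  cases m with
  | zero => exact Submodule.pow_zero_le (mem_divOps.2 (hPow_anti (Nat.zero_le 2) ⟨y, rfl⟩))
  | succ m =>
    refine Submodule.pow_succ_le fun D hD E hE => mem_divOps.2 ?_
    obtain ⟨c, hc⟩ := hy E hE
    rw [Module.End.mul_apply, hc, map_smul, smul_comm]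
    refine Submodule.smul_mem _ c ?_
    have h2 := smul_mem_hPow (m := 2) (mem_slowSub.1 h1 m D hD)
    rwa [show 2 + 2 * (m + 0) = 2 * (m + 1 + 0) by ring, pow_zero, one_smul] at h2

/-- The subalgebra of the elements on which the products of operators in `S` are divisible by large
powers of `ħ`. -/
def slow (hS : ∀ D ∈ S, ∀ x y, D (x * y) = D x * y + x * D y) : Subalgebra k⟦X⟧ B where
  carrier := {y | ∃ c, y ∈ slowSub S c 0}
  mul_mem' := by
    rintro x y ⟨c, hc⟩ ⟨c', hc'⟩
    have h1 := mul_mem_slowSub hS hc hc'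
    rw [add_zero] at h1
    exact ⟨c + c', h1⟩
  add_mem' := by
    rintro x y ⟨c, hc⟩ ⟨c', hc'⟩
    have h1 := slowSub_mono (Nat.le_add_right c c') 0 hc
    have h2 := slowSub_mono (Nat.le_add_left c' c) 0 hc'
    exact ⟨c + c', Submodule.add_mem _ h1 h2⟩
  algebraMap_mem' a := ⟨0, mem_slowSub_of_eigen fun D hD => ⟨0, by
    have h1 := hS D hD 1 1
    rw [mul_one, mul_one, one_mul] at h1
    rw [Algebra.algebraMap_eq_smul_one, map_smul, left_eq_add.1 h1]
    simp⟩⟩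

variable [CharZero k] [IsAdicComplete (hIdeal k) B] {n : ℕ}
variable {h : Type*} [AddCommGroup h] [Module k⟦X⟧ h]
variable {τ : h →ₗ[k⟦X⟧] B} {e f : Fin n → B}
variable {η : h →ₗ[k⟦X⟧] h →ₗ[k⟦X⟧] k⟦X⟧}
variable {w w' : h →ₗ[k⟦X⟧] Fin n → k⟦X⟧}
variable {L M : h →ₗ[k⟦X⟧] Module.End k⟦X⟧ B}
variable {Λ N : B →ₐ[k⟦X⟧] Ser (Module.End k⟦X⟧ B)}

/-- The subalgebra generated by the toral elements, their exponentials, the `e i` and the `f i`. -/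
def polyAdj (τ : h →ₗ[k⟦X⟧] B) (e f : Fin n → B) : Subalgebra k⟦X⟧ B :=
  Algebra.adjoin k⟦X⟧ (Set.range τ ∪ Set.range (fun T => hexp (k := k) (τ T)) ∪ Set.range e ∪ Set.range f)

theorem polyAdj_le {A : Subalgebra k⟦X⟧ B} (h1 : ∀ T, τ T ∈ A) (h2 : ∀ T, hexp (k := k) (τ T) ∈ A)
    (h3 : ∀ i, e i ∈ A) (h4 : ∀ i, f i ∈ A) : polyAdj τ e f ≤ A := by
  refine Algebra.adjoin_le ?_
  rintro _ (((⟨T, rfl⟩ | ⟨T, rfl⟩) | ⟨i, rfl⟩) | ⟨i, rfl⟩)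
  · exact h1 T
  · exact h2 T
  · exact h3 i
  · exact h4 i

/-- The operators `ħ L T`. -/
def derSub (L : h →ₗ[k⟦X⟧] Module.End k⟦X⟧ B) : Submodule k⟦X⟧ (Module.End k⟦X⟧ B) :=
  LinearMap.range ((PowerSeries.X : k⟦X⟧) • L)

theorem smul_mem_derSub (T : h) : (PowerSeries.X : k⟦X⟧) • L T ∈ derSub L := ⟨T, rfl⟩

theorem IsToralDer.derSub_mul (hL : IsToralDer η w w' τ e f L) :
    ∀ D ∈ derSub L, ∀ x y, D (x * y) = D x * y + x * D y := by
  rintro _ ⟨T, rfl⟩ x y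
  simp only [LinearMap.smul_apply, hL.mul, smul_add, smul_mul_assoc, mul_smul_comm]

theorem IsToralDer.polyAdj_le_slow (hL : IsToralDer η w w' τ e f L) :
    polyAdj τ e f ≤ slow hL.derSub_mul := by
  refine polyAdj_le (fun T => ⟨2, mem_slowSub_of_const ?_ ?_⟩)
    (fun T => ⟨0, mem_slowSub_of_eigen ?_⟩) (fun i => ⟨0, mem_slowSub_of_eigen ?_⟩)
    (fun i => ⟨0, mem_slowSub_of_eigen ?_⟩) <;> rintro _ ⟨T', rfl⟩ <;>
    simp only [LinearMap.smul_apply]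
  · rw [hL.map_one, smul_zero]
  · exact ⟨PowerSeries.X * η T' T, by rw [hL.tor, Algebra.algebraMap_eq_smul_one, smul_smul]⟩
  · exact ⟨η T' T, by rw [hL.hexp, smul_smul, pow_two, mul_assoc]⟩
  · exact ⟨w T' i, by rw [hL.E, smul_smul, pow_two, mul_assoc]⟩
  · exact ⟨w' T' i, by rw [hL.F, smul_smul, pow_two, mul_assoc]⟩

theorem IsToralRep.polyAdj_le_comap_tame (hΛ : IsToralRep τ e f L Λ) :
    polyAdj τ e f ≤ (Ser.tame (derSub L)).comap Λ := by
  refine polyAdj_le (fun T => ?_) (fun T => ?_) (fun i => ?_) (fun i => ?_) <;>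
    rw [Subalgebra.mem_comap]
  · rw [hΛ.tor]
    exact Ser.single_mem_tame (c := 1) (by rw [pow_one]; exact smul_mem_derSub T)
  · rw [map_hexp, hΛ.tor]
    exact Ser.hexp_single_mem_tame (smul_mem_derSub T)
  · rw [hΛ.E]
    exact zero_mem _
  · rw [hΛ.F]
    exact zero_mem _

theorem serPair_mem_tame (hL : IsToralDer η w w' τ e f L) (hΛ : IsToralRep τ e f L Λ)
    (ε : B →ₗ[k⟦X⟧] k⟦X⟧) {x y : B} (hx : x ∈ polyAdj τ e f) (hy : y ∈ polyAdj τ e f) :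
    serPair ε (Λ x) y ∈ Ser.tame (Ser.hSq k) := by
  obtain ⟨c, hc⟩ := Ser.mem_tame.1 (hΛ.polyAdj_le_comap_tame hx)
  obtain ⟨c', hc'⟩ := hL.polyAdj_le_slow hy
  refine Ser.mem_tame.2 ⟨c' + c, fun m => Ser.mem_hSq_pow.2 ?_⟩
  obtain ⟨v, hv⟩ := mem_slowSub.1 hc' m _ (hc m)
  refine ⟨ε v, ?_⟩
  have h1 := congrArg ε hv
  rw [LinearMap.lsmul_apply, map_smul, LinearMap.smul_apply, smul_smul, ← pow_add, map_smul] at h1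
  rw [coeff_serPair]
  exact h1.symm

theorem rescale_mem_tame {A : Type*} [Ring A] [Algebra k⟦X⟧ A] {S : Submodule k⟦X⟧ A} {g : Ser A}
    (hg : g ∈ Ser.tame S) (r : k⟦X⟧) : Ser.rescale r g ∈ Ser.tame S := by
  obtain ⟨c, hc⟩ := Ser.mem_tame.1 hg
  refine Ser.mem_tame.2 ⟨c, fun m => ?_⟩
  rw [Ser.coeff_rescale, smul_comm]
  exact Submodule.smul_mem _ _ (hc m)

end TamePair

/-! ### The toral cocycle -/

section Cocycle

variable {k : Type*} [Field k] [CharZero k] {n : ℕ}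
variable {h : Type*} [AddCommGroup h] [Module k⟦X⟧ h]
variable {P : Matrix (Fin n) (Fin n) k⟦X⟧} {R : Realization P h}
variable {B : Type*} [Ring B] [Algebra k⟦X⟧ B] [IsAdicComplete (hIdeal k) B]
variable {τ : h →ₗ[k⟦X⟧] B} {e f : Fin n → B}
variable {η : h →ₗ[k⟦X⟧] h →ₗ[k⟦X⟧] k⟦X⟧}
variable {w w' : h →ₗ[k⟦X⟧] Fin n → k⟦X⟧}
variable {L M : h →ₗ[k⟦X⟧] Module.End k⟦X⟧ B}
variable {Λ N : B →ₐ[k⟦X⟧] Ser (Module.End k⟦X⟧ B)}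
variable {Δ : B →ₐ[k⟦X⟧] HatTensor k B B} {ε : B →ₐ[k⟦X⟧] k⟦X⟧} {S : B →ₐ[k⟦X⟧] Bᵐᵒᵖ}

theorem tor_mem_polyAdj (T : h) : τ T ∈ polyAdj τ e f :=
  Algebra.subset_adjoin (Or.inl (Or.inl (Or.inl ⟨T, rfl⟩)))

theorem hexp_mem_polyAdj (T : h) : hexp (k := k) (τ T) ∈ polyAdj τ e f :=
  Algebra.subset_adjoin (Or.inl (Or.inl (Or.inr ⟨T, rfl⟩)))

theorem E_mem_polyAdj (i : Fin n) : e i ∈ polyAdj τ e f :=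
  Algebra.subset_adjoin (Or.inl (Or.inr ⟨i, rfl⟩))

theorem F_mem_polyAdj (i : Fin n) : f i ∈ polyAdj τ e f :=
  Algebra.subset_adjoin (Or.inr ⟨i, rfl⟩)

theorem hexp_neg_mem_polyAdj (T : h) : hexp (k := k) (-τ T) ∈ polyAdj τ e f := by
  rw [← map_neg]
  exact hexp_mem_polyAdj (-T)

theorem IsTopGen.hClosure_polyAdj (hg : IsTopGen (k := k) τ e f) :
    hClosure (Subalgebra.toSubmodule (polyAdj τ e f)) = ⊤ := by
  refine eq_top_iff.2 fun x _ => ?_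
  exact hg.mem (closureSub (polyAdj τ e f)) (hClosed_hClosure _)
    (fun T => le_hClosure _ (tor_mem_polyAdj T)) (fun i => le_hClosure _ (E_mem_polyAdj i))
    (fun i => le_hClosure _ (F_mem_polyAdj i)) x

namespace IsStdHopf

variable (H : IsStdHopf R τ e f Δ ε S)

include H

theorem polyAdj_le_comap_comul : polyAdj τ e f ≤ (((toHatAlg k (B ⊗[k⟦X⟧] B)).comp
    (Algebra.TensorProduct.map (polyAdj τ e f).val (polyAdj τ e f).val)).range).comap Δ := by
  have h0 (a b : polyAdj τ e f) : toHat (k := k) ((a : B) ⊗ₜ[k⟦X⟧] (b : B)) ∈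
      ((toHatAlg k (B ⊗[k⟦X⟧] B)).comp
        (Algebra.TensorProduct.map (polyAdj τ e f).val (polyAdj τ e f).val)).range :=
    ⟨a ⊗ₜ b, rfl⟩
  refine polyAdj_le (fun T => ?_) (fun T => ?_) (fun i => ?_) (fun i => ?_) <;> rw [Subalgebra.mem_comap]
  · rw [H.comul_tor, map_add]
    exact add_mem (h0 ⟨_, tor_mem_polyAdj T⟩ 1) (h0 1 ⟨_, tor_mem_polyAdj T⟩)
  · rw [H.comul_hexp]
    exact h0 ⟨_, hexp_mem_polyAdj T⟩ ⟨_, hexp_mem_polyAdj T⟩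
  · rw [H.comul_E, map_add]
    exact add_mem (h0 ⟨_, E_mem_polyAdj i⟩ 1) (h0 ⟨_, hexp_mem_polyAdj _⟩ ⟨_, E_mem_polyAdj i⟩)
  · rw [H.comul_F, map_add]
    exact add_mem (h0 ⟨_, F_mem_polyAdj i⟩ ⟨_, hexp_neg_mem_polyAdj _⟩) (h0 1 ⟨_, F_mem_polyAdj i⟩)

theorem exists_comul_eq_sum (x : polyAdj τ e f) : ∃ (N : ℕ) (a b : Fin N → polyAdj τ e f),
    Δ (x : B) = toHat (∑ i, (a i : B) ⊗ₜ[k⟦X⟧] (b i : B)) := by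
  obtain ⟨t, ht⟩ := H.polyAdj_le_comap_comul x.2
  obtain ⟨N, a, b, rfl⟩ := TensorProduct.exists_sum_tmul_eq t
  refine ⟨N, a, b, ht.symm.trans ?_⟩
  change toHat (k := k) (Algebra.TensorProduct.map _ _ _) = _
  rw [map_sum]
  rfl

theorem exists_comul_comul_eq_sum (x : polyAdj τ e f) : ∃ (N : ℕ) (a b c : Fin N → polyAdj τ e f),
    hatTensorMap toHat Δ.toLinearMap (Δ (x : B)) =
      toHat (∑ i, (a i : B) ⊗ₜ[k⟦X⟧] ((b i : B) ⊗ₜ[k⟦X⟧] (c i : B))) := by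
  obtain ⟨N, a, b, hx⟩ := H.exists_comul_eq_sum x
  choose N' b' c hb using fun i => H.exists_comul_eq_sum (b i)
  refine ⟨∑ i, N' i, fun i => a (finSigmaFinEquiv.symm i).1,
    fun i => b' _ (finSigmaFinEquiv.symm i).2, fun i => c _ (finSigmaFinEquiv.symm i).2, ?_⟩
  have h1 (a b : B) {u : B ⊗[k⟦X⟧] B} (hu : Δ b = toHat u) :
      hatTensorMap toHat Δ.toLinearMap (toHat (k := k) (a ⊗ₜ[k⟦X⟧] b)) = toHat (a ⊗ₜ[k⟦X⟧] u) := by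
    rw [hatTensorMap, hatExtend_toHat, LinearMap.comp_apply, TensorProduct.map_tmul,
      TensorProduct.lift.tmul, AlgHom.toLinearMap_apply, hu, boxTensor_toHat]
  rw [hx, map_sum, map_sum, Finset.sum_congr rfl fun i _ => h1 (a i) (b i) (hb i), ← map_sum]
  congr 1
  refine Eq.trans ?_ (finSigmaFinEquiv.symm.sum_comp fun p : (i : Fin N) × Fin (N' i) =>
    (a p.1 : B) ⊗ₜ[k⟦X⟧] ((b' p.1 p.2 : B) ⊗ₜ[k⟦X⟧] (c p.1 p.2 : B))).symm
  rw [Fintype.sum_sigma]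
  simp only [TensorProduct.tmul_sum]

theorem unop_antipode_mem {x : B} (hx : x ∈ polyAdj τ e f) : (S x).unop ∈ polyAdj τ e f := by
  have h1 : polyAdj τ e f ≤ (polyAdj τ e f).op.comap S := by
    refine polyAdj_le (fun T => ?_) (fun T => ?_) (fun i => ?_) (fun i => ?_) <;>
      rw [Subalgebra.mem_comap, Subalgebra.mem_op]
    · rw [H.antipode_tor]
      exact neg_mem (tor_mem_polyAdj T)
    · rw [H.antipode_hexp]
      exact hexp_neg_mem_polyAdj T
    · rw [H.antipode_E]
      exact neg_mem (mul_mem (hexp_neg_mem_polyAdj _) (E_mem_polyAdj i))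
    · rw [H.antipode_F]
      exact neg_mem (mul_mem (F_mem_polyAdj i) (hexp_mem_polyAdj _))
  exact h1 hx

end IsStdHopf

theorem Ser.rescale_neg_one_rescale_neg_one {A : Type*} [Ring A] [Algebra k⟦X⟧ A] (g : Ser A) :
    Ser.rescale (-1 : k⟦X⟧) (Ser.rescale (-1 : k⟦X⟧) g) = g := Ser.ext fun m => by
  rw [Ser.coeff_rescale, Ser.coeff_rescale, smul_smul, ← mul_pow, neg_one_mul, neg_neg, one_pow, one_smul]

theorem rescale_serPair (ε : B →ₗ[k⟦X⟧] k⟦X⟧) (c : k⟦X⟧) (u : Ser (Module.End k⟦X⟧ B)) (y : B) :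
    Ser.rescale c (serPair ε u y) = serPair ε (Ser.rescale c u) y := Ser.ext fun m => by
  rw [Ser.coeff_rescale, coeff_serPair, coeff_serPair, Ser.coeff_rescale, LinearMap.smul_apply, map_smul]

namespace IsToralPair

variable (Z : IsToralPair τ e f Δ ε L M Λ N) (H : IsStdHopf R τ e f Δ ε S)

include Z H

theorem serPair_apply_one (x : B) : serPair ε.toLinearMap (Λ x) 1 = algebraMap k⟦X⟧ _ (ε x) := by
  have h0 (T : h) : L T 1 = 0 := by
    have h1 := Z.mul T 1 1
    rw [mul_one, mul_one, one_mul] at h1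
    exact left_eq_add.1 h1
  have h1 : (serPair ε.toLinearMap).flip 1 ∘ₗ Λ.toLinearMap =
      (Algebra.linearMap k⟦X⟧ (Ser k⟦X⟧)) ∘ₗ ε.toLinearMap := by
    refine H.gen.linearMap_ext ?_ (fun T x hx => ?_) (fun i x hx => ?_) (fun i x hx => ?_) <;>
      simp only [LinearMap.comp_apply, AlgHom.toLinearMap_apply, LinearMap.flip_apply,
        Algebra.linearMap_apply]
    · rw [map_one Λ, serPair_one]
      rfl
    · rw [Z.serPair_tor_mul H, h0, map_zero, mul_zero, map_mul ε, H.counit_tor, zero_mul, map_zero]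
    · rw [Z.left.E_mul, map_zero, LinearMap.zero_apply, map_mul ε, H.counit_E, zero_mul, map_zero]
    · rw [Z.left.F_mul, map_zero, LinearMap.zero_apply, map_mul ε, H.counit_F, zero_mul, map_zero]
  exact LinearMap.congr_fun h1 x

theorem sum_serPair_mul_inv {x y : B} {ι ι' : Type*} [Fintype ι] [Fintype ι'] {a b : ι → B}
    {c c' : ι' → B} (hx : Δ x = toHat (∑ i, a i ⊗ₜ[k⟦X⟧] b i))
    (hy : Δ y = toHat (∑ j, c j ⊗ₜ[k⟦X⟧] c' j)) :
    ∑ i, ∑ j, serPair ε.toLinearMap (Λ (a i)) (c j) *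
      Ser.rescale (-1 : k⟦X⟧) (serPair ε.toLinearMap (Λ (b i)) (c' j)) =
      algebraMap k⟦X⟧ _ (ε x * ε y) := by
  simp only [rescale_serPair]
  simp only [← Z.serPair_mul H hy]
  rw [← LinearMap.sum_apply, ← map_sum, Z.map_mul_map_comul H x hx, Algebra.algebraMap_eq_smul_one,
    map_smul, LinearMap.smul_apply, serPair_one, Algebra.algebraMap_eq_smul_one, mul_smul]
  congr 1
  exact Algebra.algebraMap_eq_smul_one _

theorem sum_serPair_inv_mul {x y : B} {ι ι' : Type*} [Fintype ι] [Fintype ι'] {a b : ι → B}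
    {c c' : ι' → B} (hx : Δ x = toHat (∑ i, a i ⊗ₜ[k⟦X⟧] b i))
    (hy : Δ y = toHat (∑ j, c j ⊗ₜ[k⟦X⟧] c' j)) :
    ∑ i, ∑ j, Ser.rescale (-1 : k⟦X⟧) (serPair ε.toLinearMap (Λ (a i)) (c j)) *
      serPair ε.toLinearMap (Λ (b i)) (c' j) = algebraMap k⟦X⟧ _ (ε x * ε y) := by
  have h1 := congrArg (Ser.rescale (-1 : k⟦X⟧)) (Z.sum_serPair_mul_inv H hx hy)
  simpa only [map_sum, map_mul, Ser.rescale_neg_one_rescale_neg_one, AlgHom.commutes] using h1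

theorem sum_serPair_cocycle {x y z : B} {ι ι' ι'' : Type*} [Fintype ι] [Fintype ι'] [Fintype ι'']
    {a b : ι → B} {c c' : ι' → B} {r r' : ι'' → B} (hx : Δ x = toHat (∑ i, a i ⊗ₜ[k⟦X⟧] b i))
    (hy : Δ y = toHat (∑ j, c j ⊗ₜ[k⟦X⟧] c' j)) (hz : Δ z = toHat (∑ l, r l ⊗ₜ[k⟦X⟧] r' l)) :
    ∑ j, ∑ l, serPair ε.toLinearMap (Λ (c j)) (r l) * serPair ε.toLinearMap (Λ x) (c' j * r' l) =
      ∑ i, ∑ j, serPair ε.toLinearMap (Λ (a i)) (c j) * serPair ε.toLinearMap (Λ (b i * c' j)) z := by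
  have h1 (x y : B) := Z.left.commute Z.left H.gen Z.comm_left x y
  have h2 (j : ι') : ∑ l, serPair ε.toLinearMap (Λ (c j)) (r l) *
      serPair ε.toLinearMap (Λ x) (c' j * r' l) =
      ∑ i, serPair ε.toLinearMap (Λ (a i)) (c' j) * serPair ε.toLinearMap (Λ (c j) * Λ (b i)) z := by
    simp only [Z.serPair_apply_mul H hx, Finset.mul_sum]
    rw [Finset.sum_comm]
    refine Finset.sum_congr rfl fun i _ => ?_
    rw [(h1 (c j) (b i)).eq, Z.serPair_mul H hz, Finset.mul_sum]
    refine Finset.sum_congr rfl fun l _ => ?_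
    rw [mul_left_comm]
  rw [Finset.sum_congr rfl fun j _ => h2 j, Finset.sum_comm]
  refine Finset.sum_congr rfl fun i _ => ?_
  rw [← Z.sum_serPair_mul_swap H hy]
  refine Finset.sum_congr rfl fun j _ => ?_
  rw [map_mul Λ, (h1 (c' j) (b i)).eq]

end IsToralPair

variable {U : Subalgebra k⟦X⟧ B} (hU : U ≤ polyAdj τ e f)

/-- The toral pairing on the dense subalgebra, with values in tame series. -/
def tamePair (hL : IsToralDer η w w' τ e f L) (hΛ : IsToralRep τ e f L Λ) (ε : B →ₐ[k⟦X⟧] k⟦X⟧) (s : k) :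
    U →ₗ[k⟦X⟧] U →ₗ[k⟦X⟧] Ser.tame (Ser.hSq k) :=
  LinearMap.mk₂ k⟦X⟧
    (fun x y => ⟨Ser.rescale (C s : k⟦X⟧) (serPair ε.toLinearMap (Λ x) y),
      rescale_mem_tame (serPair_mem_tame hL hΛ ε.toLinearMap (hU x.2) (hU y.2)) _⟩)
    (fun x x' y => Subtype.ext (by simp)) (fun c x y => Subtype.ext (by simp))
    (fun x y y' => Subtype.ext (by simp)) (fun c x y => Subtype.ext (by simp))

theorem coe_tamePair (hL : IsToralDer η w w' τ e f L) (hΛ : IsToralRep τ e f L Λ) (ε : B →ₐ[k⟦X⟧] k⟦X⟧)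
    (s : k) (x y : U) : (tamePair hU hL hΛ ε s x y : Ser k⟦X⟧) =
      Ser.rescale (C s : k⟦X⟧) (serPair ε.toLinearMap (Λ x) y) := rfl

/-- The toral cocycle. -/
def toralForm (hL : IsToralDer η w w' τ e f L) (hΛ : IsToralRep τ e f L Λ) (ε : B →ₐ[k⟦X⟧] k⟦X⟧) (s : k) :
    U →ₗ[k⟦X⟧] U →ₗ[k⟦X⟧] LaurentSeries k :=
  (tamePair hU hL hΛ ε s).compr₂ (Ser.evalInvHom k).toLinearMap

theorem toralForm_apply (hL : IsToralDer η w w' τ e f L) (hΛ : IsToralRep τ e f L Λ)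
    (ε : B →ₐ[k⟦X⟧] k⟦X⟧) (s : k) (x y : U) :
    toralForm hU hL hΛ ε s x y = Ser.evalInvHom k (tamePair hU hL hΛ ε s x y) := rfl

theorem Ser.rescale_one {A : Type*} [Ring A] [Algebra k⟦X⟧ A] (g : Ser A) :
    Ser.rescale (C (1 : k) : k⟦X⟧) g = g := Ser.ext fun m => by
  rw [Ser.coeff_rescale, map_one, one_pow, one_smul]

theorem rescale_C_neg_one {A : Type*} [Ring A] [Algebra k⟦X⟧ A] (g : Ser A) :
    Ser.rescale (C (-1 : k) : k⟦X⟧) g = Ser.rescale (-1 : k⟦X⟧) g := by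
  rw [map_neg, map_one]

namespace IsToralPair

variable (Z : IsToralPair τ e f Δ ε L M Λ N) (H : IsStdHopf R τ e f Δ ε S)
  (hL : IsToralDer η w w' τ e f L)

include Z H

theorem toralForm_one_right (x : U) : toralForm hU hL Z.left ε 1 x 1 =
    algebraMap k⟦X⟧ (LaurentSeries k) (ε x) := by
  rw [toralForm_apply]
  refine Eq.trans (congrArg _ (Subtype.ext ?_)) ((Ser.evalInvHom k).commutes _)
  rw [coe_tamePair, Ser.rescale_one]
  exact Z.serPair_apply_one H x

theorem toralForm_one_left (x : U) : toralForm hU hL Z.left ε 1 1 x =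
    algebraMap k⟦X⟧ (LaurentSeries k) (ε x) := by
  rw [toralForm_apply]
  refine Eq.trans (congrArg _ (Subtype.ext ?_)) ((Ser.evalInvHom k).commutes _)
  rw [coe_tamePair, Ser.rescale_one]
  refine Eq.trans ?_ (serPair_one (ε := ε) (x : B))
  rw [← map_one Λ]
  rfl

theorem toralForm_mul_inv {x y : U} {ι ι' : Type*} [Fintype ι] [Fintype ι'] {a b : ι → U}
    {c c' : ι' → U} (hx : Δ x = toHat (∑ i, (a i : B) ⊗ₜ[k⟦X⟧] (b i : B)))
    (hy : Δ y = toHat (∑ j, (c j : B) ⊗ₜ[k⟦X⟧] (c' j : B))) :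
    ∑ i, ∑ j, toralForm hU hL Z.left ε 1 (a i) (c j) * toralForm hU hL Z.left ε (-1) (b i) (c' j) =
      algebraMap k⟦X⟧ (LaurentSeries k) (ε x * ε y) := by
  simp only [toralForm_apply, ← map_mul (Ser.evalInvHom k), ← map_sum (Ser.evalInvHom k)]
  refine Eq.trans (congrArg _ (Subtype.ext ?_)) ((Ser.evalInvHom k).commutes _)
  simp only [AddSubmonoidClass.coe_finsetSum, MulMemClass.coe_mul, coe_tamePair, Ser.rescale_one,
    rescale_C_neg_one]
  exact Z.sum_serPair_mul_inv H hx hy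

theorem toralForm_inv_mul {x y : U} {ι ι' : Type*} [Fintype ι] [Fintype ι'] {a b : ι → U}
    {c c' : ι' → U} (hx : Δ x = toHat (∑ i, (a i : B) ⊗ₜ[k⟦X⟧] (b i : B)))
    (hy : Δ y = toHat (∑ j, (c j : B) ⊗ₜ[k⟦X⟧] (c' j : B))) :
    ∑ i, ∑ j, toralForm hU hL Z.left ε (-1) (a i) (c j) * toralForm hU hL Z.left ε 1 (b i) (c' j) =
      algebraMap k⟦X⟧ (LaurentSeries k) (ε x * ε y) := by
  simp only [toralForm_apply, ← map_mul (Ser.evalInvHom k), ← map_sum (Ser.evalInvHom k)]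
  refine Eq.trans (congrArg _ (Subtype.ext ?_)) ((Ser.evalInvHom k).commutes _)
  simp only [AddSubmonoidClass.coe_finsetSum, MulMemClass.coe_mul, coe_tamePair, Ser.rescale_one,
    rescale_C_neg_one]
  exact Z.sum_serPair_inv_mul H hx hy

theorem toralForm_cocycle {x y z : U} {ι ι' ι'' : Type*} [Fintype ι] [Fintype ι'] [Fintype ι'']
    {a b : ι → U} {c c' : ι' → U} {r r' : ι'' → U}
    (hx : Δ x = toHat (∑ i, (a i : B) ⊗ₜ[k⟦X⟧] (b i : B)))
    (hy : Δ y = toHat (∑ j, (c j : B) ⊗ₜ[k⟦X⟧] (c' j : B)))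
    (hz : Δ z = toHat (∑ l, (r l : B) ⊗ₜ[k⟦X⟧] (r' l : B))) :
    ∑ j, ∑ l, toralForm hU hL Z.left ε 1 (c j) (r l) * toralForm hU hL Z.left ε 1 x (c' j * r' l) =
      ∑ i, ∑ j, toralForm hU hL Z.left ε 1 (a i) (c j) * toralForm hU hL Z.left ε 1 (b i * c' j) z := by
  simp only [toralForm_apply, ← map_mul (Ser.evalInvHom k), ← map_sum (Ser.evalInvHom k)]
  refine congrArg _ (Subtype.ext ?_)
  simp only [AddSubmonoidClass.coe_finsetSum, MulMemClass.coe_mul, coe_tamePair, Ser.rescale_one]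
  exact Z.sum_serPair_cocycle H hx hy hz

end IsToralPair

end Cocycle

section CocycleUAlg

variable {k : Type*} [Field k] [CharZero k] {n : ℕ}
variable {h : Type*} [AddCommGroup h] [Module k⟦X⟧ h]
variable {A : Matrix (Fin n) (Fin n) ℤ} {d : Fin n → ℕ} {P : Matrix (Fin n) (Fin n) k⟦X⟧}
variable (hA : IsSymmetrizableGCM A d) (hP : IsCartanType A d P) (R : Realization P h)
variable {η : h →ₗ[k⟦X⟧] h →ₗ[k⟦X⟧] k⟦X⟧}
variable {w w' : h →ₗ[k⟦X⟧] Fin n → k⟦X⟧}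
variable {L M : h →ₗ[k⟦X⟧] Module.End k⟦X⟧ (UAlg A d R)}
variable {Λ N : UAlg A d R →ₐ[k⟦X⟧] Ser (Module.End k⟦X⟧ (UAlg A d R))}

theorem UAlg.isDenseHopf : IsDenseHopf (UAlg.hopf hA hP R) where
  dense := (UAlg.isTopGen A d R).hClosure_polyAdj
  sweedler_two := (UAlg.isStdHopf hA hP R).exists_comul_eq_sum
  sweedler_three := (UAlg.isStdHopf hA hP R).exists_comul_comul_eq_sum
  antipode_mem _ hx := (UAlg.isStdHopf hA hP R).unop_antipode_mem hx

variable (A d) in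
theorem UAlg.polySub_le : polySub A d R ≤ polyAdj (UAlg.torₗ A d R) (UAlg.E A d R) (UAlg.F A d R) :=
  le_of_eq rfl

/-- The toral cocycle of `U_{P,ħ}^R(g)`. -/
def UAlg.toralForm (hL : IsToralDer η w w' (UAlg.torₗ A d R) (UAlg.E A d R) (UAlg.F A d R) L)
    (hΛ : IsToralRep (UAlg.torₗ A d R) (UAlg.E A d R) (UAlg.F A d R) L Λ) (s : k) :
    polySub A d R →ₗ[k⟦X⟧] polySub A d R →ₗ[k⟦X⟧] LaurentSeries k :=
  FoMpQUEA.toralForm (UAlg.polySub_le A d R) hL hΛ (UAlg.counit A d R) s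

theorem UAlg.isHopfTwoCocycle
    (Z : IsToralPair (UAlg.torₗ A d R) (UAlg.E A d R) (UAlg.F A d R) (UAlg.comul hA hP R)
      (UAlg.counit A d R) L M Λ N)
    (hL : IsToralDer η w w' (UAlg.torₗ A d R) (UAlg.E A d R) (UAlg.F A d R) L) :
    IsHopfTwoCocycle (UAlg.hopf hA hP R) (UAlg.toralForm R hL Z.left 1)
      (UAlg.toralForm R hL Z.left (-1)) where
  norm_right := Z.toralForm_one_right (UAlg.polySub_le A d R) (UAlg.isStdHopf hA hP R) hL
  norm_left := Z.toralForm_one_left (UAlg.polySub_le A d R) (UAlg.isStdHopf hA hP R) hL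
  mul_inv x y N N' x₁ x₂ y₁ y₂ hx hy :=
    Z.toralForm_mul_inv (UAlg.polySub_le A d R) (UAlg.isStdHopf hA hP R) hL hx hy
  inv_mul x y N N' x₁ x₂ y₁ y₂ hx hy :=
    Z.toralForm_inv_mul (UAlg.polySub_le A d R) (UAlg.isStdHopf hA hP R) hL hx hy
  cocycle x y z N N' N'' x₁ x₂ y₁ y₂ z₁ z₂ hx hy hz :=
    Z.toralForm_cocycle (UAlg.polySub_le A d R) (UAlg.isStdHopf hA hP R) hL hx hy hz

theorem UAlg.isToralProj {π : UAlg A d R →ₐ[k⟦X⟧] Hat k R.symBar}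
    (hπ : IsSymProj (UAlg.torₗ A d R) (UAlg.E A d R) (UAlg.F A d R) R.sSpan.mkQ π) :
    IsToralProj (UAlg.hopf hA hP R) π := by
  have h1 := hπ.map_comul (UAlg.isStdHopf hA hP R)
  have h2 := hπ.map_counit (UAlg.isStdHopf hA hP R)
  have h3 := hπ.surjective (Submodule.mkQ_surjective _)
  constructor
  · exact hπ.E
  · exact hπ.F
  · exact hπ.tor
  · exact h3
  · exact h1
  · exact h2

include hA hP in
theorem UAlg.isToralCocycle (χ : AltS R) (hη : η = (C (2⁻¹ : k) : k⟦X⟧) • χ.form)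
    {π : UAlg A d R →ₐ[k⟦X⟧] Hat k R.symBar}
    (hπ : IsSymProj (UAlg.torₗ A d R) (UAlg.E A d R) (UAlg.F A d R) R.sSpan.mkQ π)
    (hL : IsToralDer η w w' (UAlg.torₗ A d R) (UAlg.E A d R) (UAlg.F A d R) L)
    (hΛ : IsToralRep (UAlg.torₗ A d R) (UAlg.E A d R) (UAlg.F A d R) L Λ)
    (hLL : ∀ T T', Commute (L T) (L T')) (s : k) :
    IsToralCocycle χ π s (UAlg.toralForm R hL hΛ s) := by
  intro x y r
  obtain ⟨M₀, hM⟩ := Ser.evalInvHom_sub_sum (tamePair (UAlg.polySub_le A d R) hL hΛ (UAlg.counit A d R) s x y) r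
  refine ⟨M₀, fun M hMM => ?_⟩
  obtain ⟨v, hv⟩ := hM M hMM
  refine ⟨v, hv ▸ ?_⟩
  rw [UAlg.toralForm, FoMpQUEA.toralForm_apply]
  congr 1
  refine Finset.sum_congr rfl fun m _ => ?_
  have h1 := hπ.counit_coeff (UAlg.isStdHopf hA hP R) hL hΛ hLL (β := χ.bar) (c := (C (2⁻¹ : k) : k⟦X⟧))
    (fun T T' => by rw [hη]; rfl) m x y
  rw [coe_tamePair, Ser.coeff_rescale, coeff_serPair, AlgHom.toLinearMap_apply, h1]
  have h2 : toralTerm χ π m ((x : UAlg A d R) ⊗ₜ (y : UAlg A d R)) =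
      hatExtend (symPow χ.bar m) (boxTensor (π x) (π y)) := rfl
  have h3 : expCoeff k s m = Ser.hInv k m *
      algebraMap k⟦X⟧ (LaurentSeries k) (C s ^ m * (C (2⁻¹ : k) ^ m * C ((m.factorial : k)⁻¹))) := by
    rw [← map_pow, ← map_pow, ← map_mul, ← map_mul, Ser.hInv, expCoeff]
    have h4 (a : k) : algebraMap k⟦X⟧ (LaurentSeries k) (C a) = HahnSeries.single 0 a :=
      HahnSeries.ofPowerSeries_C a
    rw [h4, HahnSeries.single_mul_single, add_zero, one_mul]
    congr 1
    rw [div_eq_mul_inv, mul_inv, inv_pow]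
  rw [h2, h3, mul_assoc, ← map_mul, smul_eq_mul, mul_assoc]

end CocycleUAlg

/-! ### Exponentials of derivations -/

section ExpDer

variable {k : Type*} [Field k] [CharZero k]
variable {B : Type*} [Ring B] [Algebra k⟦X⟧ B]

theorem Ser.SumsAt.congr {f g : Ser (Module.End k⟦X⟧ B)} {y z v : B} (hf : Ser.SumsAt k f y v)
    (hfg : ∀ m, Ser.coeff m g z = Ser.coeff m f y) : Ser.SumsAt k g z v := by
  simpa only [Ser.SumsAt, hfg] using hf

theorem coeff_expS_mul {δ : Module.End k⟦X⟧ B} (hδ : ∀ x y, δ (x * y) = δ x * y + x * δ y) (m : ℕ)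
    (x y : B) : Ser.coeff m (Ser.expS k δ) (x * y) = ∑ p ∈ Finset.HasAntidiagonal.antidiagonal m,
      Ser.coeff p.1 (Ser.expS k δ) x * Ser.coeff p.2 (Ser.expS k δ) y := by
  have hc : Commute (δ.rTensor B) (δ.lTensor B) := (LinearMap.rTensor_comp_lTensor B δ δ).trans
    (LinearMap.lTensor_comp_rTensor B δ δ).symm
  have h1 (m : ℕ) (u : B ⊗[k⟦X⟧] B) : LinearMap.mul' k⟦X⟧ B (((δ.rTensor B + δ.lTensor B) ^ m) u) =
      (δ ^ m) (LinearMap.mul' k⟦X⟧ B u) := by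
    induction m with
    | zero => rfl
    | succ m ih =>
      rw [pow_succ', pow_succ', Module.End.mul_apply, Module.End.mul_apply, ← ih]
      generalize ((δ.rTensor B + δ.lTensor B) ^ m) u = u
      induction u using TensorProduct.induction_on with
      | zero => simp
      | add u v hu hv => rw [map_add, map_add, map_add, map_add, hu, hv]
      | tmul a b => simp [hδ]
  have h2 := congrArg (fun t : Module.End k⟦X⟧ (B ⊗[k⟦X⟧] B) => LinearMap.mul' k⟦X⟧ B (t (x ⊗ₜ y)))
    (congrArg (Ser.coeff m) (Ser.expS_add (k := k) hc))
  simp only [Ser.coeff_expS, Ser.coeff_mul, LinearMap.smul_apply, map_smul, h1, LinearMap.sum_apply,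
    map_sum, Module.End.mul_apply, LinearMap.rTensor_pow, LinearMap.lTensor_pow, LinearMap.lTensor_tmul,
    LinearMap.rTensor_tmul, LinearMap.mul'_apply] at h2 ⊢
  rw [h2]
  refine Finset.sum_congr rfl fun p _ => ?_
  rw [smul_mul_smul_comm, smul_smul, mul_comm]

theorem Ser.SumsAt.expS_mul {δ : Module.End k⟦X⟧ B} (hδ : ∀ x y, δ (x * y) = δ x * y + x * δ y)
    {x y v w : B} (hx : Ser.SumsAt k (Ser.expS k δ) x v) (hy : Ser.SumsAt k (Ser.expS k δ) y w) :
    Ser.SumsAt k (Ser.expS k δ) (x * y) (v * w) := by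
  let f : Ser (Module.End k⟦X⟧ B) := Ser.mk fun m => LinearMap.mulLeft k⟦X⟧ (Ser.coeff m (Ser.expS k δ) x)
  have hf (m : ℕ) (y : B) : Ser.coeff m f y = Ser.coeff m (Ser.expS k δ) x * y := by
    rw [(Ser.coeff_mk _ m : Ser.coeff m f = _)]
    rfl
  have h1 (y : B) : Ser.SumsAt k f y (LinearMap.mulLeft k⟦X⟧ v y) := fun r => by
    obtain ⟨N, hN⟩ := hx r
    refine ⟨N, fun m hm => ?_⟩
    have := Ser.map_mem_hIdeal (LinearMap.mulRight k⟦X⟧ y) (hN m hm)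
    simpa only [hf, LinearMap.mulRight_apply, sub_mul, Finset.sum_mul, LinearMap.mulLeft_apply] using this
  refine (Ser.SumsAt.mul h1 hy).congr fun m => ?_
  rw [coeff_expS_mul hδ, Ser.coeff_mul, LinearMap.sum_apply]
  exact Finset.sum_congr rfl fun p _ => (hf _ _).symm

theorem sumsAt_expS_of_eigen [IsAdicComplete (hIdeal k) B] {δ : Module.End k⟦X⟧ B} {x : B} {c : k⟦X⟧}
    (hx : δ x = (PowerSeries.X * c : k⟦X⟧) • x) : Ser.SumsAt k (Ser.expS k δ) x (sexp k c • x) := by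
  have h1 (m : ℕ) : (δ ^ m) x = (PowerSeries.X * c : k⟦X⟧) ^ m • x := by
    induction m with
    | zero => simp
    | succ m ih => rw [pow_succ', Module.End.mul_apply, ih, map_smul, hx, smul_smul, pow_succ]
  intro r
  refine ⟨r, fun N hN => ?_⟩
  obtain ⟨v, hv⟩ := hSeries_sub (k := k) (M := k⟦X⟧)
    (fun j => (C ((j.factorial : k)⁻¹) : k⟦X⟧) • c ^ j) N
  rw [mem_hIdeal_pow_smul_top]
  refine ⟨(PowerSeries.X ^ (N - r) : k⟦X⟧) • v • x, ?_⟩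
  rw [smul_smul (PowerSeries.X ^ r : k⟦X⟧), ← pow_add, Nat.add_sub_cancel' hN, ← smul_assoc, ← hv, sub_smul,
    Finset.sum_smul]
  congr 1
  refine Finset.sum_congr rfl fun m _ => ?_
  rw [Ser.coeff_expS, LinearMap.smul_apply, h1, smul_smul, smul_smul, _root_.mul_pow, smul_eq_mul,
    mul_left_comm, mul_assoc, mul_left_comm]

theorem sumsAt_expS_of_eq_algebraMap {δ : Module.End k⟦X⟧ B} (hδ : δ 1 = 0) {x : B} {c : k⟦X⟧}
    (hx : δ x = algebraMap k⟦X⟧ B c) : Ser.SumsAt k (Ser.expS k δ) x (x + algebraMap k⟦X⟧ B c) := by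
  refine ((Ser.sumsAt_const (k := k) (LinearMap.id : Module.End k⟦X⟧ B) x).add
    (Ser.sumsAt_single (k := k) δ x)).congr (fun m => ?_) |> fun h1 => by rwa [hx] at h1
  rw [map_add, Ser.coeff_const, Ser.coeff_single, Ser.coeff_expS]
  match m with
  | 0 => simp
  | 1 => simp
  | m + 2 =>
    have : (δ ^ (m + 2)) x = 0 := by
      rw [pow_add, Module.End.mul_apply, pow_two, Module.End.mul_apply, hx,
        Algebra.algebraMap_eq_smul_one, map_smul, hδ, smul_zero, map_zero]
    simp [this]

variable {n : ℕ} {h : Type*} [AddCommGroup h] [Module k⟦X⟧ h]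
variable [IsAdicComplete (hIdeal k) B] {τ : h →ₗ[k⟦X⟧] B} {e f : Fin n → B}

theorem IsTopGen.sumsAt_expS (hg : IsTopGen (k := k) τ e f) {δ : Module.End k⟦X⟧ B}
    (hδ : ∀ x y, δ (x * y) = δ x * y + x * δ y) (φ : B →ₐ[k⟦X⟧] B)
    (hT : ∀ T, Ser.SumsAt k (Ser.expS k δ) (τ T) (φ (τ T)))
    (hE : ∀ i, Ser.SumsAt k (Ser.expS k δ) (e i) (φ (e i)))
    (hF : ∀ i, Ser.SumsAt k (Ser.expS k δ) (f i) (φ (f i))) (x : B) :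
    Ser.SumsAt k (Ser.expS k δ) x (φ x) := by
  let V : Submodule k⟦X⟧ B :=
    { carrier := {x | Ser.SumsAt k (Ser.expS k δ) x (φ x)}
      zero_mem' := fun r => ⟨0, fun N _ => by simp⟩
      add_mem' := fun {x y} hx hy r => by
        obtain ⟨N, hN⟩ := hx r
        obtain ⟨N', hN'⟩ := hy r
        refine ⟨max N N', fun m hm => ?_⟩
        have := add_mem (hN m (le_of_max_le_left hm)) (hN' m (le_of_max_le_right hm))
        simp only [map_add, Finset.sum_add_distrib] at this ⊢
        rwa [add_sub_add_comm]
      smul_mem' := fun c x hx r => by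
        obtain ⟨N, hN⟩ := hx r
        refine ⟨N, fun m hm => ?_⟩
        have := Submodule.smul_mem _ c (hN m hm)
        simpa only [map_smul, smul_sub, Finset.smul_sum] using this }
  have hV : HClosed V := fun x hx r => by
    obtain ⟨s, hs, v, rfl⟩ := hx r
    obtain ⟨N, hN⟩ := hs r
    refine ⟨N, fun m hm => ?_⟩
    have h1 : φ ((PowerSeries.X ^ r : k⟦X⟧) • v) -
        ∑ m ∈ Finset.range m, Ser.coeff m (Ser.expS k δ) ((PowerSeries.X ^ r : k⟦X⟧) • v) ∈
          (hIdeal k ^ r • ⊤ : Submodule k⟦X⟧ B) := by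
      rw [mem_hIdeal_pow_smul_top]
      refine ⟨φ v - ∑ m ∈ Finset.range m, Ser.coeff m (Ser.expS k δ) v, ?_⟩
      simp only [map_smul, smul_sub, Finset.smul_sum]
    have := add_mem (hN m hm) h1
    simp only [map_add, Finset.sum_add_distrib]
    rwa [← add_sub_add_comm] at this
  have h1 : δ 1 = 0 := by
    have := hδ 1 1
    rw [mul_one, mul_one, one_mul] at this
    exact left_eq_add.1 this
  refine hg.induction hV ?_ (fun T x hx => ?_) (fun i x hx => ?_) (fun i x hx => ?_) x
  · have := sumsAt_expS_of_eigen (k := k) (c := 0) (by rw [h1, mul_zero, zero_smul] : δ 1 = _)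
    have h0 : sexp k 0 = 1 := hexp_zero
    rw [h0, one_smul] at this
    change Ser.SumsAt k _ _ _
    rwa [map_one φ]
  all_goals
    change Ser.SumsAt k _ _ _
    rw [map_mul φ]
  · exact (hT T).expS_mul hδ hx
  · exact (hE i).expS_mul hδ hx
  · exact (hF i).expS_mul hδ hx

variable {η : h →ₗ[k⟦X⟧] h →ₗ[k⟦X⟧] k⟦X⟧} {Tp : Fin n → h}
variable {L M : h →ₗ[k⟦X⟧] Module.End k⟦X⟧ B}
variable {a b : Fin n → B →ₐ[k⟦X⟧] B} {D : h →ₗ[k⟦X⟧] Module.End k⟦X⟧ B}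

theorem sexp_zero_smul (x : B) : sexp k 0 • x = x := by
  have h0 : sexp k 0 = 1 := hexp_zero
  rw [h0, one_smul]

theorem IsTwistOps.sumsAt_a (hO : IsTwistOps η Tp τ e f a b D) (hg : IsTopGen (k := k) τ e f)
    (hL : IsToralDer η (rowForm η Tp) 0 τ e f L) (j : Fin n) (y : B) :
    Ser.SumsAt k (Ser.expS k (L (Tp j))) y (a j y) := by
  refine hg.sumsAt_expS (hL.mul _) (a j) (fun T => ?_) (fun i => ?_) (fun i => ?_) y
  · rw [hO.a_tor]
    exact sumsAt_expS_of_eq_algebraMap (hL.map_one _) (hL.tor _ _)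
  · rw [hO.a_E]
    exact sumsAt_expS_of_eigen (hL.E _ _)
  · have := sumsAt_expS_of_eigen (k := k) (δ := L (Tp j)) (c := 0) (hL.F _ i)
    rw [sexp_zero_smul] at this
    rwa [hO.a_F]

theorem IsTwistOps.sumsAt_b (hO : IsTwistOps η Tp τ e f a b D) (hg : IsTopGen (k := k) τ e f)
    (hM : IsToralDer η 0 (rowForm η Tp) τ e f M) (j : Fin n) (y : B) :
    Ser.SumsAt k (Ser.expS k (-M (Tp j))) y (b j y) := by
  have h1 (x y : B) : (-M (Tp j)) (x * y) = (-M (Tp j)) x * y + x * (-M (Tp j)) y := by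
    simp only [LinearMap.neg_apply, hM.mul, neg_add, neg_mul, mul_neg]
  refine hg.sumsAt_expS h1 (b j) (fun T => ?_) (fun i => ?_) (fun i => ?_) y
  · rw [hO.b_tor, sub_eq_add_neg, ← map_neg (algebraMap k⟦X⟧ B)]
    refine sumsAt_expS_of_eq_algebraMap ?_ ?_
    · rw [LinearMap.neg_apply, hM.map_one, neg_zero]
    · rw [LinearMap.neg_apply, hM.tor, map_neg]
  · have := sumsAt_expS_of_eigen (k := k) (δ := -M (Tp j)) (x := e i) (c := 0)
      (by rw [LinearMap.neg_apply, hM.E]; simp)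
    rw [sexp_zero_smul] at this
    rwa [hO.b_E]
  · rw [hO.b_F]
    refine sumsAt_expS_of_eigen ?_
    rw [LinearMap.neg_apply, hM.F, mul_neg, neg_smul, rowForm_apply]

theorem IsTwistOps.sub_eq_smul (hO : IsTwistOps η Tp τ e f a b D) (hg : IsTopGen (k := k) τ e f)
    (hL : IsToralDer η (rowForm η Tp) 0 τ e f L) (hM : IsToralDer η 0 (rowForm η Tp) τ e f M) (T : h) :
    L T - M T = (PowerSeries.X : k⟦X⟧) • D T := by
  have h1 (x y : B) : (L T - M T) (x * y) = (L T - M T) x * y + x * (L T - M T) y := by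
    simp only [LinearMap.sub_apply, hL.mul, hM.mul, sub_mul, mul_sub]
    abel
  refine hg.derivation_ext (AlgHom.id k⟦X⟧ B) h1 (fun x y => ?_) (fun T' => ?_) (fun i => ?_) (fun i => ?_)
  · simp only [LinearMap.smul_apply, hO.D_mul hg, AlgHom.coe_id, id_eq, smul_add, smul_mul_assoc, mul_smul_comm]
  · have := hO.D_tor T T' 1
    rw [mul_one, hO.D_one, mul_zero] at this
    rw [LinearMap.sub_apply, hL.tor, hM.tor, sub_self, LinearMap.smul_apply, this, smul_zero]
  · have := hO.D_E T i 1
    rw [mul_one, hO.D_one, zero_add, mul_smul_comm, mul_one] at this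
    rw [LinearMap.sub_apply, hL.E, hM.E, LinearMap.smul_apply, this, smul_smul]
    simp [rowForm_apply]
  · have := hO.D_F T i 1
    rw [mul_one, hO.D_one, zero_sub, mul_neg, mul_smul_comm, mul_one] at this
    rw [LinearMap.sub_apply, hL.F, hM.F, LinearMap.smul_apply, this, smul_neg, smul_smul]
    simp [rowForm_apply]

theorem hexp_lmul_add_rmul (x y z : B) :
    hexp (k := k) (Algebra.lmul k⟦X⟧ B x + Algebra.lsmul k⟦X⟧ k⟦X⟧ B (MulOpposite.op y)) z =
      hexp (k := k) x * (z * hexp (k := k) y) := by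
  have h1 : Commute (Algebra.lmul k⟦X⟧ B x) (Algebra.lsmul k⟦X⟧ k⟦X⟧ B (MulOpposite.op y)) :=
    LinearMap.ext fun g => (mul_assoc x g y).symm
  have h2 : hexp (k := k) (MulOpposite.op y) = MulOpposite.op (hexp (k := k) y) :=
    (map_hSeries (k := k) (MulOpposite.opLinearEquiv k⟦X⟧ (M := B)).toLinearMap fun j =>
      (C ((j.factorial : k)⁻¹) : k⟦X⟧) • y ^ j).symm
  rw [hexp_add h1, ← map_hexp, ← map_hexp, h2]
  rfl

theorem IsTwistMul.hexp_apply {μ : B →ₗ[k⟦X⟧] B →ₗ[k⟦X⟧] B} (hμ : IsTwistMul τ e f a b D μ) (T : h) (x y : B) :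
    μ (hexp (k := k) (τ T) * x) y = hexp (k := k) (τ T) * μ x (hexp (k := k) (D T) y) := by
  have h1 := hexp_intertwine (k := k) (M := B) (N := Module.End k⟦X⟧ B) (ψ := μ)
    (X' := Algebra.lmul k⟦X⟧ B (τ T))
    (Y := Algebra.lmul k⟦X⟧ (Module.End k⟦X⟧ B) (Algebra.lmul k⟦X⟧ B (τ T)) +
      Algebra.lsmul k⟦X⟧ k⟦X⟧ (Module.End k⟦X⟧ B) (MulOpposite.op (D T)))
    (fun x => LinearMap.ext fun y => hμ.tor_apply T x y) x
  rw [hexp_lmul_add_rmul, ← map_hexp] at h1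
  exact LinearMap.congr_fun h1 y

end ExpDer

/-! ### The deformed product on the dense subalgebra -/

section DeformedMul

variable {k : Type*} [Field k] [CharZero k] {n : ℕ}
variable {h : Type*} [AddCommGroup h] [Module k⟦X⟧ h]
variable {P : Matrix (Fin n) (Fin n) k⟦X⟧} {R : Realization P h}
variable {B : Type*} [Ring B] [Algebra k⟦X⟧ B] [IsAdicComplete (hIdeal k) B]
variable {τ : h →ₗ[k⟦X⟧] B} {e f : Fin n → B}
variable {η : h →ₗ[k⟦X⟧] h →ₗ[k⟦X⟧] k⟦X⟧}
variable {L M : h →ₗ[k⟦X⟧] Module.End k⟦X⟧ B}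
variable {Λ N : B →ₐ[k⟦X⟧] Ser (Module.End k⟦X⟧ B)}
variable {Δ : B →ₐ[k⟦X⟧] HatTensor k B B} {ε : B →ₐ[k⟦X⟧] k⟦X⟧} {S : B →ₐ[k⟦X⟧] Bᵐᵒᵖ}

/-- The map `a ⊗ b ⊗ c ↦ b Λ a N c` of the completed tensor cube. -/
def opCube (Λ N : B →ₐ[k⟦X⟧] Ser (Module.End k⟦X⟧ B)) :
    Hat k (B ⊗[k⟦X⟧] (B ⊗[k⟦X⟧] B)) →ₗ[k⟦X⟧] Ser (Module.End k⟦X⟧ B) :=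
  hatExtend (LinearMap.mul' k⟦X⟧ _ ∘ₗ
    TensorProduct.map ((Ser.const (k := k)).comp (Algebra.lmul k⟦X⟧ B)).toLinearMap
      (LinearMap.mul' k⟦X⟧ _ ∘ₗ TensorProduct.map Λ.toLinearMap N.toLinearMap) ∘ₗ
    (TensorProduct.leftComm k⟦X⟧ B B B).toLinearMap)

theorem opCube_toHat (a b c : B) : opCube Λ N (toHat (k := k) (a ⊗ₜ[k⟦X⟧] (b ⊗ₜ[k⟦X⟧] c))) =
    Ser.const (k := k) (Algebra.lmul k⟦X⟧ B b) * (Λ a * N c) := hatExtend_toHat _ _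

theorem hatCube_ext {Q : Type*} [AddCommGroup Q] [Module k⟦X⟧ Q] [IsHausdorff (hIdeal k) Q]
    {φ ψ : Hat k (B ⊗[k⟦X⟧] (B ⊗[k⟦X⟧] B)) →ₗ[k⟦X⟧] Q}
    (hφ : ∀ a b c, φ (toHat (k := k) (a ⊗ₜ[k⟦X⟧] (b ⊗ₜ[k⟦X⟧] c))) =
      ψ (toHat (k := k) (a ⊗ₜ[k⟦X⟧] (b ⊗ₜ[k⟦X⟧] c)))) : φ = ψ := by
  refine hat_ext fun u => ?_
  induction u using TensorProduct.induction_on with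
  | zero => simp
  | add u v hu hv => rw [map_add, map_add, map_add, hu, hv]
  | tmul a t =>
    induction t using TensorProduct.induction_on with
    | zero => simp
    | add u v hu hv => rw [TensorProduct.tmul_add, map_add, map_add, map_add, hu, hv]
    | tmul b c => exact hφ a b c

theorem opCube_mul (hΛ : ∀ x y, Commute (Λ x) (Λ y)) (hN : ∀ x y, Commute (N x) (N y))
    (hΛN : ∀ x y, Commute (Λ x) (N y)) (a b c : B) (u : Hat k (B ⊗[k⟦X⟧] (B ⊗[k⟦X⟧] B))) :
    opCube Λ N (toHat (k := k) (a ⊗ₜ[k⟦X⟧] (b ⊗ₜ[k⟦X⟧] c)) * u) =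
      Ser.const (k := k) (Algebra.lmul k⟦X⟧ B b) * (opCube Λ N u * (Λ a * N c)) := by
  have h1 : opCube Λ N ∘ₗ LinearMap.mulLeft k⟦X⟧ (toHat (k := k) (a ⊗ₜ[k⟦X⟧] (b ⊗ₜ[k⟦X⟧] c))) =
      LinearMap.mulLeft k⟦X⟧ (Ser.const (k := k) (Algebra.lmul k⟦X⟧ B b)) ∘ₗ
        LinearMap.mulRight k⟦X⟧ (Λ a * N c) ∘ₗ opCube Λ N := hatCube_ext fun a' b' c' => by
    simp only [LinearMap.comp_apply, LinearMap.mulLeft_apply, LinearMap.mulRight_apply]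
    rw [toHat_mul, Algebra.TensorProduct.tmul_mul_tmul, Algebra.TensorProduct.tmul_mul_tmul, opCube_toHat,
      opCube_toHat, map_mul (Algebra.lmul k⟦X⟧ B), map_mul (Ser.const (k := k)), map_mul Λ, map_mul N,
      mul_assoc (Ser.const (k := k) _), mul_assoc (Ser.const (k := k) _), (hΛ a a').eq, (hN c c').eq]
    congr 2
    exact Commute.mul_mul_mul_comm (hΛN a c') (Λ a') (N c)
  exact LinearMap.congr_fun h1 u

/-- The operator series `∑ x₍₂₎ Λ x₍₁₎ N x₍₃₎`. -/
def opSer (Δ : B →ₐ[k⟦X⟧] HatTensor k B B) (Λ N : B →ₐ[k⟦X⟧] Ser (Module.End k⟦X⟧ B)) :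
    B →ₗ[k⟦X⟧] Ser (Module.End k⟦X⟧ B) :=
  opCube Λ N ∘ₗ ((hatTensorAlg (toHatAlg k B) Δ).comp Δ).toLinearMap

theorem opSer_apply (x : B) : opSer Δ Λ N x = opCube Λ N (hatTensorMap toHat Δ.toLinearMap (Δ x)) :=
  congrArg (opCube Λ N) (hatTensorAlg_eq _ _ _)

theorem opSer_mul (hΛ : ∀ x y, Commute (Λ x) (Λ y)) (hN : ∀ x y, Commute (N x) (N y))
    (hΛN : ∀ x y, Commute (Λ x) (N y)) {ι : Type*} [Fintype ι] {x : B} {a b c : ι → B}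
    (hx : hatTensorAlg (toHatAlg k B) Δ (Δ x) = toHat (∑ i, a i ⊗ₜ[k⟦X⟧] (b i ⊗ₜ[k⟦X⟧] c i))) (y : B) :
    opSer Δ Λ N (x * y) = ∑ i, Ser.const (k := k) (Algebra.lmul k⟦X⟧ B (b i)) *
      (opSer Δ Λ N y * (Λ (a i) * N (c i))) := by
  have h1 (u : Hat k (B ⊗[k⟦X⟧] (B ⊗[k⟦X⟧] B))) :
      opCube Λ N (toHat (∑ i, a i ⊗ₜ[k⟦X⟧] (b i ⊗ₜ[k⟦X⟧] c i)) * u) =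
      ∑ i, Ser.const (k := k) (Algebra.lmul k⟦X⟧ B (b i)) * (opCube Λ N u * (Λ (a i) * N (c i))) := by
    let G : B ⊗[k⟦X⟧] (B ⊗[k⟦X⟧] B) →ₗ[k⟦X⟧] Ser (Module.End k⟦X⟧ B) :=
      opCube Λ N ∘ₗ LinearMap.mulRight k⟦X⟧ u ∘ₗ toHat
    have hG (t : B ⊗[k⟦X⟧] (B ⊗[k⟦X⟧] B)) : G t = opCube Λ N (toHat t * u) := rfl
    rw [← hG, map_sum]
    exact Finset.sum_congr rfl fun i _ => opCube_mul hΛ hN hΛN _ _ _ _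
  have h2 := h1 (hatTensorAlg (toHatAlg k B) Δ (Δ y))
  rw [← hx, ← map_mul, ← map_mul] at h2
  exact h2

namespace IsToralPair

variable (Z : IsToralPair τ e f Δ ε L M Λ N) (H : IsStdHopf R τ e f Δ ε S)

include Z H

theorem opSer_hyps : (∀ x y, Commute (Λ x) (Λ y)) ∧
    (∀ x y, Commute ((Ser.rescale (-1 : k⟦X⟧)).comp N x) ((Ser.rescale (-1 : k⟦X⟧)).comp N y)) ∧
    ∀ x y, Commute (Λ x) ((Ser.rescale (-1 : k⟦X⟧)).comp N y) := by
  refine ⟨Z.left.commute Z.left H.gen Z.comm_left, ?_, ?_⟩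
  · refine Z.right.rescale_neg_one.commute Z.right.rescale_neg_one H.gen fun T T' => ?_
    exact (Z.comm_right T T').neg_left.neg_right
  · refine Z.left.commute Z.right.rescale_neg_one H.gen fun T T' => (Z.comm T T').neg_right

theorem opSer_one : opSer Δ Λ ((Ser.rescale (-1 : k⟦X⟧)).comp N) 1 = 1 := by
  have h1 : opSer Δ Λ ((Ser.rescale (-1 : k⟦X⟧)).comp N) 1 =
    opCube Λ ((Ser.rescale (-1 : k⟦X⟧)).comp N) 1 :=
    congrArg (opCube Λ _) (map_one ((hatTensorAlg (toHatAlg k B) Δ).comp Δ))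
  refine h1.trans ((opCube_toHat 1 1 1).trans ?_)
  rw [map_one Λ, map_one (Algebra.lmul k⟦X⟧ B), map_one (Ser.const (k := k)),
    map_one ((Ser.rescale (-1 : k⟦X⟧)).comp N), one_mul, one_mul]

theorem opSer_tor_mul (T : h) (x : B) : opSer Δ Λ ((Ser.rescale (-1 : k⟦X⟧)).comp N) (τ T * x) =
    Ser.const (k := k) (Algebra.lmul k⟦X⟧ B (τ T)) * opSer Δ Λ ((Ser.rescale (-1 : k⟦X⟧)).comp N) x +
      opSer Δ Λ ((Ser.rescale (-1 : k⟦X⟧)).comp N) x * Ser.single (L T - M T) := by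
  obtain ⟨h1, h2, h3⟩ := Z.opSer_hyps H
  rw [opSer_mul h1 h2 h3 (ι := Fin 3) (a := ![τ T, 1, 1]) (b := ![1, τ T, 1]) (c := ![1, 1, τ T])]
  · have h4 := Z.right.rescale_neg_one.tor T
    simp only [Fin.sum_univ_three, Matrix.cons_val]
    rw [h4, Z.left.tor, map_one Λ, map_one ((Ser.rescale (-1 : k⟦X⟧)).comp N),
      map_one (Algebra.lmul k⟦X⟧ B), map_one (Ser.const (k := k)), mul_one, mul_one, one_mul, one_mul,
      one_mul, mul_one, sub_eq_add_neg, Ser.single_add, mul_add, LinearMap.neg_apply]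
    abel
  · rw [H.comul_tor, map_add, map_add, IsStdHopf.hatTensorAlg_toHat_right _ IsStdHopf.comul_one,
      IsStdHopf.hatTensorAlg_toHat_right _ (H.comul_tor T), ← map_add, TensorProduct.tmul_add, Fin.sum_univ_three]
    simp only [Matrix.cons_val]
    rw [add_assoc]

theorem opSer_E_mul (i : Fin n) (x : B) : opSer Δ Λ ((Ser.rescale (-1 : k⟦X⟧)).comp N) (e i * x) =
    Ser.const (k := k) (Algebra.lmul k⟦X⟧ B (e i)) * (opSer Δ Λ ((Ser.rescale (-1 : k⟦X⟧)).comp N) x *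
      hexp (k := k) (Ser.single (L (R.Tpos i)))) := by
  obtain ⟨h1, h2, h3⟩ := Z.opSer_hyps H
  rw [opSer_mul h1 h2 h3 (ι := Fin 3) (a := ![e i, hexp (k := k) (τ (R.Tpos i)), hexp (k := k) (τ (R.Tpos i))])
    (b := ![1, e i, hexp (k := k) (τ (R.Tpos i))]) (c := ![1, 1, e i])]
  · have h4 := Z.right.rescale_neg_one.E i
    simp only [Fin.sum_univ_three, Matrix.cons_val]
    rw [h4, Z.left.E, map_one ((Ser.rescale (-1 : k⟦X⟧)).comp N), mul_zero, mul_zero, zero_mul, mul_zero,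
      mul_zero, mul_zero, mul_one, zero_add, add_zero, map_hexp, Z.left.tor]
  · rw [H.comul_E, map_add, map_add, IsStdHopf.hatTensorAlg_toHat_right _ IsStdHopf.comul_one,
      IsStdHopf.hatTensorAlg_toHat_right _ (H.comul_E i), ← map_add, TensorProduct.tmul_add, Fin.sum_univ_three]
    simp only [Matrix.cons_val]
    rw [add_assoc]

theorem opSer_F_mul (i : Fin n) (x : B) : opSer Δ Λ ((Ser.rescale (-1 : k⟦X⟧)).comp N) (f i * x) =
    Ser.const (k := k) (Algebra.lmul k⟦X⟧ B (f i)) * (opSer Δ Λ ((Ser.rescale (-1 : k⟦X⟧)).comp N) x *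
      hexp (k := k) (Ser.single (M (R.Tneg i)))) := by
  obtain ⟨h1, h2, h3⟩ := Z.opSer_hyps H
  have hK := H.comul_hexp_neg (R.Tneg i)
  rw [opSer_mul h1 h2 h3 (ι := Fin 3) (a := ![f i, 1, 1])
    (b := ![hexp (k := k) (-τ (R.Tneg i)), f i, 1])
    (c := ![hexp (k := k) (-τ (R.Tneg i)), hexp (k := k) (-τ (R.Tneg i)), f i])]
  · have h4 := Z.right.rescale_neg_one.F i
    have h5 := Z.right.rescale_neg_one.tor (R.Tneg i)
    simp only [Fin.sum_univ_three, Matrix.cons_val]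
    rw [h4, Z.left.F, map_one Λ, mul_zero, mul_zero, zero_mul, mul_zero,
      mul_zero, mul_zero, one_mul, zero_add, add_zero, map_hexp, map_neg, h5, LinearMap.neg_apply, Ser.single_neg,
      neg_neg]
  · rw [H.comul_F, map_add, map_add, IsStdHopf.hatTensorAlg_toHat_right _ hK,
      IsStdHopf.hatTensorAlg_toHat_right _ (H.comul_F i), ← map_add, TensorProduct.tmul_add, Fin.sum_univ_three]
    simp only [Matrix.cons_val]
    rw [add_assoc]

theorem opSer_hexp_mul (T : h) (x : B) :
    opSer Δ Λ ((Ser.rescale (-1 : k⟦X⟧)).comp N) (hexp (k := k) (τ T) * x) =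
      Ser.const (k := k) (Algebra.lmul k⟦X⟧ B (hexp (k := k) (τ T))) *
        (opSer Δ Λ ((Ser.rescale (-1 : k⟦X⟧)).comp N) x * hexp (k := k) (Ser.single (L T - M T))) := by
  obtain ⟨h1, h2, h3⟩ := Z.opSer_hyps H
  have hK := H.comul_hexp T
  rw [opSer_mul h1 h2 h3 (ι := Fin 1) (a := ![hexp (k := k) (τ T)]) (b := ![hexp (k := k) (τ T)])
    (c := ![hexp (k := k) (τ T)])]
  · have h5 := Z.right.rescale_neg_one.tor T
    simp only [Finset.univ_unique, Fin.default_eq_zero, Finset.sum_singleton, Matrix.cons_val]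
    rw [map_hexp Λ, map_hexp ((Ser.rescale (-1 : k⟦X⟧)).comp N), h5, Z.left.tor, ← hexp_add, ← Ser.single_add, LinearMap.neg_apply,
      sub_eq_add_neg]
    exact Ser.commute_single (Z.comm T T).neg_right
  · rw [hK, IsStdHopf.hatTensorAlg_toHat_right _ hK]
    simp

end IsToralPair

end DeformedMul

/-! ### The deformed product and the toral cocycle -/

section DeformedMul

variable {k : Type*} [Field k] [CharZero k] {n : ℕ}
variable {h : Type*} [AddCommGroup h] [Module k⟦X⟧ h]
variable {P : Matrix (Fin n) (Fin n) k⟦X⟧} {R : Realization P h}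
variable {B : Type*} [Ring B] [Algebra k⟦X⟧ B] [IsAdicComplete (hIdeal k) B]
variable {τ : h →ₗ[k⟦X⟧] B} {e f : Fin n → B}
variable {η : h →ₗ[k⟦X⟧] h →ₗ[k⟦X⟧] k⟦X⟧}
variable {w w' : h →ₗ[k⟦X⟧] Fin n → k⟦X⟧}
variable {L M : h →ₗ[k⟦X⟧] Module.End k⟦X⟧ B}
variable {Λ N : B →ₐ[k⟦X⟧] Ser (Module.End k⟦X⟧ B)}
variable {Δ : B →ₐ[k⟦X⟧] HatTensor k B B} {ε : B →ₐ[k⟦X⟧] k⟦X⟧} {S : B →ₐ[k⟦X⟧] Bᵐᵒᵖ}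
variable {a b : Fin n → B →ₐ[k⟦X⟧] B} {D : h →ₗ[k⟦X⟧] Module.End k⟦X⟧ B}

/-- The map `a ⊗ b ⊗ c ↦ g a • g' c • b` of the completed tensor cube. -/
def midAct (g g' : B →ₗ[k⟦X⟧] k⟦X⟧) : Hat k (B ⊗[k⟦X⟧] (B ⊗[k⟦X⟧] B)) →ₗ[k⟦X⟧] B :=
  hatExtend ((TensorProduct.lid k⟦X⟧ B).toLinearMap ∘ₗ TensorProduct.map g
    ((TensorProduct.rid k⟦X⟧ B).toLinearMap ∘ₗ TensorProduct.map LinearMap.id g'))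

theorem midAct_toHat (g g' : B →ₗ[k⟦X⟧] k⟦X⟧) (a b c : B) :
    midAct g g' (toHat (k := k) (a ⊗ₜ[k⟦X⟧] (b ⊗ₜ[k⟦X⟧] c))) = g a • g' c • b := hatExtend_toHat _ _

theorem midAct_comul (g g' : B →ₗ[k⟦X⟧] k⟦X⟧) {G : Module.End k⟦X⟧ B}
    (hG : ∀ y, G y = rightAct g' (Δ y)) (u : HatTensor k B B) :
    G (leftAct g u) = midAct g g' (hatTensorMap toHat Δ.toLinearMap u) := by
  have h1 (a : B) : midAct g g' ∘ₗ boxTensor (toHat a) = g a • rightAct g' := hatTensor_ext fun b c => by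
    rw [LinearMap.comp_apply, boxTensor_toHat, midAct_toHat, LinearMap.smul_apply, rightAct_toHat]
  have h2 : G ∘ₗ leftAct g = midAct g g' ∘ₗ hatTensorMap toHat Δ.toLinearMap := hatTensor_ext fun a b => by
    rw [LinearMap.comp_apply, LinearMap.comp_apply, leftAct_toHat, map_smul, hG, hatTensorMap_toHat]
    exact (LinearMap.congr_fun (h1 a) (Δ b)).symm
  exact LinearMap.congr_fun h2 u

namespace IsToralPair

variable (Z : IsToralPair τ e f Δ ε L M Λ N) (H : IsStdHopf R τ e f Δ ε S)

include Z H

theorem coeff_left_mul_right {ι : Type*} [Fintype ι] {y : B} {y₁ y₂ y₃ : ι → B}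
    (hy : hatTensorMap toHat Δ.toLinearMap (Δ y) = toHat (∑ j, y₁ j ⊗ₜ[k⟦X⟧] (y₂ j ⊗ₜ[k⟦X⟧] y₃ j)))
    (m : ℕ) (x z : B) :
    Ser.coeff m (Λ x * (Ser.rescale (-1 : k⟦X⟧)).comp N z) y = ∑ j,
      Ser.coeff m (serPair ε.toLinearMap (Λ x) (y₁ j) *
        Ser.rescale (-1 : k⟦X⟧) (serPair ε.toLinearMap (Λ z) (y₃ j))) • y₂ j := by
  have h1 (p q : ℕ) : Ser.coeff q (N z) (Ser.coeff p (Λ x) y) = ∑ j,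
      (ε (Ser.coeff p (Λ x) (y₁ j)) * ε (Ser.coeff q (Λ z) (y₃ j))) • y₂ j := by
    rw [Z.left.coeff_eq_leftAct H Z.comm_left Z.comul_left p x y, midAct_comul _ _
      (Z.right.coeff_eq_rightAct H Z.comm_right Z.comul_right q z), hy, map_sum, map_sum]
    refine Finset.sum_congr rfl fun j _ => (midAct_toHat _ _ _ _ _).trans ?_
    have h2 := Z.left.apply_coeff_eq Z.right H.gen Z.comm Z.comm_right
      (φ := ε.toLinearMap) Z.counit_eq q z (y₃ j)
    rw [mul_smul, LinearMap.comp_apply, LinearMap.comp_apply, ← h2]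
    rfl
  obtain ⟨-, -, h3⟩ := Z.opSer_hyps H
  rw [(h3 x z).eq, Ser.coeff_mul, LinearMap.sum_apply, ← Finset.Nat.sum_antidiagonal_swap]
  simp only [Ser.coeff_mul, Finset.sum_smul]
  rw [Finset.sum_comm]
  refine Finset.sum_congr rfl fun p _ => ?_
  rw [Prod.fst_swap, Prod.snd_swap, Module.End.mul_apply, AlgHom.comp_apply, Ser.coeff_rescale,
    LinearMap.smul_apply, h1, Finset.smul_sum]
  refine Finset.sum_congr rfl fun j _ => ?_
  rw [Ser.coeff_rescale, coeff_serPair, coeff_serPair, smul_smul, smul_eq_mul, mul_left_comm]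
  rfl

theorem coeff_opSer {ι ι' : Type*} [Fintype ι] [Fintype ι'] {x y : B} {x₁ x₂ x₃ : ι → B}
    {y₁ y₂ y₃ : ι' → B}
    (hx : hatTensorMap toHat Δ.toLinearMap (Δ x) = toHat (∑ j, x₁ j ⊗ₜ[k⟦X⟧] (x₂ j ⊗ₜ[k⟦X⟧] x₃ j)))
    (hy : hatTensorMap toHat Δ.toLinearMap (Δ y) = toHat (∑ j, y₁ j ⊗ₜ[k⟦X⟧] (y₂ j ⊗ₜ[k⟦X⟧] y₃ j)))
    (m : ℕ) : Ser.coeff m (opSer Δ Λ ((Ser.rescale (-1 : k⟦X⟧)).comp N) x) y = ∑ i, ∑ j,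
      Ser.coeff m (serPair ε.toLinearMap (Λ (x₁ i)) (y₁ j) *
        Ser.rescale (-1 : k⟦X⟧) (serPair ε.toLinearMap (Λ (x₃ i)) (y₃ j))) • (x₂ i * y₂ j) := by
  rw [opSer_apply, hx, map_sum, map_sum, map_sum, LinearMap.sum_apply]
  refine Finset.sum_congr rfl fun i _ => ?_
  rw [opCube_toHat, Ser.coeff_const_mul, Module.End.mul_apply, Z.coeff_left_mul_right H hy, map_sum]
  refine Finset.sum_congr rfl fun j _ => ?_
  rw [map_smul]
  rfl

theorem exists_opSer_eq (hO : IsTwistOps η R.Tpos τ e f a b D)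
    (hL : IsToralDer η (rowForm η R.Tpos) 0 τ e f L) (hM : IsToralDer η 0 (rowForm η R.Tpos) τ e f M)
    (hneg : ∀ i, M (R.Tneg i) = -M (R.Tpos i)) {μ : B →ₗ[k⟦X⟧] B →ₗ[k⟦X⟧] B}
    (hμ : IsTwistMul τ e f a b D μ) {x : B} (hx : x ∈ polyAdj τ e f) :
    ∃ Ξ, opSer Δ Λ ((Ser.rescale (-1 : k⟦X⟧)).comp N) x = Ser.rescale (PowerSeries.X : k⟦X⟧) Ξ ∧
      ∀ y, Ser.SumsAt k Ξ y (μ x y) := by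
  have hg := H.gen
  let V : Submodule k⟦X⟧ B :=
    { carrier := {x | ∃ Ξ, opSer Δ Λ ((Ser.rescale (-1 : k⟦X⟧)).comp N) x =
        Ser.rescale (PowerSeries.X : k⟦X⟧) Ξ ∧ ∀ y, Ser.SumsAt k Ξ y (μ x y)}
      zero_mem' := ⟨0, by rw [map_zero, map_zero], fun y r => ⟨0, fun N _ => by simp⟩⟩
      add_mem' := by
        rintro x x' ⟨Ξ, h1, h2⟩ ⟨Ξ', h1', h2'⟩
        refine ⟨Ξ + Ξ', by rw [map_add, map_add, h1, h1'], fun y => ?_⟩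
        rw [map_add, LinearMap.add_apply]
        exact (h2 y).add (h2' y)
      smul_mem' := by
        rintro c x ⟨Ξ, h1, h2⟩
        refine ⟨c • Ξ, by rw [map_smul, map_smul, h1], fun y => ?_⟩
        rw [map_smul, LinearMap.smul_apply]
        exact (h2 y).smul c }
  let W : Subalgebra k⟦X⟧ B :=
    { carrier := {x | ∀ y ∈ V, x * y ∈ V}
      mul_mem' := fun {a b} ha hb y hy => by rw [mul_assoc]; exact ha _ (hb _ hy)
      add_mem' := fun {a b} ha hb y hy => by rw [add_mul]; exact V.add_mem (ha _ hy) (hb _ hy)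
      algebraMap_mem' := fun c y hy => by rw [← Algebra.smul_def]; exact V.smul_mem _ hy }
  have h1 : (1 : B) ∈ V := by
    refine ⟨1, by rw [Z.opSer_one H, map_one (Ser.rescale _)], fun y => ?_⟩
    rw [hμ.one_apply, ← map_one (Ser.const (k := k))]
    exact Ser.sumsAt_const 1 y
  have hs (x : B) (Ξ : Ser (Module.End k⟦X⟧ B)) :
      Ser.const (k := k) (Algebra.lmul k⟦X⟧ B x) * Ser.rescale (PowerSeries.X : k⟦X⟧) Ξ =
        Ser.rescale (PowerSeries.X : k⟦X⟧) (Ser.const (k := k) (Algebra.lmul k⟦X⟧ B x) * Ξ) :=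
    Ser.ext fun m => by
      rw [Ser.coeff_const_mul, Ser.coeff_rescale, Ser.coeff_rescale, Ser.coeff_const_mul, mul_smul_comm]
  have hD (T : h) : Ser.single (L T - M T) = Ser.rescale (PowerSeries.X : k⟦X⟧) (Ser.single (D T)) := by
    rw [hO.sub_eq_smul hg hL hM, Ser.single_smul_eq_rescale]
  have h2 : polyAdj τ e f ≤ W := by
    refine polyAdj_le (fun T => ?_) (fun T => ?_) (fun i => ?_) (fun i => ?_) <;>
      rintro x ⟨Ξ, h1, h2⟩
    · refine ⟨Ser.const (k := k) (Algebra.lmul k⟦X⟧ B (τ T)) * Ξ + Ξ * Ser.single (D T), ?_, fun y => ?_⟩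
      · rw [Z.opSer_tor_mul H, h1, hs, hD, map_add, map_mul (Ser.rescale _) Ξ]
      · rw [hμ.tor_apply]
        exact (Ser.SumsAt.mul (g := Algebra.lmul k⟦X⟧ B (τ T)) (Ser.sumsAt_const _) (h2 y)).add
          (Ser.SumsAt.mul h2 (Ser.sumsAt_single (D T) y))
    · refine ⟨Ser.const (k := k) (Algebra.lmul k⟦X⟧ B (hexp (k := k) (τ T))) *
        (Ξ * hexp (k := k) (Ser.single (D T))), ?_, fun y => ?_⟩
      · rw [Z.opSer_hexp_mul H, h1, hD, ← map_hexp (Ser.rescale _), ← map_mul (Ser.rescale _), hs]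
      · rw [hμ.hexp_apply]
        exact Ser.SumsAt.mul (g := Algebra.lmul k⟦X⟧ B (hexp (k := k) (τ T))) (Ser.sumsAt_const _)
          (Ser.SumsAt.mul h2 (Ser.sumsAt_hexp_single (D T) y))
    · refine ⟨Ser.const (k := k) (Algebra.lmul k⟦X⟧ B (e i)) * (Ξ * Ser.expS k (L (R.Tpos i))), ?_,
        fun y => ?_⟩
      · rw [Z.opSer_E_mul H, h1, Ser.hexp_single, ← map_mul (Ser.rescale _), hs]
      · rw [hμ.E_apply]
        exact Ser.SumsAt.mul (g := Algebra.lmul k⟦X⟧ B (e i)) (Ser.sumsAt_const _)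
          (Ser.SumsAt.mul h2 (hO.sumsAt_a hg hL i y))
    · refine ⟨Ser.const (k := k) (Algebra.lmul k⟦X⟧ B (f i)) * (Ξ * Ser.expS k (-M (R.Tpos i))), ?_,
        fun y => ?_⟩
      · rw [Z.opSer_F_mul H, h1, hneg, Ser.hexp_single, ← map_mul (Ser.rescale _), hs]
      · rw [hμ.F_apply]
        exact Ser.SumsAt.mul (g := Algebra.lmul k⟦X⟧ B (f i)) (Ser.sumsAt_const _)
          (Ser.SumsAt.mul h2 (hO.sumsAt_b hg hM i y))
  have h3 := h2 hx 1 h1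
  rwa [mul_one] at h3

end IsToralPair

/-- Sums of series at `z = 1 / ħ` with coefficients in a module. -/
theorem sum_evalInvHom_tmul {ι : Type*} [Fintype ι] (g : ι → Ser.tame (Ser.hSq k)) (u : ι → B)
    {Ξ : Ser (Module.End k⟦X⟧ B)} {y v : B} (hΞ : Ser.SumsAt k Ξ y v)
    (hg : ∀ m, ∑ i, Ser.coeff m (g i : Ser k⟦X⟧) • u i = (PowerSeries.X ^ m : k⟦X⟧) • Ser.coeff m Ξ y)
    (r : ℕ) : ∃ z : B, ∑ i, Ser.evalInvHom k (g i) ⊗ₜ[k⟦X⟧] u i =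
      (1 : LaurentSeries k) ⊗ₜ[k⟦X⟧] (v + (PowerSeries.X ^ r : k⟦X⟧) • z) := by
  choose M₀ hM using fun i => Ser.evalInvHom_sub_sum (g i) r
  obtain ⟨N, hN⟩ := hΞ r
  let m := N + Finset.univ.sup M₀
  choose w hw using fun i => hM i m ((Finset.le_sup (f := M₀) (Finset.mem_univ i)).trans (Nat.le_add_left _ _))
  obtain ⟨z, hz⟩ := mem_hIdeal_pow_smul_top.1 (hN m (Nat.le_add_right _ _))
  refine ⟨∑ i, w i • u i - z, ?_⟩
  have h1 (c : k⟦X⟧) (t : LaurentSeries k) (u : B) :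
      (t * algebraMap k⟦X⟧ (LaurentSeries k) c) ⊗ₜ[k⟦X⟧] u = t ⊗ₜ[k⟦X⟧] (c • u) := by
    rw [mul_comm, ← Algebra.smul_def, TensorProduct.smul_tmul]
  have h2 (i : ι) : Ser.evalInvHom k (g i) ⊗ₜ[k⟦X⟧] u i =
      ∑ m ∈ Finset.range m, Ser.hInv k m ⊗ₜ[k⟦X⟧] (Ser.coeff m (g i : Ser k⟦X⟧) • u i) +
        1 ⊗ₜ[k⟦X⟧] ((PowerSeries.X ^ r : k⟦X⟧) • w i • u i) := by
    rw [sub_eq_iff_eq_add'.1 (hw i), TensorProduct.add_tmul, TensorProduct.sum_tmul, ← mul_smul, ← h1, one_mul]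
    simp only [h1]
  have h3 (m : ℕ) : Ser.hInv k m ⊗ₜ[k⟦X⟧] ((PowerSeries.X ^ m : k⟦X⟧) • Ser.coeff m Ξ y) =
      (1 : LaurentSeries k) ⊗ₜ[k⟦X⟧] Ser.coeff m Ξ y := by
    rw [← h1, Ser.hInv_mul_X_pow]
  rw [Finset.sum_congr rfl fun i _ => h2 i, Finset.sum_add_distrib, Finset.sum_comm]
  simp only [← TensorProduct.tmul_sum, hg, h3]
  rw [← TensorProduct.tmul_add, ← Finset.smul_sum, smul_sub, ← hz]
  congr 1
  abel

variable {U : Subalgebra k⟦X⟧ B} (hU : U ≤ polyAdj τ e f)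

theorem IsToralPair.sum_toralForm_tmul (Z : IsToralPair τ e f Δ ε L M Λ N)
    (H : IsStdHopf R τ e f Δ ε S) (hO : IsTwistOps η R.Tpos τ e f a b D)
    (hL : IsToralDer η (rowForm η R.Tpos) 0 τ e f L) (hM : IsToralDer η 0 (rowForm η R.Tpos) τ e f M)
    (hneg : ∀ i, M (R.Tneg i) = -M (R.Tpos i)) {μ : B →ₗ[k⟦X⟧] B →ₗ[k⟦X⟧] B}
    (hμ : IsTwistMul τ e f a b D μ) {ι ι' : Type*} [Fintype ι] [Fintype ι'] {x y : U}
    {x₁ x₂ x₃ : ι → U} {y₁ y₂ y₃ : ι' → U}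
    (hx : hatTensorMap toHat Δ.toLinearMap (Δ x) =
      toHat (∑ j, (x₁ j : B) ⊗ₜ[k⟦X⟧] ((x₂ j : B) ⊗ₜ[k⟦X⟧] (x₃ j : B))))
    (hy : hatTensorMap toHat Δ.toLinearMap (Δ y) =
      toHat (∑ j, (y₁ j : B) ⊗ₜ[k⟦X⟧] ((y₂ j : B) ⊗ₜ[k⟦X⟧] (y₃ j : B)))) (r : ℕ) :
    ∃ v : B, ∑ i, ∑ j, (toralForm hU hL Z.left ε 1 (x₁ i) (y₁ j) *
      toralForm hU hL Z.left ε (-1) (x₃ i) (y₃ j)) ⊗ₜ[k⟦X⟧] ((x₂ i : B) * (y₂ j : B)) =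
      (1 : LaurentSeries k) ⊗ₜ[k⟦X⟧] (μ x y + (PowerSeries.X ^ r : k⟦X⟧) • v) := by
  obtain ⟨Ξ, h1, h2⟩ := Z.exists_opSer_eq H hO hL hM hneg hμ (hU x.2)
  obtain ⟨v, hv⟩ := sum_evalInvHom_tmul
    (fun p : ι × ι' => tamePair hU hL Z.left ε 1 (x₁ p.1) (y₁ p.2) *
      tamePair hU hL Z.left ε (-1) (x₃ p.1) (y₃ p.2)) (fun p => (x₂ p.1 : B) * (y₂ p.2 : B)) (h2 y)
    (fun m => by
      have h3 := Z.coeff_opSer H hx hy m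
      rw [h1, Ser.coeff_rescale, LinearMap.smul_apply] at h3
      rw [h3, Fintype.sum_prod_type]
      simp only [MulMemClass.coe_mul, coe_tamePair, Ser.rescale_one, rescale_C_neg_one]) r
  refine ⟨v, hv ▸ ?_⟩
  rw [Fintype.sum_prod_type]
  simp only [map_mul (Ser.evalInvHom k), toralForm_apply]

end DeformedMul

/-! ### The deformation of `U_{P,ħ}^R(g)` by a toral cocycle -/

section Deformation

variable {k : Type*} [Field k] [CharZero k] {n : ℕ}
variable {h : Type*} [AddCommGroup h] [Module k⟦X⟧ h]
variable {A : Matrix (Fin n) (Fin n) ℤ} {d : Fin n → ℕ} {P : Matrix (Fin n) (Fin n) k⟦X⟧}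

theorem Realization.isDeformation_deform (R : Realization P h) (χ : AltS R) :
    IsDeformation R (R.deform χ) ((C (2⁻¹ : k) : k⟦X⟧) • χ.form) where
  Tpos_eq := rfl
  Tneg_eq := rfl
  α_eq j T := by
    have h1 : (2 : k⟦X⟧) * C (2⁻¹ : k) = 1 := by
      rw [← map_ofNat C 2, ← map_mul, mul_inv_cancel₀ two_ne_zero, map_one]
    rw [LinearMap.smul_apply, LinearMap.smul_apply, smul_eq_mul, ← mul_assoc, h1, one_mul]
    rfl
  antisymm x y := by
    rw [LinearMap.smul_apply, LinearMap.smul_apply, χ.antisymm, smul_neg]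
    rfl
  right_Tneg i x := by
    have h1 : χ.form x (R.Tneg i) = -χ.form x (R.Tpos i) := by
      rw [χ.antisymm x, χ.form_Tneg, neg_neg, χ.antisymm]
    rw [LinearMap.smul_apply, LinearMap.smul_apply, LinearMap.smul_apply, h1, smul_neg]

variable {R : Realization P h}
variable {η : h →ₗ[k⟦X⟧] h →ₗ[k⟦X⟧] k⟦X⟧}

section Generic

variable {B : Type*} [Ring B] [Algebra k⟦X⟧ B] [IsAdicComplete (hIdeal k) B]
variable {τ : h →ₗ[k⟦X⟧] B} {e f : Fin n → B}
variable {L M : h →ₗ[k⟦X⟧] Module.End k⟦X⟧ B}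
variable {Λ N : B →ₐ[k⟦X⟧] Ser (Module.End k⟦X⟧ B)}
variable {Δ : B →ₐ[k⟦X⟧] HatTensor k B B} {ε : B →ₐ[k⟦X⟧] k⟦X⟧} {S : B →ₐ[k⟦X⟧] Bᵐᵒᵖ}

theorem IsStdHopf.isToralPair (H : IsStdHopf R τ e f Δ ε S)
    (hη : ∀ i x, η x (R.Tneg i) = -η x (R.Tpos i))
    (hL : IsToralDer η (rowForm η R.Tpos) 0 τ e f L) (hM : IsToralDer η 0 (rowForm η R.Tpos) τ e f M)
    (hΛ : IsToralRep τ e f L Λ) (hN : IsToralRep τ e f M N) : IsToralPair τ e f Δ ε L M Λ N where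
  left := hΛ
  right := hN
  comm_left := hL.commute H.gen hL
  comm_right := hM.commute H.gen hM
  comm := hL.commute H.gen hM
  comul_left := hL.comul_left H (fun _ _ => rfl) rfl
  comul_right := hM.comul_right H hη rfl fun _ _ => rfl
  counit_eq := hL.counit_eq H hM
  map_eq := hΛ.map_der_eq H.gen hL hM
  mul := hL.mul

end Generic

/-- The toral representations that belong to a form `η`. -/
theorem UAlg.exists_isToralPair (hA : IsSymmetrizableGCM A d) (hP : IsCartanType A d P)
    (hη : ∀ i x, η x (R.Tneg i) = -η x (R.Tpos i)) (hη' : ∀ i, η (R.Tneg i) = -η (R.Tpos i)) :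
    ∃ (L M : h →ₗ[k⟦X⟧] Module.End k⟦X⟧ (UAlg A d R))
      (Λ N : UAlg A d R →ₐ[k⟦X⟧] Ser (Module.End k⟦X⟧ (UAlg A d R))),
      IsToralDer η (rowForm η R.Tpos) 0 (UAlg.torₗ A d R) (UAlg.E A d R) (UAlg.F A d R) L ∧
      IsToralDer η 0 (rowForm η R.Tpos) (UAlg.torₗ A d R) (UAlg.E A d R) (UAlg.F A d R) M ∧
      (∀ i, M (R.Tneg i) = -M (R.Tpos i)) ∧
      IsToralPair (UAlg.torₗ A d R) (UAlg.E A d R) (UAlg.F A d R) (UAlg.comul hA hP R)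
        (UAlg.counit A d R) L M Λ N := by
  obtain ⟨L, hL⟩ := UAlg.exists_isToralDer A d R (w := rowForm η R.Tpos) (w' := 0) hη
    (fun T i => add_zero _)
  obtain ⟨M, hM⟩ := UAlg.exists_isToralDer A d R (w := 0) (w' := rowForm η R.Tpos) hη
    (fun T i => zero_add _)
  have hg := UAlg.isTopGen A d R
  have hr (i : Fin n) : rowForm η R.Tpos (R.Tneg i) = -rowForm η R.Tpos (R.Tpos i) := by
    funext j
    rw [Pi.neg_apply, rowForm_apply, rowForm_apply, hη', LinearMap.neg_apply]
  have h0 (i : Fin n) : (0 : h →ₗ[k⟦X⟧] Fin n → k⟦X⟧) (R.Tneg i) =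
      -(0 : h →ₗ[k⟦X⟧] Fin n → k⟦X⟧) (R.Tpos i) := by
    rw [LinearMap.zero_apply, LinearMap.zero_apply, neg_zero]
  have hLn (i : Fin n) := hL.eq_neg hg (hη' i) (hr i) (h0 i)
  have hMn (i : Fin n) := hM.eq_neg hg (hη' i) (h0 i) (hr i)
  obtain ⟨Λ, hΛ⟩ := UAlg.exists_isToralRep A d R (hL.commute hg hL) hLn
  obtain ⟨N, hN⟩ := UAlg.exists_isToralRep A d R (hM.commute hg hM) hMn
  exact ⟨L, M, Λ, N, hL, hM, hMn, (UAlg.isStdHopf hA hP R).isToralPair hη hL hM hΛ hN⟩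

theorem UAlg.isDeformedMul (hA : IsSymmetrizableGCM A d) (hP : IsCartanType A d P)
    {L M : h →ₗ[k⟦X⟧] Module.End k⟦X⟧ (UAlg A d R)}
    {Λ N : UAlg A d R →ₐ[k⟦X⟧] Ser (Module.End k⟦X⟧ (UAlg A d R))}
    {a b : Fin n → UAlg A d R →ₐ[k⟦X⟧] UAlg A d R} {D : h →ₗ[k⟦X⟧] Module.End k⟦X⟧ (UAlg A d R)}
    (Z : IsToralPair (UAlg.torₗ A d R) (UAlg.E A d R) (UAlg.F A d R) (UAlg.comul hA hP R)
      (UAlg.counit A d R) L M Λ N)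
    (hO : IsTwistOps η R.Tpos (UAlg.torₗ A d R) (UAlg.E A d R) (UAlg.F A d R) a b D)
    (hL : IsToralDer η (rowForm η R.Tpos) 0 (UAlg.torₗ A d R) (UAlg.E A d R) (UAlg.F A d R) L)
    (hM : IsToralDer η 0 (rowForm η R.Tpos) (UAlg.torₗ A d R) (UAlg.E A d R) (UAlg.F A d R) M)
    (hneg : ∀ i, M (R.Tneg i) = -M (R.Tpos i))
    {m : UAlg A d R ⊗[k⟦X⟧] UAlg A d R →ₗ[k⟦X⟧] UAlg A d R}
    (hμ : IsTwistMul (UAlg.torₗ A d R) (UAlg.E A d R) (UAlg.F A d R) a b D (TensorProduct.curry m)) :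
    IsDeformedMul (UAlg.hopf hA hP R) (UAlg.toralForm R hL Z.left 1) (UAlg.toralForm R hL Z.left (-1)) m := by
  intro x y p p' x₁ x₂ x₃ y₁ y₂ y₃ hx hy r
  exact Z.sum_toralForm_tmul (UAlg.polySub_le A d R) (UAlg.isStdHopf hA hP R) hO hL hM hneg hμ hx hy r

end Deformation

end FoMpQUEA

end

theorem mainTheorem6 {k : Type*} [Field k] [CharZero k] {n : ℕ}
    (A : Matrix (Fin n) (Fin n) ℤ) (d : Fin n → ℕ) (hA : IsSymmetrizableGCM A d)
    (P : Matrix (Fin n) (Fin n) k⟦X⟧) (hP : IsCartanType A d P)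
    {h : Type*} [AddCommGroup h] [Module k⟦X⟧ h] [Module.Free k⟦X⟧ h] [Module.Finite k⟦X⟧ h]
    (R : Realization P h) (χ : AltS R) :
    ∃ (H : HopfData k (UAlg A d R)) (H' : HopfData k (UAlg A d (R.deform χ)))
      (π : UAlg A d R →ₐ[k⟦X⟧] Hat k R.symBar)
      (σ σ' : polySub A d R →ₗ[k⟦X⟧] polySub A d R →ₗ[k⟦X⟧] LaurentSeries k)
      (Hσ : HopfData k (UAlg A d R)) (φ : UAlg A d R ≃ₗ[k⟦X⟧] UAlg A d (R.deform χ)),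
      IsFoMpHopf A d R H ∧ IsFoMpHopf A d (R.deform χ) H' ∧
      IsDenseHopf H ∧ IsToralProj H π ∧
      IsToralCocycle χ π 1 σ ∧ IsToralCocycle χ π (-1) σ' ∧ IsHopfTwoCocycle H σ σ' ∧
      (IsTopHopf Hσ ∧ Hσ.one = H.one ∧ Hσ.comul = H.comul ∧ Hσ.counit = H.counit ∧
        IsDeformedMul H σ σ' Hσ.mul) ∧
      (IsHopfIso Hσ H' φ ∧
        (∀ i, φ (UAlg.E A d R i) = UAlg.E A d (R.deform χ) i) ∧
        (∀ i, φ (UAlg.F A d R i) = UAlg.F A d (R.deform χ) i) ∧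
        (∀ T, φ (UAlg.tor A d R T) = UAlg.tor A d (R.deform χ) T)) ∧
      (∀ t : Submodule k⟦X⟧ h, (∀ i, R.Tpos i ∈ t) →
        IsHopfSub H (borelPos A d R t) ∧ IsHopfSub Hσ (borelPos A d R t) ∧
        IsHopfSub H' (borelPos A d (R.deform χ) t) ∧
        (borelPos A d R t).map φ.toLinearMap = borelPos A d (R.deform χ) t) ∧
      (∀ t : Submodule k⟦X⟧ h, (∀ i, R.Tneg i ∈ t) →
        IsHopfSub H (borelNeg A d R t) ∧ IsHopfSub Hσ (borelNeg A d R t) ∧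
        IsHopfSub H' (borelNeg A d (R.deform χ) t) ∧
        (borelNeg A d R t).map φ.toLinearMap = borelNeg A d (R.deform χ) t) := by
  have hR := R.isDeformation_deform χ
  have hP' := isCartanType_deformP hP R χ
  obtain ⟨a, b, D, φ, hO, hφ, hE, hF, hT, hpos, hneg, hμ⟩ := UAlg.exists_hopfIso hA hP hP' hR
  obtain ⟨L, M, Λ, N, hL, hM, hMn, Z⟩ := UAlg.exists_isToralPair hA hP hR.right_Tneg hR.left_Tneg
  obtain ⟨π, hπ⟩ := UAlg.exists_isSymProj A d R
  have hH' := UAlg.isFoMpHopf hA hP' (R.deform χ)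
  refine ⟨UAlg.hopf hA hP R, UAlg.hopf hA hP' (R.deform χ), π, UAlg.toralForm R hL Z.left 1,
    UAlg.toralForm R hL Z.left (-1), _, φ, UAlg.isFoMpHopf hA hP R, hH', UAlg.isDenseHopf hA hP R,
    UAlg.isToralProj hA hP R hπ, UAlg.isToralCocycle hA hP R χ rfl hπ hL Z.left Z.comm_left 1,
    UAlg.isToralCocycle hA hP R χ rfl hπ hL Z.left Z.comm_left (-1),
    UAlg.isHopfTwoCocycle hA hP R Z hL,
    ⟨hφ.isTopHopf hH'.isTopHopf, rfl, rfl, rfl, UAlg.isDeformedMul hA hP Z hO hL hM hMn hμ⟩,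
    ⟨hφ, hE, hF, hT⟩, fun t ht => ?_, fun t ht => ?_⟩
  · have h' := UAlg.isHopfSub_borelPos hA hP' (R.deform χ) (t := t) ht
    exact ⟨UAlg.isHopfSub_borelPos hA hP R ht, hφ.isHopfSub (hpos t) h', h', hpos t⟩
  · have h' := UAlg.isHopfSub_borelNeg hA hP' (R.deform χ) (t := t) ht
    exact ⟨UAlg.isHopfSub_borelNeg hA hP R ht, hφ.isHopfSub (hneg t) h', h', hneg t⟩
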